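/- **Conventions.** A 2-category is a strict 2-category, a 2-functor is strict, a 2-natural transformation is strictly natural, and composites are written in diagrammatic order "$f$, then $g$". *Monoidal 2-categories.* A monoidal 2-category $\mathcal K$ is a 2-category with a pseudofunctor $\otimes\colon\mathcal K\times\mathcal K\to\mathcal K$, an object $I$, pseudonatural adjoint equivalences $(a\otimes b)\otimes c\to a\otimes(b\otimes c)$, $I\otimes a\to a$, $a\otimes I\to a$, an invertible pentagonator modification and three invertible unit modifications, satisfying the axioms of a monoidal bicategory (the nonabelian 4-cocycle condition and the two unit conditions). It is *braided* if it has a pseudonatural equivalence $\beta_{a,b}\colon a\otimes b\to b\otimes a$ and two invertible hexagonator modifications satisfying the axioms of a braided monoidal bicategory, and *symmetric* if it has moreover an invertible modification (syllepsis) $1_{a\otimes b}\cong\beta_{b,a}\circ\beta_{a,b}$ satisfying the two syllepsis axioms and the symmetry axiom. *Lax monoidal 2-functors.* A lax monoidal 2-functor $F\colon\mathcal K\to\mathcal L$ is a 2-functor with a pseudonatural family $\mu_{a,b}\colon Fa\otimes Fb\to F(a\otimes b)$, a 1-cell $\mu_0\colon I\to FI$, and invertible modifications $\omega$ (associativity of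 $\mu$), $\zeta$, $\xi$ (right and left unitality), subject to the two usual coherence conditions with the pentagonators and with the middle unit modifications. It is *braided* if it carries an invertible modification $v_{a,b}\colon \mu_{b,a}\circ\beta_{Fa,Fb}\cong F(\beta_{a,b})\circ\mu_{a,b}$ compatible with both hexagonators, and *symmetric* if moreover $v$ is compatible with the syllepses. Identities and composites of such 2-functors carry the evident structure. A monoidal 2-natural transformation $\tau\colon F\Rightarrow G$ between lax monoidal 2-functors $(F,\mu,\mu_0)$, $(G,\nu,\nu_0)$ is a 2-natural transformation with an invertible modification $u_{a,b}\colon\nu_{a,b}\circ(\tau_a\otimes\tau_b)\cong\tau_{a\otimes b}\circ\mu_{a,b}$ and an invertible 2-cell $u_0\colon\nu_0\cong\tau_I\circ\mu_0$ compatible with $\omega,\zeta,\xi$; it is *braided* (and likewise *symmetric*) if $u$ is also compatible with $v$. *2-equivalences.* A 2-equivalence $\mathcal K\simeq\mathcal L$ consists of 2-functors $F\colon\mathcal K\to\mathcal L$, $G\colon\mathcal L\to\mathcal K$ and 2-natural isomorphisms $\eta\colon 1_{\mathcal K}\cong GF$, $\varepsilon\colon FG\cong1_{\mathcal L}$. It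 is a monoidal (braided monoidal, symmetric monoidal) 2-equivalence if $F$ and $G$ are equipped with lax monoidal (braided, symmetric lax monoidal) structures for which $\eta$ and $\varepsilon$ are equipped with the structure of monoidal (braided, symmetric monoidal) 2-natural transformations. *Pseudomonoids.* A pseudomonoid in $\mathcal K$ is an object $X$ with $m\colon X\otimes X\to X$, $e\colon I\to X$ and invertible 2-cells $\alpha\colon m(m\otimes1)\cong m(1\otimes m)$ (up to the associativity equivalence) and $m(e\otimes1)\cong\mathrm{l}_X$, $m(1\otimes e)\cong\mathrm{r}_X$ (the unit equivalences), satisfying the pentagon and triangle axioms. A strong morphism $X\to Y$ is a 1-cell $f$ with invertible 2-cells $\phi\colon m_Y(f\otimes f)\cong f m_X$, $\phi_0\colon e_Y\cong f e_X$ compatible with associativity and both units; a 2-cell between strong morphisms is a 2-cell of $\mathcal K$ compatible with $\phi$ and $\phi_0$. They form a 2-category $\mathbf{PsMon}(\mathcal K)$. For braided $\mathcal K$, a braided pseudomonoid has moreover an invertible 2-cell $\gamma\colon m\circ\beta_{X,X}\cong m$ satisfying the two hexagon axioms; with the strong morphisms compatible with $\gamma$ (braided strong morphisms) and all 2-cells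 between them, they form a 2-category $\mathbf{BrPsMon}(\mathcal K)$. For symmetric $\mathcal K$, the symmetric pseudomonoids, i.e. the braided ones for which the composite $m\cong m\beta\beta\cong m\beta\cong m$ of the syllepsis and $\gamma$ twice is the identity, form with the braided strong morphisms and their 2-cells a 2-category $\mathbf{SymPsMon}(\mathcal K)$. **Proposition.** Let $\mathcal K$ and $\mathcal L$ be monoidal 2-categories and let $(F,G,\eta,\varepsilon)\colon\mathcal K\simeq\mathcal L$ be a monoidal 2-equivalence. Then there is a 2-equivalence $(\bar F,\bar G,\bar\eta,\bar\varepsilon)\colon\mathbf{PsMon}(\mathcal K)\simeq\mathbf{PsMon}(\mathcal L)$ induced by it, in the following sense. * $\bar F$ sends a pseudomonoid $(X,m,e)$ to $FX$ with multiplication $Fm\circ\mu_{X,X}$, unit $Fe\circ\mu_0$, and the associativity and unit 2-cells pasted from $\mu,\omega,\xi,\zeta$ and the images under $F$ of those of $X$; it sends a strong morphism $(f,\phi,\phi_0)$ to $Ff$ with the 2-cells pasted from the pseudonaturality of $\mu$ and $F\phi$, $F\phi_0$; and it sends a 2-cell $\sigma$ to $F\sigma$. Likewise for $\bar G$ and $G$.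 * The component of $\bar\eta$ at $(X,m,e)$ is the 1-cell $\eta_X$ with the comparison 2-cells obtained from the structure 2-cells $u_{X,X}$ and $u_0$ of $\eta$. Likewise for $\bar\varepsilon$ and $\varepsilon$. Similarly, any braided (symmetric) monoidal 2-equivalence between braided (symmetric) monoidal 2-categories $\mathcal K$ and $\mathcal L$ induces, in the same sense, a 2-equivalence $\mathbf{BrPsMon}(\mathcal K)\simeq\mathbf{BrPsMon}(\mathcal L)$ (respectively $\mathbf{SymPsMon}(\mathcal K)\simeq\mathbf{SymPsMon}(\mathcal L)$), where the braiding 2-cell of the image of $(X,m,e,\gamma)$ is the pasting of $v_{X,X}$ and $F\gamma$. -/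

import Mathlib

open CategoryTheory Bicategory

universe w₁ w₂ w₃ v₁ v₂ v₃ u₁ u₂ u₃

namespace MonTwoCat

section Squares

variable {K : Type u₁} [Bicategory.{w₁, v₁} K]

/-- Vertical pasting of two squares along the common side `g`. -/
def sqV {a b c a' b' c' : K} {f : a ⟶ a'} {g : b ⟶ b'} {h : c ⟶ c'} {u : a ⟶ b} {u' : b ⟶ c}
    {v : a' ⟶ b'} {v' : b' ⟶ c'} (s : f ≫ v ≅ u ≫ g) (t : g ≫ v' ≅ u' ≫ h) :
    f ≫ (v ≫ v') ≅ (u ≫ u') ≫ h :=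
  (α_ _ _ _).symm ≪≫ whiskerRightIso s v' ≪≫ α_ _ _ _ ≪≫ whiskerLeftIso u t ≪≫ (α_ _ _ _).symm

/-- Horizontal pasting of two squares along the common side `v`. -/
def sqH {a b a' b' a'' b'' : K} {f : a ⟶ a'} {f' : a' ⟶ a''} {g : b ⟶ b'} {g' : b' ⟶ b''}
    {u : a ⟶ b} {v : a' ⟶ b'} {w : a'' ⟶ b''} (s : f ≫ v ≅ u ≫ g) (t : f' ≫ w ≅ v ≫ g') :
    (f ≫ f') ≫ w ≅ u ≫ (g ≫ g') :=
  α_ _ _ _ ≪≫ whiskerLeftIso f t ≪≫ (α_ _ _ _).symm ≪≫ whiskerRightIso s g' ≪≫ α_ _ _ _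

/-- The identity square on a 1-cell, in the direction of vertical pasting. -/
def idSqV {a b : K} (f : a ⟶ b) : f ≫ 𝟙 b ≅ 𝟙 a ≫ f := ρ_ f ≪≫ (λ_ f).symm

/-- The identity square on a 1-cell, in the direction of horizontal pasting. -/
def idSqH {a b : K} (u : a ⟶ b) : 𝟙 a ≫ u ≅ u ≫ 𝟙 b := λ_ u ≪≫ (ρ_ u).symm

/-- The mate of a square whose vertical sides are equivalences. -/
def invSq {a b a' b' : K} {f : a ⟶ a'} {g : b ⟶ b'} (u : a ≌ b) (v : a' ≌ b')
    (s : f ≫ v.hom ≅ u.hom ≫ g) : g ≫ v.inv ≅ u.inv ≫ f :=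
  (λ_ _).symm ≪≫ whiskerRightIso u.counit.symm (g ≫ v.inv) ≪⊗≫
    whiskerLeftIso u.inv (whiskerRightIso s.symm v.inv) ≪⊗≫
      whiskerLeftIso (u.inv ≫ f) v.unit.symm ≪⊗≫ Iso.refl (u.inv ≫ f)

/-- `θ : u ⟶ u'` and `θ' : v ⟶ v'` are compatible with the squares `s` and `t`, that is,
`(θ, θ')` satisfies the modification axiom at `s` and `t`. -/
def IsCyl {a b a' b' : K} {f : a ⟶ a'} {g : b ⟶ b'} {u u' : a ⟶ b} {v v' : a' ⟶ b'}
    (s : f ≫ v ≅ u ≫ g) (t : f ≫ v' ≅ u' ≫ g) (θ : u ⟶ u') (θ' : v ⟶ v') : Prop :=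
  f ◁ θ' ≫ t.hom = s.hom ≫ θ ▷ g

/-- `σ : f ⟶ f'` and `σ' : g ⟶ g'` are compatible with the squares `s` and `t`, that is,
the squares are natural with respect to `(σ, σ')`. -/
def IsNat {a b a' b' : K} {f f' : a ⟶ a'} {g g' : b ⟶ b'} {u : a ⟶ b} {v : a' ⟶ b'}
    (s : f ≫ v ≅ u ≫ g) (t : f' ≫ v ≅ u ≫ g') (σ : f ⟶ f') (σ' : g ⟶ g') : Prop :=
  σ ▷ v ≫ t.hom = s.hom ≫ u ◁ σ'

end Squares

/-- A bicategory with a tensor product pseudofunctor and a unit object. -/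
class TensorBicategory (K : Type u₁) [Bicategory.{w₁, v₁} K] where
  /-- The tensor product pseudofunctor. -/
  tensor : Pseudofunctor (K × K) K
  /-- The unit object. -/
  I : K


section Tensor

variable {K : Type u₁} [Bicategory.{w₁, v₁} K] [TensorBicategory K]

/-- The tensor product of objects. -/
abbrev tObj (x y : K) : K := (TensorBicategory.tensor (K := K)).obj (x, y)

infixr:80 " ⊠ₒ " => tObj

/-- The tensor product of 1-cells. -/
abbrev tMap {x x' y y' : K} (f : x ⟶ x') (g : y ⟶ y') : x ⊠ₒ y ⟶ x' ⊠ₒ y' :=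
  (TensorBicategory.tensor (K := K)).map ((f, g) : (x, y) ⟶ (x', y'))

infixr:90 " ⊠ " => tMap

/-- The tensor product of 2-cells. -/
abbrev tMap₂ {x x' y y' : K} {f f' : x ⟶ x'} {g g' : y ⟶ y'} (σ : f ⟶ f') (τ : g ⟶ g') :
    f ⊠ g ⟶ f' ⊠ g' :=
  (TensorBicategory.tensor (K := K)).map₂
    ((σ, τ) : ((f, g) : (x, y) ⟶ (x', y')) ⟶ ((f', g') : (x, y) ⟶ (x', y')))

infixr:90 " ⊠₂ " => tMap₂

/-- The tensor product of invertible 2-cells. -/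
def tIso {x x' y y' : K} {f f' : x ⟶ x'} {g g' : y ⟶ y'} (σ : f ≅ f') (τ : g ≅ g') :
    f ⊠ g ≅ f' ⊠ g' :=
  (TensorBicategory.tensor (K := K)).map₂Iso
    (Iso.prod σ τ : ((f, g) : (x, y) ⟶ (x', y')) ≅ ((f', g') : (x, y) ⟶ (x', y')))

infixr:90 " ⊠ᵢ " => tIso


open TensorBicategory

/-- The comparison `(f ≫ f') ⊠ (g ≫ g') ≅ f ⊠ g ≫ f' ⊠ g'`. -/
def tComp {x x' x'' y y' y'' : K} (f : x ⟶ x') (g : y ⟶ y') (f' : x' ⟶ x'') (g' : y' ⟶ y'') :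
    (f ≫ f') ⊠ (g ≫ g') ≅ f ⊠ g ≫ f' ⊠ g' :=
  (tensor (K := K)).mapComp ((f, g) : (x, y) ⟶ (x', y')) ((f', g') : (x', y') ⟶ (x'', y''))

/-- The comparison `𝟙 x ⊠ 𝟙 y ≅ 𝟙 (x ⊠ₒ y)`. -/
def tId (x y : K) : 𝟙 x ⊠ 𝟙 y ≅ 𝟙 (x ⊠ₒ y) :=
  (tensor (K := K)).mapId (x, y)

/-- Tensoring a composite on the right with an object. -/
def wrComp {x x' x'' : K} (p : x ⟶ x') (q : x' ⟶ x'') (z : K) :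
    (p ≫ q) ⊠ 𝟙 z ≅ p ⊠ 𝟙 z ≫ q ⊠ 𝟙 z :=
  Iso.refl (p ≫ q) ⊠ᵢ (λ_ (𝟙 z)).symm ≪≫ tComp p (𝟙 z) q (𝟙 z)

/-- Tensoring a composite on the left with an object. -/
def wlComp (z : K) {x x' x'' : K} (p : x ⟶ x') (q : x' ⟶ x'') :
    𝟙 z ⊠ (p ≫ q) ≅ 𝟙 z ⊠ p ≫ 𝟙 z ⊠ q :=
  (λ_ (𝟙 z)).symm ⊠ᵢ Iso.refl (p ≫ q) ≪≫ tComp (𝟙 z) p (𝟙 z) q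

/-- Tensoring a threefold composite on the right with an object. -/
def wrComp₃ {x₀ x₁ x₂ x₃ : K} (p : x₀ ⟶ x₁) (q : x₁ ⟶ x₂) (r : x₂ ⟶ x₃) (z : K) :
    (p ≫ q ≫ r) ⊠ 𝟙 z ≅ p ⊠ 𝟙 z ≫ q ⊠ 𝟙 z ≫ r ⊠ 𝟙 z :=
  wrComp p (q ≫ r) z ≪≫ whiskerLeftIso _ (wrComp q r z)

/-- Tensoring a threefold composite on the left with an object. -/
def wlComp₃ (z : K) {x₀ x₁ x₂ x₃ : K} (p : x₀ ⟶ x₁) (q : x₁ ⟶ x₂) (r : x₂ ⟶ x₃) :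
    𝟙 z ⊠ (p ≫ q ≫ r) ≅ 𝟙 z ⊠ p ≫ 𝟙 z ⊠ q ≫ 𝟙 z ⊠ r :=
  wlComp z p (q ≫ r) ≪≫ whiskerLeftIso _ (wlComp z q r)

/-- Tensoring a fivefold composite on the right with an object. -/
def wrComp₅ {x₀ x₁ x₂ x₃ x₄ x₅ : K} (p : x₀ ⟶ x₁) (q : x₁ ⟶ x₂) (r : x₂ ⟶ x₃) (s : x₃ ⟶ x₄)
    (t : x₄ ⟶ x₅) (z : K) :
    (p ≫ q ≫ r ≫ s ≫ t) ⊠ 𝟙 z ≅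
      p ⊠ 𝟙 z ≫ q ⊠ 𝟙 z ≫ r ⊠ 𝟙 z ≫ s ⊠ 𝟙 z ≫ t ⊠ 𝟙 z :=
  wrComp₃ p q (r ≫ s ≫ t) z ≪≫ whiskerLeftIso _ (whiskerLeftIso _ (wrComp₃ r s t z))

/-- Tensoring a fivefold composite on the left with an object. -/
def wlComp₅ (z : K) {x₀ x₁ x₂ x₃ x₄ x₅ : K} (p : x₀ ⟶ x₁) (q : x₁ ⟶ x₂) (r : x₂ ⟶ x₃)
    (s : x₃ ⟶ x₄) (t : x₄ ⟶ x₅) :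
    𝟙 z ⊠ (p ≫ q ≫ r ≫ s ≫ t) ≅
      𝟙 z ⊠ p ≫ 𝟙 z ⊠ q ≫ 𝟙 z ⊠ r ≫ 𝟙 z ⊠ s ≫ 𝟙 z ⊠ t :=
  wlComp₃ z p q (r ≫ s ≫ t) ≪≫ whiskerLeftIso _ (whiskerLeftIso _ (wlComp₃ z r s t))

/-- The factorization `f ⊠ g ≅ f ⊠ 𝟙 ≫ 𝟙 ⊠ g`. -/
def tSplit {x x' y y' : K} (f : x ⟶ x') (g : y ⟶ y') : f ⊠ g ≅ f ⊠ 𝟙 y ≫ 𝟙 x' ⊠ g :=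
  (ρ_ f).symm ⊠ᵢ (λ_ g).symm ≪≫ tComp f (𝟙 y) (𝟙 x') g

/-- The factorization `f ⊠ g ≅ 𝟙 ⊠ g ≫ f ⊠ 𝟙`. -/
def tSplit' {x x' y y' : K} (f : x ⟶ x') (g : y ⟶ y') : f ⊠ g ≅ 𝟙 x ⊠ g ≫ f ⊠ 𝟙 y' :=
  (λ_ f).symm ⊠ᵢ (ρ_ g).symm ≪≫ tComp (𝟙 x) g f (𝟙 y')

/-- The interchange isomorphism `f ⊠ 𝟙 ≫ 𝟙 ⊠ g ≅ 𝟙 ⊠ g ≫ f ⊠ 𝟙`. -/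
def xch {x x' y y' : K} (f : x ⟶ x') (g : y ⟶ y') :
    f ⊠ 𝟙 y ≫ 𝟙 x' ⊠ g ≅ 𝟙 x ⊠ g ≫ f ⊠ 𝟙 y' :=
  (tSplit f g).symm ≪≫ tSplit' f g

/-- The tensor product of two squares. -/
def tSq {a b a' b' c d c' d' : K} {f : a ⟶ a'} {g : b ⟶ b'} {u : a ⟶ b} {v : a' ⟶ b'}
    {h : c ⟶ c'} {k : d ⟶ d'} {s : c ⟶ d} {t : c' ⟶ d'}
    (p : f ≫ v ≅ u ≫ g) (q : h ≫ t ≅ s ≫ k) :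
    f ⊠ h ≫ v ⊠ t ≅ u ⊠ s ≫ g ⊠ k :=
  (tComp f h v t).symm ≪≫ p ⊠ᵢ q ≪≫ tComp u s g k

/-- The unit of `e` tensored on the right with an object. -/
def unitR {x y : K} (e : x ≌ y) (z : K) : 𝟙 (x ⊠ₒ z) ≅ e.hom ⊠ 𝟙 z ≫ e.inv ⊠ 𝟙 z :=
  (tId x z).symm ≪≫ e.unit ⊠ᵢ Iso.refl (𝟙 z) ≪≫ wrComp e.hom e.inv z

/-- The counit of `e` tensored on the right with an object. -/
def counitR {x y : K} (e : x ≌ y) (z : K) : e.inv ⊠ 𝟙 z ≫ e.hom ⊠ 𝟙 z ≅ 𝟙 (y ⊠ₒ z) :=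
  (wrComp e.inv e.hom z).symm ≪≫ e.counit ⊠ᵢ Iso.refl (𝟙 z) ≪≫ tId y z

/-- The unit of `e` tensored on the left with an object. -/
def unitL (z : K) {x y : K} (e : x ≌ y) : 𝟙 (z ⊠ₒ x) ≅ 𝟙 z ⊠ e.hom ≫ 𝟙 z ⊠ e.inv :=
  (tId z x).symm ≪≫ Iso.refl (𝟙 z) ⊠ᵢ e.unit ≪≫ wlComp z e.hom e.inv

/-- The counit of `e` tensored on the left with an object. -/
def counitL (z : K) {x y : K} (e : x ≌ y) : 𝟙 z ⊠ e.inv ≫ 𝟙 z ⊠ e.hom ≅ 𝟙 (z ⊠ₒ y) :=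
  (wlComp z e.inv e.hom).symm ≪≫ Iso.refl (𝟙 z) ⊠ᵢ e.counit ≪≫ tId z y

end Tensor

open TensorBicategory

/-- A tensor product with pseudonatural equivalences for associativity and units. -/
class UnitalTensorBicategory (K : Type u₁) [Bicategory.{w₁, v₁} K] extends
    TensorBicategory K where
  /-- The components of the associator, with chosen adjoint inverses. -/
  assoc (x y z : K) : (x ⊠ₒ y) ⊠ₒ z ≌ x ⊠ₒ (y ⊠ₒ z)
  /-- The pseudonaturality cells of the associator. -/
  assocNat {x x' y y' z z' : K} (f : x ⟶ x') (g : y ⟶ y') (h : z ⟶ z') :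
    (f ⊠ g) ⊠ h ≫ (assoc x' y' z').hom ≅ (assoc x y z).hom ≫ f ⊠ (g ⊠ h)
  assocNat_nat {x x' y y' z z' : K} {f f' : x ⟶ x'} {g g' : y ⟶ y'} {h h' : z ⟶ z'}
    (σ : f ⟶ f') (τ : g ⟶ g') (υ : h ⟶ h') :
    IsNat (assocNat f g h) (assocNat f' g' h') ((σ ⊠₂ τ) ⊠₂ υ) (σ ⊠₂ (τ ⊠₂ υ))
  assocNat_id (x y z : K) :
    IsNat (assocNat (𝟙 x) (𝟙 y) (𝟙 z)) (idSqH (assoc x y z).hom)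
      ((tId x y).hom ⊠₂ 𝟙 (𝟙 z) ≫ (tId (x ⊠ₒ y) z).hom)
      (𝟙 (𝟙 x) ⊠₂ (tId y z).hom ≫ (tId x (y ⊠ₒ z)).hom)
  assocNat_comp {x x' x'' y y' y'' z z' z'' : K} (f : x ⟶ x') (g : y ⟶ y') (h : z ⟶ z')
    (f' : x' ⟶ x'') (g' : y' ⟶ y'') (h' : z' ⟶ z'') :
    IsNat (assocNat (f ≫ f') (g ≫ g') (h ≫ h')) (sqH (assocNat f g h) (assocNat f' g' h'))
      ((tComp f g f' g').hom ⊠₂ 𝟙 (h ≫ h') ≫ (tComp (f ⊠ g) h (f' ⊠ g') h').hom)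
      (𝟙 (f ≫ f') ⊠₂ (tComp g h g' h').hom ≫ (tComp f (g ⊠ h) f' (g' ⊠ h')).hom)
  /-- The components of the left unitor. -/
  lUnit (x : K) : I ⊠ₒ x ≌ x
  /-- The pseudonaturality cells of the left unitor. -/
  lUnitNat {x x' : K} (f : x ⟶ x') : 𝟙 I ⊠ f ≫ (lUnit x').hom ≅ (lUnit x).hom ≫ f
  lUnitNat_nat {x x' : K} {f f' : x ⟶ x'} (σ : f ⟶ f') :
    IsNat (lUnitNat f) (lUnitNat f') (𝟙 (𝟙 I) ⊠₂ σ) σ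
  lUnitNat_id (x : K) :
    IsNat (lUnitNat (𝟙 x)) (idSqH (lUnit x).hom) (tId I x).hom (𝟙 (𝟙 x))
  lUnitNat_comp {x x' x'' : K} (f : x ⟶ x') (f' : x' ⟶ x'') :
    IsNat (lUnitNat (f ≫ f')) (sqH (lUnitNat f) (lUnitNat f')) (wlComp I f f').hom (𝟙 (f ≫ f'))
  /-- The components of the right unitor. -/
  rUnit (x : K) : x ⊠ₒ I ≌ x
  /-- The pseudonaturality cells of the right unitor. -/
  rUnitNat {x x' : K} (f : x ⟶ x') : f ⊠ 𝟙 I ≫ (rUnit x').hom ≅ (rUnit x).hom ≫ f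
  rUnitNat_nat {x x' : K} {f f' : x ⟶ x'} (σ : f ⟶ f') :
    IsNat (rUnitNat f) (rUnitNat f') (σ ⊠₂ 𝟙 (𝟙 I)) σ
  rUnitNat_id (x : K) :
    IsNat (rUnitNat (𝟙 x)) (idSqH (rUnit x).hom) (tId x I).hom (𝟙 (𝟙 x))
  rUnitNat_comp {x x' x'' : K} (f : x ⟶ x') (f' : x' ⟶ x'') :
    IsNat (rUnitNat (f ≫ f')) (sqH (rUnitNat f) (rUnitNat f')) (wrComp f f' I).hom (𝟙 (f ≫ f'))

open UnitalTensorBicategory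

section Unital

variable {K : Type u₁} [Bicategory.{w₁, v₁} K] [UnitalTensorBicategory K]

/-- The associator. -/
abbrev asc (x y z : K) : (x ⊠ₒ y) ⊠ₒ z ⟶ x ⊠ₒ (y ⊠ₒ z) := (assoc x y z).hom

/-- The chosen inverse of the associator. -/
abbrev ascInv (x y z : K) : x ⊠ₒ (y ⊠ₒ z) ⟶ (x ⊠ₒ y) ⊠ₒ z := (assoc x y z).inv

/-- The left unitor. -/
abbrev lun (x : K) : I ⊠ₒ x ⟶ x := (lUnit x).hom

/-- The right unitor. -/
abbrev run (x : K) : x ⊠ₒ I ⟶ x := (rUnit x).hom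

/-- Naturality of the associator in the first variable. -/
def ascL {x x' : K} (f : x ⟶ x') (y z : K) :
    (f ⊠ 𝟙 y) ⊠ 𝟙 z ≫ asc x' y z ≅ asc x y z ≫ f ⊠ 𝟙 (y ⊠ₒ z) :=
  assocNat f (𝟙 y) (𝟙 z) ≪≫ whiskerLeftIso (asc x y z) (Iso.refl f ⊠ᵢ tId y z)

/-- Naturality of the associator in the second variable. -/
def ascM (x : K) {y y' : K} (g : y ⟶ y') (z : K) :
    (𝟙 x ⊠ g) ⊠ 𝟙 z ≫ asc x y' z ≅ asc x y z ≫ 𝟙 x ⊠ (g ⊠ 𝟙 z) :=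
  assocNat (𝟙 x) g (𝟙 z)

/-- Naturality of the associator in the third variable. -/
def ascR (x y : K) {z z' : K} (h : z ⟶ z') :
    𝟙 (x ⊠ₒ y) ⊠ h ≫ asc x y z' ≅ asc x y z ≫ 𝟙 x ⊠ (𝟙 y ⊠ h) :=
  whiskerRightIso ((tId x y).symm ⊠ᵢ Iso.refl h) (asc x y z') ≪≫ assocNat (𝟙 x) (𝟙 y) h

end Unital

/-- A monoidal bicategory. -/
class MonoidalBicategory (K : Type u₁) [Bicategory.{w₁, v₁} K] extends
    UnitalTensorBicategory K where
  /-- The pentagonator. -/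
  pent (a b c d : K) :
    asc a b c ⊠ 𝟙 d ≫ asc a (b ⊠ₒ c) d ≫ 𝟙 a ⊠ asc b c d ≅
      asc (a ⊠ₒ b) c d ≫ asc a b (c ⊠ₒ d)
  pent_modif {a a' b b' c c' d d' : K} (f : a ⟶ a') (g : b ⟶ b') (h : c ⟶ c') (k : d ⟶ d') :
    IsCyl
      (sqV (tSq (assocNat f g h) (idSqV k))
        (sqV (assocNat f (g ⊠ h) k) (tSq (idSqV f) (assocNat g h k))))
      (sqV (assocNat (f ⊠ g) h k) (assocNat f g (h ⊠ k)))
      (pent a b c d).hom (pent a' b' c' d').hom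
  /-- The middle unit 2-cells. -/
  midU (a b : K) : asc a I b ≫ 𝟙 a ⊠ lun b ≅ run a ⊠ 𝟙 b
  midU_modif {a a' b b' : K} (f : a ⟶ a') (g : b ⟶ b') :
    IsCyl (sqV (assocNat f (𝟙 I) g) (tSq (idSqV f) (lUnitNat g))) (tSq (rUnitNat f) (idSqV g))
      (midU a b).hom (midU a' b').hom
  /-- The left unit 2-cells. -/
  leftU (a b : K) : asc I a b ≫ lun (a ⊠ₒ b) ≅ lun a ⊠ 𝟙 b
  leftU_modif {a a' b b' : K} (f : a ⟶ a') (g : b ⟶ b') :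
    IsCyl (sqV (assocNat (𝟙 I) f g) (lUnitNat (f ⊠ g))) (tSq (lUnitNat f) (idSqV g))
      (leftU a b).hom (leftU a' b').hom
  /-- The right unit 2-cells. -/
  rightU (a b : K) : asc a b I ≫ 𝟙 a ⊠ run b ≅ run (a ⊠ₒ b)
  rightU_modif {a a' b b' : K} (f : a ⟶ a') (g : b ⟶ b') :
    IsCyl (sqV (assocNat f g (𝟙 I)) (tSq (idSqV f) (rUnitNat g))) (rUnitNat (f ⊠ g))
      (rightU a b).hom (rightU a' b').hom
  /-- The nonabelian 4-cocycle condition. -/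
  associahedron (a b c d e : K) :
    (𝟙 ((asc a b c ⊠ 𝟙 d) ⊠ 𝟙 e ≫ asc a (b ⊠ₒ c) d ⊠ 𝟙 e ≫ (𝟙 a ⊠ asc b c d) ⊠ 𝟙 e ≫
          asc a (b ⊠ₒ c ⊠ₒ d) e ≫ 𝟙 a ⊠ asc b (c ⊠ₒ d) e ≫ 𝟙 a ⊠ (𝟙 b ⊠ asc c d e)) ⊗≫
      (wrComp₃ (asc a b c ⊠ 𝟙 d) (asc a (b ⊠ₒ c) d) (𝟙 a ⊠ asc b c d) e).inv ▷
        (asc a (b ⊠ₒ c ⊠ₒ d) e ≫ 𝟙 a ⊠ asc b (c ⊠ₒ d) e ≫ 𝟙 a ⊠ (𝟙 b ⊠ asc c d e)) ⊗≫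
      ((pent a b c d).hom ⊠₂ 𝟙 (𝟙 e)) ▷
        (asc a (b ⊠ₒ c ⊠ₒ d) e ≫ 𝟙 a ⊠ asc b (c ⊠ₒ d) e ≫ 𝟙 a ⊠ (𝟙 b ⊠ asc c d e)) ⊗≫
      (wrComp (asc (a ⊠ₒ b) c d) (asc a b (c ⊠ₒ d)) e).hom ▷
        (asc a (b ⊠ₒ c ⊠ₒ d) e ≫ 𝟙 a ⊠ asc b (c ⊠ₒ d) e ≫ 𝟙 a ⊠ (𝟙 b ⊠ asc c d e)) ⊗≫
      asc (a ⊠ₒ b) c d ⊠ 𝟙 e ◁ (pent a b (c ⊠ₒ d) e).hom ▷ 𝟙 a ⊠ (𝟙 b ⊠ asc c d e) ⊗≫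
      (asc (a ⊠ₒ b) c d ⊠ 𝟙 e ≫ asc (a ⊠ₒ b) (c ⊠ₒ d) e) ◁ (ascR a b (asc c d e)).inv ⊗≫
      (pent (a ⊠ₒ b) c d e).hom ▷ asc a b (c ⊠ₒ d ⊠ₒ e) ⊗≫
      𝟙 (asc ((a ⊠ₒ b) ⊠ₒ c) d e ≫ asc (a ⊠ₒ b) c (d ⊠ₒ e) ≫ asc a b (c ⊠ₒ d ⊠ₒ e))) =
    (𝟙 ((asc a b c ⊠ 𝟙 d) ⊠ 𝟙 e ≫ asc a (b ⊠ₒ c) d ⊠ 𝟙 e ≫ (𝟙 a ⊠ asc b c d) ⊠ 𝟙 e ≫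
          asc a (b ⊠ₒ c ⊠ₒ d) e ≫ 𝟙 a ⊠ asc b (c ⊠ₒ d) e ≫ 𝟙 a ⊠ (𝟙 b ⊠ asc c d e)) ⊗≫
      ((asc a b c ⊠ 𝟙 d) ⊠ 𝟙 e ≫ asc a (b ⊠ₒ c) d ⊠ 𝟙 e) ◁ (ascM a (asc b c d) e).hom ▷
        (𝟙 a ⊠ asc b (c ⊠ₒ d) e ≫ 𝟙 a ⊠ (𝟙 b ⊠ asc c d e)) ⊗≫
      ((asc a b c ⊠ 𝟙 d) ⊠ 𝟙 e ≫ asc a (b ⊠ₒ c) d ⊠ 𝟙 e ≫ asc a ((b ⊠ₒ c) ⊠ₒ d) e) ◁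
        ((wlComp₃ a (asc b c d ⊠ 𝟙 e) (asc b (c ⊠ₒ d) e) (𝟙 b ⊠ asc c d e)).inv ≫
          𝟙 (𝟙 a) ⊠₂ (pent b c d e).hom ≫
          (wlComp a (asc (b ⊠ₒ c) d e) (asc b c (d ⊠ₒ e))).hom) ⊗≫
      (asc a b c ⊠ 𝟙 d) ⊠ 𝟙 e ◁ (pent a (b ⊠ₒ c) d e).hom ▷ 𝟙 a ⊠ asc b c (d ⊠ₒ e) ⊗≫
      (ascL (asc a b c) d e).hom ▷
        (asc a (b ⊠ₒ c) (d ⊠ₒ e) ≫ 𝟙 a ⊠ asc b c (d ⊠ₒ e)) ⊗≫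
      asc ((a ⊠ₒ b) ⊠ₒ c) d e ◁ (pent a b c (d ⊠ₒ e)).hom ⊗≫
      𝟙 (asc ((a ⊠ₒ b) ⊠ₒ c) d e ≫ asc (a ⊠ₒ b) c (d ⊠ₒ e) ≫ asc a b (c ⊠ₒ d ⊠ₒ e)))
  /-- The coherence of the pentagonator with a unit in the second place. -/
  unit_second (a b c : K) :
    (𝟙 (asc a I b ⊠ 𝟙 c ≫ asc a (I ⊠ₒ b) c ≫ 𝟙 a ⊠ asc I b c ≫ 𝟙 a ⊠ lun (b ⊠ₒ c)) ⊗≫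
      (pent a I b c).hom ▷ 𝟙 a ⊠ lun (b ⊠ₒ c) ⊗≫
      asc (a ⊠ₒ I) b c ◁ (midU a (b ⊠ₒ c)).hom ⊗≫
      𝟙 (asc (a ⊠ₒ I) b c ≫ run a ⊠ 𝟙 (b ⊠ₒ c))) =
    (𝟙 (asc a I b ⊠ 𝟙 c ≫ asc a (I ⊠ₒ b) c ≫ 𝟙 a ⊠ asc I b c ≫ 𝟙 a ⊠ lun (b ⊠ₒ c)) ⊗≫
      (asc a I b ⊠ 𝟙 c ≫ asc a (I ⊠ₒ b) c) ◁
        ((wlComp a (asc I b c) (lun (b ⊠ₒ c))).inv ≫ 𝟙 (𝟙 a) ⊠₂ (leftU b c).hom) ⊗≫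
      asc a I b ⊠ 𝟙 c ◁ (ascM a (lun b) c).inv ⊗≫
      ((wrComp (asc a I b) (𝟙 a ⊠ lun b) c).inv ≫ (midU a b).hom ⊠₂ 𝟙 (𝟙 c)) ▷ asc a b c ⊗≫
      (ascL (run a) b c).hom ⊗≫
      𝟙 (asc (a ⊠ₒ I) b c ≫ run a ⊠ 𝟙 (b ⊠ₒ c)))
  /-- The coherence of the pentagonator with a unit in the third place. -/
  unit_third (a b c : K) :
    (𝟙 (asc a b I ⊠ 𝟙 c ≫ asc a (b ⊠ₒ I) c ≫ 𝟙 a ⊠ asc b I c ≫ 𝟙 a ⊠ (𝟙 b ⊠ lun c)) ⊗≫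
      (pent a b I c).hom ▷ 𝟙 a ⊠ (𝟙 b ⊠ lun c) ⊗≫
      asc (a ⊠ₒ b) I c ◁ (ascR a b (lun c)).inv ⊗≫
      (midU (a ⊠ₒ b) c).hom ▷ asc a b c ⊗≫
      𝟙 (run (a ⊠ₒ b) ⊠ 𝟙 c ≫ asc a b c)) =
    (𝟙 (asc a b I ⊠ 𝟙 c ≫ asc a (b ⊠ₒ I) c ≫ 𝟙 a ⊠ asc b I c ≫ 𝟙 a ⊠ (𝟙 b ⊠ lun c)) ⊗≫
      (asc a b I ⊠ 𝟙 c ≫ asc a (b ⊠ₒ I) c) ◁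
        ((wlComp a (asc b I c) (𝟙 b ⊠ lun c)).inv ≫ 𝟙 (𝟙 a) ⊠₂ (midU b c).hom) ⊗≫
      asc a b I ⊠ 𝟙 c ◁ (ascM a (run b) c).inv ⊗≫
      ((wrComp (asc a b I) (𝟙 a ⊠ run b) c).inv ≫ (rightU a b).hom ⊠₂ 𝟙 (𝟙 c)) ▷ asc a b c ⊗≫
      𝟙 (run (a ⊠ₒ b) ⊠ 𝟙 c ≫ asc a b c))

open MonoidalBicategory

/-- A monoidal bicategory with a pseudonatural equivalence `x ⊠ₒ y ≌ y ⊠ₒ x` and two families of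
hexagonators. -/
class HexagonBicategory (K : Type u₁) [Bicategory.{w₁, v₁} K] extends MonoidalBicategory K where
  /-- The components of the braiding. -/
  braiding (x y : K) : x ⊠ₒ y ≌ y ⊠ₒ x
  /-- The pseudonaturality cells of the braiding. -/
  braidNat {x x' y y' : K} (f : x ⟶ x') (g : y ⟶ y') :
    f ⊠ g ≫ (braiding x' y').hom ≅ (braiding x y).hom ≫ g ⊠ f
  braidNat_nat {x x' y y' : K} {f f' : x ⟶ x'} {g g' : y ⟶ y'} (σ : f ⟶ f') (τ : g ⟶ g') :
    IsNat (braidNat f g) (braidNat f' g') (σ ⊠₂ τ) (τ ⊠₂ σ)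
  braidNat_id (x y : K) :
    IsNat (braidNat (𝟙 x) (𝟙 y)) (idSqH (braiding x y).hom) (tId x y).hom (tId y x).hom
  braidNat_comp {x x' x'' y y' y'' : K} (f : x ⟶ x') (g : y ⟶ y') (f' : x' ⟶ x'')
    (g' : y' ⟶ y'') :
    IsNat (braidNat (f ≫ f') (g ≫ g')) (sqH (braidNat f g) (braidNat f' g'))
      (tComp f g f' g').hom (tComp g f g' f').hom
  /-- The hexagonator moving one object past two. -/
  hexR (a b c : K) :
    asc a b c ≫ (braiding a (b ⊠ₒ c)).hom ≫ asc b c a ≅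
      (braiding a b).hom ⊠ 𝟙 c ≫ asc b a c ≫ 𝟙 b ⊠ (braiding a c).hom
  hexR_modif {a a' b b' c c' : K} (f : a ⟶ a') (g : b ⟶ b') (h : c ⟶ c') :
    IsCyl
      (sqV (assocNat f g h) (sqV (braidNat f (g ⊠ h)) (assocNat g h f)))
      (sqV (tSq (braidNat f g) (idSqV h))
        (sqV (assocNat g f h) (tSq (idSqV g) (braidNat f h))))
      (hexR a b c).hom (hexR a' b' c').hom
  /-- The hexagonator moving two objects past one. -/
  hexS (a b c : K) :
    (braiding (a ⊠ₒ b) c).hom ≅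
      asc a b c ≫ 𝟙 a ⊠ (braiding b c).hom ≫ ascInv a c b ≫ (braiding a c).hom ⊠ 𝟙 b ≫ asc c a b
  hexS_modif {a a' b b' c c' : K} (f : a ⟶ a') (g : b ⟶ b') (h : c ⟶ c') :
    IsCyl
      (braidNat (f ⊠ g) h)
      (sqV (assocNat f g h)
        (sqV (tSq (idSqV f) (braidNat g h))
          (sqV (invSq (assoc a c b) (assoc a' c' b') (assocNat f h g))
            (sqV (tSq (braidNat f h) (idSqV g)) (assocNat h f g)))))
      (hexS a b c).hom (hexS a' b' c').hom

open HexagonBicategory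

/-- The braiding. -/
abbrev brd {K : Type u₁} [Bicategory.{w₁, v₁} K] [HexagonBicategory K] (x y : K) :
    x ⊠ₒ y ⟶ y ⊠ₒ x :=
  (braiding x y).hom

section Shuffles

variable {K : Type u₁} [Bicategory.{w₁, v₁} K] [HexagonBicategory K]

/-- A mate of the pentagonator. -/
def pentMate₁ (a b c d : K) :
    asc a b (c ⊠ₒ d) ≫ 𝟙 a ⊠ ascInv b c d ⟶
      ascInv (a ⊠ₒ b) c d ≫ asc a b c ⊠ 𝟙 d ≫ asc a (b ⊠ₒ c) d :=
  𝟙 (asc a b (c ⊠ₒ d) ≫ 𝟙 a ⊠ ascInv b c d) ⊗≫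
  (assoc (a ⊠ₒ b) c d).counit.inv ▷ (asc a b (c ⊠ₒ d) ≫ 𝟙 a ⊠ ascInv b c d) ⊗≫
  ascInv (a ⊠ₒ b) c d ◁ (pent a b c d).inv ▷ 𝟙 a ⊠ ascInv b c d ⊗≫
  (ascInv (a ⊠ₒ b) c d ≫ asc a b c ⊠ 𝟙 d ≫ asc a (b ⊠ₒ c) d) ◁ (unitL a (assoc b c d)).inv ⊗≫
  𝟙 (ascInv (a ⊠ₒ b) c d ≫ asc a b c ⊠ 𝟙 d ≫ asc a (b ⊠ₒ c) d)

/-- A mate of the pentagonator. -/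
def pentMate₂ (a b c d : K) :
    asc a (b ⊠ₒ c) d ≫ 𝟙 a ⊠ asc b c d ⟶
      ascInv a b c ⊠ 𝟙 d ≫ asc (a ⊠ₒ b) c d ≫ asc a b (c ⊠ₒ d) :=
  𝟙 (asc a (b ⊠ₒ c) d ≫ 𝟙 a ⊠ asc b c d) ⊗≫
  (counitR (assoc a b c) d).inv ▷ (asc a (b ⊠ₒ c) d ≫ 𝟙 a ⊠ asc b c d) ⊗≫
  ascInv a b c ⊠ 𝟙 d ◁ (pent a b c d).hom ⊗≫
  𝟙 (ascInv a b c ⊠ 𝟙 d ≫ asc (a ⊠ₒ b) c d ≫ asc a b (c ⊠ₒ d))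

/-- A mate of the pentagonator. -/
def pentMate₃ (a b c d : K) :
    asc a b c ⊠ 𝟙 d ≫ asc a (b ⊠ₒ c) d ⟶
      asc (a ⊠ₒ b) c d ≫ asc a b (c ⊠ₒ d) ≫ 𝟙 a ⊠ ascInv b c d :=
  𝟙 (asc a b c ⊠ 𝟙 d ≫ asc a (b ⊠ₒ c) d) ⊗≫
  (asc a b c ⊠ 𝟙 d ≫ asc a (b ⊠ₒ c) d) ◁ (unitL a (assoc b c d)).hom ⊗≫
  (pent a b c d).hom ▷ 𝟙 a ⊠ ascInv b c d ⊗≫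
  𝟙 (asc (a ⊠ₒ b) c d ≫ asc a b (c ⊠ₒ d) ≫ 𝟙 a ⊠ ascInv b c d)

/-- The braiding of the two middle factors of `a`, `b`, `d`, `c`, for the bracketings
`a ⊠ₒ (b ⊠ₒ (d ⊠ₒ c))` and `(a ⊠ₒ b) ⊠ₒ (d ⊠ₒ c)`. -/
def shuffle₁ (a b c d : K) :
    asc a b (d ⊠ₒ c) ≫ 𝟙 a ⊠ ascInv b d c ≫ 𝟙 a ⊠ (brd b d ⊠ 𝟙 c) ≫ 𝟙 a ⊠ asc d b c ≫
        ascInv a d (b ⊠ₒ c) ⟶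
      ascInv (a ⊠ₒ b) d c ≫ asc a b d ⊠ 𝟙 c ≫ (𝟙 a ⊠ brd b d) ⊠ 𝟙 c ≫ ascInv a d b ⊠ 𝟙 c ≫
        asc (a ⊠ₒ d) b c :=
  𝟙 (asc a b (d ⊠ₒ c) ≫ 𝟙 a ⊠ ascInv b d c ≫ 𝟙 a ⊠ (brd b d ⊠ 𝟙 c) ≫ 𝟙 a ⊠ asc d b c ≫
        ascInv a d (b ⊠ₒ c)) ⊗≫
  pentMate₁ a b d c ▷ (𝟙 a ⊠ (brd b d ⊠ 𝟙 c) ≫ 𝟙 a ⊠ asc d b c ≫ ascInv a d (b ⊠ₒ c)) ⊗≫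
  (ascInv (a ⊠ₒ b) d c ≫ asc a b d ⊠ 𝟙 c) ◁
    ((ascM a (brd b d) c).inv ▷ (𝟙 a ⊠ asc d b c ≫ ascInv a d (b ⊠ₒ c)) ⊗≫
      (𝟙 a ⊠ brd b d) ⊠ 𝟙 c ◁
        (pentMate₂ a d b c ▷ ascInv a d (b ⊠ₒ c) ⊗≫
          (ascInv a d b ⊠ 𝟙 c ≫ asc (a ⊠ₒ d) b c) ◁ (assoc a d (b ⊠ₒ c)).unit.inv)) ⊗≫
  𝟙 (ascInv (a ⊠ₒ b) d c ≫ asc a b d ⊠ 𝟙 c ≫ (𝟙 a ⊠ brd b d) ⊠ 𝟙 c ≫ ascInv a d b ⊠ 𝟙 c ≫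
        asc (a ⊠ₒ d) b c)

/-- A loop of associators contracted by means of the pentagonator. -/
def pentLoop (a b c d : K) :
    asc a b (c ⊠ₒ d) ≫ 𝟙 a ⊠ ascInv b c d ≫ ascInv a (b ⊠ₒ c) d ≫ ascInv a b c ⊠ 𝟙 d ≫
      asc (a ⊠ₒ b) c d ⟶ 𝟙 ((a ⊠ₒ b) ⊠ₒ (c ⊠ₒ d)) :=
  𝟙 (asc a b (c ⊠ₒ d) ≫ 𝟙 a ⊠ ascInv b c d ≫ ascInv a (b ⊠ₒ c) d ≫ ascInv a b c ⊠ 𝟙 d ≫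
      asc (a ⊠ₒ b) c d) ⊗≫
  pentMate₁ a b c d ▷ (ascInv a (b ⊠ₒ c) d ≫ ascInv a b c ⊠ 𝟙 d ≫ asc (a ⊠ₒ b) c d) ⊗≫
  (ascInv (a ⊠ₒ b) c d ≫ asc a b c ⊠ 𝟙 d) ◁ (assoc a (b ⊠ₒ c) d).unit.inv ▷
    (ascInv a b c ⊠ 𝟙 d ≫ asc (a ⊠ₒ b) c d) ⊗≫
  ascInv (a ⊠ₒ b) c d ◁ (unitR (assoc a b c) d).inv ▷ asc (a ⊠ₒ b) c d ⊗≫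
  (assoc (a ⊠ₒ b) c d).counit.hom

/-- The commutation of the braidings of `a` with `c` and of `b` with `d`. -/
def shuffle₂ (a b c d : K) :
    asc a (c ⊠ₒ b) d ≫ 𝟙 a ⊠ asc c b d ≫ 𝟙 a ⊠ (𝟙 c ⊠ brd b d) ≫ 𝟙 a ⊠ ascInv c d b ≫
        ascInv a (c ⊠ₒ d) b ≫ ascInv a c d ⊠ 𝟙 b ≫ (brd a c ⊠ 𝟙 d) ⊠ 𝟙 b ≫ asc c a d ⊠ 𝟙 b ≫
        asc c (a ⊠ₒ d) b ⟶
      ascInv a c b ⊠ 𝟙 d ≫ asc (a ⊠ₒ c) b d ≫ brd a c ⊠ 𝟙 (b ⊠ₒ d) ≫ 𝟙 (c ⊠ₒ a) ⊠ brd b d ≫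
        asc c a (d ⊠ₒ b) ≫ 𝟙 c ⊠ ascInv a d b :=
  𝟙 (asc a (c ⊠ₒ b) d ≫ 𝟙 a ⊠ asc c b d ≫ 𝟙 a ⊠ (𝟙 c ⊠ brd b d) ≫ 𝟙 a ⊠ ascInv c d b ≫
        ascInv a (c ⊠ₒ d) b ≫ ascInv a c d ⊠ 𝟙 b ≫ (brd a c ⊠ 𝟙 d) ⊠ 𝟙 b ≫ asc c a d ⊠ 𝟙 b ≫
        asc c (a ⊠ₒ d) b) ⊗≫
  pentMate₂ a c b d ▷
    (𝟙 a ⊠ (𝟙 c ⊠ brd b d) ≫ 𝟙 a ⊠ ascInv c d b ≫ ascInv a (c ⊠ₒ d) b ≫ ascInv a c d ⊠ 𝟙 b ≫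
      (brd a c ⊠ 𝟙 d) ⊠ 𝟙 b ≫ asc c a d ⊠ 𝟙 b ≫ asc c (a ⊠ₒ d) b) ⊗≫
  (ascInv a c b ⊠ 𝟙 d ≫ asc (a ⊠ₒ c) b d) ◁
    ((ascR a c (brd b d)).inv ▷
        (𝟙 a ⊠ ascInv c d b ≫ ascInv a (c ⊠ₒ d) b ≫ ascInv a c d ⊠ 𝟙 b ≫
          (brd a c ⊠ 𝟙 d) ⊠ 𝟙 b ≫ asc c a d ⊠ 𝟙 b ≫ asc c (a ⊠ₒ d) b) ⊗≫
      (𝟙 (a ⊠ₒ c) ⊠ brd b d ≫ asc a c (d ⊠ₒ b) ≫ 𝟙 a ⊠ ascInv c d b ≫ ascInv a (c ⊠ₒ d) b ≫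
          ascInv a c d ⊠ 𝟙 b) ◁
        ((brd a c ⊠ 𝟙 d) ⊠ 𝟙 b ◁ pentMate₃ c a d b ⊗≫
          (ascL (brd a c) d b).hom ▷ (asc c a (d ⊠ₒ b) ≫ 𝟙 c ⊠ ascInv a d b)) ⊗≫
      𝟙 (a ⊠ₒ c) ⊠ brd b d ◁ pentLoop a c d b ▷
        (brd a c ⊠ 𝟙 (d ⊠ₒ b) ≫ asc c a (d ⊠ₒ b) ≫ 𝟙 c ⊠ ascInv a d b) ⊗≫
      (xch (brd a c) (brd b d)).inv ▷ (asc c a (d ⊠ₒ b) ≫ 𝟙 c ⊠ ascInv a d b)) ⊗≫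
  𝟙 (ascInv a c b ⊠ 𝟙 d ≫ asc (a ⊠ₒ c) b d ≫ brd a c ⊠ 𝟙 (b ⊠ₒ d) ≫ 𝟙 (c ⊠ₒ a) ⊠ brd b d ≫
        asc c a (d ⊠ₒ b) ≫ 𝟙 c ⊠ ascInv a d b)

end Shuffles

/-- A braided monoidal bicategory. -/
class BraidedMonoidalBicategory (K : Type u₁) [Bicategory.{w₁, v₁} K] extends
    HexagonBicategory K where
  /-- The two ways of moving `a` past `b`, `c`, `d` one at a time agree. -/
  braid_one_three (a b c d : K) :
    (𝟙 ((brd a b ⊠ 𝟙 c) ⊠ 𝟙 d ≫ asc b a c ⊠ 𝟙 d ≫ (𝟙 b ⊠ brd a c) ⊠ 𝟙 d ≫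
          asc b (c ⊠ₒ a) d ≫ 𝟙 b ⊠ asc c a d ≫ 𝟙 b ⊠ (𝟙 c ⊠ brd a d)) ⊗≫
      ((wrComp₃ (brd a b ⊠ 𝟙 c) (asc b a c) (𝟙 b ⊠ brd a c) d).inv ≫
        (hexR a b c).inv ⊠₂ 𝟙 (𝟙 d) ≫
        (wrComp₃ (asc a b c) (brd a (b ⊠ₒ c)) (asc b c a) d).hom) ▷
          (asc b (c ⊠ₒ a) d ≫ 𝟙 b ⊠ asc c a d ≫ 𝟙 b ⊠ (𝟙 c ⊠ brd a d)) ⊗≫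
      (asc a b c ⊠ 𝟙 d ≫ brd a (b ⊠ₒ c) ⊠ 𝟙 d) ◁ (pent b c a d).hom ▷
          𝟙 b ⊠ (𝟙 c ⊠ brd a d) ⊗≫
      (asc a b c ⊠ 𝟙 d ≫ brd a (b ⊠ₒ c) ⊠ 𝟙 d ≫ asc (b ⊠ₒ c) a d) ◁
          (ascR b c (brd a d)).inv ⊗≫
      asc a b c ⊠ 𝟙 d ◁ (hexR a (b ⊠ₒ c) d).inv ▷ asc b c (d ⊠ₒ a) ⊗≫
      (asc a b c ⊠ 𝟙 d ≫ asc a (b ⊠ₒ c) d ≫ brd a ((b ⊠ₒ c) ⊠ₒ d)) ◁ (pent b c d a).inv ⊗≫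
      (asc a b c ⊠ 𝟙 d ≫ asc a (b ⊠ₒ c) d) ◁ (braidNat (𝟙 a) (asc b c d)).inv ▷
          (asc b (c ⊠ₒ d) a ≫ 𝟙 b ⊠ asc c d a) ⊗≫
      𝟙 (asc a b c ⊠ 𝟙 d ≫ asc a (b ⊠ₒ c) d ≫ 𝟙 a ⊠ asc b c d ≫ brd a (b ⊠ₒ c ⊠ₒ d) ≫
          asc b (c ⊠ₒ d) a ≫ 𝟙 b ⊠ asc c d a)) =
    (𝟙 ((brd a b ⊠ 𝟙 c) ⊠ 𝟙 d ≫ asc b a c ⊠ 𝟙 d ≫ (𝟙 b ⊠ brd a c) ⊠ 𝟙 d ≫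
          asc b (c ⊠ₒ a) d ≫ 𝟙 b ⊠ asc c a d ≫ 𝟙 b ⊠ (𝟙 c ⊠ brd a d)) ⊗≫
      ((brd a b ⊠ 𝟙 c) ⊠ 𝟙 d ≫ asc b a c ⊠ 𝟙 d) ◁ (ascM b (brd a c) d).hom ▷
          (𝟙 b ⊠ asc c a d ≫ 𝟙 b ⊠ (𝟙 c ⊠ brd a d)) ⊗≫
      ((brd a b ⊠ 𝟙 c) ⊠ 𝟙 d ≫ asc b a c ⊠ 𝟙 d ≫ asc b (a ⊠ₒ c) d) ◁
        ((wlComp₃ b (brd a c ⊠ 𝟙 d) (asc c a d) (𝟙 c ⊠ brd a d)).inv ≫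
          𝟙 (𝟙 b) ⊠₂ (hexR a c d).inv ≫
          (wlComp₃ b (asc a c d) (brd a (c ⊠ₒ d)) (asc c d a)).hom) ⊗≫
      (brd a b ⊠ 𝟙 c) ⊠ 𝟙 d ◁ (pent b a c d).hom ▷
          (𝟙 b ⊠ brd a (c ⊠ₒ d) ≫ 𝟙 b ⊠ asc c d a) ⊗≫
      (ascL (brd a b) c d).hom ▷
          (asc b a (c ⊠ₒ d) ≫ 𝟙 b ⊠ brd a (c ⊠ₒ d) ≫ 𝟙 b ⊠ asc c d a) ⊗≫
      asc (a ⊠ₒ b) c d ◁ (hexR a b (c ⊠ₒ d)).inv ▷ 𝟙 b ⊠ asc c d a ⊗≫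
      (pent a b c d).inv ▷ (brd a (b ⊠ₒ c ⊠ₒ d) ≫ asc b (c ⊠ₒ d) a ≫ 𝟙 b ⊠ asc c d a) ⊗≫
      𝟙 (asc a b c ⊠ 𝟙 d ≫ asc a (b ⊠ₒ c) d ≫ 𝟙 a ⊠ asc b c d ≫ brd a (b ⊠ₒ c ⊠ₒ d) ≫
          asc b (c ⊠ₒ d) a ≫ 𝟙 b ⊠ asc c d a))
  /-- The two ways of moving `a`, `b`, `c` past `d` one at a time agree. -/
  braid_three_one (a b c d : K) :
    (𝟙 (brd ((a ⊠ₒ b) ⊠ₒ c) d ≫ 𝟙 d ⊠ asc a b c) ⊗≫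
      (hexS (a ⊠ₒ b) c d).hom ▷ 𝟙 d ⊠ asc a b c ⊗≫
      (asc (a ⊠ₒ b) c d ≫ 𝟙 (a ⊠ₒ b) ⊠ brd c d ≫ ascInv (a ⊠ₒ b) d c) ◁
        ((hexS a b d).hom ⊠₂ 𝟙 (𝟙 c) ≫
          (wrComp₅ (asc a b d) (𝟙 a ⊠ brd b d) (ascInv a d b) (brd a d ⊠ 𝟙 b)
            (asc d a b) c).hom) ▷
        (asc d (a ⊠ₒ b) c ≫ 𝟙 d ⊠ asc a b c) ⊗≫
      (asc (a ⊠ₒ b) c d ≫ 𝟙 (a ⊠ₒ b) ⊠ brd c d ≫ ascInv (a ⊠ₒ b) d c ≫ asc a b d ⊠ 𝟙 c ≫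
          (𝟙 a ⊠ brd b d) ⊠ 𝟙 c ≫ ascInv a d b ⊠ 𝟙 c ≫ (brd a d ⊠ 𝟙 b) ⊠ 𝟙 c) ◁
        (pent d a b c).hom ⊗≫
      (asc (a ⊠ₒ b) c d ≫ 𝟙 (a ⊠ₒ b) ⊠ brd c d ≫ ascInv (a ⊠ₒ b) d c ≫ asc a b d ⊠ 𝟙 c ≫
          (𝟙 a ⊠ brd b d) ⊠ 𝟙 c ≫ ascInv a d b ⊠ 𝟙 c) ◁
        (ascL (brd a d) b c).hom ▷ asc d a (b ⊠ₒ c) ⊗≫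
      𝟙 (asc (a ⊠ₒ b) c d ≫ 𝟙 (a ⊠ₒ b) ⊠ brd c d ≫ ascInv (a ⊠ₒ b) d c ≫ asc a b d ⊠ 𝟙 c ≫
          (𝟙 a ⊠ brd b d) ⊠ 𝟙 c ≫ ascInv a d b ⊠ 𝟙 c ≫ asc (a ⊠ₒ d) b c ≫
          brd a d ⊠ 𝟙 (b ⊠ₒ c) ≫ asc d a (b ⊠ₒ c))) =
    (𝟙 (brd ((a ⊠ₒ b) ⊠ₒ c) d ≫ 𝟙 d ⊠ asc a b c) ⊗≫
      (braidNat (asc a b c) (𝟙 d)).inv ⊗≫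
      asc a b c ⊠ 𝟙 d ◁ (hexS a (b ⊠ₒ c) d).hom ⊗≫
      (asc a b c ⊠ 𝟙 d ≫ asc a (b ⊠ₒ c) d) ◁
        (𝟙 (𝟙 a) ⊠₂ (hexS b c d).hom ≫
          (wlComp₅ a (asc b c d) (𝟙 b ⊠ brd c d) (ascInv b d c) (brd b d ⊠ 𝟙 c)
            (asc d b c)).hom) ▷
        (ascInv a d (b ⊠ₒ c) ≫ brd a d ⊠ 𝟙 (b ⊠ₒ c) ≫ asc d a (b ⊠ₒ c)) ⊗≫
      (pent a b c d).hom ▷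
        (𝟙 a ⊠ (𝟙 b ⊠ brd c d) ≫ 𝟙 a ⊠ ascInv b d c ≫ 𝟙 a ⊠ (brd b d ⊠ 𝟙 c) ≫
          𝟙 a ⊠ asc d b c ≫ ascInv a d (b ⊠ₒ c) ≫ brd a d ⊠ 𝟙 (b ⊠ₒ c) ≫ asc d a (b ⊠ₒ c)) ⊗≫
      asc (a ⊠ₒ b) c d ◁ (ascR a b (brd c d)).inv ▷
        (𝟙 a ⊠ ascInv b d c ≫ 𝟙 a ⊠ (brd b d ⊠ 𝟙 c) ≫
          𝟙 a ⊠ asc d b c ≫ ascInv a d (b ⊠ₒ c) ≫ brd a d ⊠ 𝟙 (b ⊠ₒ c) ≫ asc d a (b ⊠ₒ c)) ⊗≫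
      (asc (a ⊠ₒ b) c d ≫ 𝟙 (a ⊠ₒ b) ⊠ brd c d) ◁ shuffle₁ a b c d ▷
        (brd a d ⊠ 𝟙 (b ⊠ₒ c) ≫ asc d a (b ⊠ₒ c)) ⊗≫
      𝟙 (asc (a ⊠ₒ b) c d ≫ 𝟙 (a ⊠ₒ b) ⊠ brd c d ≫ ascInv (a ⊠ₒ b) d c ≫ asc a b d ⊠ 𝟙 c ≫
          (𝟙 a ⊠ brd b d) ⊠ 𝟙 c ≫ ascInv a d b ⊠ 𝟙 c ≫ asc (a ⊠ₒ d) b c ≫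
          brd a d ⊠ 𝟙 (b ⊠ₒ c) ≫ asc d a (b ⊠ₒ c)))
  /-- The two ways of moving `a`, `b` past `c`, `d` one at a time agree. -/
  braid_two_two (a b c d : K) :
    (𝟙 (asc (a ⊠ₒ b) c d ≫ brd (a ⊠ₒ b) (c ⊠ₒ d) ≫ asc c d (a ⊠ₒ b)) ⊗≫
      (hexR (a ⊠ₒ b) c d).hom ⊗≫
      ((hexS a b c).hom ⊠₂ 𝟙 (𝟙 d) ≫
          (wrComp₅ (asc a b c) (𝟙 a ⊠ brd b c) (ascInv a c b) (brd a c ⊠ 𝟙 b)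
            (asc c a b) d).hom) ▷
        (asc c (a ⊠ₒ b) d ≫ 𝟙 c ⊠ brd (a ⊠ₒ b) d) ⊗≫
      (asc a b c ⊠ 𝟙 d ≫ (𝟙 a ⊠ brd b c) ⊠ 𝟙 d ≫ ascInv a c b ⊠ 𝟙 d ≫ (brd a c ⊠ 𝟙 b) ⊠ 𝟙 d ≫
          asc c a b ⊠ 𝟙 d ≫ asc c (a ⊠ₒ b) d) ◁
        (𝟙 (𝟙 c) ⊠₂ (hexS a b d).hom ≫
          (wlComp₅ c (asc a b d) (𝟙 a ⊠ brd b d) (ascInv a d b) (brd a d ⊠ 𝟙 b)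
            (asc d a b)).hom) ⊗≫
      (asc a b c ⊠ 𝟙 d ≫ (𝟙 a ⊠ brd b c) ⊠ 𝟙 d ≫ ascInv a c b ⊠ 𝟙 d ≫
          (brd a c ⊠ 𝟙 b) ⊠ 𝟙 d) ◁
        (pent c a b d).hom ▷
        (𝟙 c ⊠ (𝟙 a ⊠ brd b d) ≫ 𝟙 c ⊠ ascInv a d b ≫ 𝟙 c ⊠ (brd a d ⊠ 𝟙 b) ≫
          𝟙 c ⊠ asc d a b) ⊗≫
      (asc a b c ⊠ 𝟙 d ≫ (𝟙 a ⊠ brd b c) ⊠ 𝟙 d ≫ ascInv a c b ⊠ 𝟙 d) ◁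
        (ascL (brd a c) b d).hom ▷
        (asc c a (b ⊠ₒ d) ≫ 𝟙 c ⊠ (𝟙 a ⊠ brd b d) ≫ 𝟙 c ⊠ ascInv a d b ≫
          𝟙 c ⊠ (brd a d ⊠ 𝟙 b) ≫ 𝟙 c ⊠ asc d a b) ⊗≫
      (asc a b c ⊠ 𝟙 d ≫ (𝟙 a ⊠ brd b c) ⊠ 𝟙 d ≫ ascInv a c b ⊠ 𝟙 d ≫ asc (a ⊠ₒ c) b d ≫
          brd a c ⊠ 𝟙 (b ⊠ₒ d)) ◁
        (ascR c a (brd b d)).inv ▷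
        (𝟙 c ⊠ ascInv a d b ≫ 𝟙 c ⊠ (brd a d ⊠ 𝟙 b) ≫ 𝟙 c ⊠ asc d a b) ⊗≫
      𝟙 (asc a b c ⊠ 𝟙 d ≫ (𝟙 a ⊠ brd b c) ⊠ 𝟙 d ≫ ascInv a c b ⊠ 𝟙 d ≫ asc (a ⊠ₒ c) b d ≫
          brd a c ⊠ 𝟙 (b ⊠ₒ d) ≫ 𝟙 (c ⊠ₒ a) ⊠ brd b d ≫ asc c a (d ⊠ₒ b) ≫
          𝟙 c ⊠ ascInv a d b ≫ 𝟙 c ⊠ (brd a d ⊠ 𝟙 b) ≫ 𝟙 c ⊠ asc d a b)) =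
    (𝟙 (asc (a ⊠ₒ b) c d ≫ brd (a ⊠ₒ b) (c ⊠ₒ d) ≫ asc c d (a ⊠ₒ b)) ⊗≫
      asc (a ⊠ₒ b) c d ◁ (hexS a b (c ⊠ₒ d)).hom ▷ asc c d (a ⊠ₒ b) ⊗≫
      (pent a b c d).inv ▷
        (𝟙 a ⊠ brd b (c ⊠ₒ d) ≫ ascInv a (c ⊠ₒ d) b ≫ brd a (c ⊠ₒ d) ⊠ 𝟙 b ≫
          asc (c ⊠ₒ d) a b ≫ asc c d (a ⊠ₒ b)) ⊗≫
      (asc a b c ⊠ 𝟙 d ≫ asc a (b ⊠ₒ c) d ≫ 𝟙 a ⊠ asc b c d ≫ 𝟙 a ⊠ brd b (c ⊠ₒ d) ≫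
          ascInv a (c ⊠ₒ d) b ≫ brd a (c ⊠ₒ d) ⊠ 𝟙 b) ◁ (pent c d a b).inv ⊗≫
      (asc a b c ⊠ 𝟙 d ≫ asc a (b ⊠ₒ c) d ≫ 𝟙 a ⊠ asc b c d ≫ 𝟙 a ⊠ brd b (c ⊠ₒ d)) ◁
        (unitL a (assoc c d b)).hom ▷
        (ascInv a (c ⊠ₒ d) b ≫ brd a (c ⊠ₒ d) ⊠ 𝟙 b ≫
          asc c d a ⊠ 𝟙 b ≫ asc c (d ⊠ₒ a) b ≫ 𝟙 c ⊠ asc d a b) ⊗≫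
      (asc a b c ⊠ 𝟙 d ≫ asc a (b ⊠ₒ c) d) ◁
        ((wlComp₃ a (asc b c d) (brd b (c ⊠ₒ d)) (asc c d b)).inv ≫
          𝟙 (𝟙 a) ⊠₂ (hexR b c d).hom ≫
          (wlComp₃ a (brd b c ⊠ 𝟙 d) (asc c b d) (𝟙 c ⊠ brd b d)).hom) ▷
        (𝟙 a ⊠ ascInv c d b ≫ ascInv a (c ⊠ₒ d) b ≫ brd a (c ⊠ₒ d) ⊠ 𝟙 b ≫
          asc c d a ⊠ 𝟙 b ≫ asc c (d ⊠ₒ a) b ≫ 𝟙 c ⊠ asc d a b) ⊗≫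
      (asc a b c ⊠ 𝟙 d ≫ asc a (b ⊠ₒ c) d ≫ 𝟙 a ⊠ (brd b c ⊠ 𝟙 d) ≫ 𝟙 a ⊠ asc c b d ≫
          𝟙 a ⊠ (𝟙 c ⊠ brd b d) ≫ 𝟙 a ⊠ ascInv c d b ≫ ascInv a (c ⊠ₒ d) b) ◁
        (counitR (assoc a c d) b).inv ▷
        (brd a (c ⊠ₒ d) ⊠ 𝟙 b ≫
          asc c d a ⊠ 𝟙 b ≫ asc c (d ⊠ₒ a) b ≫ 𝟙 c ⊠ asc d a b) ⊗≫
      (asc a b c ⊠ 𝟙 d ≫ asc a (b ⊠ₒ c) d ≫ 𝟙 a ⊠ (brd b c ⊠ 𝟙 d) ≫ 𝟙 a ⊠ asc c b d ≫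
          𝟙 a ⊠ (𝟙 c ⊠ brd b d) ≫ 𝟙 a ⊠ ascInv c d b ≫ ascInv a (c ⊠ₒ d) b ≫
          ascInv a c d ⊠ 𝟙 b) ◁
        ((wrComp₃ (asc a c d) (brd a (c ⊠ₒ d)) (asc c d a) b).inv ≫
          (hexR a c d).hom ⊠₂ 𝟙 (𝟙 b) ≫
          (wrComp₃ (brd a c ⊠ 𝟙 d) (asc c a d) (𝟙 c ⊠ brd a d) b).hom) ▷
        (asc c (d ⊠ₒ a) b ≫ 𝟙 c ⊠ asc d a b) ⊗≫
      asc a b c ⊠ 𝟙 d ◁ (ascM a (brd b c) d).inv ▷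
        (𝟙 a ⊠ asc c b d ≫
          𝟙 a ⊠ (𝟙 c ⊠ brd b d) ≫ 𝟙 a ⊠ ascInv c d b ≫ ascInv a (c ⊠ₒ d) b ≫
          ascInv a c d ⊠ 𝟙 b ≫ (brd a c ⊠ 𝟙 d) ⊠ 𝟙 b ≫ asc c a d ⊠ 𝟙 b ≫
          (𝟙 c ⊠ brd a d) ⊠ 𝟙 b ≫ asc c (d ⊠ₒ a) b ≫ 𝟙 c ⊠ asc d a b) ⊗≫
      (asc a b c ⊠ 𝟙 d ≫ (𝟙 a ⊠ brd b c) ⊠ 𝟙 d ≫ asc a (c ⊠ₒ b) d ≫ 𝟙 a ⊠ asc c b d ≫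
          𝟙 a ⊠ (𝟙 c ⊠ brd b d) ≫ 𝟙 a ⊠ ascInv c d b ≫ ascInv a (c ⊠ₒ d) b ≫
          ascInv a c d ⊠ 𝟙 b ≫ (brd a c ⊠ 𝟙 d) ⊠ 𝟙 b ≫ asc c a d ⊠ 𝟙 b) ◁
        (ascM c (brd a d) b).hom ▷ 𝟙 c ⊠ asc d a b ⊗≫
      (asc a b c ⊠ 𝟙 d ≫ (𝟙 a ⊠ brd b c) ⊠ 𝟙 d) ◁ shuffle₂ a b c d ▷
        (𝟙 c ⊠ (brd a d ⊠ 𝟙 b) ≫ 𝟙 c ⊠ asc d a b) ⊗≫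
      𝟙 (asc a b c ⊠ 𝟙 d ≫ (𝟙 a ⊠ brd b c) ⊠ 𝟙 d ≫ ascInv a c b ⊠ 𝟙 d ≫ asc (a ⊠ₒ c) b d ≫
          brd a c ⊠ 𝟙 (b ⊠ₒ d) ≫ 𝟙 (c ⊠ₒ a) ⊠ brd b d ≫ asc c a (d ⊠ₒ b) ≫
          𝟙 c ⊠ ascInv a d b ≫ 𝟙 c ⊠ (brd a d ⊠ 𝟙 b) ≫ 𝟙 c ⊠ asc d a b))
  /-- The two proofs of the Yang-Baxter equation agree. -/
  yang_baxter (a b c : K) :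
    (𝟙 (asc a b c ≫ 𝟙 a ⊠ brd b c ≫ ascInv a c b ≫ brd a c ⊠ 𝟙 b ≫ asc c a b ≫
          𝟙 c ⊠ brd a b) ⊗≫
      (hexS a b c).inv ▷ 𝟙 c ⊠ brd a b ⊗≫
      (braidNat (brd a b) (𝟙 c)).inv ⊗≫
      brd a b ⊠ 𝟙 c ◁ (hexS b a c).hom ⊗≫
      𝟙 (brd a b ⊠ 𝟙 c ≫ asc b a c ≫ 𝟙 b ⊠ brd a c ≫ ascInv b c a ≫ brd b c ⊠ 𝟙 a ≫
          asc c b a)) =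
    (𝟙 (asc a b c ≫ 𝟙 a ⊠ brd b c ≫ ascInv a c b ≫ brd a c ⊠ 𝟙 b ≫ asc c a b ≫
          𝟙 c ⊠ brd a b) ⊗≫
      (asc a b c ≫ 𝟙 a ⊠ brd b c ≫ ascInv a c b) ◁ (hexR a c b).inv ⊗≫
      (asc a b c ≫ 𝟙 a ⊠ brd b c) ◁ (assoc a c b).counit.hom ▷
        (brd a (c ⊠ₒ b) ≫ asc c b a) ⊗≫
      asc a b c ◁ (braidNat (𝟙 a) (brd b c)).hom ▷ asc c b a ⊗≫
      (asc a b c ≫ brd a (b ⊠ₒ c)) ◁ (assoc b c a).unit.hom ▷ (brd b c ⊠ 𝟙 a ≫ asc c b a) ⊗≫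
      (hexR a b c).hom ▷ (ascInv b c a ≫ brd b c ⊠ 𝟙 a ≫ asc c b a) ⊗≫
      𝟙 (brd a b ⊠ 𝟙 c ≫ asc b a c ≫ 𝟙 b ⊠ brd a c ≫ ascInv b c a ≫ brd b c ⊠ 𝟙 a ≫
          asc c b a))

/-- A braided monoidal bicategory with a syllepsis that is a symmetry. -/
class SymmetricMonoidalBicategory (K : Type u₁) [Bicategory.{w₁, v₁} K] extends
    BraidedMonoidalBicategory K where
  /-- The syllepsis. -/
  syl (a b : K) : 𝟙 (a ⊠ₒ b) ≅ brd a b ≫ brd b a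
  syl_modif {a a' b b' : K} (f : a ⟶ a') (g : b ⟶ b') :
    IsCyl (idSqV (f ⊠ g)) (sqV (braidNat f g) (braidNat g f)) (syl a b).hom (syl a' b').hom
  /-- Compatibility of the syllepsis with a tensor product in the second variable. -/
  syl_tensor_right (a b c : K) :
    (𝟙 (asc a b c) ⊗≫
      asc a b c ◁ (syl a (b ⊠ₒ c)).hom ⊗≫
      (asc a b c ≫ brd a (b ⊠ₒ c)) ◁ (hexS b c a).hom ⊗≫
      (hexR a b c).hom ▷ (𝟙 b ⊠ brd c a ≫ ascInv b a c ≫ brd b a ⊠ 𝟙 c ≫ asc a b c) ⊗≫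
      𝟙 (brd a b ⊠ 𝟙 c ≫ asc b a c ≫ 𝟙 b ⊠ brd a c ≫ 𝟙 b ⊠ brd c a ≫ ascInv b a c ≫
          brd b a ⊠ 𝟙 c ≫ asc a b c)) =
    (𝟙 (asc a b c) ⊗≫
      ((tId (a ⊠ₒ b) c).inv ≫ (syl a b).hom ⊠₂ 𝟙 (𝟙 c) ≫ (wrComp (brd a b) (brd b a) c).hom) ▷
        asc a b c ⊗≫
      brd a b ⊠ 𝟙 c ◁ (assoc b a c).unit.hom ▷ (brd b a ⊠ 𝟙 c ≫ asc a b c) ⊗≫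
      (brd a b ⊠ 𝟙 c ≫ asc b a c) ◁
        ((tId b (a ⊠ₒ c)).inv ≫ 𝟙 (𝟙 b) ⊠₂ (syl a c).hom ≫
          (wlComp b (brd a c) (brd c a)).hom) ▷
        (ascInv b a c ≫ brd b a ⊠ 𝟙 c ≫ asc a b c) ⊗≫
      𝟙 (brd a b ⊠ 𝟙 c ≫ asc b a c ≫ 𝟙 b ⊠ brd a c ≫ 𝟙 b ⊠ brd c a ≫ ascInv b a c ≫
          brd b a ⊠ 𝟙 c ≫ asc a b c))
  /-- Compatibility of the syllepsis with a tensor product in the first variable. -/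
  syl_tensor_left (a b c : K) :
    (𝟙 (asc a b c) ⊗≫
      (syl (a ⊠ₒ b) c).hom ▷ asc a b c ⊗≫
      (hexS a b c).hom ▷ (brd c (a ⊠ₒ b) ≫ asc a b c) ⊗≫
      (asc a b c ≫ 𝟙 a ⊠ brd b c ≫ ascInv a c b ≫ brd a c ⊠ 𝟙 b) ◁ (hexR c a b).hom ⊗≫
      𝟙 (asc a b c ≫ 𝟙 a ⊠ brd b c ≫ ascInv a c b ≫ brd a c ⊠ 𝟙 b ≫ brd c a ⊠ 𝟙 b ≫
          asc a c b ≫ 𝟙 a ⊠ brd c b)) =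
    (𝟙 (asc a b c) ⊗≫
      asc a b c ◁ ((tId a (b ⊠ₒ c)).inv ≫ 𝟙 (𝟙 a) ⊠₂ (syl b c).hom ≫
          (wlComp a (brd b c) (brd c b)).hom) ⊗≫
      (asc a b c ≫ 𝟙 a ⊠ brd b c) ◁ (assoc a c b).counit.inv ▷ 𝟙 a ⊠ brd c b ⊗≫
      (asc a b c ≫ 𝟙 a ⊠ brd b c ≫ ascInv a c b) ◁
        ((tId (a ⊠ₒ c) b).inv ≫ (syl a c).hom ⊠₂ 𝟙 (𝟙 b) ≫
          (wrComp (brd a c) (brd c a) b).hom) ▷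
        (asc a c b ≫ 𝟙 a ⊠ brd c b) ⊗≫
      𝟙 (asc a b c ≫ 𝟙 a ⊠ brd b c ≫ ascInv a c b ≫ brd a c ⊠ 𝟙 b ≫ brd c a ⊠ 𝟙 b ≫
          asc a c b ≫ 𝟙 a ⊠ brd c b))
  /-- The symmetry axiom. -/
  syl_symm (a b : K) :
    (𝟙 (brd a b) ⊗≫ (syl a b).hom ▷ brd a b ⊗≫ 𝟙 (brd a b ≫ brd b a ≫ brd a b)) =
    (𝟙 (brd a b) ⊗≫ brd a b ◁ (syl b a).hom ⊗≫ 𝟙 (brd a b ≫ brd b a ≫ brd a b))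

/-! ### Pseudomonoids -/

/-- The data of a pseudomonoid. -/
structure PsMonData (K : Type u₁) [Bicategory.{w₁, v₁} K] [MonoidalBicategory K] where
  /-- The underlying object. -/
  X : K
  /-- The multiplication. -/
  mul : X ⊠ₒ X ⟶ X
  /-- The unit. -/
  one : (I : K) ⟶ X
  /-- The associativity 2-cell. -/
  mulAssoc : mul ⊠ 𝟙 X ≫ mul ≅ asc X X X ≫ 𝟙 X ⊠ mul ≫ mul
  /-- The left unit 2-cell. -/
  oneMul : one ⊠ 𝟙 X ≫ mul ≅ lun X
  /-- The right unit 2-cell. -/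
  mulOne : 𝟙 X ⊠ one ≫ mul ≅ run X

/-- A pseudomonoid in a monoidal bicategory. -/
structure PsMon (K : Type u₁) [Bicategory.{w₁, v₁} K] [MonoidalBicategory K] extends
    PsMonData K where
  pentagon :
    (𝟙 ((mul ⊠ 𝟙 X) ⊠ 𝟙 X ≫ mul ⊠ 𝟙 X ≫ mul) ⊗≫
      (mul ⊠ 𝟙 X) ⊠ 𝟙 X ◁ mulAssoc.hom ⊗≫
      (ascL mul X X).hom ▷ (𝟙 X ⊠ mul ≫ mul) ⊗≫
      asc (X ⊠ₒ X) X X ◁ (xch mul mul).hom ▷ mul ⊗≫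
      (asc (X ⊠ₒ X) X X ≫ 𝟙 (X ⊠ₒ X) ⊠ mul) ◁ mulAssoc.hom ⊗≫
      asc (X ⊠ₒ X) X X ◁ (ascR X X mul).hom ▷ (𝟙 X ⊠ mul ≫ mul) ⊗≫
      𝟙 (asc (X ⊠ₒ X) X X ≫ asc X X (X ⊠ₒ X) ≫ 𝟙 X ⊠ (𝟙 X ⊠ mul) ≫ 𝟙 X ⊠ mul ≫ mul)) =
    (𝟙 ((mul ⊠ 𝟙 X) ⊠ 𝟙 X ≫ mul ⊠ 𝟙 X ≫ mul) ⊗≫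
      ((wrComp (mul ⊠ 𝟙 X) mul X).inv ≫ mulAssoc.hom ⊠₂ 𝟙 (𝟙 X) ≫
        (wrComp₃ (asc X X X) (𝟙 X ⊠ mul) mul X).hom) ▷ mul ⊗≫
      (asc X X X ⊠ 𝟙 X ≫ (𝟙 X ⊠ mul) ⊠ 𝟙 X) ◁ mulAssoc.hom ⊗≫
      asc X X X ⊠ 𝟙 X ◁ (ascM X mul X).hom ▷ (𝟙 X ⊠ mul ≫ mul) ⊗≫
      (asc X X X ⊠ 𝟙 X ≫ asc X (X ⊠ₒ X) X) ◁
        ((wlComp X (mul ⊠ 𝟙 X) mul).inv ≫ 𝟙 (𝟙 X) ⊠₂ mulAssoc.hom ≫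
          (wlComp₃ X (asc X X X) (𝟙 X ⊠ mul) mul).hom) ▷ mul ⊗≫
      (pent X X X X).hom ▷ (𝟙 X ⊠ (𝟙 X ⊠ mul) ≫ 𝟙 X ⊠ mul ≫ mul) ⊗≫
      𝟙 (asc (X ⊠ₒ X) X X ≫ asc X X (X ⊠ₒ X) ≫ 𝟙 X ⊠ (𝟙 X ⊠ mul) ≫ 𝟙 X ⊠ mul ≫ mul))
  triangle :
    (𝟙 ((𝟙 X ⊠ one) ⊠ 𝟙 X ≫ mul ⊠ 𝟙 X ≫ mul) ⊗≫
      ((wrComp (𝟙 X ⊠ one) mul X).inv ≫ mulOne.hom ⊠₂ 𝟙 (𝟙 X)) ▷ mul ⊗≫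
      𝟙 (run X ⊠ 𝟙 X ≫ mul)) =
    (𝟙 ((𝟙 X ⊠ one) ⊠ 𝟙 X ≫ mul ⊠ 𝟙 X ≫ mul) ⊗≫
      (𝟙 X ⊠ one) ⊠ 𝟙 X ◁ mulAssoc.hom ⊗≫
      (ascM X one X).hom ▷ (𝟙 X ⊠ mul ≫ mul) ⊗≫
      asc X I X ◁ ((wlComp X (one ⊠ 𝟙 X) mul).inv ≫ 𝟙 (𝟙 X) ⊠₂ oneMul.hom) ▷ mul ⊗≫
      (midU X X).hom ▷ mul ⊗≫
      𝟙 (run X ⊠ 𝟙 X ≫ mul))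

section PsMon

variable {K : Type u₁} [Bicategory.{w₁, v₁} K] [MonoidalBicategory K]

/-- The data of a strong morphism of pseudomonoids. -/
@[ext]
structure StrongMorData (A B : PsMonData K) where
  /-- The underlying 1-cell. -/
  f : A.X ⟶ B.X
  /-- The comparison of multiplications. -/
  φ : f ⊠ f ≫ B.mul ≅ A.mul ≫ f
  /-- The comparison of units. -/
  φ₀ : B.one ≅ A.one ≫ f

/-- The comparison of units as a square. -/
def StrongMorData.unitSq {A B : PsMonData K} (F : StrongMorData A B) :
    𝟙 I ≫ B.one ≅ A.one ≫ F.f :=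
  λ_ B.one ≪≫ F.φ₀

/-- A strong morphism of pseudomonoids. -/
@[ext]
structure StrongMor (A B : PsMon K) extends StrongMorData A.toPsMonData B.toPsMonData where
  assoc_compat :
    IsCyl (sqV (tSq φ (idSqV f)) φ) (sqV (assocNat f f f) (sqV (tSq (idSqV f) φ) φ))
      A.mulAssoc.hom B.mulAssoc.hom
  one_mul_compat :
    IsCyl (sqV (tSq toStrongMorData.unitSq (idSqV f)) φ) (lUnitNat f)
      A.oneMul.hom B.oneMul.hom
  mul_one_compat :
    IsCyl (sqV (tSq (idSqV f) toStrongMorData.unitSq) φ) (rUnitNat f)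
      A.mulOne.hom B.mulOne.hom

/-- A 2-cell between strong morphisms of pseudomonoids. -/
@[ext]
structure PsMonCell {A B : PsMon K} (F G : StrongMor A B) where
  /-- The underlying 2-cell. -/
  hom : F.f ⟶ G.f
  mul_compat : IsNat F.φ G.φ (hom ⊠₂ hom) hom
  one_compat : F.φ₀.hom ≫ A.one ◁ hom = G.φ₀.hom


end PsMon
/-! ### The calculus of squares -/

section SquareLemmas

variable {K : Type u₁} [Bicategory.{w₁, v₁} K]

/-- Replacing the horizontal sides of a square by isomorphic 1-cells. -/
def sqConj {a b a' b' : K} {f f' : a ⟶ a'} {g g' : b ⟶ b'} {u : a ⟶ b} {v : a' ⟶ b'}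
    (e : f' ≅ f) (e' : g ≅ g') (s : f ≫ v ≅ u ≫ g) : f' ≫ v ≅ u ≫ g' :=
  whiskerRightIso e v ≪≫ s ≪≫ whiskerLeftIso u e'

theorem IsCyl.conj {a b a' b' : K} {f f' : a ⟶ a'} {g g' : b ⟶ b'} {u u' : a ⟶ b}
    {v v' : a' ⟶ b'} {s : f ≫ v ≅ u ≫ g} {t : f ≫ v' ≅ u' ≫ g} {θ : u ⟶ u'} {θ' : v ⟶ v'}
    (h : IsCyl s t θ θ') (e : f' ≅ f) (e' : g ≅ g') :
    IsCyl (sqConj e e' s) (sqConj e e' t) θ θ' := by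
  simp only [IsCyl, sqConj, Iso.trans_hom, whiskerRightIso_hom, whiskerLeftIso_hom,
    Category.assoc] at h ⊢
  rw [whisker_exchange_assoc, reassoc_of% h, whisker_exchange]

theorem IsCyl.sqH {a b a' b' a'' b'' : K} {f : a ⟶ a'} {f' : a' ⟶ a''} {g : b ⟶ b'}
    {g' : b' ⟶ b''} {u u' : a ⟶ b} {v v' : a' ⟶ b'} {w w' : a'' ⟶ b''}
    {s : f ≫ v ≅ u ≫ g} {t : f ≫ v' ≅ u' ≫ g} {s' : f' ≫ w ≅ v ≫ g'} {t' : f' ≫ w' ≅ v' ≫ g'}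
    {θ : u ⟶ u'} {θ' : v ⟶ v'} {θ'' : w ⟶ w'}
    (h : IsCyl s t θ θ') (h' : IsCyl s' t' θ' θ'') :
    IsCyl (sqH s s') (sqH t t') θ θ'' := by
  simp only [IsCyl, MonTwoCat.sqH, Iso.trans_hom, Iso.symm_hom, whiskerRightIso_hom,
    whiskerLeftIso_hom, Category.assoc] at h h' ⊢
  have h1 := congrArg (fun z => f ◁ z) h'
  have h2 := congrArg (fun z => z ▷ g') h
  simp only [whiskerLeft_comp, comp_whiskerRight] at h1 h2
  calc (f ≫ f') ◁ θ'' ≫ (α_ f f' w').hom ≫ f ◁ t'.hom ≫ (α_ f v' g').inv ≫ t.hom ▷ g' ≫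
        (α_ u' g g').hom
      = (α_ f f' w).hom ≫ (f ◁ f' ◁ θ'' ≫ f ◁ t'.hom) ≫ (α_ f v' g').inv ≫ t.hom ▷ g' ≫
        (α_ u' g g').hom := by simp
    _ = (α_ f f' w).hom ≫ f ◁ s'.hom ≫ (α_ f v g').inv ≫ ((f ◁ θ') ▷ g' ≫ t.hom ▷ g') ≫
        (α_ u' g g').hom := by rw [h1]; simp
    _ = _ := by rw [h2]; simp

theorem sqV_sqH {a b c a' b' c' a'' b'' c'' : K} {f : a ⟶ a'} {f' : a' ⟶ a''} {g : b ⟶ b'}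
    {g' : b' ⟶ b''} {h : c ⟶ c'} {h' : c' ⟶ c''} {u : a ⟶ b} {u' : b ⟶ c} {v : a' ⟶ b'}
    {v' : b' ⟶ c'} {w : a'' ⟶ b''} {w' : b'' ⟶ c''}
    (s : f ≫ v ≅ u ≫ g) (s' : f' ≫ w ≅ v ≫ g') (t : g ≫ v' ≅ u' ≫ h) (t' : g' ≫ w' ≅ v' ≫ h') :
    sqV (sqH s s') (sqH t t') = sqH (sqV s t) (sqV s' t') := by
  ext
  have h1 := whisker_exchange s.hom t'.hom
  have h2 : s.hom ▷ g' ▷ w' ≫ (α_ (u ≫ g) g' w').hom ≫ (α_ u g (g' ≫ w')).hom ≫ u ◁ g ◁ t'.hom =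
      (α_ (f ≫ v) g' w').hom ≫ (s.hom ▷ (g' ≫ w') ≫ (u ≫ g) ◁ t'.hom) ≫
        (α_ u g (v' ≫ h')).hom := by simp
  simp only [sqV, sqH, Iso.trans_hom, Iso.symm_hom, whiskerRightIso_hom, whiskerLeftIso_hom,
    comp_whiskerRight, whiskerLeft_comp, Category.assoc, whisker_assoc,
    pentagon_assoc]
  simp only [← h1] at h2
  simp [reassoc_of% h2]

theorem sqV_conj {a b c a' b' c' : K} {f f₁ : a ⟶ a'} {g g₁ : b ⟶ b'} {h h₁ : c ⟶ c'}
    {u : a ⟶ b} {u' : b ⟶ c} {v : a' ⟶ b'} {v' : b' ⟶ c'} (s : f ≫ v ≅ u ≫ g)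
    (t : g ≫ v' ≅ u' ≫ h) (e : f₁ ≅ f) (e' : g₁ ≅ g) (e'' : h ≅ h₁) :
    sqV (sqConj e e'.symm s) (sqConj e' e'' t) = sqConj e e'' (sqV s t) := by
  ext
  simp [sqV, sqConj]

theorem idSqV_comp {a b c : K} (f : a ⟶ b) (g : b ⟶ c) :
    idSqV (f ≫ g) = sqH (idSqV f) (idSqV g) := by
  ext
  simp [idSqV, sqH]

theorem sqConj_conj {a b a' b' : K} {f f' f'' : a ⟶ a'} {g g' g'' : b ⟶ b'} {u : a ⟶ b}
    {v : a' ⟶ b'} (e : f' ≅ f) (e' : g ≅ g') (d : f'' ≅ f') (d' : g' ≅ g'')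
    (s : f ≫ v ≅ u ≫ g) :
    sqConj d d' (sqConj e e' s) = sqConj (d ≪≫ e) (e' ≪≫ d') s := by
  ext
  simp [sqConj]

theorem IsNat.eq_conj {a b a' b' : K} {f f' : a ⟶ a'} {g g' : b ⟶ b'} {u : a ⟶ b}
    {v : a' ⟶ b'} {s : f ≫ v ≅ u ≫ g} {t : f' ≫ v ≅ u ≫ g'} (e : f ≅ f') (e' : g ≅ g')
    (h : IsNat s t e.hom e'.hom) : s = sqConj e e'.symm t := by
  ext
  simp only [IsNat] at h
  simp only [sqConj, Iso.trans_hom, whiskerRightIso_hom, whiskerLeftIso_hom, Iso.symm_hom]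
  rw [reassoc_of% h]
  simp

theorem sqConj_refl {a b a' b' : K} {f : a ⟶ a'} {g : b ⟶ b'} {u : a ⟶ b} {v : a' ⟶ b'}
    (s : f ≫ v ≅ u ≫ g) : sqConj (Iso.refl f) (Iso.refl g) s = s := by
  ext
  simp [sqConj]

theorem isCyl_idSqH {a b : K} {u u' : a ⟶ b} (θ : u ⟶ u') :
    IsCyl (idSqH u) (idSqH u') θ θ := by
  simp [IsCyl, idSqH]

theorem sqV_idSqH {a b c : K} (u : a ⟶ b) (u' : b ⟶ c) :
    sqV (idSqH u) (idSqH u') = idSqH (u ≫ u') := by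
  ext
  simp [sqV, idSqH]

theorem idSqV_id (a : K) : idSqV (𝟙 a) = idSqH (𝟙 a) := by
  ext
  simp [idSqV, idSqH, unitors_equal]

section IsNat

variable {a b a' b' : K} {f f' f'' : a ⟶ a'} {g g' g'' : b ⟶ b'} {u : a ⟶ b} {v : a' ⟶ b'}

theorem isNat_id (s : f ≫ v ≅ u ≫ g) : IsNat s s (𝟙 f) (𝟙 g) := by
  simp [IsNat]

theorem IsNat.of_eq {s : f ≫ v ≅ u ≫ g} {t : f' ≫ v ≅ u ≫ g'} {σ τ : f ⟶ f'} {σ' τ' : g ⟶ g'}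
    (h : IsNat s t σ σ') (e : σ = τ) (e' : σ' = τ') : IsNat s t τ τ' :=
  e ▸ e' ▸ h

theorem IsNat.comp {s : f ≫ v ≅ u ≫ g} {t : f' ≫ v ≅ u ≫ g'} {r : f'' ≫ v ≅ u ≫ g''}
    {σ : f ⟶ f'} {σ' : g ⟶ g'} {τ : f' ⟶ f''} {τ' : g' ⟶ g''} (h : IsNat s t σ σ')
    (k : IsNat t r τ τ') : IsNat s r (σ ≫ τ) (σ' ≫ τ') := by
  simp only [IsNat, comp_whiskerRight, whiskerLeft_comp, Category.assoc] at h k ⊢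
  rw [k, reassoc_of% h]

theorem IsNat.symm {s : f ≫ v ≅ u ≫ g} {t : f' ≫ v ≅ u ≫ g'} (e : f ≅ f') (e' : g ≅ g')
    (h : IsNat s t e.hom e'.hom) : IsNat t s e.inv e'.inv := by
  simp only [IsNat] at h ⊢
  rw [← cancel_epi (whiskerRightIso e v).hom, whiskerRightIso_hom, reassoc_of% h]
  simp

theorem IsNat.conj {s : f ≫ v ≅ u ≫ g} {t : f' ≫ v ≅ u ≫ g'} {σ : f ⟶ f'} {σ' : g ⟶ g'}
    (h : IsNat s t σ σ') {f₁ f₁' : a ⟶ a'} {g₁ g₁' : b ⟶ b'} (e : f₁ ≅ f) (e' : g ≅ g₁)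
    (d : f₁' ≅ f') (d' : g' ≅ g₁') :
    IsNat (sqConj e e' s) (sqConj d d' t) (e.hom ≫ σ ≫ d.inv) (e'.inv ≫ σ' ≫ d'.hom) := by
  simp only [IsNat] at h ⊢
  simp [sqConj, reassoc_of% h]

theorem IsNat.conj_left {s : f ≫ v ≅ u ≫ g} {t : f' ≫ v ≅ u ≫ g'} {σ : f ⟶ f'} {σ' : g ⟶ g'}
    (h : IsNat s t σ σ') {f₁ : a ⟶ a'} {g₁ : b ⟶ b'} (e : f₁ ≅ f) (e' : g ≅ g₁) :
    IsNat (sqConj e e' s) t (e.hom ≫ σ) (e'.inv ≫ σ') := by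
  simp only [IsNat] at h ⊢
  simp [sqConj, h]

variable {a'' b'' : K} {h h' : a' ⟶ a''} {k k' : b' ⟶ b''} {w : a'' ⟶ b''}

theorem IsNat.sqH_left {p : h ≫ w ≅ v ≫ k} {q : h' ≫ w ≅ v ≫ k'} {σ : h ⟶ h'} {σ' : k ⟶ k'}
    (H : IsNat p q σ σ') (s : f ≫ v ≅ u ≫ g) :
    IsNat (MonTwoCat.sqH s p) (MonTwoCat.sqH s q) (f ◁ σ) (g ◁ σ') := by
  simp only [IsNat] at H ⊢
  have h1 := congrArg (fun z => f ◁ z) H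
  simp only [whiskerLeft_comp] at h1
  have h2 : f ◁ v ◁ σ' ≫ (α_ f v k').inv ≫ s.hom ▷ k' ≫ (α_ u g k').hom =
      (α_ f v k).inv ≫ s.hom ▷ k ≫ (α_ u g k).hom ≫ u ◁ g ◁ σ' := by
    rw [← cancel_epi (α_ f v k).hom]
    simpa using whisker_exchange_assoc s.hom σ' (α_ u g k').hom
  simp [MonTwoCat.sqH, reassoc_of% h1, h2]

theorem IsNat.sqH_right {s : f ≫ v ≅ u ≫ g} {t : f' ≫ v ≅ u ≫ g'} {σ : f ⟶ f'} {σ' : g ⟶ g'}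
    (H : IsNat s t σ σ') (p : h ≫ w ≅ v ≫ k) :
    IsNat (MonTwoCat.sqH s p) (MonTwoCat.sqH t p) (σ ▷ h) (σ' ▷ k) := by
  simp only [IsNat] at H ⊢
  have h1 := congrArg (fun z => z ▷ k) H
  simp only [comp_whiskerRight] at h1
  have h2 : σ ▷ (h ≫ w) ≫ f' ◁ p.hom ≫ (α_ f' v k).inv =
      f ◁ p.hom ≫ (α_ f v k).inv ≫ σ ▷ v ▷ k := by
    rw [← whisker_exchange_assoc]
    simp
  simp only [MonTwoCat.sqH, Iso.trans_hom, Iso.symm_hom, whiskerRightIso_hom,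
    whiskerLeftIso_hom, Category.assoc, associator_naturality_left_assoc]
  rw [reassoc_of% h2, reassoc_of% h1]
  simp

theorem sqH_conj_left {f₁ : a ⟶ a'} {g₁ : b ⟶ b'} (e : f₁ ≅ f) (e' : g ≅ g₁)
    (s : f ≫ v ≅ u ≫ g) (p : h ≫ w ≅ v ≫ k) :
    sqH (sqConj e e' s) p =
      sqConj (whiskerRightIso e h) (whiskerRightIso e' k) (sqH s p) := by
  ext
  have h2 : e.hom ▷ (h ≫ w) ≫ f ◁ p.hom ≫ (α_ f v k).inv =
      f₁ ◁ p.hom ≫ (α_ f₁ v k).inv ≫ e.hom ▷ v ▷ k := by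
    rw [← whisker_exchange_assoc]
    simp
  simp only [sqH, sqConj, Iso.trans_hom, Iso.symm_hom, whiskerRightIso_hom,
    whiskerLeftIso_hom, Category.assoc, associator_naturality_left_assoc]
  rw [reassoc_of% h2]
  simp

theorem sqH_conj_right {h₁ : a' ⟶ a''} {k₁ : b' ⟶ b''} (e : h₁ ≅ h) (e' : k ≅ k₁)
    (s : f ≫ v ≅ u ≫ g) (p : h ≫ w ≅ v ≫ k) :
    sqH s (sqConj e e' p) =
      sqConj (whiskerLeftIso f e) (whiskerLeftIso g e') (sqH s p) := by
  ext
  have h2 : f ◁ v ◁ e'.hom ≫ (α_ f v k₁).inv ≫ s.hom ▷ k₁ ≫ (α_ u g k₁).hom =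
      (α_ f v k).inv ≫ s.hom ▷ k ≫ (α_ u g k).hom ≫ u ◁ g ◁ e'.hom := by
    rw [← cancel_epi (α_ f v k).hom]
    simpa using whisker_exchange_assoc s.hom e'.hom (α_ u g k₁).hom
  simp [sqH, sqConj, h2]

theorem isNat_assoc {a₃ b₃ : K} {l : a'' ⟶ a₃} {m : b'' ⟶ b₃} {x : a₃ ⟶ b₃}
    (s : f ≫ v ≅ u ≫ g) (p : h ≫ w ≅ v ≫ k) (q : l ≫ x ≅ w ≫ m) :
    IsNat (sqH (sqH s p) q) (sqH s (sqH p q)) (α_ f h l).hom (α_ g k m).hom := by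
  simp [IsNat, sqH]

theorem isNat_leftUnitor (s : f ≫ v ≅ u ≫ g) :
    IsNat (sqH (idSqH u) s) s (λ_ f).hom (λ_ g).hom := by
  simp [IsNat, sqH, idSqH]

theorem isNat_rightUnitor (s : f ≫ v ≅ u ≫ g) :
    IsNat (sqH s (idSqH v)) s (ρ_ f).hom (ρ_ g).hom := by
  simp [IsNat, sqH, idSqH]

end IsNat

theorem one_compat_wL {w x y z : K} {i : w ⟶ x} {j : w ⟶ y} {k : w ⟶ z} {f : x ⟶ y}
    {g h : y ⟶ z} (φ : j ⟶ i ≫ f) {σ : g ⟶ h} {ψ : k ⟶ j ≫ g} {χ : k ⟶ j ≫ h}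
    (H : ψ ≫ j ◁ σ = χ) :
    (ψ ≫ φ ▷ g ≫ (α_ i f g).hom) ≫ i ◁ f ◁ σ = χ ≫ φ ▷ h ≫ (α_ i f h).hom := by
  subst H
  have h := whisker_exchange_assoc φ σ (α_ i f h).hom
  simp only [comp_whiskerLeft, Category.assoc, Iso.inv_hom_id, Category.comp_id] at h
  simp [← h]

theorem one_compat_wR {w x y z : K} {i : w ⟶ x} {j : w ⟶ y} {k : w ⟶ z} {f g : x ⟶ y}
    {h : y ⟶ z} (χ : k ⟶ j ≫ h) {σ : f ⟶ g} {φ : j ⟶ i ≫ f} {ψ : j ⟶ i ≫ g}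
    (H : φ ≫ i ◁ σ = ψ) :
    (χ ≫ φ ▷ h ≫ (α_ i f h).hom) ≫ i ◁ σ ▷ h = χ ≫ ψ ▷ h ≫ (α_ i g h).hom := by
  subst H
  simp

theorem one_compat_assoc {x₀ x₁ x₂ x₃ x₄ : K} {i : x₀ ⟶ x₁} {j : x₀ ⟶ x₂} {k : x₀ ⟶ x₃}
    {l : x₀ ⟶ x₄} {f : x₁ ⟶ x₂} {g : x₂ ⟶ x₃} {h : x₃ ⟶ x₄} (φ : j ⟶ i ≫ f) (ψ : k ⟶ j ≫ g)
    (χ : l ⟶ k ≫ h) :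
    (χ ≫ (ψ ≫ φ ▷ g ≫ (α_ i f g).hom) ▷ h ≫ (α_ i (f ≫ g) h).hom) ≫ i ◁ (α_ f g h).hom =
      (χ ≫ ψ ▷ h ≫ (α_ j g h).hom) ≫ φ ▷ (g ≫ h) ≫ (α_ i f (g ≫ h)).hom := by
  simp

theorem one_compat_left {w x y : K} {i : w ⟶ x} {j : w ⟶ y} {f : x ⟶ y} (φ : j ⟶ i ≫ f) :
    (φ ≫ (ρ_ i).inv ▷ f ≫ (α_ i (𝟙 x) f).hom) ≫ i ◁ (λ_ f).hom = φ := by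
  simp

theorem one_compat_right {w x y : K} {i : w ⟶ x} {j : w ⟶ y} {f : x ⟶ y} (φ : j ⟶ i ≫ f) :
    ((ρ_ j).inv ≫ φ ▷ 𝟙 y ≫ (α_ i f (𝟙 y)).hom) ≫ i ◁ (ρ_ f).hom = φ := by
  simp

theorem associator_aux {w x y z : K} (f : w ⟶ x) (g : x ⟶ y) (h : y ⟶ z) :
    (whiskerRightIso (Iso.refl (f ≫ g)) h ≪≫ Iso.refl ((f ≫ g) ≫ h)).inv ≫ (α_ f g h).hom ≫
      (whiskerLeftIso f (Iso.refl (g ≫ h)) ≪≫ Iso.refl (f ≫ g ≫ h)).hom = (α_ f g h).hom := by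
  simp

theorem leftUnitor_aux {x y : K} (f : x ⟶ y) :
    (whiskerRightIso (Iso.refl (𝟙 x)) f ≪≫ Iso.refl (𝟙 x ≫ f)).inv ≫ (λ_ f).hom =
      (λ_ f).hom := by
  simp

theorem rightUnitor_aux {x y : K} (f : x ⟶ y) :
    (whiskerLeftIso f (Iso.refl (𝟙 y)) ≪≫ Iso.refl (f ≫ 𝟙 y)).inv ≫ (ρ_ f).hom =
      (ρ_ f).hom := by
  simp

end SquareLemmas

section TensorLemmas

variable {K : Type u₁} [Bicategory.{w₁, v₁} K] [TensorBicategory K]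

@[simp]
theorem tIso_hom {x x' y y' : K} {f f' : x ⟶ x'} {g g' : y ⟶ y'} (σ : f ≅ f') (τ : g ≅ g') :
    (σ ⊠ᵢ τ).hom = σ.hom ⊠₂ τ.hom := rfl

@[simp]
theorem tIso_inv {x x' y y' : K} {f f' : x ⟶ x'} {g g' : y ⟶ y'} (σ : f ≅ f') (τ : g ≅ g') :
    (σ ⊠ᵢ τ).inv = σ.inv ⊠₂ τ.inv := rfl

theorem tMap₂_comp {x x' y y' : K} {f f' f'' : x ⟶ x'} {g g' g'' : y ⟶ y'} (σ : f ⟶ f')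
    (σ' : f' ⟶ f'') (τ : g ⟶ g') (τ' : g' ⟶ g'') :
    (σ ≫ σ') ⊠₂ (τ ≫ τ') = σ ⊠₂ τ ≫ σ' ⊠₂ τ' :=
  (TensorBicategory.tensor (K := K)).map₂_comp
    ((σ, τ) : ((f, g) : (x, y) ⟶ (x', y')) ⟶ ((f', g') : (x, y) ⟶ (x', y')))
    ((σ', τ') : ((f', g') : (x, y) ⟶ (x', y')) ⟶ ((f'', g'') : (x, y) ⟶ (x', y')))

theorem tMap₂_id {x x' y y' : K} (f : x ⟶ x') (g : y ⟶ y') : 𝟙 f ⊠₂ 𝟙 g = 𝟙 (f ⊠ g) :=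
  (TensorBicategory.tensor (K := K)).map₂_id ((f, g) : (x, y) ⟶ (x', y'))

theorem tMap₂_whiskerLeft {x x' x'' y y' y'' : K} (f : x ⟶ x') (g : y ⟶ y')
    {h h' : x' ⟶ x''} {k k' : y' ⟶ y''} (σ : h ⟶ h') (τ : k ⟶ k') :
    (f ◁ σ) ⊠₂ (g ◁ τ) = (tComp f g h k).hom ≫ f ⊠ g ◁ σ ⊠₂ τ ≫ (tComp f g h' k').inv :=
  (TensorBicategory.tensor (K := K)).map₂_whisker_left ((f, g) : (x, y) ⟶ (x', y'))
    ((σ, τ) : ((h, k) : (x', y') ⟶ (x'', y'')) ⟶ ((h', k') : (x', y') ⟶ (x'', y'')))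

theorem tMap₂_whiskerRight {x x' x'' y y' y'' : K} {f f' : x ⟶ x'} {g g' : y ⟶ y'}
    (σ : f ⟶ f') (τ : g ⟶ g') (h : x' ⟶ x'') (k : y' ⟶ y'') :
    (σ ▷ h) ⊠₂ (τ ▷ k) = (tComp f g h k).hom ≫ σ ⊠₂ τ ▷ h ⊠ k ≫ (tComp f' g' h k).inv :=
  (TensorBicategory.tensor (K := K)).map₂_whisker_right
    ((σ, τ) : ((f, g) : (x, y) ⟶ (x', y')) ⟶ ((f', g') : (x, y) ⟶ (x', y')))
    ((h, k) : (x', y') ⟶ (x'', y''))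

theorem tMap₂_associator {x₀ x₁ x₂ x₃ y₀ y₁ y₂ y₃ : K} (f : x₀ ⟶ x₁) (g : x₁ ⟶ x₂)
    (h : x₂ ⟶ x₃) (f' : y₀ ⟶ y₁) (g' : y₁ ⟶ y₂) (h' : y₂ ⟶ y₃) :
    (α_ f g h).hom ⊠₂ (α_ f' g' h').hom =
      (tComp (f ≫ g) (f' ≫ g') h h').hom ≫ (tComp f f' g g').hom ▷ h ⊠ h' ≫
      (α_ (f ⊠ f') (g ⊠ g') (h ⊠ h')).hom ≫ f ⊠ f' ◁ (tComp g g' h h').inv ≫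
      (tComp f f' (g ≫ h) (g' ≫ h')).inv :=
  (TensorBicategory.tensor (K := K)).map₂_associator ((f, f') : (x₀, y₀) ⟶ (x₁, y₁))
    ((g, g') : (x₁, y₁) ⟶ (x₂, y₂)) ((h, h') : (x₂, y₂) ⟶ (x₃, y₃))

theorem tMap₂_associator_inv {x₀ x₁ x₂ x₃ y₀ y₁ y₂ y₃ : K} (f : x₀ ⟶ x₁) (g : x₁ ⟶ x₂)
    (h : x₂ ⟶ x₃) (f' : y₀ ⟶ y₁) (g' : y₁ ⟶ y₂) (h' : y₂ ⟶ y₃) :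
    (α_ f g h).inv ⊠₂ (α_ f' g' h').inv =
      (tComp f f' (g ≫ h) (g' ≫ h')).hom ≫ f ⊠ f' ◁ (tComp g g' h h').hom ≫
      (α_ (f ⊠ f') (g ⊠ g') (h ⊠ h')).inv ≫ (tComp f f' g g').inv ▷ h ⊠ h' ≫
      (tComp (f ≫ g) (f' ≫ g') h h').inv := by
  rw [← cancel_epi (α_ f g h ⊠ᵢ α_ f' g' h').hom, tIso_hom, ← tMap₂_comp, Iso.hom_inv_id,
    Iso.hom_inv_id, tMap₂_id, tMap₂_associator]
  simp

theorem tMap₂_leftUnitor {x x' y y' : K} (f : x ⟶ x') (g : y ⟶ y') :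
    (λ_ f).hom ⊠₂ (λ_ g).hom =
      (tComp (𝟙 x) (𝟙 y) f g).hom ≫ (tId x y).hom ▷ f ⊠ g ≫ (λ_ (f ⊠ g)).hom :=
  (TensorBicategory.tensor (K := K)).map₂_left_unitor ((f, g) : (x, y) ⟶ (x', y'))

theorem tMap₂_rightUnitor {x x' y y' : K} (f : x ⟶ x') (g : y ⟶ y') :
    (ρ_ f).hom ⊠₂ (ρ_ g).hom =
      (tComp f g (𝟙 x') (𝟙 y')).hom ≫ f ⊠ g ◁ (tId x' y').hom ≫ (ρ_ (f ⊠ g)).hom :=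
  (TensorBicategory.tensor (K := K)).map₂_right_unitor ((f, g) : (x, y) ⟶ (x', y'))

theorem tIso_refl {x x' y y' : K} (f : x ⟶ x') (g : y ⟶ y') :
    Iso.refl f ⊠ᵢ Iso.refl g = Iso.refl (f ⊠ g) :=
  Iso.ext (tMap₂_id f g)

theorem tSq_sqH {a b a' b' a'' b'' c d c' d' c'' d'' : K} {f : a ⟶ a'} {g : b ⟶ b'} {u : a ⟶ b}
    {v : a' ⟶ b'} {f' : a' ⟶ a''} {g' : b' ⟶ b''} {w : a'' ⟶ b''}
    {h : c ⟶ c'} {k : d ⟶ d'} {r : c ⟶ d} {s : c' ⟶ d'} {h' : c' ⟶ c''} {k' : d' ⟶ d''}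
    {t : c'' ⟶ d''}
    (p : f ≫ v ≅ u ≫ g) (p' : f' ≫ w ≅ v ≫ g') (q : h ≫ s ≅ r ≫ k) (q' : h' ≫ t ≅ s ≫ k') :
    tSq (sqH p p') (sqH q q') =
      sqConj (tComp f h f' h') (tComp g k g' k').symm (sqH (tSq p q) (tSq p' q')) := by
  ext
  simp [tSq, sqH, sqConj, tMap₂_comp, tMap₂_associator, tMap₂_whiskerLeft, tMap₂_whiskerRight,
    tMap₂_associator_inv]

theorem tSq_conj {a b a' b' c d c' d' : K} {f f₁ : a ⟶ a'} {g g₁ : b ⟶ b'} {u : a ⟶ b}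
    {v : a' ⟶ b'} {h h₁ : c ⟶ c'} {k k₁ : d ⟶ d'} {s : c ⟶ d} {t : c' ⟶ d'}
    (p : f ≫ v ≅ u ≫ g) (q : h ≫ t ≅ s ≫ k) (e : f₁ ≅ f) (e' : g ≅ g₁) (d : h₁ ≅ h)
    (d' : k ≅ k₁) :
    tSq (sqConj e e' p) (sqConj d d' q) = sqConj (e ⊠ᵢ d) (e' ⊠ᵢ d') (tSq p q) := by
  ext
  simp [tSq, sqConj, tMap₂_comp, tMap₂_whiskerLeft, tMap₂_whiskerRight]

theorem tSq_idSqH {a b c d : K} (u : a ⟶ b) (u' : c ⟶ d) :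
    tSq (idSqH u) (idSqH u') = sqConj (tId a c) (tId b d).symm (idSqH (u ⊠ u')) := by
  ext
  have h1 : (tComp (𝟙 a) (𝟙 c) u u').inv ≫ (λ_ u).hom ⊠₂ (λ_ u').hom =
      (tId a c).hom ▷ u ⊠ u' ≫ (λ_ (u ⊠ u')).hom := by
    rw [tMap₂_leftUnitor]; simp
  have h2 : (ρ_ u).inv ⊠₂ (ρ_ u').inv ≫ (tComp u u' (𝟙 b) (𝟙 d)).hom =
      (ρ_ (u ⊠ u')).inv ≫ u ⊠ u' ◁ (tId b d).inv := by
    rw [← cancel_epi (ρ_ u ⊠ᵢ ρ_ u').hom, tIso_hom, ← Category.assoc, ← tMap₂_comp,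
      Iso.hom_inv_id, Iso.hom_inv_id, tMap₂_id, tMap₂_rightUnitor]
    simp
  simp [tSq, sqConj, idSqH, tMap₂_comp, reassoc_of% h1, h2]

theorem tSq_conj_left {a b a' b' c d c' d' : K} {f f₁ : a ⟶ a'} {g : b ⟶ b'} {u : a ⟶ b}
    {v : a' ⟶ b'} {h : c ⟶ c'} {k : d ⟶ d'} {s : c ⟶ d} {t : c' ⟶ d'}
    (p : f ≫ v ≅ u ≫ g) (q : h ≫ t ≅ s ≫ k) (e : f₁ ≅ f) :
    tSq (sqConj e (Iso.refl g) p) q =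
      sqConj (e ⊠ᵢ Iso.refl h) (Iso.refl (g ⊠ k)) (tSq p q) := by
  have := tSq_conj p q e (Iso.refl g) (Iso.refl h) (Iso.refl k)
  rwa [sqConj_refl, tIso_refl] at this

theorem tSq_conj_right {a b a' b' c d c' d' : K} {f : a ⟶ a'} {g : b ⟶ b'} {u : a ⟶ b}
    {v : a' ⟶ b'} {h h₁ : c ⟶ c'} {k : d ⟶ d'} {s : c ⟶ d} {t : c' ⟶ d'}
    (p : f ≫ v ≅ u ≫ g) (q : h ≫ t ≅ s ≫ k) (e : h₁ ≅ h) :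
    tSq p (sqConj e (Iso.refl k) q) =
      sqConj (Iso.refl f ⊠ᵢ e) (Iso.refl (g ⊠ k)) (tSq p q) := by
  have := tSq_conj p q (Iso.refl f) (Iso.refl g) e (Iso.refl k)
  rwa [sqConj_refl, tIso_refl] at this

theorem tMap₂_associator_aux {x₀ x₁ x₂ x₃ y₀ y₁ y₂ y₃ : K} (f : x₀ ⟶ x₁) (g : x₁ ⟶ x₂)
    (h : x₂ ⟶ x₃) (f' : y₀ ⟶ y₁) (g' : y₁ ⟶ y₂) (h' : y₂ ⟶ y₃) :
    (tComp (f ≫ g) (f' ≫ g') h h' ≪≫ whiskerRightIso (tComp f f' g g') (h ⊠ h')).hom ≫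
        (α_ (f ⊠ f') (g ⊠ g') (h ⊠ h')).hom ≫
        (tComp f f' (g ≫ h) (g' ≫ h') ≪≫ whiskerLeftIso (f ⊠ f') (tComp g g' h h')).inv =
      (α_ f g h).hom ⊠₂ (α_ f' g' h').hom := by
  rw [tMap₂_associator]
  simp

end TensorLemmas

/-! ### The 2-category of pseudomonoids -/

section PsMonCategory

variable {K : Type u₁} [Bicategory.{w₁, v₁} K] [MonoidalBicategory K]

theorem assocNat_id_eq (x y z : K) :
    assocNat (𝟙 x) (𝟙 y) (𝟙 z) =
      sqConj (tId x y ⊠ᵢ Iso.refl (𝟙 z) ≪≫ tId (x ⊠ₒ y) z)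
        (Iso.refl (𝟙 x) ⊠ᵢ tId y z ≪≫ tId x (y ⊠ₒ z)).symm (idSqH (asc x y z)) :=
  IsNat.eq_conj _ _ (assocNat_id x y z)

theorem assocNat_comp_eq {x x' x'' y y' y'' z z' z'' : K} (f : x ⟶ x') (g : y ⟶ y')
    (h : z ⟶ z') (f' : x' ⟶ x'') (g' : y' ⟶ y'') (h' : z' ⟶ z'') :
    assocNat (f ≫ f') (g ≫ g') (h ≫ h') =
      sqConj (tComp f g f' g' ⊠ᵢ Iso.refl (h ≫ h') ≪≫ tComp (f ⊠ g) h (f' ⊠ g') h')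
        (Iso.refl (f ≫ f') ⊠ᵢ tComp g h g' h' ≪≫ tComp f (g ⊠ h) f' (g' ⊠ h')).symm
        (sqH (assocNat f g h) (assocNat f' g' h')) :=
  IsNat.eq_conj _ _ (assocNat_comp f g h f' g' h')

theorem lUnitNat_id_eq (x : K) :
    lUnitNat (𝟙 x) = sqConj (tId I x) (Iso.refl _) (idSqH (lun x)) :=
  IsNat.eq_conj _ (Iso.refl _) (lUnitNat_id x)

theorem rUnitNat_id_eq (x : K) :
    rUnitNat (𝟙 x) = sqConj (tId x I) (Iso.refl _) (idSqH (run x)) :=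
  IsNat.eq_conj _ (Iso.refl _) (rUnitNat_id x)

theorem lUnitNat_comp_eq {x x' x'' : K} (f : x ⟶ x') (f' : x' ⟶ x'') :
    lUnitNat (f ≫ f') =
      sqConj (wlComp I f f') (Iso.refl _) (sqH (lUnitNat f) (lUnitNat f')) :=
  IsNat.eq_conj _ (Iso.refl _) (lUnitNat_comp f f')

theorem rUnitNat_comp_eq {x x' x'' : K} (f : x ⟶ x') (f' : x' ⟶ x'') :
    rUnitNat (f ≫ f') =
      sqConj (wrComp f f' I) (Iso.refl _) (sqH (rUnitNat f) (rUnitNat f')) :=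
  IsNat.eq_conj _ (Iso.refl _) (rUnitNat_comp f f')

namespace StrongMor

/-- The data of the identity strong morphism. -/
@[simps]
def idData (A : PsMon K) : StrongMorData A.toPsMonData A.toPsMonData where
  f := 𝟙 A.X
  φ := sqConj (tId A.X A.X) (Iso.refl _) (idSqH A.mul)
  φ₀ := (ρ_ A.one).symm

/-- The identity strong morphism. -/
def id (A : PsMon K) : StrongMor A A where
  toStrongMorData := idData A
  assoc_compat := by
    change IsCyl
      (sqV (tSq (sqConj (tId A.X A.X) (Iso.refl _) (idSqH A.mul)) (idSqV (𝟙 A.X)))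
        (sqConj (tId A.X A.X) (Iso.refl _) (idSqH A.mul)))
      (sqV (assocNat (𝟙 A.X) (𝟙 A.X) (𝟙 A.X))
        (sqV (tSq (idSqV (𝟙 A.X)) (sqConj (tId A.X A.X) (Iso.refl _) (idSqH A.mul)))
          (sqConj (tId A.X A.X) (Iso.refl _) (idSqH A.mul)))) _ _
    rw [tSq_conj_left, tSq_conj_right, assocNat_id_eq, idSqV_id, tSq_idSqH, tSq_idSqH,
      sqConj_conj, sqConj_conj, Iso.trans_refl, sqV_conj, sqV_conj, sqV_conj,
      sqV_idSqH, sqV_idSqH, sqV_idSqH]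
    exact (isCyl_idSqH _).conj _ _
  one_mul_compat := by
    change IsCyl
      (sqV (tSq (idSqH A.one) (idSqV (𝟙 A.X)))
        (sqConj (tId A.X A.X) (Iso.refl _) (idSqH A.mul)))
      (lUnitNat (𝟙 A.X)) _ _
    rw [lUnitNat_id_eq, idSqV_id, tSq_idSqH, sqV_conj, sqV_idSqH]
    exact (isCyl_idSqH _).conj _ _
  mul_one_compat := by
    change IsCyl
      (sqV (tSq (idSqV (𝟙 A.X)) (idSqH A.one))
        (sqConj (tId A.X A.X) (Iso.refl _) (idSqH A.mul)))
      (rUnitNat (𝟙 A.X)) _ _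
    rw [rUnitNat_id_eq, idSqV_id, tSq_idSqH, sqV_conj, sqV_idSqH]
    exact (isCyl_idSqH _).conj _ _

variable {A B C D : PsMon K}

/-- The data of the composite of two strong morphisms. -/
@[simps]
def compData (F : StrongMor A B) (G : StrongMor B C) :
    StrongMorData A.toPsMonData C.toPsMonData where
  f := F.f ≫ G.f
  φ := sqConj (tComp F.f F.f G.f G.f) (Iso.refl _) (sqH F.φ G.φ)
  φ₀ := G.φ₀ ≪≫ whiskerRightIso F.φ₀ G.f ≪≫ α_ _ _ _

theorem compData_unitSq (F : StrongMor A B) (G : StrongMor B C) :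
    (compData F G).unitSq =
      sqConj (λ_ (𝟙 I)).symm (Iso.refl _) (sqH F.unitSq G.unitSq) := by
  ext
  simp [StrongMorData.unitSq, sqConj, sqH]
  rfl

/-- The composite of two strong morphisms. -/
def comp (F : StrongMor A B) (G : StrongMor B C) : StrongMor A C where
  toStrongMorData := compData F G
  assoc_compat := by
    change IsCyl
      (sqV (tSq (sqConj (tComp F.f F.f G.f G.f) (Iso.refl _) (sqH F.φ G.φ))
          (idSqV (F.f ≫ G.f)))
        (sqConj (tComp F.f F.f G.f G.f) (Iso.refl _) (sqH F.φ G.φ)))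
      (sqV (assocNat (F.f ≫ G.f) (F.f ≫ G.f) (F.f ≫ G.f))
        (sqV (tSq (idSqV (F.f ≫ G.f))
            (sqConj (tComp F.f F.f G.f G.f) (Iso.refl _) (sqH F.φ G.φ)))
          (sqConj (tComp F.f F.f G.f G.f) (Iso.refl _) (sqH F.φ G.φ)))) _ _
    rw [tSq_conj_left, tSq_conj_right, assocNat_comp_eq, idSqV_comp, tSq_sqH, tSq_sqH,
      sqConj_conj, sqConj_conj, Iso.trans_refl, sqV_conj, sqV_conj, sqV_conj,
      sqV_sqH, sqV_sqH, sqV_sqH]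
    exact (F.assoc_compat.sqH G.assoc_compat).conj _ _
  one_mul_compat := by
    rw [compData_unitSq]
    change IsCyl
      (sqV (tSq (sqConj (λ_ (𝟙 I)).symm (Iso.refl _) (sqH F.unitSq G.unitSq))
          (idSqV (F.f ≫ G.f)))
        (sqConj (tComp F.f F.f G.f G.f) (Iso.refl _) (sqH F.φ G.φ)))
      (lUnitNat (F.f ≫ G.f)) _ _
    rw [lUnitNat_comp_eq, tSq_conj_left, idSqV_comp, tSq_sqH, sqConj_conj, Iso.trans_refl,
      sqV_conj, sqV_sqH]
    exact (F.one_mul_compat.sqH G.one_mul_compat).conj _ _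
  mul_one_compat := by
    rw [compData_unitSq]
    change IsCyl
      (sqV (tSq (idSqV (F.f ≫ G.f))
          (sqConj (λ_ (𝟙 I)).symm (Iso.refl _) (sqH F.unitSq G.unitSq)))
        (sqConj (tComp F.f F.f G.f G.f) (Iso.refl _) (sqH F.φ G.φ)))
      (rUnitNat (F.f ≫ G.f)) _ _
    rw [rUnitNat_comp_eq, tSq_conj_right, idSqV_comp, tSq_sqH, sqConj_conj, Iso.trans_refl,
      sqV_conj, sqV_sqH]
    exact (F.mul_one_compat.sqH G.mul_one_compat).conj _ _

end StrongMor

namespace PsMonCell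

variable {A B C D : PsMon K}

instance : CategoryStruct (StrongMor A B) where
  Hom F G := PsMonCell F G
  id F := ⟨𝟙 F.f, isNat_id _ |>.of_eq (tMap₂_id _ _).symm rfl, by simp⟩
  comp σ τ := ⟨σ.hom ≫ τ.hom, (σ.mul_compat.comp τ.mul_compat).of_eq
    (tMap₂_comp _ _ _ _).symm rfl, by simp [← τ.one_compat, ← σ.one_compat]⟩

@[ext]
theorem hom_ext {F G : StrongMor A B} {σ τ : F ⟶ G} (h : σ.hom = τ.hom) : σ = τ :=
  PsMonCell.ext h

@[simp]
theorem id_hom (F : StrongMor A B) : (𝟙 F : F ⟶ F).hom = 𝟙 F.f := rfl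

@[simp]
theorem comp_hom {F G H : StrongMor A B} (σ : F ⟶ G) (τ : G ⟶ H) :
    (σ ≫ τ).hom = σ.hom ≫ τ.hom := rfl

instance : Category (StrongMor A B) where

/-- An invertible 2-cell of `K` that is a 2-cell of strong morphisms is invertible as such. -/
@[simps]
def isoMk {F G : StrongMor A B} (e : F.f ≅ G.f) (h : IsNat F.φ G.φ (e.hom ⊠₂ e.hom) e.hom)
    (h' : F.φ₀.hom ≫ A.one ◁ e.hom = G.φ₀.hom) : F ≅ G where
  hom := ⟨e.hom, h, h'⟩
  inv := ⟨e.inv, h.symm (e ⊠ᵢ e) e, by rw [← h']; simp⟩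

/-- Left whiskering. -/
@[simps]
def wL (F : StrongMor A B) {G H : StrongMor B C} (σ : PsMonCell G H) :
    PsMonCell (F.comp G) (F.comp H) where
  hom := F.f ◁ σ.hom
  mul_compat := ((σ.mul_compat.sqH_left F.φ).conj (tComp _ _ _ _) (Iso.refl _) (tComp _ _ _ _)
    (Iso.refl _)).of_eq
    (tMap₂_whiskerLeft F.f F.f σ.hom σ.hom).symm ((Category.id_comp _).trans (Category.comp_id _))
  one_compat := one_compat_wL F.φ₀.hom σ.one_compat

/-- Right whiskering. -/
@[simps]
def wR {F G : StrongMor A B} (σ : PsMonCell F G) (H : StrongMor B C) :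
    PsMonCell (F.comp H) (G.comp H) where
  hom := σ.hom ▷ H.f
  mul_compat := ((σ.mul_compat.sqH_right H.φ).conj (tComp _ _ _ _) (Iso.refl _) (tComp _ _ _ _)
    (Iso.refl _)).of_eq
    (tMap₂_whiskerRight σ.hom σ.hom H.f H.f).symm ((Category.id_comp _).trans (Category.comp_id _))
  one_compat := one_compat_wR H.φ₀.hom σ.one_compat

end PsMonCell

instance : Bicategory (PsMon K) where
  Hom A B := StrongMor A B
  id A := StrongMor.id A
  comp F G := F.comp G
  homCategory A B := inferInstanceAs (Category (StrongMor A B))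
  whiskerLeft F _ _ σ := PsMonCell.wL F σ
  whiskerRight σ H := PsMonCell.wR σ H
  associator F G H := PsMonCell.isoMk (α_ F.f G.f H.f)
    (by
      change IsNat
        (sqConj (tComp _ _ _ _) (Iso.refl _)
          (sqH (sqConj (tComp _ _ _ _) (Iso.refl _) (sqH F.φ G.φ)) H.φ))
        (sqConj (tComp _ _ _ _) (Iso.refl _)
          (sqH F.φ (sqConj (tComp _ _ _ _) (Iso.refl _) (sqH G.φ H.φ)))) _ _
      rw [sqH_conj_left, sqH_conj_right, sqConj_conj, sqConj_conj]
      refine ((isNat_assoc F.φ G.φ H.φ).conj _ _ _ _).of_eq ?_ ?_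
      · exact tMap₂_associator_aux F.f G.f H.f F.f G.f H.f
      · exact associator_aux F.f G.f H.f)
    (one_compat_assoc F.φ₀.hom G.φ₀.hom H.φ₀.hom)
  leftUnitor F := PsMonCell.isoMk (λ_ F.f)
    (by
      change IsNat (sqConj (tComp _ _ _ _) (Iso.refl _)
        (sqH (sqConj (tId _ _) (Iso.refl _) (idSqH _)) F.φ)) F.φ _ _
      rw [sqH_conj_left, sqConj_conj]
      refine ((isNat_leftUnitor F.φ).conj_left _ _).of_eq ?_ ?_
      · exact (Category.assoc _ _ _).trans (tMap₂_leftUnitor F.f F.f).symm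
      · exact leftUnitor_aux F.f)
    (one_compat_left F.φ₀.hom)
  rightUnitor F := PsMonCell.isoMk (ρ_ F.f)
    (by
      change IsNat (sqConj (tComp _ _ _ _) (Iso.refl _)
        (sqH F.φ (sqConj (tId _ _) (Iso.refl _) (idSqH _)))) F.φ _ _
      rw [sqH_conj_right, sqConj_conj]
      refine ((isNat_rightUnitor F.φ).conj_left _ _).of_eq ?_ ?_
      · exact (Category.assoc _ _ _).trans (tMap₂_rightUnitor F.f F.f).symm
      · exact rightUnitor_aux F.f)
    (one_compat_right F.φ₀.hom)
  whiskerLeft_id _ _ := PsMonCell.hom_ext (Bicategory.whiskerLeft_id _ _)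
  whiskerLeft_comp _ _ _ _ _ _ := PsMonCell.hom_ext (Bicategory.whiskerLeft_comp _ _ _)
  id_whiskerLeft _ := PsMonCell.hom_ext (Bicategory.id_whiskerLeft _)
  comp_whiskerLeft _ _ _ _ _ := PsMonCell.hom_ext (Bicategory.comp_whiskerLeft _ _ _)
  id_whiskerRight _ _ := PsMonCell.hom_ext (Bicategory.id_whiskerRight _ _)
  comp_whiskerRight _ _ _ := PsMonCell.hom_ext (Bicategory.comp_whiskerRight _ _ _)
  whiskerRight_id _ := PsMonCell.hom_ext (Bicategory.whiskerRight_id _)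
  whiskerRight_comp _ _ _ := PsMonCell.hom_ext (Bicategory.whiskerRight_comp _ _ _)
  whisker_assoc _ _ _ _ _ := PsMonCell.hom_ext (Bicategory.whisker_assoc _ _ _)
  whisker_exchange _ _ := PsMonCell.hom_ext (Bicategory.whisker_exchange _ _)
  pentagon _ _ _ _ := PsMonCell.hom_ext (Bicategory.pentagon _ _ _ _)
  triangle _ _ := PsMonCell.hom_ext (Bicategory.triangle _ _)

end PsMonCategory

section PsMonStrict

variable {K : Type u₁} [Bicategory.{w₁, v₁} K] [MonoidalBicategory K]

theorem PsMonCell.iso_ext {A B : PsMon K} {F G : StrongMor A B} {e e' : F ≅ G}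
    (h : e.hom.hom = e'.hom.hom) : e = e' :=
  Iso.ext (PsMonCell.hom_ext h)

theorem PsMonCell.eqToIso_hom_hom {A B : PsMon K} {F G : StrongMor A B} (h : F = G) :
    (eqToIso h).hom.hom = eqToHom (congrArg (fun H : StrongMor A B => H.f) h) := by
  subst h
  rfl

/-- Strong morphisms related by a 2-cell that is an identity are equal. -/
theorem StrongMor.eq_of_cell {A B : PsMon K} {F G : StrongMor A B} (σ : PsMonCell F G)
    (h : F.f = G.f) (hσ : σ.hom = eqToHom h) : F = G := by
  obtain ⟨⟨f, φ, φ₀⟩, h₁, h₂, h₃⟩ := F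
  obtain ⟨⟨g, ψ, ψ₀⟩, k₁, k₂, k₃⟩ := G
  obtain ⟨s, m, o⟩ := σ
  dsimp only at h hσ m o
  subst h
  subst hσ
  have e : φ = ψ := by
    ext
    have := m
    simp only [IsNat, eqToHom_refl, Bicategory.whiskerLeft_id, Category.comp_id] at this
    rw [tMap₂_id, Bicategory.id_whiskerRight, Category.id_comp] at this
    exact this.symm
  have e₀ : φ₀ = ψ₀ := by
    ext
    simpa using o
  subst e
  subst e₀
  rfl

theorem PsMonCell.eq_eqToIso {A B : PsMon K} {F G : StrongMor A B} (e : F ≅ G)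
    (h : F.f = G.f) (he : e.hom.hom = eqToHom h) (h' : F = G) : e = eqToIso h' :=
  PsMonCell.iso_ext (he.trans (PsMonCell.eqToIso_hom_hom h').symm)

instance [Bicategory.Strict K] : Bicategory.Strict (PsMon K) where
  id_comp F := StrongMor.eq_of_cell (λ_ F).hom (Strict.id_comp F.f)
    (congrArg Iso.hom (Strict.leftUnitor_eqToIso F.f))
  comp_id F := StrongMor.eq_of_cell (ρ_ F).hom (Strict.comp_id F.f)
    (congrArg Iso.hom (Strict.rightUnitor_eqToIso F.f))
  assoc F G H := StrongMor.eq_of_cell (α_ F G H).hom (Strict.assoc F.f G.f H.f)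
    (congrArg Iso.hom (Strict.associator_eqToIso F.f G.f H.f))
  leftUnitor_eqToIso F := PsMonCell.eq_eqToIso (λ_ F) (Strict.id_comp F.f)
    (congrArg Iso.hom (Strict.leftUnitor_eqToIso F.f)) _
  rightUnitor_eqToIso F := PsMonCell.eq_eqToIso (ρ_ F) (Strict.comp_id F.f)
    (congrArg Iso.hom (Strict.rightUnitor_eqToIso F.f)) _
  associator_eqToIso F G H := PsMonCell.eq_eqToIso (α_ F G H) (Strict.assoc F.f G.f H.f)
    (congrArg Iso.hom (Strict.associator_eqToIso F.f G.f H.f)) _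

end PsMonStrict

section LocallyFull

/-- A class of 1-cells between objects of `C`, indexed by a type `X`, that contains the
identities and is closed under composition. -/
structure OneCellClass (X : Type u₂) (C : Type u₁) [Bicategory.{w₁, v₁} C] where
  /-- The objects. -/
  obj : X → C
  /-- The 1-cells. -/
  mem {a b : X} : (obj a ⟶ obj b) → Prop
  id_mem (a : X) : mem (𝟙 (obj a))
  comp_mem {a b c : X} {f : obj a ⟶ obj b} {g : obj b ⟶ obj c} : mem f → mem g → mem (f ≫ g)

namespace OneCellClass

variable {X : Type u₂} {C : Type u₁} [Bicategory.{w₁, v₁} C] (S : OneCellClass X C)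

/-- The category of 1-cells in the class, with all 2-cells between them. -/
abbrev homCategory (a b : X) : Category {f : S.obj a ⟶ S.obj b // S.mem f} where
  Hom f g := f.1 ⟶ g.1
  id f := 𝟙 f.1
  comp σ τ := σ ≫ τ

/-- An invertible 2-cell, viewed between 1-cells of the class. -/
abbrev isoMk {a b : X} {f g : {f : S.obj a ⟶ S.obj b // S.mem f}} (e : f.1 ≅ g.1) :
    letI := S.homCategory a b
    f ≅ g :=
  letI := S.homCategory a b
  { hom := e.hom, inv := e.inv, hom_inv_id := e.hom_inv_id, inv_hom_id := e.inv_hom_id }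

/-- The bicategory with 1-cells in the class, and all 2-cells between them. -/
abbrev bicategory : Bicategory X where
  Hom a b := {f : S.obj a ⟶ S.obj b // S.mem f}
  id a := ⟨𝟙 (S.obj a), S.id_mem a⟩
  comp f g := ⟨f.1 ≫ g.1, S.comp_mem f.2 g.2⟩
  homCategory a b := S.homCategory a b
  whiskerLeft f _ _ σ := Bicategory.whiskerLeft f.1 σ
  whiskerRight σ h := Bicategory.whiskerRight σ h.1
  associator f g h := S.isoMk (α_ f.1 g.1 h.1)
  leftUnitor f := S.isoMk (λ_ f.1)
  rightUnitor f := S.isoMk (ρ_ f.1)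
  whiskerLeft_id _ _ := Bicategory.whiskerLeft_id _ _
  whiskerLeft_comp _ _ _ _ _ _ := Bicategory.whiskerLeft_comp _ _ _
  id_whiskerLeft _ := Bicategory.id_whiskerLeft _
  comp_whiskerLeft _ _ _ _ _ := Bicategory.comp_whiskerLeft _ _ _
  id_whiskerRight _ _ := Bicategory.id_whiskerRight _ _
  comp_whiskerRight _ _ _ := Bicategory.comp_whiskerRight _ _ _
  whiskerRight_id _ := Bicategory.whiskerRight_id _
  whiskerRight_comp _ _ _ := Bicategory.whiskerRight_comp _ _ _
  whisker_assoc _ _ _ _ _ := Bicategory.whisker_assoc _ _ _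
  whisker_exchange _ _ := Bicategory.whisker_exchange _ _
  pentagon _ _ _ _ := Bicategory.pentagon _ _ _ _
  triangle _ _ := Bicategory.triangle _ _

theorem isoMk_eqToIso {a b : X} {f g : {f : S.obj a ⟶ S.obj b // S.mem f}} (h : f = g)
    (e : f.1 ≅ g.1) (he : e = eqToIso (congrArg Subtype.val h)) :
    letI := S.homCategory a b
    S.isoMk e = eqToIso h := by
  subst he
  subst h
  rfl

theorem strict [Bicategory.Strict C] :
    letI := S.bicategory
    Bicategory.Strict X :=
  letI := S.bicategory
  { id_comp := fun f => Subtype.ext (Strict.id_comp f.1)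
    comp_id := fun f => Subtype.ext (Strict.comp_id f.1)
    assoc := fun f g h => Subtype.ext (Strict.assoc f.1 g.1 h.1)
    leftUnitor_eqToIso := fun f =>
      S.isoMk_eqToIso (Subtype.ext (Strict.id_comp f.1)) _ (Strict.leftUnitor_eqToIso f.1)
    rightUnitor_eqToIso := fun f =>
      S.isoMk_eqToIso (Subtype.ext (Strict.comp_id f.1)) _ (Strict.rightUnitor_eqToIso f.1)
    associator_eqToIso := fun f g h =>
      S.isoMk_eqToIso (Subtype.ext (Strict.assoc f.1 g.1 h.1)) _
        (Strict.associator_eqToIso f.1 g.1 h.1) }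

end OneCellClass

end LocallyFull

/-! ### Braided and symmetric pseudomonoids -/

/-- The data of a braided pseudomonoid. -/
structure BrPsMonData (K : Type u₁) [Bicategory.{w₁, v₁} K] [BraidedMonoidalBicategory K] extends
    PsMonData K where
  /-- The braiding 2-cell. -/
  γ : brd X X ≫ mul ≅ mul

/-- A braided pseudomonoid in a braided monoidal bicategory. -/
structure BrPsMon (K : Type u₁) [Bicategory.{w₁, v₁} K] [BraidedMonoidalBicategory K] extends
    PsMon K, BrPsMonData K where
  hexagon_right :
    (𝟙 (asc X X X ≫ brd X (X ⊠ₒ X) ≫ asc X X X ≫ 𝟙 X ⊠ mul ≫ mul) ⊗≫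
      (asc X X X ≫ brd X (X ⊠ₒ X)) ◁ mulAssoc.inv ⊗≫
      asc X X X ◁ (braidNat (𝟙 X) mul).inv ▷ mul ⊗≫
      (asc X X X ≫ 𝟙 X ⊠ mul) ◁ γ.hom ⊗≫
      𝟙 (asc X X X ≫ 𝟙 X ⊠ mul ≫ mul)) =
    (𝟙 (asc X X X ≫ brd X (X ⊠ₒ X) ≫ asc X X X ≫ 𝟙 X ⊠ mul ≫ mul) ⊗≫
      (hexR X X X).hom ▷ (𝟙 X ⊠ mul ≫ mul) ⊗≫
      (brd X X ⊠ 𝟙 X ≫ asc X X X) ◁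
        ((wlComp X (brd X X) mul).inv ≫ 𝟙 (𝟙 X) ⊠₂ γ.hom) ▷ mul ⊗≫
      brd X X ⊠ 𝟙 X ◁ mulAssoc.inv ⊗≫
      ((wrComp (brd X X) mul X).inv ≫ γ.hom ⊠₂ 𝟙 (𝟙 X)) ▷ mul ⊗≫
      mulAssoc.hom ⊗≫
      𝟙 (asc X X X ≫ 𝟙 X ⊠ mul ≫ mul))
  hexagon_left :
    (𝟙 (brd (X ⊠ₒ X) X ≫ 𝟙 X ⊠ mul ≫ mul) ⊗≫
      (braidNat mul (𝟙 X)).inv ▷ mul ⊗≫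
      mul ⊠ 𝟙 X ◁ γ.hom ⊗≫
      mulAssoc.hom ⊗≫
      𝟙 (asc X X X ≫ 𝟙 X ⊠ mul ≫ mul)) =
    (𝟙 (brd (X ⊠ₒ X) X ≫ 𝟙 X ⊠ mul ≫ mul) ⊗≫
      (hexS X X X).hom ▷ (𝟙 X ⊠ mul ≫ mul) ⊗≫
      (asc X X X ≫ 𝟙 X ⊠ brd X X ≫ ascInv X X X ≫ brd X X ⊠ 𝟙 X) ◁ mulAssoc.inv ⊗≫
      (asc X X X ≫ 𝟙 X ⊠ brd X X ≫ ascInv X X X) ◁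
        ((wrComp (brd X X) mul X).inv ≫ γ.hom ⊠₂ 𝟙 (𝟙 X)) ▷ mul ⊗≫
      (asc X X X ≫ 𝟙 X ⊠ brd X X ≫ ascInv X X X) ◁ mulAssoc.hom ⊗≫
      (asc X X X ≫ 𝟙 X ⊠ brd X X) ◁ (assoc X X X).counit.hom ▷ (𝟙 X ⊠ mul ≫ mul) ⊗≫
      asc X X X ◁ ((wlComp X (brd X X) mul).inv ≫ 𝟙 (𝟙 X) ⊠₂ γ.hom) ▷ mul ⊗≫
      𝟙 (asc X X X ≫ 𝟙 X ⊠ mul ≫ mul))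

/-- A symmetric pseudomonoid in a symmetric monoidal bicategory. -/
structure SymPsMon (K : Type u₁) [Bicategory.{w₁, v₁} K] [SymmetricMonoidalBicategory K] extends
    BrPsMon K where
  symmetry :
    (𝟙 mul ⊗≫ (SymmetricMonoidalBicategory.syl X X).hom ▷ mul ⊗≫ brd X X ◁ γ.hom ⊗≫ γ.hom) = 𝟙 mul

section BrPsMon

variable {K : Type u₁} [Bicategory.{w₁, v₁} K]

/-- The condition for a strong morphism between braided pseudomonoids to be braided. -/
def StrongMor.IsBraided [BraidedMonoidalBicategory K] {A B : BrPsMon K}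
    (F : A.toPsMon ⟶ B.toPsMon) : Prop :=
  IsCyl (sqV (braidNat (StrongMorData.f F.toStrongMorData) F.f) F.φ) F.φ A.γ.hom B.γ.hom

section Braided

variable [BraidedMonoidalBicategory K]

theorem braidNat_id_eq (x y : K) :
    braidNat (𝟙 x) (𝟙 y) = sqConj (tId x y) (tId y x).symm (idSqH (brd x y)) :=
  IsNat.eq_conj _ _ (braidNat_id x y)

theorem braidNat_comp_eq {x x' x'' y y' y'' : K} (f : x ⟶ x') (g : y ⟶ y') (f' : x' ⟶ x'')
    (g' : y' ⟶ y'') :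
    braidNat (f ≫ f') (g ≫ g') =
      sqConj (tComp f g f' g') (tComp g f g' f').symm (sqH (braidNat f g) (braidNat f' g')) :=
  IsNat.eq_conj _ _ (braidNat_comp f g f' g')

theorem StrongMor.isBraided_id (A : BrPsMon K) :
    StrongMor.IsBraided (A := A) (B := A) (𝟙 A.toPsMon) := by
  change IsCyl (sqV (braidNat (𝟙 A.X) (𝟙 A.X))
    (sqConj (tId A.X A.X) (Iso.refl _) (idSqH A.mul)))
    (sqConj (tId A.X A.X) (Iso.refl _) (idSqH A.mul)) _ _
  rw [braidNat_id_eq, sqV_conj, sqV_idSqH]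
  exact (isCyl_idSqH _).conj _ _

theorem StrongMor.isBraided_comp {A B C : BrPsMon K} {F : A.toPsMon ⟶ B.toPsMon}
    {G : B.toPsMon ⟶ C.toPsMon} (hF : StrongMor.IsBraided F) (hG : StrongMor.IsBraided G) :
    StrongMor.IsBraided (A := A) (B := C) (F ≫ G) := by
  change IsCyl (sqV (braidNat (F.f ≫ G.f) (F.f ≫ G.f))
    (sqConj (tComp F.f F.f G.f G.f) (Iso.refl _) (sqH F.φ G.φ)))
    (sqConj (tComp F.f F.f G.f G.f) (Iso.refl _) (sqH F.φ G.φ)) _ _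
  rw [braidNat_comp_eq, sqV_conj, sqV_sqH]
  exact (IsCyl.sqH hF hG).conj _ _

end Braided

/-- Braided strong morphisms. -/
abbrev brMor (K : Type u₁) [Bicategory.{w₁, v₁} K] [BraidedMonoidalBicategory K] :
    OneCellClass (BrPsMon K) (PsMon K) where
  obj A := A.toPsMon
  mem F := StrongMor.IsBraided F
  id_mem A := StrongMor.isBraided_id A
  comp_mem := StrongMor.isBraided_comp

/-- The 2-category of braided pseudomonoids, braided strong morphisms and 2-cells. -/
instance [BraidedMonoidalBicategory K] : Bicategory (BrPsMon K) := (brMor K).bicategory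

instance [BraidedMonoidalBicategory K] [Bicategory.Strict K] : Bicategory.Strict (BrPsMon K) :=
  (brMor K).strict

/-- Braided strong morphisms between symmetric pseudomonoids. -/
abbrev symMor (K : Type u₁) [Bicategory.{w₁, v₁} K] [SymmetricMonoidalBicategory K] :
    OneCellClass (SymPsMon K) (PsMon K) where
  obj A := A.toPsMon
  mem {A B} F := StrongMor.IsBraided (A := A.toBrPsMon) (B := B.toBrPsMon) F
  id_mem A := StrongMor.isBraided_id A.toBrPsMon
  comp_mem := StrongMor.isBraided_comp

/-- The 2-category of symmetric pseudomonoids, braided strong morphisms and 2-cells. -/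
instance [SymmetricMonoidalBicategory K] : Bicategory (SymPsMon K) := (symMor K).bicategory

instance [SymmetricMonoidalBicategory K] [Bicategory.Strict K] :
    Bicategory.Strict (SymPsMon K) :=
  (symMor K).strict

end BrPsMon

/-! ### Lax monoidal 2-functors -/

section MapLemmas

variable {K : Type u₁} [Bicategory.{w₁, v₁} K] {L : Type u₂} [Bicategory.{w₂, v₂} L]
  (F : StrictPseudofunctor K L)

/-- The image of a square. -/
def mapSq {a b a' b' : K} {f : a ⟶ a'} {g : b ⟶ b'} {u : a ⟶ b} {v : a' ⟶ b'}
    (s : f ≫ v ≅ u ≫ g) : F.map f ≫ F.map v ≅ F.map u ≫ F.map g :=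
  (F.mapComp f v).symm ≪≫ F.map₂Iso s ≪≫ F.mapComp u g

/-- The image of a threefold composite. -/
def mapComp₃ {a b c d : K} (f : a ⟶ b) (g : b ⟶ c) (h : c ⟶ d) :
    F.map (f ≫ g ≫ h) ≅ F.map f ≫ F.map g ≫ F.map h :=
  F.mapComp f (g ≫ h) ≪≫ whiskerLeftIso (F.map f) (F.mapComp g h)

/-- The image of a fivefold composite. -/
def mapComp₅ {x₀ x₁ x₂ x₃ x₄ x₅ : K} (p : x₀ ⟶ x₁) (q : x₁ ⟶ x₂) (r : x₂ ⟶ x₃) (s : x₃ ⟶ x₄)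
    (t : x₄ ⟶ x₅) :
    F.map (p ≫ q ≫ r ≫ s ≫ t) ≅ F.map p ≫ F.map q ≫ F.map r ≫ F.map s ≫ F.map t :=
  mapComp₃ F p q (r ≫ s ≫ t) ≪≫ whiskerLeftIso _ (whiskerLeftIso _ (mapComp₃ F r s t))

end MapLemmas

section Lax

variable {K : Type u₁} [Bicategory.{w₁, v₁} K] {L : Type u₂} [Bicategory.{w₂, v₂} L]

/-- The data of a lax monoidal 2-functor. -/
structure LaxMonoidalData [MonoidalBicategory K] [MonoidalBicategory L]
    (F : StrictPseudofunctor K L) where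
  /-- The comparison of tensor products. -/
  μ (a b : K) : F.obj a ⊠ₒ F.obj b ⟶ F.obj (a ⊠ₒ b)
  /-- The pseudonaturality cells of `μ`. -/
  μNat {a a' b b' : K} (f : a ⟶ a') (g : b ⟶ b') :
    F.map f ⊠ F.map g ≫ μ a' b' ≅ μ a b ≫ F.map (f ⊠ g)
  /-- The comparison of units. -/
  ι : (I : L) ⟶ F.obj I
  /-- The associativity 2-cells. -/
  ω (a b c : K) :
    μ a b ⊠ 𝟙 (F.obj c) ≫ μ (a ⊠ₒ b) c ≫ F.map (asc a b c) ≅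
      asc (F.obj a) (F.obj b) (F.obj c) ≫ 𝟙 (F.obj a) ⊠ μ b c ≫ μ a (b ⊠ₒ c)
  /-- The right unit 2-cells. -/
  ζ (a : K) : 𝟙 (F.obj a) ⊠ ι ≫ μ a I ≫ F.map (run a) ≅ run (F.obj a)
  /-- The left unit 2-cells. -/
  ξ (a : K) : ι ⊠ 𝟙 (F.obj a) ≫ μ I a ≫ F.map (lun a) ≅ lun (F.obj a)

namespace LaxMonoidalData

section

variable [MonoidalBicategory K] [MonoidalBicategory L] {F : StrictPseudofunctor K L}
  (m : LaxMonoidalData F)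

/-- Naturality of `μ` in the first variable. -/
def μL {a a' : K} (f : a ⟶ a') (b : K) :
    F.map f ⊠ 𝟙 (F.obj b) ≫ m.μ a' b ≅ m.μ a b ≫ F.map (f ⊠ 𝟙 b) :=
  whiskerRightIso (Iso.refl (F.map f) ⊠ᵢ (F.mapId b).symm) (m.μ a' b) ≪≫ m.μNat f (𝟙 b)

/-- Naturality of `μ` in the second variable. -/
def μR (a : K) {b b' : K} (g : b ⟶ b') :
    𝟙 (F.obj a) ⊠ F.map g ≫ m.μ a b' ≅ m.μ a b ≫ F.map (𝟙 a ⊠ g) :=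
  whiskerRightIso ((F.mapId a).symm ⊠ᵢ Iso.refl (F.map g)) (m.μ a b') ≪≫ m.μNat (𝟙 a) g

/-- The naturality square of the comparison of units. -/
def ιSq : 𝟙 I ≫ m.ι ≅ m.ι ≫ F.map (𝟙 I) :=
  idSqH m.ι ≪≫ whiskerLeftIso m.ι (F.mapId I).symm

end

end LaxMonoidalData

/-- A lax monoidal 2-functor. -/
structure LaxMonoidal [MonoidalBicategory K] [MonoidalBicategory L]
    (F : StrictPseudofunctor K L) extends LaxMonoidalData F where
  μNat_nat {a a' b b' : K} {f f' : a ⟶ a'} {g g' : b ⟶ b'} (σ : f ⟶ f') (τ : g ⟶ g') :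
    IsNat (μNat f g) (μNat f' g') (F.map₂ σ ⊠₂ F.map₂ τ) (F.map₂ (σ ⊠₂ τ))
  μNat_id (a b : K) :
    IsNat (μNat (𝟙 a) (𝟙 b)) (idSqH (μ a b))
      ((F.mapId a).hom ⊠₂ (F.mapId b).hom ≫ (tId (F.obj a) (F.obj b)).hom)
      (F.map₂ (tId a b).hom ≫ (F.mapId (a ⊠ₒ b)).hom)
  μNat_comp {a a' a'' b b' b'' : K} (f : a ⟶ a') (g : b ⟶ b') (f' : a' ⟶ a'') (g' : b' ⟶ b'') :
    IsNat (μNat (f ≫ f') (g ≫ g')) (sqH (μNat f g) (μNat f' g'))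
      ((F.mapComp f f').hom ⊠₂ (F.mapComp g g').hom ≫
        (tComp (F.map f) (F.map g) (F.map f') (F.map g')).hom)
      (F.map₂ (tComp f g f' g').hom ≫ (F.mapComp (f ⊠ g) (f' ⊠ g')).hom)
  ω_modif {a a' b b' c c' : K} (f : a ⟶ a') (g : b ⟶ b') (h : c ⟶ c') :
    IsCyl
      (sqV (tSq (μNat f g) (idSqV (F.map h))) (sqV (μNat (f ⊠ g) h) (mapSq F (assocNat f g h))))
      (sqV (assocNat (F.map f) (F.map g) (F.map h))
        (sqV (tSq (idSqV (F.map f)) (μNat g h)) (μNat f (g ⊠ h))))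
      (ω a b c).hom (ω a' b' c').hom
  ζ_modif {a a' : K} (f : a ⟶ a') :
    IsCyl
      (sqV (tSq (idSqV (F.map f)) toLaxMonoidalData.ιSq)
        (sqV (μNat f (𝟙 I)) (mapSq F (rUnitNat f))))
      (rUnitNat (F.map f)) (ζ a).hom (ζ a').hom
  ξ_modif {a a' : K} (f : a ⟶ a') :
    IsCyl
      (sqV (tSq toLaxMonoidalData.ιSq (idSqV (F.map f)))
        (sqV (μNat (𝟙 I) f) (mapSq F (lUnitNat f))))
      (lUnitNat (F.map f)) (ξ a).hom (ξ a').hom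
  /-- The compatibility of `ω` with the pentagonators. -/
  assoc_coherence (a b c d : K) :
    (𝟙 ((μ a b ⊠ 𝟙 (F.obj c)) ⊠ 𝟙 (F.obj d) ≫ μ (a ⊠ₒ b) c ⊠ 𝟙 (F.obj d) ≫
          μ ((a ⊠ₒ b) ⊠ₒ c) d ≫ F.map (asc a b c ⊠ 𝟙 d) ≫ F.map (asc a (b ⊠ₒ c) d) ≫
          F.map (𝟙 a ⊠ asc b c d)) ⊗≫
      ((μ a b ⊠ 𝟙 (F.obj c)) ⊠ 𝟙 (F.obj d) ≫ μ (a ⊠ₒ b) c ⊠ 𝟙 (F.obj d) ≫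
          μ ((a ⊠ₒ b) ⊠ₒ c) d) ◁
        ((mapComp₃ F (asc a b c ⊠ 𝟙 d) (asc a (b ⊠ₒ c) d) (𝟙 a ⊠ asc b c d)).inv ≫
          F.map₂ (pent a b c d).hom ≫
          (F.mapComp (asc (a ⊠ₒ b) c d) (asc a b (c ⊠ₒ d))).hom) ⊗≫
      (μ a b ⊠ 𝟙 (F.obj c)) ⊠ 𝟙 (F.obj d) ◁ (ω (a ⊠ₒ b) c d).hom ▷
        F.map (asc a b (c ⊠ₒ d)) ⊗≫
      (ascL (μ a b) (F.obj c) (F.obj d)).hom ▷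
        (𝟙 (F.obj (a ⊠ₒ b)) ⊠ μ c d ≫ μ (a ⊠ₒ b) (c ⊠ₒ d) ≫ F.map (asc a b (c ⊠ₒ d))) ⊗≫
      asc (F.obj a ⊠ₒ F.obj b) (F.obj c) (F.obj d) ◁ (xch (μ a b) (μ c d)).hom ▷
        (μ (a ⊠ₒ b) (c ⊠ₒ d) ≫ F.map (asc a b (c ⊠ₒ d))) ⊗≫
      (asc (F.obj a ⊠ₒ F.obj b) (F.obj c) (F.obj d) ≫
          𝟙 (F.obj a ⊠ₒ F.obj b) ⊠ μ c d) ◁ (ω a b (c ⊠ₒ d)).hom ⊗≫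
      asc (F.obj a ⊠ₒ F.obj b) (F.obj c) (F.obj d) ◁
        (ascR (F.obj a) (F.obj b) (μ c d)).hom ▷
        (𝟙 (F.obj a) ⊠ μ b (c ⊠ₒ d) ≫ μ a (b ⊠ₒ c ⊠ₒ d)) ⊗≫
      𝟙 (asc (F.obj a ⊠ₒ F.obj b) (F.obj c) (F.obj d) ≫
          asc (F.obj a) (F.obj b) (F.obj c ⊠ₒ F.obj d) ≫
          𝟙 (F.obj a) ⊠ (𝟙 (F.obj b) ⊠ μ c d) ≫ 𝟙 (F.obj a) ⊠ μ b (c ⊠ₒ d) ≫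
          μ a (b ⊠ₒ c ⊠ₒ d))) =
    (𝟙 ((μ a b ⊠ 𝟙 (F.obj c)) ⊠ 𝟙 (F.obj d) ≫ μ (a ⊠ₒ b) c ⊠ 𝟙 (F.obj d) ≫
          μ ((a ⊠ₒ b) ⊠ₒ c) d ≫ F.map (asc a b c ⊠ 𝟙 d) ≫ F.map (asc a (b ⊠ₒ c) d) ≫
          F.map (𝟙 a ⊠ asc b c d)) ⊗≫
      ((μ a b ⊠ 𝟙 (F.obj c)) ⊠ 𝟙 (F.obj d) ≫ μ (a ⊠ₒ b) c ⊠ 𝟙 (F.obj d)) ◁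
        (toLaxMonoidalData.μL (asc a b c) d).inv ▷
        (F.map (asc a (b ⊠ₒ c) d) ≫ F.map (𝟙 a ⊠ asc b c d)) ⊗≫
      ((wrComp₃ (μ a b ⊠ 𝟙 (F.obj c)) (μ (a ⊠ₒ b) c) (F.map (asc a b c)) (F.obj d)).inv ≫
          (ω a b c).hom ⊠₂ 𝟙 (𝟙 (F.obj d)) ≫
          (wrComp₃ (asc (F.obj a) (F.obj b) (F.obj c)) (𝟙 (F.obj a) ⊠ μ b c)
            (μ a (b ⊠ₒ c)) (F.obj d)).hom) ▷
        (μ (a ⊠ₒ b ⊠ₒ c) d ≫ F.map (asc a (b ⊠ₒ c) d) ≫ F.map (𝟙 a ⊠ asc b c d)) ⊗≫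
      (asc (F.obj a) (F.obj b) (F.obj c) ⊠ 𝟙 (F.obj d) ≫
          (𝟙 (F.obj a) ⊠ μ b c) ⊠ 𝟙 (F.obj d)) ◁ (ω a (b ⊠ₒ c) d).hom ▷
        F.map (𝟙 a ⊠ asc b c d) ⊗≫
      (asc (F.obj a) (F.obj b) (F.obj c) ⊠ 𝟙 (F.obj d) ≫
          (𝟙 (F.obj a) ⊠ μ b c) ⊠ 𝟙 (F.obj d) ≫ asc (F.obj a) (F.obj (b ⊠ₒ c)) (F.obj d) ≫
          𝟙 (F.obj a) ⊠ μ (b ⊠ₒ c) d) ◁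
        (toLaxMonoidalData.μR a (asc b c d)).inv ⊗≫
      asc (F.obj a) (F.obj b) (F.obj c) ⊠ 𝟙 (F.obj d) ◁
        (ascM (F.obj a) (μ b c) (F.obj d)).hom ▷
        (𝟙 (F.obj a) ⊠ μ (b ⊠ₒ c) d ≫ 𝟙 (F.obj a) ⊠ F.map (asc b c d) ≫
          μ a (b ⊠ₒ c ⊠ₒ d)) ⊗≫
      (asc (F.obj a) (F.obj b) (F.obj c) ⊠ 𝟙 (F.obj d) ≫
          asc (F.obj a) (F.obj b ⊠ₒ F.obj c) (F.obj d)) ◁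
        ((wlComp₃ (F.obj a) (μ b c ⊠ 𝟙 (F.obj d)) (μ (b ⊠ₒ c) d) (F.map (asc b c d))).inv ≫
          𝟙 (𝟙 (F.obj a)) ⊠₂ (ω b c d).hom ≫
          (wlComp₃ (F.obj a) (asc (F.obj b) (F.obj c) (F.obj d)) (𝟙 (F.obj b) ⊠ μ c d)
            (μ b (c ⊠ₒ d))).hom) ▷
        μ a (b ⊠ₒ c ⊠ₒ d) ⊗≫
      (pent (F.obj a) (F.obj b) (F.obj c) (F.obj d)).hom ▷
        (𝟙 (F.obj a) ⊠ (𝟙 (F.obj b) ⊠ μ c d) ≫ 𝟙 (F.obj a) ⊠ μ b (c ⊠ₒ d) ≫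
          μ a (b ⊠ₒ c ⊠ₒ d)) ⊗≫
      𝟙 (asc (F.obj a ⊠ₒ F.obj b) (F.obj c) (F.obj d) ≫
          asc (F.obj a) (F.obj b) (F.obj c ⊠ₒ F.obj d) ≫
          𝟙 (F.obj a) ⊠ (𝟙 (F.obj b) ⊠ μ c d) ≫ 𝟙 (F.obj a) ⊠ μ b (c ⊠ₒ d) ≫
          μ a (b ⊠ₒ c ⊠ₒ d)))
  /-- The compatibility of `ζ` and `ξ` with the middle unit 2-cells. -/
  unit_coherence (a b : K) :
    (𝟙 ((𝟙 (F.obj a) ⊠ ι) ⊠ 𝟙 (F.obj b) ≫ μ a I ⊠ 𝟙 (F.obj b) ≫ μ (a ⊠ₒ I) b ≫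
          F.map (asc a I b) ≫ F.map (𝟙 a ⊠ lun b)) ⊗≫
      ((𝟙 (F.obj a) ⊠ ι) ⊠ 𝟙 (F.obj b) ≫ μ a I ⊠ 𝟙 (F.obj b) ≫ μ (a ⊠ₒ I) b) ◁
        ((F.mapComp (asc a I b) (𝟙 a ⊠ lun b)).inv ≫ F.map₂ (midU a b).hom) ⊗≫
      ((𝟙 (F.obj a) ⊠ ι) ⊠ 𝟙 (F.obj b) ≫ μ a I ⊠ 𝟙 (F.obj b)) ◁
        (toLaxMonoidalData.μL (run a) b).inv ⊗≫
      ((wrComp₃ (𝟙 (F.obj a) ⊠ ι) (μ a I) (F.map (run a)) (F.obj b)).inv ≫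
        (ζ a).hom ⊠₂ 𝟙 (𝟙 (F.obj b))) ▷ μ a b ⊗≫
      𝟙 (run (F.obj a) ⊠ 𝟙 (F.obj b) ≫ μ a b)) =
    (𝟙 ((𝟙 (F.obj a) ⊠ ι) ⊠ 𝟙 (F.obj b) ≫ μ a I ⊠ 𝟙 (F.obj b) ≫ μ (a ⊠ₒ I) b ≫
          F.map (asc a I b) ≫ F.map (𝟙 a ⊠ lun b)) ⊗≫
      (𝟙 (F.obj a) ⊠ ι) ⊠ 𝟙 (F.obj b) ◁ (ω a I b).hom ▷ F.map (𝟙 a ⊠ lun b) ⊗≫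
      (ascM (F.obj a) ι (F.obj b)).hom ▷
        (𝟙 (F.obj a) ⊠ μ I b ≫ μ a (I ⊠ₒ b) ≫ F.map (𝟙 a ⊠ lun b)) ⊗≫
      (asc (F.obj a) I (F.obj b) ≫ 𝟙 (F.obj a) ⊠ (ι ⊠ 𝟙 (F.obj b)) ≫ 𝟙 (F.obj a) ⊠ μ I b) ◁
        (toLaxMonoidalData.μR a (lun b)).inv ⊗≫
      asc (F.obj a) I (F.obj b) ◁
        ((wlComp₃ (F.obj a) (ι ⊠ 𝟙 (F.obj b)) (μ I b) (F.map (lun b))).inv ≫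
          𝟙 (𝟙 (F.obj a)) ⊠₂ (ξ b).hom) ▷ μ a b ⊗≫
      (midU (F.obj a) (F.obj b)).hom ▷ μ a b ⊗≫
      𝟙 (run (F.obj a) ⊠ 𝟙 (F.obj b) ≫ μ a b))

/-- The data of a braided lax monoidal 2-functor. -/
structure BraidedLaxData [BraidedMonoidalBicategory K] [BraidedMonoidalBicategory L]
    (F : StrictPseudofunctor K L) extends LaxMonoidalData F where
  /-- The braiding 2-cells. -/
  v (a b : K) : brd (F.obj a) (F.obj b) ≫ μ b a ≅ μ a b ≫ F.map (brd a b)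

/-- A braided lax monoidal 2-functor. -/
structure BraidedLaxMonoidal [BraidedMonoidalBicategory K] [BraidedMonoidalBicategory L]
    (F : StrictPseudofunctor K L) extends LaxMonoidal F, BraidedLaxData F where
  v_modif {a a' b b' : K} (f : a ⟶ a') (g : b ⟶ b') :
    IsCyl (sqV (braidNat (F.map f) (F.map g)) (μNat g f))
      (sqV (μNat f g) (mapSq F (braidNat f g))) (v a b).hom (v a' b').hom
  /-- The compatibility with the hexagonators moving one object past two. -/
  hexR_coherence (a b c : K) :
    (𝟙 (μ a b ⊠ 𝟙 (F.obj c) ≫ μ (a ⊠ₒ b) c ≫ F.map (asc a b c) ≫ F.map (brd a (b ⊠ₒ c)) ≫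
          F.map (asc b c a)) ⊗≫
      (ω a b c).hom ▷ (F.map (brd a (b ⊠ₒ c)) ≫ F.map (asc b c a)) ⊗≫
      (asc (F.obj a) (F.obj b) (F.obj c) ≫ 𝟙 (F.obj a) ⊠ μ b c) ◁ (v a (b ⊠ₒ c)).inv ▷
        F.map (asc b c a) ⊗≫
      asc (F.obj a) (F.obj b) (F.obj c) ◁ (braidNat (𝟙 (F.obj a)) (μ b c)).hom ▷
        (μ (b ⊠ₒ c) a ≫ F.map (asc b c a)) ⊗≫
      (asc (F.obj a) (F.obj b) (F.obj c) ≫ brd (F.obj a) (F.obj b ⊠ₒ F.obj c)) ◁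
        (ω b c a).hom ⊗≫
      (hexR (F.obj a) (F.obj b) (F.obj c)).hom ▷ (𝟙 (F.obj b) ⊠ μ c a ≫ μ b (c ⊠ₒ a)) ⊗≫
      𝟙 (brd (F.obj a) (F.obj b) ⊠ 𝟙 (F.obj c) ≫ asc (F.obj b) (F.obj a) (F.obj c) ≫
          𝟙 (F.obj b) ⊠ brd (F.obj a) (F.obj c) ≫ 𝟙 (F.obj b) ⊠ μ c a ≫ μ b (c ⊠ₒ a))) =
    (𝟙 (μ a b ⊠ 𝟙 (F.obj c) ≫ μ (a ⊠ₒ b) c ≫ F.map (asc a b c) ≫ F.map (brd a (b ⊠ₒ c)) ≫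
          F.map (asc b c a)) ⊗≫
      (μ a b ⊠ 𝟙 (F.obj c) ≫ μ (a ⊠ₒ b) c) ◁
        ((mapComp₃ F (asc a b c) (brd a (b ⊠ₒ c)) (asc b c a)).inv ≫
          F.map₂ (hexR a b c).hom ≫
          (mapComp₃ F (brd a b ⊠ 𝟙 c) (asc b a c) (𝟙 b ⊠ brd a c)).hom) ⊗≫
      μ a b ⊠ 𝟙 (F.obj c) ◁ (toLaxMonoidalData.μL (brd a b) c).inv ▷
        (F.map (asc b a c) ≫ F.map (𝟙 b ⊠ brd a c)) ⊗≫
      ((wrComp (μ a b) (F.map (brd a b)) (F.obj c)).inv ≫ (v a b).inv ⊠₂ 𝟙 (𝟙 (F.obj c)) ≫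
          (wrComp (brd (F.obj a) (F.obj b)) (μ b a) (F.obj c)).hom) ▷
        (μ (b ⊠ₒ a) c ≫ F.map (asc b a c) ≫ F.map (𝟙 b ⊠ brd a c)) ⊗≫
      brd (F.obj a) (F.obj b) ⊠ 𝟙 (F.obj c) ◁ (ω b a c).hom ▷ F.map (𝟙 b ⊠ brd a c) ⊗≫
      (brd (F.obj a) (F.obj b) ⊠ 𝟙 (F.obj c) ≫ asc (F.obj b) (F.obj a) (F.obj c) ≫
          𝟙 (F.obj b) ⊠ μ a c) ◁ (toLaxMonoidalData.μR b (brd a c)).inv ⊗≫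
      (brd (F.obj a) (F.obj b) ⊠ 𝟙 (F.obj c) ≫ asc (F.obj b) (F.obj a) (F.obj c)) ◁
        ((wlComp (F.obj b) (μ a c) (F.map (brd a c))).inv ≫ 𝟙 (𝟙 (F.obj b)) ⊠₂ (v a c).inv ≫
          (wlComp (F.obj b) (brd (F.obj a) (F.obj c)) (μ c a)).hom) ▷ μ b (c ⊠ₒ a) ⊗≫
      𝟙 (brd (F.obj a) (F.obj b) ⊠ 𝟙 (F.obj c) ≫ asc (F.obj b) (F.obj a) (F.obj c) ≫
          𝟙 (F.obj b) ⊠ brd (F.obj a) (F.obj c) ≫ 𝟙 (F.obj b) ⊠ μ c a ≫ μ b (c ⊠ₒ a)))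
  /-- The compatibility with the hexagonators moving two objects past one. -/
  hexS_coherence (a b c : K) :
    (𝟙 (μ a b ⊠ 𝟙 (F.obj c) ≫ μ (a ⊠ₒ b) c ≫ F.map (brd (a ⊠ₒ b) c)) ⊗≫
      μ a b ⊠ 𝟙 (F.obj c) ◁ (v (a ⊠ₒ b) c).inv ⊗≫
      (braidNat (μ a b) (𝟙 (F.obj c))).hom ▷ μ c (a ⊠ₒ b) ⊗≫
      (hexS (F.obj a) (F.obj b) (F.obj c)).hom ▷ (𝟙 (F.obj c) ⊠ μ a b ≫ μ c (a ⊠ₒ b)) ⊗≫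
      𝟙 (asc (F.obj a) (F.obj b) (F.obj c) ≫ 𝟙 (F.obj a) ⊠ brd (F.obj b) (F.obj c) ≫
          ascInv (F.obj a) (F.obj c) (F.obj b) ≫ brd (F.obj a) (F.obj c) ⊠ 𝟙 (F.obj b) ≫
          asc (F.obj c) (F.obj a) (F.obj b) ≫ 𝟙 (F.obj c) ⊠ μ a b ≫ μ c (a ⊠ₒ b))) =
    (𝟙 (μ a b ⊠ 𝟙 (F.obj c) ≫ μ (a ⊠ₒ b) c ≫ F.map (brd (a ⊠ₒ b) c)) ⊗≫
      (μ a b ⊠ 𝟙 (F.obj c) ≫ μ (a ⊠ₒ b) c) ◁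
        (F.map₂ (hexS a b c).hom ≫
          (mapComp₅ F (asc a b c) (𝟙 a ⊠ brd b c) (ascInv a c b) (brd a c ⊠ 𝟙 b)
            (asc c a b)).hom) ⊗≫
      (ω a b c).hom ▷
        (F.map (𝟙 a ⊠ brd b c) ≫ F.map (ascInv a c b) ≫ F.map (brd a c ⊠ 𝟙 b) ≫
          F.map (asc c a b)) ⊗≫
      (asc (F.obj a) (F.obj b) (F.obj c) ≫ 𝟙 (F.obj a) ⊠ μ b c) ◁
        (toLaxMonoidalData.μR a (brd b c)).inv ▷
        (F.map (ascInv a c b) ≫ F.map (brd a c ⊠ 𝟙 b) ≫ F.map (asc c a b)) ⊗≫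
      asc (F.obj a) (F.obj b) (F.obj c) ◁
        ((wlComp (F.obj a) (μ b c) (F.map (brd b c))).inv ≫ 𝟙 (𝟙 (F.obj a)) ⊠₂ (v b c).inv ≫
          (wlComp (F.obj a) (brd (F.obj b) (F.obj c)) (μ c b)).hom) ▷
        (μ a (c ⊠ₒ b) ≫ F.map (ascInv a c b) ≫ F.map (brd a c ⊠ 𝟙 b) ≫ F.map (asc c a b)) ⊗≫
      (asc (F.obj a) (F.obj b) (F.obj c) ≫ 𝟙 (F.obj a) ⊠ brd (F.obj b) (F.obj c)) ◁
        ((assoc (F.obj a) (F.obj c) (F.obj b)).counit.inv ▷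
            (𝟙 (F.obj a) ⊠ μ c b ≫ μ a (c ⊠ₒ b) ≫ F.map (ascInv a c b)) ⊗≫
          ascInv (F.obj a) (F.obj c) (F.obj b) ◁ (ω a c b).inv ▷ F.map (ascInv a c b) ⊗≫
          (ascInv (F.obj a) (F.obj c) (F.obj b) ≫ μ a c ⊠ 𝟙 (F.obj b) ≫ μ (a ⊠ₒ c) b) ◁
            ((F.mapComp (asc a c b) (ascInv a c b)).inv ≫ F.map₂ (assoc a c b).unit.inv ≫
              (F.mapId ((a ⊠ₒ c) ⊠ₒ b)).hom) ⊗≫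
          𝟙 (ascInv (F.obj a) (F.obj c) (F.obj b) ≫ μ a c ⊠ 𝟙 (F.obj b) ≫ μ (a ⊠ₒ c) b)) ▷
        (F.map (brd a c ⊠ 𝟙 b) ≫ F.map (asc c a b)) ⊗≫
      (asc (F.obj a) (F.obj b) (F.obj c) ≫ 𝟙 (F.obj a) ⊠ brd (F.obj b) (F.obj c) ≫
          ascInv (F.obj a) (F.obj c) (F.obj b)) ◁
        (μ a c ⊠ 𝟙 (F.obj b) ◁ (toLaxMonoidalData.μL (brd a c) b).inv ▷ F.map (asc c a b) ⊗≫
          ((wrComp (μ a c) (F.map (brd a c)) (F.obj b)).inv ≫ (v a c).inv ⊠₂ 𝟙 (𝟙 (F.obj b)) ≫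
              (wrComp (brd (F.obj a) (F.obj c)) (μ c a) (F.obj b)).hom) ▷
            (μ (c ⊠ₒ a) b ≫ F.map (asc c a b)) ⊗≫
          brd (F.obj a) (F.obj c) ⊠ 𝟙 (F.obj b) ◁ (ω c a b).hom) ⊗≫
      𝟙 (asc (F.obj a) (F.obj b) (F.obj c) ≫ 𝟙 (F.obj a) ⊠ brd (F.obj b) (F.obj c) ≫
          ascInv (F.obj a) (F.obj c) (F.obj b) ≫ brd (F.obj a) (F.obj c) ⊠ 𝟙 (F.obj b) ≫
          asc (F.obj c) (F.obj a) (F.obj b) ≫ 𝟙 (F.obj c) ⊠ μ a b ≫ μ c (a ⊠ₒ b)))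

/-- A symmetric lax monoidal 2-functor. -/
structure SymmetricLaxMonoidal [SymmetricMonoidalBicategory K] [SymmetricMonoidalBicategory L]
    (F : StrictPseudofunctor K L) extends BraidedLaxMonoidal F where
  syl_coherence (a b : K) :
    (𝟙 (μ a b) ⊗≫
      (SymmetricMonoidalBicategory.syl (F.obj a) (F.obj b)).hom ▷ μ a b ⊗≫
      brd (F.obj a) (F.obj b) ◁ (v b a).hom ⊗≫
      (v a b).hom ▷ F.map (brd b a) ⊗≫
      𝟙 (μ a b ≫ F.map (brd a b) ≫ F.map (brd b a))) =
    (𝟙 (μ a b) ⊗≫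
      μ a b ◁ ((F.mapId (a ⊠ₒ b)).inv ≫ F.map₂ (SymmetricMonoidalBicategory.syl a b).hom ≫
        (F.mapComp (brd a b) (brd b a)).hom) ⊗≫
      𝟙 (μ a b ≫ F.map (brd a b) ≫ F.map (brd b a)))

namespace LaxMonoidalData

section

variable (K) [MonoidalBicategory K]

/-- The lax monoidal structure of the identity 2-functor. -/
def id : LaxMonoidalData (StrictPseudofunctor.id K) where
  μ a b := 𝟙 (a ⊠ₒ b)
  μNat f g := idSqV (f ⊠ g)
  ι := 𝟙 I
  ω a b c :=
    (whiskerRightIso (tId (a ⊠ₒ b) c) (𝟙 ((a ⊠ₒ b) ⊠ₒ c) ≫ asc a b c) ≪⊗≫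
      whiskerLeftIso (asc a b c)
        (whiskerRightIso (tId a (b ⊠ₒ c)).symm (𝟙 (a ⊠ₒ b ⊠ₒ c))) :
      𝟙 (a ⊠ₒ b) ⊠ 𝟙 c ≫ 𝟙 ((a ⊠ₒ b) ⊠ₒ c) ≫ asc a b c ≅
        asc a b c ≫ 𝟙 a ⊠ 𝟙 (b ⊠ₒ c) ≫ 𝟙 (a ⊠ₒ b ⊠ₒ c))
  ζ a :=
    (whiskerRightIso (tId a I) (𝟙 (a ⊠ₒ I) ≫ run a) ≪⊗≫ Iso.refl (run a) :
      𝟙 a ⊠ 𝟙 I ≫ 𝟙 (a ⊠ₒ I) ≫ run a ≅ run a)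
  ξ a :=
    (whiskerRightIso (tId I a) (𝟙 (I ⊠ₒ a) ≫ lun a) ≪⊗≫ Iso.refl (lun a) :
      𝟙 I ⊠ 𝟙 a ≫ 𝟙 (I ⊠ₒ a) ≫ lun a ≅ lun a)

end

section

variable [MonoidalBicategory K] [MonoidalBicategory L] {M : Type u₃} [Bicategory.{w₃, v₃} M]
  [MonoidalBicategory M] {F : StrictPseudofunctor K L} {G : StrictPseudofunctor L M}

/-- The lax monoidal structure of a composite 2-functor. -/
def comp (m : LaxMonoidalData F) (n : LaxMonoidalData G) : LaxMonoidalData (F.comp G) where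
  μ a b := n.μ (F.obj a) (F.obj b) ≫ G.map (m.μ a b)
  μNat f g := sqV (n.μNat (F.map f) (F.map g)) (mapSq G (m.μNat f g))
  ι := n.ι ≫ G.map m.ι
  ω a b c :=
    (whiskerRightIso (wrComp (n.μ (F.obj a) (F.obj b)) (G.map (m.μ a b)) (G.obj (F.obj c)))
        ((n.μ (F.obj (a ⊠ₒ b)) (F.obj c) ≫ G.map (m.μ (a ⊠ₒ b) c)) ≫
          G.map (F.map (asc a b c))) ≪⊗≫
      whiskerLeftIso (n.μ (F.obj a) (F.obj b) ⊠ 𝟙 (G.obj (F.obj c)))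
        (whiskerRightIso (n.μL (m.μ a b) (F.obj c))
          (G.map (m.μ (a ⊠ₒ b) c) ≫ G.map (F.map (asc a b c)))) ≪⊗≫
      whiskerLeftIso (n.μ (F.obj a) (F.obj b) ⊠ 𝟙 (G.obj (F.obj c)) ≫
          n.μ (F.obj a ⊠ₒ F.obj b) (F.obj c))
        ((mapComp₃ G (m.μ a b ⊠ 𝟙 (F.obj c)) (m.μ (a ⊠ₒ b) c) (F.map (asc a b c))).symm ≪≫
          G.map₂Iso (m.ω a b c) ≪≫
          mapComp₃ G (asc (F.obj a) (F.obj b) (F.obj c)) (𝟙 (F.obj a) ⊠ m.μ b c)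
            (m.μ a (b ⊠ₒ c))) ≪⊗≫
      whiskerRightIso (n.ω (F.obj a) (F.obj b) (F.obj c))
        (G.map (𝟙 (F.obj a) ⊠ m.μ b c) ≫ G.map (m.μ a (b ⊠ₒ c))) ≪⊗≫
      whiskerLeftIso (asc (G.obj (F.obj a)) (G.obj (F.obj b)) (G.obj (F.obj c)) ≫
          𝟙 (G.obj (F.obj a)) ⊠ n.μ (F.obj b) (F.obj c))
        (whiskerRightIso (n.μR (F.obj a) (m.μ b c)).symm (G.map (m.μ a (b ⊠ₒ c)))) ≪⊗≫
      whiskerLeftIso (asc (G.obj (F.obj a)) (G.obj (F.obj b)) (G.obj (F.obj c)))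
        (whiskerRightIso
          (wlComp (G.obj (F.obj a)) (n.μ (F.obj b) (F.obj c)) (G.map (m.μ b c))).symm
          (n.μ (F.obj a) (F.obj (b ⊠ₒ c)) ≫ G.map (m.μ a (b ⊠ₒ c)))) :
      (n.μ (F.obj a) (F.obj b) ≫ G.map (m.μ a b)) ⊠ 𝟙 (G.obj (F.obj c)) ≫
          (n.μ (F.obj (a ⊠ₒ b)) (F.obj c) ≫ G.map (m.μ (a ⊠ₒ b) c)) ≫ G.map (F.map (asc a b c)) ≅
        asc (G.obj (F.obj a)) (G.obj (F.obj b)) (G.obj (F.obj c)) ≫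
          𝟙 (G.obj (F.obj a)) ⊠ (n.μ (F.obj b) (F.obj c) ≫ G.map (m.μ b c)) ≫
          (n.μ (F.obj a) (F.obj (b ⊠ₒ c)) ≫ G.map (m.μ a (b ⊠ₒ c))))
  ζ a :=
    (whiskerRightIso (wlComp (G.obj (F.obj a)) n.ι (G.map m.ι))
        ((n.μ (F.obj a) (F.obj I) ≫ G.map (m.μ a I)) ≫ G.map (F.map (run a))) ≪⊗≫
      whiskerLeftIso (𝟙 (G.obj (F.obj a)) ⊠ n.ι)
        (whiskerRightIso (n.μR (F.obj a) m.ι) (G.map (m.μ a I) ≫ G.map (F.map (run a)))) ≪⊗≫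
      whiskerLeftIso (𝟙 (G.obj (F.obj a)) ⊠ n.ι ≫ n.μ (F.obj a) I)
        ((mapComp₃ G (𝟙 (F.obj a) ⊠ m.ι) (m.μ a I) (F.map (run a))).symm ≪≫
          G.map₂Iso (m.ζ a)) ≪⊗≫
      n.ζ (F.obj a) :
      𝟙 (G.obj (F.obj a)) ⊠ (n.ι ≫ G.map m.ι) ≫
          (n.μ (F.obj a) (F.obj I) ≫ G.map (m.μ a I)) ≫ G.map (F.map (run a)) ≅
        run (G.obj (F.obj a)))
  ξ a :=
    (whiskerRightIso (wrComp n.ι (G.map m.ι) (G.obj (F.obj a)))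
        ((n.μ (F.obj I) (F.obj a) ≫ G.map (m.μ I a)) ≫ G.map (F.map (lun a))) ≪⊗≫
      whiskerLeftIso (n.ι ⊠ 𝟙 (G.obj (F.obj a)))
        (whiskerRightIso (n.μL m.ι (F.obj a)) (G.map (m.μ I a) ≫ G.map (F.map (lun a)))) ≪⊗≫
      whiskerLeftIso (n.ι ⊠ 𝟙 (G.obj (F.obj a)) ≫ n.μ I (F.obj a))
        ((mapComp₃ G (m.ι ⊠ 𝟙 (F.obj a)) (m.μ I a) (F.map (lun a))).symm ≪≫
          G.map₂Iso (m.ξ a)) ≪⊗≫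
      n.ξ (F.obj a) :
      (n.ι ≫ G.map m.ι) ⊠ 𝟙 (G.obj (F.obj a)) ≫
          (n.μ (F.obj I) (F.obj a) ≫ G.map (m.μ I a)) ≫ G.map (F.map (lun a)) ≅
        lun (G.obj (F.obj a)))

end

end LaxMonoidalData

namespace BraidedLaxData

/-- The braided lax monoidal structure of the identity 2-functor. -/
def id (K : Type u₁) [Bicategory.{w₁, v₁} K] [BraidedMonoidalBicategory K] :
    BraidedLaxData (StrictPseudofunctor.id K) where
  toLaxMonoidalData := LaxMonoidalData.id K
  v a b := idSqV (brd a b)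

/-- The braided lax monoidal structure of a composite 2-functor. -/
def comp [BraidedMonoidalBicategory K] [BraidedMonoidalBicategory L] {M : Type u₃}
    [Bicategory.{w₃, v₃} M] [BraidedMonoidalBicategory M] {F : StrictPseudofunctor K L}
    {G : StrictPseudofunctor L M} (m : BraidedLaxData F) (n : BraidedLaxData G) :
    BraidedLaxData (F.comp G) where
  toLaxMonoidalData := m.toLaxMonoidalData.comp n.toLaxMonoidalData
  v a b := sqV (n.v (F.obj a) (F.obj b)) (mapSq G (m.v a b))

end BraidedLaxData

/-! ### Monoidal 2-natural transformations and 2-equivalences -/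

/-- A 2-natural transformation between 2-functors. -/
structure TwoNatTrans (F G : StrictPseudofunctor K L) where
  /-- The components. -/
  app (a : K) : F.obj a ⟶ G.obj a
  naturality {a b : K} (f : a ⟶ b) : F.map f ≫ app b = app a ≫ G.map f
  naturality₂ {a b : K} {f g : a ⟶ b} (σ : f ⟶ g) :
    F.map₂ σ ▷ app b ≫ eqToHom (naturality g) = eqToHom (naturality f) ≫ app a ◁ G.map₂ σ

namespace TwoNatTrans

variable {F G : StrictPseudofunctor K L}

/-- A 2-natural transformation whose components are isomorphisms. -/
def IsIso (τ : TwoNatTrans F G) : Prop :=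
  ∀ a : K, ∃ g : G.obj a ⟶ F.obj a, τ.app a ≫ g = 𝟙 (F.obj a) ∧ g ≫ τ.app a = 𝟙 (G.obj a)

/-- The naturality square of a 2-natural transformation. -/
def sq (τ : TwoNatTrans F G) {a b : K} (f : a ⟶ b) :
    τ.app a ≫ G.map f ≅ F.map f ≫ τ.app b :=
  eqToIso (τ.naturality f).symm

end TwoNatTrans

/-- The data of a monoidal 2-natural transformation. -/
structure MonoidalTransData [MonoidalBicategory K] [MonoidalBicategory L]
    {F G : StrictPseudofunctor K L} (τ : TwoNatTrans F G) (m : LaxMonoidalData F)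
    (n : LaxMonoidalData G) where
  /-- The compatibility with the comparisons of tensor products. -/
  u (a b : K) : τ.app a ⊠ τ.app b ≫ n.μ a b ≅ m.μ a b ≫ τ.app (a ⊠ₒ b)
  /-- The compatibility with the comparisons of units. -/
  u₀ : n.ι ≅ m.ι ≫ τ.app I

/-- A monoidal 2-natural transformation. -/
structure MonoidalTrans [MonoidalBicategory K] [MonoidalBicategory L]
    {F G : StrictPseudofunctor K L} (τ : TwoNatTrans F G) (m : LaxMonoidalData F)
    (n : LaxMonoidalData G) extends MonoidalTransData τ m n where
  u_modif {a a' b b' : K} (f : a ⟶ a') (g : b ⟶ b') :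
    IsCyl (sqV (tSq (τ.sq f).symm (τ.sq g).symm) (n.μNat f g))
      (sqV (m.μNat f g) (τ.sq (f ⊠ g)).symm) (u a b).hom (u a' b').hom
  assoc_compat (a b c : K) :
    IsCyl
      (sqV (tSq (u a b) (idSqV (τ.app c))) (sqV (u (a ⊠ₒ b) c) (τ.sq (asc a b c))))
      (sqV (assocNat (τ.app a) (τ.app b) (τ.app c))
        (sqV (tSq (idSqV (τ.app a)) (u b c)) (u a (b ⊠ₒ c))))
      (m.ω a b c).hom (n.ω a b c).hom
  right_unit_compat (a : K) :
    IsCyl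
      (sqV (tSq (idSqV (τ.app a)) (λ_ n.ι ≪≫ u₀)) (sqV (u a I) (τ.sq (run a))))
      (rUnitNat (τ.app a)) (m.ζ a).hom (n.ζ a).hom
  left_unit_compat (a : K) :
    IsCyl
      (sqV (tSq (λ_ n.ι ≪≫ u₀) (idSqV (τ.app a))) (sqV (u I a) (τ.sq (lun a))))
      (lUnitNat (τ.app a)) (m.ξ a).hom (n.ξ a).hom

/-- A braided monoidal 2-natural transformation. -/
structure BraidedTrans [BraidedMonoidalBicategory K] [BraidedMonoidalBicategory L]
    {F G : StrictPseudofunctor K L} (τ : TwoNatTrans F G) (m : BraidedLaxData F)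
    (n : BraidedLaxData G) extends
    MonoidalTrans τ m.toLaxMonoidalData n.toLaxMonoidalData where
  braid_compat (a b : K) :
    IsCyl (sqV (braidNat (τ.app a) (τ.app b)) (u b a)) (sqV (u a b) (τ.sq (brd a b)))
      (m.v a b).hom (n.v a b).hom

end Lax

/-- A 2-equivalence. -/
structure TwoEquivalence (K : Type u₁) [Bicategory.{w₁, v₁} K] (L : Type u₂)
    [Bicategory.{w₂, v₂} L] where
  /-- The 2-functor. -/
  functor : StrictPseudofunctor K L
  /-- The 2-functor in the opposite direction. -/
  inverse : StrictPseudofunctor L K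
  /-- The comparison of the identity of `K` with the composite. -/
  unit : TwoNatTrans (StrictPseudofunctor.id K) (functor.comp inverse)
  unit_isIso : unit.IsIso
  /-- The comparison of the composite with the identity of `L`. -/
  counit : TwoNatTrans (inverse.comp functor) (StrictPseudofunctor.id L)
  counit_isIso : counit.IsIso

/-- A monoidal 2-equivalence. -/
structure MonoidalTwoEquivalence (K : Type u₁) [Bicategory.{w₁, v₁} K] [MonoidalBicategory K]
    (L : Type u₂) [Bicategory.{w₂, v₂} L] [MonoidalBicategory L] extends
    TwoEquivalence K L where
  /-- The lax monoidal structure of the 2-functor. -/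
  functorLax : LaxMonoidal functor
  /-- The lax monoidal structure of the 2-functor in the opposite direction. -/
  inverseLax : LaxMonoidal inverse
  /-- The monoidal structure of the unit. -/
  unitMon : MonoidalTrans unit (LaxMonoidalData.id K)
    (functorLax.toLaxMonoidalData.comp inverseLax.toLaxMonoidalData)
  /-- The monoidal structure of the counit. -/
  counitMon : MonoidalTrans counit
    (inverseLax.toLaxMonoidalData.comp functorLax.toLaxMonoidalData) (LaxMonoidalData.id L)

/-- A braided monoidal 2-equivalence. -/
structure BraidedTwoEquivalence (K : Type u₁) [Bicategory.{w₁, v₁} K]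
    [BraidedMonoidalBicategory K] (L : Type u₂) [Bicategory.{w₂, v₂} L]
    [BraidedMonoidalBicategory L] extends TwoEquivalence K L where
  /-- The braided lax monoidal structure of the 2-functor. -/
  functorLax : BraidedLaxMonoidal functor
  /-- The braided lax monoidal structure of the 2-functor in the opposite direction. -/
  inverseLax : BraidedLaxMonoidal inverse
  /-- The braided monoidal structure of the unit. -/
  unitMon : BraidedTrans unit (BraidedLaxData.id K)
    (functorLax.toBraidedLaxData.comp inverseLax.toBraidedLaxData)
  /-- The braided monoidal structure of the counit. -/
  counitMon : BraidedTrans counit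
    (inverseLax.toBraidedLaxData.comp functorLax.toBraidedLaxData) (BraidedLaxData.id L)

/-- A symmetric monoidal 2-equivalence. -/
structure SymmetricTwoEquivalence (K : Type u₁) [Bicategory.{w₁, v₁} K]
    [SymmetricMonoidalBicategory K] (L : Type u₂) [Bicategory.{w₂, v₂} L]
    [SymmetricMonoidalBicategory L] extends TwoEquivalence K L where
  /-- The symmetric lax monoidal structure of the 2-functor. -/
  functorLax : SymmetricLaxMonoidal functor
  /-- The symmetric lax monoidal structure of the 2-functor in the opposite direction. -/
  inverseLax : SymmetricLaxMonoidal inverse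
  /-- The symmetric monoidal structure of the unit. -/
  unitMon : BraidedTrans unit (BraidedLaxData.id K)
    (functorLax.toBraidedLaxData.comp inverseLax.toBraidedLaxData)
  /-- The symmetric monoidal structure of the counit. -/
  counitMon : BraidedTrans counit
    (inverseLax.toBraidedLaxData.comp functorLax.toBraidedLaxData) (BraidedLaxData.id L)

/-! ### The induced 2-functors -/

section Induced

variable {K : Type u₁} [Bicategory.{w₁, v₁} K] {L : Type u₂} [Bicategory.{w₂, v₂} L]
  {F G : StrictPseudofunctor K L}

section

variable [MonoidalBicategory K] [MonoidalBicategory L]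

namespace LaxMonoidalData

/-- The image of a pseudomonoid under a lax monoidal 2-functor. -/
@[simps]
def mapObj (m : LaxMonoidalData F) (A : PsMonData K) : PsMonData L where
  X := F.obj A.X
  mul := m.μ A.X A.X ≫ F.map A.mul
  one := m.ι ≫ F.map A.one
  mulAssoc :=
    whiskerRightIso (wrComp (m.μ A.X A.X) (F.map A.mul) (F.obj A.X))
        (m.μ A.X A.X ≫ F.map A.mul) ≪⊗≫
      whiskerLeftIso (m.μ A.X A.X ⊠ 𝟙 (F.obj A.X))
        (whiskerRightIso (m.μL A.mul A.X) (F.map A.mul)) ≪⊗≫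
      whiskerLeftIso (m.μ A.X A.X ⊠ 𝟙 (F.obj A.X) ≫ m.μ (A.X ⊠ₒ A.X) A.X)
        ((F.mapComp (A.mul ⊠ 𝟙 A.X) A.mul).symm ≪≫ F.map₂Iso A.mulAssoc ≪≫
          mapComp₃ F (asc A.X A.X A.X) (𝟙 A.X ⊠ A.mul) A.mul) ≪⊗≫
      whiskerRightIso (m.ω A.X A.X A.X) (F.map (𝟙 A.X ⊠ A.mul) ≫ F.map A.mul) ≪⊗≫
      whiskerLeftIso (asc (F.obj A.X) (F.obj A.X) (F.obj A.X) ≫ 𝟙 (F.obj A.X) ⊠ m.μ A.X A.X)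
        (whiskerRightIso (m.μR A.X A.mul).symm (F.map A.mul)) ≪⊗≫
      whiskerLeftIso (asc (F.obj A.X) (F.obj A.X) (F.obj A.X))
        (whiskerRightIso (wlComp (F.obj A.X) (m.μ A.X A.X) (F.map A.mul)).symm
          (m.μ A.X A.X ≫ F.map A.mul))
  oneMul :=
    whiskerRightIso (wrComp m.ι (F.map A.one) (F.obj A.X)) (m.μ A.X A.X ≫ F.map A.mul) ≪⊗≫
      whiskerLeftIso (m.ι ⊠ 𝟙 (F.obj A.X))
        (whiskerRightIso (m.μL A.one A.X) (F.map A.mul)) ≪⊗≫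
      whiskerLeftIso (m.ι ⊠ 𝟙 (F.obj A.X) ≫ m.μ I A.X)
        ((F.mapComp (A.one ⊠ 𝟙 A.X) A.mul).symm ≪≫ F.map₂Iso A.oneMul) ≪⊗≫
      m.ξ A.X
  mulOne :=
    whiskerRightIso (wlComp (F.obj A.X) m.ι (F.map A.one)) (m.μ A.X A.X ≫ F.map A.mul) ≪⊗≫
      whiskerLeftIso (𝟙 (F.obj A.X) ⊠ m.ι)
        (whiskerRightIso (m.μR A.X A.one) (F.map A.mul)) ≪⊗≫
      whiskerLeftIso (𝟙 (F.obj A.X) ⊠ m.ι ≫ m.μ A.X I)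
        ((F.mapComp (𝟙 A.X ⊠ A.one) A.mul).symm ≪≫ F.map₂Iso A.mulOne) ≪⊗≫
      m.ζ A.X

/-- The image of a strong morphism under a lax monoidal 2-functor. -/
@[simps]
def mapMor (m : LaxMonoidalData F) {A B : PsMonData K} (f : StrongMorData A B) :
    StrongMorData (m.mapObj A) (m.mapObj B) where
  f := F.map f.f
  φ := sqV (m.μNat f.f f.f) (mapSq F f.φ)
  φ₀ := whiskerLeftIso m.ι (F.map₂Iso f.φ₀ ≪≫ F.mapComp A.one f.f) ≪≫ (α_ _ _ _).symm

end LaxMonoidalData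

/-- The component of a monoidal 2-natural transformation at a pseudomonoid. -/
@[simps]
def MonoidalTransData.component {τ : TwoNatTrans F G} {m : LaxMonoidalData F}
    {n : LaxMonoidalData G} (t : MonoidalTransData τ m n) (A : PsMonData K) :
    StrongMorData (m.mapObj A) (n.mapObj A) where
  f := τ.app A.X
  φ := sqV (t.u A.X A.X) (τ.sq A.mul)
  φ₀ := whiskerRightIso t.u₀ (G.map A.one) ≪≫ α_ _ _ _ ≪≫
    whiskerLeftIso m.ι (τ.sq A.one) ≪≫ (α_ _ _ _).symm

/-- Strong morphisms with equal underlying data. -/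
structure StrongMorData.Agrees {A B A' B' : PsMonData K} (f : StrongMorData A B)
    (g : StrongMorData A' B') : Prop where
  f_heq : HEq f.f g.f
  φ_heq : HEq f.φ g.φ
  φ₀_heq : HEq f.φ₀ g.φ₀

/-- The 2-functor `P` between 2-categories of pseudomonoids is given by the 2-functor `F` with the
lax monoidal structure `m`. -/
structure LaxMonoidalData.Lifts (m : LaxMonoidalData F)
    (P : StrictPseudofunctor (PsMon K) (PsMon L)) : Prop where
  obj_eq (A : PsMon K) : (P.obj A).toPsMonData = m.mapObj A.toPsMonData
  map_agrees {A B : PsMon K} (f : A ⟶ B) :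
    (P.map f).toStrongMorData.Agrees (m.mapMor f.toStrongMorData)
  map₂_heq {A B : PsMon K} {f g : A ⟶ B} (σ : f ⟶ g) :
    HEq (PsMonCell.hom (P.map₂ σ)) (F.map₂ (PsMonCell.hom σ))

/-- The 2-equivalence `P` between 2-categories of pseudomonoids is induced by the monoidal
2-equivalence `E`. -/
structure MonoidalTwoEquivalence.Induces (E : MonoidalTwoEquivalence K L)
    (P : TwoEquivalence (PsMon K) (PsMon L)) : Prop where
  functor_lifts : E.functorLax.toLaxMonoidalData.Lifts P.functor
  inverse_lifts : E.inverseLax.toLaxMonoidalData.Lifts P.inverse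
  unit_agrees (A : PsMon K) :
    (StrongMor.toStrongMorData (P.unit.app A)).Agrees
      (E.unitMon.toMonoidalTransData.component A.toPsMonData)
  counit_agrees (A : PsMon L) :
    (StrongMor.toStrongMorData (P.counit.app A)).Agrees
      (E.counitMon.toMonoidalTransData.component A.toPsMonData)

end

section

variable [BraidedMonoidalBicategory K] [BraidedMonoidalBicategory L]

/-- The image of a braided pseudomonoid under a braided lax monoidal 2-functor. -/
@[simps!]
def BraidedLaxData.mapBrObj (m : BraidedLaxData F) (A : BrPsMonData K) : BrPsMonData L where
  toPsMonData := m.toLaxMonoidalData.mapObj A.toPsMonData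
  γ := (α_ _ _ _).symm ≪≫ whiskerRightIso (m.v A.X A.X) (F.map A.mul) ≪≫ α_ _ _ _ ≪≫
    whiskerLeftIso (m.μ A.X A.X) ((F.mapComp (brd A.X A.X) A.mul).symm ≪≫ F.map₂Iso A.γ)

/-- The 2-functor `P` between 2-categories of braided pseudomonoids is given by the 2-functor `F`
with the braided lax monoidal structure `m`. -/
structure BraidedLaxData.Lifts (m : BraidedLaxData F)
    (P : StrictPseudofunctor (BrPsMon K) (BrPsMon L)) : Prop where
  obj_eq (A : BrPsMon K) : (P.obj A).toBrPsMonData = m.mapBrObj A.toBrPsMonData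
  map_agrees {A B : BrPsMon K} (f : A ⟶ B) :
    (P.map f).1.toStrongMorData.Agrees (m.toLaxMonoidalData.mapMor f.1.toStrongMorData)
  map₂_heq {A B : BrPsMon K} {f g : A ⟶ B} (σ : f ⟶ g) :
    HEq (PsMonCell.hom (P.map₂ σ)) (F.map₂ (PsMonCell.hom σ))

/-- The 2-equivalence `P` between 2-categories of braided pseudomonoids is induced by the braided
monoidal 2-equivalence `E`. -/
structure BraidedTwoEquivalence.Induces (E : BraidedTwoEquivalence K L)
    (P : TwoEquivalence (BrPsMon K) (BrPsMon L)) : Prop where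
  functor_lifts : E.functorLax.toBraidedLaxData.Lifts P.functor
  inverse_lifts : E.inverseLax.toBraidedLaxData.Lifts P.inverse
  unit_agrees (A : BrPsMon K) :
    (StrongMor.toStrongMorData (P.unit.app A).1).Agrees
      (E.unitMon.toMonoidalTransData.component A.toPsMonData)
  counit_agrees (A : BrPsMon L) :
    (StrongMor.toStrongMorData (P.counit.app A).1).Agrees
      (E.counitMon.toMonoidalTransData.component A.toPsMonData)

end

section

variable [SymmetricMonoidalBicategory K] [SymmetricMonoidalBicategory L]

/-- The 2-functor `P` between 2-categories of symmetric pseudomonoids is given by the 2-functor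
`F` with the braided lax monoidal structure `m`. -/
structure BraidedLaxData.SymLifts (m : BraidedLaxData F)
    (P : StrictPseudofunctor (SymPsMon K) (SymPsMon L)) : Prop where
  obj_eq (A : SymPsMon K) : (P.obj A).toBrPsMonData = m.mapBrObj A.toBrPsMonData
  map_agrees {A B : SymPsMon K} (f : A ⟶ B) :
    (P.map f).1.toStrongMorData.Agrees (m.toLaxMonoidalData.mapMor f.1.toStrongMorData)
  map₂_heq {A B : SymPsMon K} {f g : A ⟶ B} (σ : f ⟶ g) :
    HEq (PsMonCell.hom (P.map₂ σ)) (F.map₂ (PsMonCell.hom σ))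

/-- The 2-equivalence `P` between 2-categories of symmetric pseudomonoids is induced by the
symmetric monoidal 2-equivalence `E`. -/
structure SymmetricTwoEquivalence.Induces (E : SymmetricTwoEquivalence K L)
    (P : TwoEquivalence (SymPsMon K) (SymPsMon L)) : Prop where
  functor_lifts : E.functorLax.toBraidedLaxData.SymLifts P.functor
  inverse_lifts : E.inverseLax.toBraidedLaxData.SymLifts P.inverse
  unit_agrees (A : SymPsMon K) :
    (StrongMor.toStrongMorData (P.unit.app A).1).Agrees
      (E.unitMon.toMonoidalTransData.component A.toPsMonData)
  counit_agrees (A : SymPsMon L) :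
    (StrongMor.toStrongMorData (P.counit.app A).1).Agrees
      (E.counitMon.toMonoidalTransData.component A.toPsMonData)

end

end Induced

end MonTwoCat

open MonTwoCat

set_option linter.unusedSectionVars false

namespace MonTwoCat

open TensorBicategory UnitalTensorBicategory HexagonBicategory MonoidalBicategory

section Tails

variable {B : Type u₁} [Bicategory.{w₁, v₁} B]

/-- A 2-cell `f ≅ u ≫ g` applied to a 1-cell. -/
def tl12 {a b c z : B} {f : a ⟶ c} {u : a ⟶ b} {g : b ⟶ c} (s : f ≅ u ≫ g) (k : c ⟶ z) :
    f ≫ k ≅ u ≫ g ≫ k :=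
  whiskerRightIso s k ≪≫ α_ u g k

/-- A 2-cell `u ≫ g ≅ f` applied to a 1-cell. -/
def tl21 {a b c z : B} {f : a ⟶ c} {u : a ⟶ b} {g : b ⟶ c} (s : u ≫ g ≅ f) (k : c ⟶ z) :
    u ≫ g ≫ k ≅ f ≫ k :=
  (α_ u g k).symm ≪≫ whiskerRightIso s k

/-- A square applied to a 1-cell. -/
def tl22 {a b a' b' z : B} {f : a ⟶ a'} {g : b ⟶ b'} {u : a ⟶ b} {v : a' ⟶ b'}
    (s : f ≫ v ≅ u ≫ g) (k : b' ⟶ z) : f ≫ v ≫ k ≅ u ≫ g ≫ k :=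
  (α_ f v k).symm ≪≫ whiskerRightIso s k ≪≫ α_ u g k

/-- A 2-cell from a twofold to a threefold composite applied to a 1-cell. -/
def tl23 {a b b' c' d z : B} {f : a ⟶ b} {g : b ⟶ d} {f' : a ⟶ b'} {g' : b' ⟶ c'}
    {h' : c' ⟶ d} (s : f ≫ g ≅ f' ≫ g' ≫ h') (k : d ⟶ z) :
    f ≫ g ≫ k ≅ f' ≫ g' ≫ h' ≫ k :=
  (α_ f g k).symm ≪≫ whiskerRightIso s k ≪≫ α_ f' (g' ≫ h') k ≪≫ whiskerLeftIso f' (α_ g' h' k)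

/-- A 2-cell between threefold composites applied to a 1-cell. -/
def tl33 {a b c b' c' d z : B} {f : a ⟶ b} {g : b ⟶ c} {h : c ⟶ d} {f' : a ⟶ b'} {g' : b' ⟶ c'}
    {h' : c' ⟶ d} (s : f ≫ g ≫ h ≅ f' ≫ g' ≫ h') (k : d ⟶ z) :
    f ≫ g ≫ h ≫ k ≅ f' ≫ g' ≫ h' ≫ k :=
  whiskerLeftIso f (α_ g h k).symm ≪≫ (α_ f (g ≫ h) k).symm ≪≫ whiskerRightIso s k ≪≫
    α_ f' (g' ≫ h') k ≪≫ whiskerLeftIso f' (α_ g' h' k)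

/-- A 2-cell from a threefold to a twofold composite applied to a 1-cell. -/
def tl32 {a b c b' d z : B} {f : a ⟶ b} {g : b ⟶ c} {h : c ⟶ d} {f' : a ⟶ b'} {g' : b' ⟶ d}
    (s : f ≫ g ≫ h ≅ f' ≫ g') (k : d ⟶ z) :
    f ≫ g ≫ h ≫ k ≅ f' ≫ g' ≫ k :=
  whiskerLeftIso f (α_ g h k).symm ≪≫ (α_ f (g ≫ h) k).symm ≪≫ whiskerRightIso s k ≪≫
    α_ f' g' k

/-- A 2-cell from a threefold composite to a 1-cell, applied to a 1-cell. -/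
def tl31 {a b c d z : B} {f : a ⟶ b} {g : b ⟶ c} {h : c ⟶ d} {f' : a ⟶ d}
    (s : f ≫ g ≫ h ≅ f') (k : d ⟶ z) : f ≫ g ≫ h ≫ k ≅ f' ≫ k :=
  whiskerLeftIso f (α_ g h k).symm ≪≫ (α_ f (g ≫ h) k).symm ≪≫ whiskerRightIso s k

section Nat

variable {a b c b' c' d z : B} {f : a ⟶ b} {g : b ⟶ c} {h : c ⟶ d}
  {f' : a ⟶ b'} {g' : b' ⟶ c'} {h' : c' ⟶ d} {k k' : d ⟶ z}

theorem tl12_nat {p : a ⟶ d} {q : b ⟶ d} (s : p ≅ f ≫ q) (σ : k ⟶ k') :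
    p ◁ σ ≫ (tl12 s k').hom = (tl12 s k).hom ≫ f ◁ q ◁ σ := by
  have e := congrArg (fun x => 𝟙 _ ≫ x ≫ (α_ f q k').hom) (whisker_exchange s.hom σ)
  simp only [tl12, Iso.trans_hom, whiskerRightIso_hom]
  refine Eq.trans ?_ (e.trans ?_) <;> bicategory

theorem tl21_nat {p : a ⟶ d} {q : b ⟶ d} (s : f ≫ q ≅ p) (σ : k ⟶ k') :
    f ◁ q ◁ σ ≫ (tl21 s k').hom = (tl21 s k).hom ≫ p ◁ σ := by
  have e := congrArg (fun x => (α_ f q k).inv ≫ x ≫ 𝟙 _) (whisker_exchange s.hom σ)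
  simp only [tl21, Iso.trans_hom, Iso.symm_hom, whiskerRightIso_hom]
  refine Eq.trans ?_ (e.trans ?_) <;> bicategory

theorem tl22_nat {q : b ⟶ d} {q' : b' ⟶ d} (s : f ≫ q ≅ f' ≫ q') (σ : k ⟶ k') :
    f ◁ q ◁ σ ≫ (tl22 s k').hom = (tl22 s k).hom ≫ f' ◁ q' ◁ σ := by
  have e := congrArg (fun x => (α_ f q k).inv ≫ x ≫ (α_ f' q' k').hom) (whisker_exchange s.hom σ)
  simp only [tl22, Iso.trans_hom, Iso.symm_hom, whiskerRightIso_hom]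
  refine Eq.trans ?_ (e.trans ?_) <;> bicategory

theorem tl33_nat (s : f ≫ g ≫ h ≅ f' ≫ g' ≫ h') (σ : k ⟶ k') :
    f ◁ g ◁ h ◁ σ ≫ (tl33 s k').hom = (tl33 s k).hom ≫ f' ◁ g' ◁ h' ◁ σ := by
  have e := congrArg (fun x => (f ◁ (α_ g h k).inv ≫ (α_ f (g ≫ h) k).inv) ≫ x ≫ ((α_ f' (g' ≫ h') k').hom ≫ f' ◁ (α_ g' h' k').hom)) (whisker_exchange s.hom σ)
  simp only [tl33, Iso.trans_hom, Iso.symm_hom, whiskerRightIso_hom, whiskerLeftIso_hom]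
  refine Eq.trans ?_ (e.trans ?_) <;> bicategory

theorem tl32_nat {q' : b' ⟶ d} (s : f ≫ g ≫ h ≅ f' ≫ q') (σ : k ⟶ k') :
    f ◁ g ◁ h ◁ σ ≫ (tl32 s k').hom = (tl32 s k).hom ≫ f' ◁ q' ◁ σ := by
  have e := congrArg (fun x => (f ◁ (α_ g h k).inv ≫ (α_ f (g ≫ h) k).inv) ≫ x ≫ (α_ f' q' k').hom) (whisker_exchange s.hom σ)
  simp only [tl32, Iso.trans_hom, Iso.symm_hom, whiskerRightIso_hom, whiskerLeftIso_hom]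
  refine Eq.trans ?_ (e.trans ?_) <;> bicategory

end Nat

theorem IsNat.tl {a b a' b' z : B} {f f' : a ⟶ a'} {g g' : b ⟶ b'} {u : a ⟶ b} {v : a' ⟶ b'}
    {s : f ≫ v ≅ u ≫ g} {t : f' ≫ v ≅ u ≫ g'} {σ : f ⟶ f'} {σ' : g ⟶ g'} (H : IsNat s t σ σ')
    (k : b' ⟶ z) : σ ▷ (v ≫ k) ≫ (tl22 t k).hom = (tl22 s k).hom ≫ u ◁ σ' ▷ k := by
  have h := congrArg (fun x => (α_ f v k).inv ≫ x ▷ k ≫ (α_ u g' k).hom) H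
  simp only [tl22, Iso.trans_hom, Iso.symm_hom, whiskerRightIso_hom]
  refine Eq.trans ?_ (h.trans ?_) <;> bicategory

theorem IsNat.tl_comp {a b a' b' a'' b'' z : B} {F : a ⟶ a''} {G : b ⟶ b''} {f : a ⟶ a'}
    {f' : a' ⟶ a''} {g : b ⟶ b'} {g' : b' ⟶ b''} {u : a ⟶ b} {v : a' ⟶ b'} {w : a'' ⟶ b''}
    {S : F ≫ w ≅ u ≫ G} {s : f ≫ v ≅ u ≫ g} {t : f' ≫ w ≅ v ≫ g'} {σ : F ≅ f ≫ f'}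
    {σ' : G ≅ g ≫ g'} (H : IsNat S (sqH s t) σ.hom σ'.hom) (k : b'' ⟶ z) :
    (tl22 S k).hom ≫ u ◁ (tl12 σ' k).hom =
      (tl12 σ (w ≫ k)).hom ≫ f ◁ (tl22 t k).hom ≫ (tl22 s (g' ≫ k)).hom := by
  have h := congrArg (fun x => (α_ F w k).inv ≫ x ▷ k ≫ (α_ u (g ≫ g') k).hom ≫
    u ◁ (α_ g g' k).hom) H
  simp only [tl22, tl12, sqH, Iso.trans_hom, Iso.symm_hom, whiskerRightIso_hom,
    whiskerLeftIso_hom] at h ⊢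
  refine Eq.trans ?_ (h.symm.trans ?_) <;> bicategory

theorem isNat_idSqV {a b : B} {f f' : a ⟶ b} (σ : f ⟶ f') : IsNat (idSqV f) (idSqV f') σ σ := by
  simp [IsNat, idSqV]

theorem IsNat.sqV {a b c a' b' c' : B} {f f' : a ⟶ a'} {g g' : b ⟶ b'} {h h' : c ⟶ c'}
    {u : a ⟶ b} {u' : b ⟶ c} {v : a' ⟶ b'} {v' : b' ⟶ c'} {s : f ≫ v ≅ u ≫ g}
    {t : g ≫ v' ≅ u' ≫ h} {s' : f' ≫ v ≅ u ≫ g'} {t' : g' ≫ v' ≅ u' ≫ h'} {σ : f ⟶ f'}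
    {τ : g ⟶ g'} {υ : h ⟶ h'} (H : IsNat s s' σ τ) (H' : IsNat t t' τ υ) :
    IsNat (MonTwoCat.sqV s t) (MonTwoCat.sqV s' t') σ υ := by
  simp only [IsNat] at H H' ⊢
  have e := congrArg (fun x => (α_ f v v').inv ≫ x ▷ v' ≫ (α_ u g' v').hom ≫ u ◁ t'.hom ≫
    (α_ u u' h').inv) H
  have e' := congrArg (fun x => (α_ f v v').inv ≫ s.hom ▷ v' ≫ (α_ u g v').hom ≫ u ◁ x ≫
    (α_ u u' h').inv) H'
  simp only [MonTwoCat.sqV, Iso.trans_hom, Iso.symm_hom, whiskerRightIso_hom, whiskerLeftIso_hom]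
  refine Eq.trans ?_ (e.trans (Eq.trans ?_ (e'.trans ?_))) <;> bicategory

theorem IsCyl.of_isNat {a b a' b' : B} {f f' : a ⟶ a'} {g g' : b ⟶ b'} {u u' : a ⟶ b}
    {v v' : a' ⟶ b'} {s : f ≫ v ≅ u ≫ g} {t : f ≫ v' ≅ u' ≫ g} {s' : f' ≫ v ≅ u ≫ g'}
    {t' : f' ≫ v' ≅ u' ≫ g'} {θ : u ⟶ u'} {θ' : v ⟶ v'} (H : IsCyl s t θ θ') (e : f ≅ f')
    (e' : g ≅ g') (h : IsNat s s' e.hom e'.hom) (h' : IsNat t t' e.hom e'.hom) :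
    IsCyl s' t' θ θ' := by
  rw [IsNat.eq_conj e e' h, IsNat.eq_conj e e' h'] at H
  have := H.conj e.symm e'
  simpa [sqConj_conj, sqConj_refl] using this

end Tails

section Images

variable {B : Type u₁} [Bicategory.{w₁, v₁} B] {C : Type u₂} [Bicategory.{w₂, v₂} C]
  (P : Pseudofunctor B C)

theorem map₂_assocInv {a b c d : B} (f : a ⟶ b) (g : b ⟶ c) (h : c ⟶ d) :
    P.map₂ (α_ f g h).inv = (P.mapComp f (g ≫ h)).hom ≫ P.map f ◁ (P.mapComp g h).hom ≫
      (α_ (P.map f) (P.map g) (P.map h)).inv ≫ (P.mapComp f g).inv ▷ P.map h ≫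
        (P.mapComp (f ≫ g) h).inv := by
  rw [← cancel_epi (P.map₂Iso (α_ f g h)).hom, PrelaxFunctor.map₂Iso_hom, ← P.map₂_comp,
    Iso.hom_inv_id, P.map₂_id, P.map₂_associator]
  simp

/-- The image of a threefold composite. -/
def mc₃ {a b c d : B} (f : a ⟶ b) (g : b ⟶ c) (h : c ⟶ d) :
    P.map (f ≫ g ≫ h) ≅ P.map f ≫ P.map g ≫ P.map h :=
  P.mapComp f (g ≫ h) ≪≫ whiskerLeftIso (P.map f) (P.mapComp g h)

/-- The image of a fourfold composite. -/
def mc₄ {a b c d e : B} (f : a ⟶ b) (g : b ⟶ c) (h : c ⟶ d) (k : d ⟶ e) :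
    P.map (f ≫ g ≫ h ≫ k) ≅ P.map f ≫ P.map g ≫ P.map h ≫ P.map k :=
  P.mapComp f (g ≫ h ≫ k) ≪≫ whiskerLeftIso (P.map f) (mc₃ P g h k)

/-- The image of a 2-cell `f ≅ u ≫ g`. -/
def im12 {a b c : B} {f : a ⟶ c} {u : a ⟶ b} {g : b ⟶ c} (s : f ≅ u ≫ g) :
    P.map f ≅ P.map u ≫ P.map g :=
  P.map₂Iso s ≪≫ P.mapComp u g

/-- The image of a 2-cell `u ≫ g ≅ f`. -/
def im21 {a b c : B} {f : a ⟶ c} {u : a ⟶ b} {g : b ⟶ c} (s : u ≫ g ≅ f) :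
    P.map u ≫ P.map g ≅ P.map f :=
  (P.mapComp u g).symm ≪≫ P.map₂Iso s

/-- The image of a square. -/
def im22 {a b a' b' : B} {f : a ⟶ a'} {g : b ⟶ b'} {u : a ⟶ b} {v : a' ⟶ b'}
    (s : f ≫ v ≅ u ≫ g) : P.map f ≫ P.map v ≅ P.map u ≫ P.map g :=
  (P.mapComp f v).symm ≪≫ P.map₂Iso s ≪≫ P.mapComp u g

/-- The image of a 2-cell from a twofold to a threefold composite. -/
def im23 {a b b' c' d : B} {f : a ⟶ b} {g : b ⟶ d} {f' : a ⟶ b'} {g' : b' ⟶ c'}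
    {h' : c' ⟶ d} (s : f ≫ g ≅ f' ≫ g' ≫ h') :
    P.map f ≫ P.map g ≅ P.map f' ≫ P.map g' ≫ P.map h' :=
  (P.mapComp f g).symm ≪≫ P.map₂Iso s ≪≫ mc₃ P f' g' h'

/-- The image of a 2-cell between threefold composites. -/
def im33 {a b c b' c' d : B} {f : a ⟶ b} {g : b ⟶ c} {h : c ⟶ d} {f' : a ⟶ b'} {g' : b' ⟶ c'}
    {h' : c' ⟶ d} (s : f ≫ g ≫ h ≅ f' ≫ g' ≫ h') :
    P.map f ≫ P.map g ≫ P.map h ≅ P.map f' ≫ P.map g' ≫ P.map h' :=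
  (mc₃ P f g h).symm ≪≫ P.map₂Iso s ≪≫ mc₃ P f' g' h'

/-- The image of a 2-cell from a threefold to a twofold composite. -/
def im32 {a b c b' d : B} {f : a ⟶ b} {g : b ⟶ c} {h : c ⟶ d} {f' : a ⟶ b'} {g' : b' ⟶ d}
    (s : f ≫ g ≫ h ≅ f' ≫ g') : P.map f ≫ P.map g ≫ P.map h ≅ P.map f' ≫ P.map g' :=
  (mc₃ P f g h).symm ≪≫ P.map₂Iso s ≪≫ P.mapComp f' g'

/-- The image of a 2-cell from a threefold composite to a 1-cell. -/
def im31 {a b c d : B} {f : a ⟶ b} {g : b ⟶ c} {h : c ⟶ d} {f' : a ⟶ d}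
    (s : f ≫ g ≫ h ≅ f') : P.map f ≫ P.map g ≫ P.map h ≅ P.map f' :=
  (mc₃ P f g h).symm ≪≫ P.map₂Iso s

section

variable {a b c b' c' d z : B} {f : a ⟶ b} {g : b ⟶ c} {h : c ⟶ d}
  {f' : a ⟶ b'} {g' : b' ⟶ c'} {h' : c' ⟶ d}

theorem map₂_tl12 {p : a ⟶ d} {q : b ⟶ d} (s : p ≅ f ≫ q) (k : d ⟶ z) :
    P.map₂ (tl12 s k).hom =
      (P.mapComp p k).hom ≫ (tl12 (im12 P s) (P.map k)).hom ≫ (mc₃ P f q k).inv := by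
  simp [tl12, im12, mc₃]

theorem map₂_tl21 {p : a ⟶ d} {q : b ⟶ d} (s : f ≫ q ≅ p) (k : d ⟶ z) :
    P.map₂ (tl21 s k).hom =
      (mc₃ P f q k).hom ≫ (tl21 (im21 P s) (P.map k)).hom ≫ (P.mapComp p k).inv := by
  simp [tl21, im21, mc₃, map₂_assocInv P]

theorem map₂_tl22 {q : b ⟶ d} {q' : b' ⟶ d} (s : f ≫ q ≅ f' ≫ q') (k : d ⟶ z) :
    P.map₂ (tl22 s k).hom =
      (mc₃ P f q k).hom ≫ (tl22 (im22 P s) (P.map k)).hom ≫ (mc₃ P f' q' k).inv := by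
  simp [tl22, im22, mc₃, map₂_assocInv P]

theorem map₂_tl23 {q : b ⟶ d} (s : f ≫ q ≅ f' ≫ g' ≫ h') (k : d ⟶ z) :
    P.map₂ (tl23 s k).hom =
      (mc₃ P f q k).hom ≫ (tl23 (im23 P s) (P.map k)).hom ≫ (mc₄ P f' g' h' k).inv := by
  simp [tl23, im23, mc₃, mc₄, map₂_assocInv P]

theorem map₂_tl33 (s : f ≫ g ≫ h ≅ f' ≫ g' ≫ h') (k : d ⟶ z) :
    P.map₂ (tl33 s k).hom =
      (mc₄ P f g h k).hom ≫ (tl33 (im33 P s) (P.map k)).hom ≫ (mc₄ P f' g' h' k).inv := by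
  simp [tl33, im33, mc₃, mc₄, map₂_assocInv P]

theorem map₂_tl32 {q' : b' ⟶ d} (s : f ≫ g ≫ h ≅ f' ≫ q') (k : d ⟶ z) :
    P.map₂ (tl32 s k).hom =
      (mc₄ P f g h k).hom ≫ (tl32 (im32 P s) (P.map k)).hom ≫ (mc₃ P f' q' k).inv := by
  simp [tl32, im32, mc₃, mc₄, map₂_assocInv P]

end

end Images

section TensorPseudo

variable {K : Type u₁} [Bicategory.{w₁, v₁} K] [TensorBicategory K]

/-- Tensoring on the right with an object, as a pseudofunctor. -/
@[simps]
def tensR (z : K) : Pseudofunctor K K where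
  obj x := x ⊠ₒ z
  map f := f ⊠ 𝟙 z
  map₂ σ := σ ⊠₂ 𝟙 (𝟙 z)
  map₂_id f := tMap₂_id f (𝟙 z)
  map₂_comp σ τ := by rw [← tMap₂_comp, Category.comp_id]
  mapId x := tId x z
  mapComp f g := wrComp f g z
  map₂_whisker_left f g h η := by
    have e : (f ◁ η) ⊠₂ 𝟙 (𝟙 z) = 𝟙 (f ≫ g) ⊠₂ (λ_ (𝟙 z)).inv ≫ (f ◁ η) ⊠₂ (𝟙 z ◁ 𝟙 (𝟙 z)) ≫
        𝟙 (f ≫ h) ⊠₂ (λ_ (𝟙 z)).hom := by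
      simp only [← tMap₂_comp]; simp
    rw [e, tMap₂_whiskerLeft]
    simp [wrComp]
  map₂_whisker_right {_ _ _ f f'} η g := by
    have e : (η ▷ g) ⊠₂ 𝟙 (𝟙 z) = 𝟙 (f ≫ g) ⊠₂ (λ_ (𝟙 z)).inv ≫ (η ▷ g) ⊠₂ (𝟙 (𝟙 z) ▷ 𝟙 z) ≫
        𝟙 (f' ≫ g) ⊠₂ (λ_ (𝟙 z)).hom := by
      simp only [← tMap₂_comp]; simp
    rw [e, tMap₂_whiskerRight]
    simp [wrComp]
  map₂_associator f g h := by
    have e : (α_ f g h).hom ⊠₂ 𝟙 (𝟙 z) =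
        𝟙 ((f ≫ g) ≫ h) ⊠₂ (λ_ (𝟙 z)).inv ≫ (𝟙 (f ≫ g) ▷ h) ⊠₂ ((λ_ (𝟙 z)).inv ▷ 𝟙 z) ≫
        (α_ f g h).hom ⊠₂ (α_ (𝟙 z) (𝟙 z) (𝟙 z)).hom ≫
        (f ◁ 𝟙 (g ≫ h)) ⊠₂ (𝟙 z ◁ (λ_ (𝟙 z)).hom) ≫ 𝟙 (f ≫ g ≫ h) ⊠₂ (λ_ (𝟙 z)).hom := by
      simp only [← tMap₂_comp]
      congr 1
      · simp
      · bicategory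
    rw [e, tMap₂_whiskerLeft, tMap₂_whiskerRight, tMap₂_associator]
    simp [wrComp]
  map₂_left_unitor {x y} f := by
    have e : (λ_ f).hom ⊠₂ 𝟙 (𝟙 z) =
        𝟙 (𝟙 x ≫ f) ⊠₂ (λ_ (𝟙 z)).inv ≫ (λ_ f).hom ⊠₂ (λ_ (𝟙 z)).hom := by
      rw [← tMap₂_comp]; simp
    rw [e, tMap₂_leftUnitor]
    simp [wrComp]
  map₂_right_unitor {x y} f := by
    have e : (ρ_ f).hom ⊠₂ 𝟙 (𝟙 z) =
        𝟙 (f ≫ 𝟙 y) ⊠₂ (λ_ (𝟙 z)).inv ≫ (ρ_ f).hom ⊠₂ (ρ_ (𝟙 z)).hom := by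
      rw [← tMap₂_comp]; congr 1 <;> bicategory
    rw [e, tMap₂_rightUnitor]
    simp [wrComp]

/-- Tensoring on the left with an object, as a pseudofunctor. -/
@[simps]
def tensL (z : K) : Pseudofunctor K K where
  obj x := z ⊠ₒ x
  map f := 𝟙 z ⊠ f
  map₂ σ := 𝟙 (𝟙 z) ⊠₂ σ
  map₂_id f := tMap₂_id (𝟙 z) f
  map₂_comp σ τ := by rw [← tMap₂_comp, Category.comp_id]
  mapId x := tId z x
  mapComp f g := wlComp z f g
  map₂_whisker_left f g h η := by
    have e : 𝟙 (𝟙 z) ⊠₂ (f ◁ η) = (λ_ (𝟙 z)).inv ⊠₂ 𝟙 (f ≫ g) ≫ (𝟙 z ◁ 𝟙 (𝟙 z)) ⊠₂ (f ◁ η) ≫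
        (λ_ (𝟙 z)).hom ⊠₂ 𝟙 (f ≫ h) := by
      simp only [← tMap₂_comp]; simp
    rw [e, tMap₂_whiskerLeft]
    simp [wlComp]
  map₂_whisker_right {_ _ _ f f'} η g := by
    have e : 𝟙 (𝟙 z) ⊠₂ (η ▷ g) = (λ_ (𝟙 z)).inv ⊠₂ 𝟙 (f ≫ g) ≫ (𝟙 (𝟙 z) ▷ 𝟙 z) ⊠₂ (η ▷ g) ≫
        (λ_ (𝟙 z)).hom ⊠₂ 𝟙 (f' ≫ g) := by
      simp only [← tMap₂_comp]; simp
    rw [e, tMap₂_whiskerRight]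
    simp [wlComp]
  map₂_associator f g h := by
    have e : 𝟙 (𝟙 z) ⊠₂ (α_ f g h).hom =
        (λ_ (𝟙 z)).inv ⊠₂ 𝟙 ((f ≫ g) ≫ h) ≫ ((λ_ (𝟙 z)).inv ▷ 𝟙 z) ⊠₂ (𝟙 (f ≫ g) ▷ h) ≫
        (α_ (𝟙 z) (𝟙 z) (𝟙 z)).hom ⊠₂ (α_ f g h).hom ≫
        (𝟙 z ◁ (λ_ (𝟙 z)).hom) ⊠₂ (f ◁ 𝟙 (g ≫ h)) ≫ (λ_ (𝟙 z)).hom ⊠₂ 𝟙 (f ≫ g ≫ h) := by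
      simp only [← tMap₂_comp]
      congr 1
      · bicategory
      · simp
    rw [e, tMap₂_whiskerLeft, tMap₂_whiskerRight, tMap₂_associator]
    simp [wlComp]
  map₂_left_unitor {x y} f := by
    have e : 𝟙 (𝟙 z) ⊠₂ (λ_ f).hom =
        (λ_ (𝟙 z)).inv ⊠₂ 𝟙 (𝟙 x ≫ f) ≫ (λ_ (𝟙 z)).hom ⊠₂ (λ_ f).hom := by
      rw [← tMap₂_comp]; simp
    rw [e, tMap₂_leftUnitor]
    simp [wlComp]
  map₂_right_unitor {x y} f := by
    have e : 𝟙 (𝟙 z) ⊠₂ (ρ_ f).hom =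
        (λ_ (𝟙 z)).inv ⊠₂ 𝟙 (f ≫ 𝟙 y) ≫ (ρ_ (𝟙 z)).hom ⊠₂ (ρ_ f).hom := by
      rw [← tMap₂_comp]; congr 1 <;> bicategory
    rw [e, tMap₂_rightUnitor]
    simp [wlComp]

section

variable {a b a' b' c d c' d' : K} {f f' : a ⟶ a'} {g g' : b ⟶ b'} {u : a ⟶ b} {v : a' ⟶ b'}
  {h h' : c ⟶ c'} {k k' : d ⟶ d'} {s : c ⟶ d} {t : c' ⟶ d'}

theorem IsNat.tSq {p : f ≫ v ≅ u ≫ g} {p' : f' ≫ v ≅ u ≫ g'} {q : h ≫ t ≅ s ≫ k}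
    {q' : h' ≫ t ≅ s ≫ k'} {σ : f ⟶ f'} {σ' : g ⟶ g'} {τ : h ⟶ h'} {τ' : k ⟶ k'}
    (H : IsNat p p' σ σ') (H' : IsNat q q' τ τ') :
    IsNat (MonTwoCat.tSq p q) (MonTwoCat.tSq p' q') (σ ⊠₂ τ) (σ' ⊠₂ τ') := by
  simp only [IsNat] at H H' ⊢
  have e := congrArg₂ (fun x y => (tComp f h v t).inv ≫ x ⊠₂ y ≫ (tComp u s g' k').hom) H H'
  simp only [tMap₂_comp, tMap₂_whiskerLeft, tMap₂_whiskerRight] at e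
  simpa [MonTwoCat.tSq] using e

end

theorem xch_eq {x x' y y' : K} (f : x ⟶ x') (g : y ⟶ y') :
    xch f g = tSq (idSqV f) (idSqH g) := by
  ext
  simp [xch, tSq, idSqV, idSqH, tSplit, tSplit', tMap₂_comp]

theorem im22_tensR {a b a' b' : K} {f : a ⟶ a'} {g : b ⟶ b'} {u : a ⟶ b} {v : a' ⟶ b'}
    (s : f ≫ v ≅ u ≫ g) (z : K) : im22 (tensR z) s = tSq s (idSqV (𝟙 z)) := by
  ext
  change (wrComp f v z).inv ≫ s.hom ⊠₂ 𝟙 (𝟙 z) ≫ (wrComp u g z).hom =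
    (tComp f (𝟙 z) v (𝟙 z)).inv ≫ s.hom ⊠₂ (idSqV (𝟙 z)).hom ≫ (tComp u (𝟙 z) g (𝟙 z)).hom
  have e : s.hom ⊠₂ (idSqV (𝟙 z)).hom = 𝟙 (f ≫ v) ⊠₂ (λ_ (𝟙 z)).hom ≫ s.hom ⊠₂ (𝟙 (𝟙 z)) ≫
      𝟙 (u ≫ g) ⊠₂ (λ_ (𝟙 z)).inv := by
    simp only [← tMap₂_comp]; simp [idSqV, unitors_equal]
  rw [e]
  simp [wrComp]

theorem im22_tensL {a b a' b' : K} {f : a ⟶ a'} {g : b ⟶ b'} {u : a ⟶ b} {v : a' ⟶ b'}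
    (s : f ≫ v ≅ u ≫ g) (z : K) : im22 (tensL z) s = tSq (idSqV (𝟙 z)) s := by
  ext
  change (wlComp z f v).inv ≫ 𝟙 (𝟙 z) ⊠₂ s.hom ≫ (wlComp z u g).hom =
    (tComp (𝟙 z) f (𝟙 z) v).inv ≫ (idSqV (𝟙 z)).hom ⊠₂ s.hom ≫ (tComp (𝟙 z) u (𝟙 z) g).hom
  have e : (idSqV (𝟙 z)).hom ⊠₂ s.hom = (λ_ (𝟙 z)).hom ⊠₂ 𝟙 (f ≫ v) ≫ (𝟙 (𝟙 z)) ⊠₂ s.hom ≫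
      (λ_ (𝟙 z)).inv ⊠₂ 𝟙 (u ≫ g) := by
    simp only [← tMap₂_comp]; simp [idSqV, unitors_equal]
  rw [e]
  simp [wlComp]

end TensorPseudo

section Cyl

variable {B : Type u₁} [Bicategory.{w₁, v₁} B]

theorem IsCyl.tl_comp {a b c a' b' c' z : B} {f : a ⟶ a'} {g : b ⟶ b'} {h : c ⟶ c'} {u : a ⟶ b}
    {u' : b ⟶ c} {v : a' ⟶ b'} {v' : b' ⟶ c'} {U : a ⟶ c} {V : a' ⟶ c'}
    {S : f ≫ V ≅ U ≫ h} {s : f ≫ v ≅ u ≫ g} {t : g ≫ v' ≅ u' ≫ h} {σ : U ≅ u ≫ u'}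
    {σ' : V ≅ v ≫ v'} (H : IsCyl S (sqV s t) σ.hom σ'.hom) (k : c' ⟶ z) :
    f ◁ (tl12 σ' k).hom ≫ (tl22 s (v' ≫ k)).hom ≫ u ◁ (tl22 t k).hom =
      (tl22 S k).hom ≫ (tl12 σ (h ≫ k)).hom := by
  have h := congrArg (fun x => (α_ f V k).inv ≫ x ▷ k ≫ (α_ (u ≫ u') h k).hom ≫
    (α_ u u' (h ≫ k)).hom) H
  simp only [tl22, tl12, sqV, Iso.trans_hom, Iso.symm_hom, whiskerRightIso_hom,
    whiskerLeftIso_hom] at h ⊢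
  refine Eq.trans ?_ (h.trans ?_) <;> bicategory

theorem IsCyl.comp {a b a' b' : B} {f : a ⟶ a'} {g : b ⟶ b'} {u u' u'' : a ⟶ b}
    {v v' v'' : a' ⟶ b'} {r : f ≫ v ≅ u ≫ g} {s : f ≫ v' ≅ u' ≫ g} {t : f ≫ v'' ≅ u'' ≫ g}
    {θ : u ⟶ u'} {θ' : v ⟶ v'} {κ : u' ⟶ u''} {κ' : v' ⟶ v''} (h : IsCyl r s θ θ')
    (h' : IsCyl s t κ κ') : IsCyl r t (θ ≫ κ) (θ' ≫ κ') := by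
  simp only [IsCyl, whiskerLeft_comp, comp_whiskerRight, Category.assoc] at h h' ⊢
  rw [h', reassoc_of% h]

end Cyl

section

variable {K : Type u₁} [Bicategory.{w₁, v₁} K] [TensorBicategory K]

theorem im12_tensR_hom {a b c : K} {f : a ⟶ c} {u : a ⟶ b} {g : b ⟶ c} (s : f ≅ u ≫ g)
    (z : K) : (im12 (tensR z) s).hom = s.hom ⊠₂ 𝟙 (𝟙 z) ≫ (wrComp u g z).hom := rfl

theorem im12_tensL_hom {a b c : K} {f : a ⟶ c} {u : a ⟶ b} {g : b ⟶ c} (s : f ≅ u ≫ g)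
    (z : K) : (im12 (tensL z) s).hom = 𝟙 (𝟙 z) ⊠₂ s.hom ≫ (wlComp z u g).hom := rfl

theorem tComp_nat {x x' x'' y y' y'' : K} {f h : x ⟶ x'} {g k : x' ⟶ x''} {f' h' : y ⟶ y'}
    {g' k' : y' ⟶ y''} (σ : f ⟶ h) (τ : g ⟶ k) (σ' : f' ⟶ h') (τ' : g' ⟶ k') :
    (σ ▷ g ≫ h ◁ τ) ⊠₂ (σ' ▷ g' ≫ h' ◁ τ') ≫ (tComp h h' k k').hom =
      (tComp f f' g g').hom ≫ σ ⊠₂ σ' ▷ g ⊠ g' ≫ h ⊠ h' ◁ τ ⊠₂ τ' := by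
  simp [tMap₂_comp, tMap₂_whiskerLeft, tMap₂_whiskerRight]

theorem IsCyl.tSq {a b a' b' c d c' d' : K} {f : a ⟶ a'} {g : b ⟶ b'} {u u' : a ⟶ b}
    {v v' : a' ⟶ b'} {h : c ⟶ c'} {k : d ⟶ d'} {w w' : c ⟶ d} {x x' : c' ⟶ d'}
    {s : f ≫ v ≅ u ≫ g} {t : f ≫ v' ≅ u' ≫ g} {θ : u ⟶ u'} {θ' : v ⟶ v'}
    {p : h ≫ x ≅ w ≫ k} {q : h ≫ x' ≅ w' ≫ k} {κ : w ⟶ w'} {κ' : x ⟶ x'}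
    (H : IsCyl s t θ θ') (H' : IsCyl p q κ κ') :
    IsCyl (MonTwoCat.tSq s p) (MonTwoCat.tSq t q) (θ ⊠₂ κ) (θ' ⊠₂ κ') := by
  simp only [IsCyl] at H H' ⊢
  have e := congrArg₂ (fun x y => (tComp _ _ _ _).inv ≫ x ⊠₂ y ≫ (tComp _ _ _ _).hom) H H'
  simp only [tMap₂_comp, tMap₂_whiskerLeft, tMap₂_whiskerRight] at e
  simpa [MonTwoCat.tSq] using e

theorem tId_comp_inner (y z : K) :
    (tId y z).inv ≫ (λ_ (𝟙 y)).inv ⊠₂ (λ_ (𝟙 z)).inv ≫ (tComp (𝟙 y) (𝟙 z) (𝟙 y) (𝟙 z)).hom ≫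
      (tId y z).hom ▷ (𝟙 y ⊠ 𝟙 z) ≫ 𝟙 (y ⊠ₒ z) ◁ (tId y z).hom = (λ_ (𝟙 (y ⊠ₒ z))).inv := by
  have h := congrArg (fun t => (λ_ (𝟙 y)).inv ⊠₂ (λ_ (𝟙 z)).inv ≫ t) (tMap₂_leftUnitor (𝟙 y) (𝟙 z))
  simp only [← tMap₂_comp, Iso.inv_hom_id, tMap₂_id] at h
  rw [← cancel_epi (tId y z).hom, Iso.hom_inv_id_assoc, ← cancel_mono (λ_ (𝟙 (y ⊠ₒ z))).hom]
  have h2 := congrArg (fun t => t ≫ (tId y z).hom) h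
  simp only [Category.assoc, Category.id_comp] at h2 ⊢
  rw [Iso.inv_hom_id, Category.comp_id]
  refine Eq.trans ?_ h2.symm
  simp

theorem wrComp_inner {x x' x'' y z : K} (f : x ⟶ x') (f' : x' ⟶ x'') :
    𝟙 (f ≫ f') ⊠₂ (tId y z).inv ≫ 𝟙 (f ≫ f') ⊠₂ ((λ_ (𝟙 y)).inv ⊠₂ (λ_ (𝟙 z)).inv) ≫
      𝟙 (f ≫ f') ⊠₂ (tComp (𝟙 y) (𝟙 z) (𝟙 y) (𝟙 z)).hom ≫
      (tComp f (𝟙 y ⊠ 𝟙 z) f' (𝟙 y ⊠ 𝟙 z)).hom ≫ 𝟙 f ⊠₂ (tId y z).hom ▷ _ ≫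
      _ ◁ 𝟙 f' ⊠₂ (tId y z).hom = (wrComp f f' (y ⊠ₒ z)).hom := by
  have e := tComp_nat (𝟙 f) (𝟙 f') (tId y z).hom (tId y z).hom
  rw [← e, wrComp, Iso.trans_hom, tIso_hom, Iso.symm_hom, Iso.refl_hom, ← tId_comp_inner]
  simp only [← Category.assoc, ← tMap₂_comp]
  simp

theorem wlComp_inner {x x' x'' y z : K} (f : x ⟶ x') (f' : x' ⟶ x'') :
    (tId y z).inv ⊠₂ 𝟙 (f ≫ f') ≫ ((λ_ (𝟙 y)).inv ⊠₂ (λ_ (𝟙 z)).inv) ⊠₂ 𝟙 (f ≫ f') ≫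
      (tComp (𝟙 y) (𝟙 z) (𝟙 y) (𝟙 z)).hom ⊠₂ 𝟙 (f ≫ f') ≫
      (tComp (𝟙 y ⊠ 𝟙 z) f (𝟙 y ⊠ 𝟙 z) f').hom ≫ (tId y z).hom ⊠₂ 𝟙 f ▷ _ ≫
      _ ◁ (tId y z).hom ⊠₂ 𝟙 f' = (wlComp (y ⊠ₒ z) f f').hom := by
  have e := tComp_nat (tId y z).hom (tId y z).hom (𝟙 f) (𝟙 f')
  rw [← e, wlComp, Iso.trans_hom, tIso_hom, Iso.symm_hom, Iso.refl_hom, ← tId_comp_inner]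
  simp only [← Category.assoc, ← tMap₂_comp]
  simp

theorem xch_comp_left {x x' x'' y y' : K} (f : x ⟶ x') (f' : x' ⟶ x'') (g : y ⟶ y') :
    IsNat (xch (f ≫ f') g) (sqH (xch f g) (xch f' g)) (wrComp f f' y).hom
      (wrComp f f' y').hom := by
  have e : IsNat (sqH (idSqH g) (idSqH g)) (idSqH g) (λ_ (𝟙 y)).hom (λ_ (𝟙 y')).hom :=
    isNat_leftUnitor _
  have h : IsNat (tSq (idSqV (f ≫ f')) (idSqH g))
      (tSq (sqH (idSqV f) (idSqV f')) (sqH (idSqH g) (idSqH g)))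
      (𝟙 _ ⊠₂ (λ_ (𝟙 y)).inv) (𝟙 _ ⊠₂ (λ_ (𝟙 y')).inv) := by
    rw [idSqV_comp]
    exact (isNat_id _).tSq (e.symm (λ_ _) (λ_ _))
  rw [xch_eq, xch_eq, xch_eq]
  refine (h.comp ?_)
  rw [tSq_sqH]
  simpa using ((isNat_id (sqH (tSq (idSqV f) (idSqH g)) (tSq (idSqV f') (idSqH g)))).conj_left
    (tComp f (𝟙 y) f' (𝟙 y)) (tComp f (𝟙 y') f' (𝟙 y')).symm)

theorem tSq_sqV {a b c a' b' c' d e g d' e' g' : K} {f : a ⟶ a'} {h : b ⟶ b'} {k : c ⟶ c'}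
    {u : a ⟶ b} {u' : b ⟶ c} {v : a' ⟶ b'} {v' : b' ⟶ c'} {F : d ⟶ d'} {H : e ⟶ e'} {G : g ⟶ g'}
    {U : d ⟶ e} {U' : e ⟶ g} {V : d' ⟶ e'} {V' : e' ⟶ g'}
    (p : f ≫ v ≅ u ≫ h) (q : h ≫ v' ≅ u' ≫ k) (P : F ≫ V ≅ U ≫ H) (Q : H ≫ V' ≅ U' ≫ G) :
    IsCyl (tSq (sqV p q) (sqV P Q)) (sqV (tSq p P) (tSq q Q)) (tComp u U u' U').hom
      (tComp v V v' V').hom := by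
  simp [IsCyl, tSq, sqV, tMap₂_comp, tMap₂_associator, tMap₂_whiskerLeft, tMap₂_whiskerRight,
    tMap₂_associator_inv]

theorem xch_comp_right {x x' y y' y'' : K} (f : x ⟶ x') (g : y ⟶ y') (g' : y' ⟶ y'') :
    IsCyl (xch f (g ≫ g')) (sqV (xch f g) (xch f g')) (wlComp x g g').hom
      (wlComp x' g g').hom := by
  rw [xch_eq, xch_eq, xch_eq]
  have h := tSq_sqV (idSqV f) (idSqV f) (idSqH g) (idSqH g')
  rw [sqV_idSqH] at h
  have e1 : IsCyl (idSqV f) (sqV (idSqV f) (idSqV f)) (λ_ (𝟙 x)).inv (λ_ (𝟙 x')).inv := by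
    simp only [IsCyl, sqV, idSqV, Iso.trans_hom, Iso.symm_hom, whiskerRightIso_hom,
      whiskerLeftIso_hom]
    bicategory
  exact (e1.tSq (isCyl_idSqH (𝟙 (g ≫ g')))).comp h

end

section

variable {K : Type u₁} [Bicategory.{w₁, v₁} K] [UnitalTensorBicategory K]

theorem ascL_comp {x x' x'' : K} (f : x ⟶ x') (f' : x' ⟶ x'') (y z : K) :
    IsNat (ascL (f ≫ f') y z) (sqH (ascL f y z) (ascL f' y z))
      (im12 (tensR z) (wrComp f f' y)).hom (wrComp f f' (y ⊠ₒ z)).hom := by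
  have e {w w' : K} (k : w ⟶ w') : IsNat (assocNat k (𝟙 y) (𝟙 z)) (ascL k y z)
      (Iso.refl _).hom (Iso.refl k ⊠ᵢ tId y z).hom := by simp [IsNat, ascL]
  have h := assocNat_nat (𝟙 (f ≫ f')) (λ_ (𝟙 y)).inv (λ_ (𝟙 z)).inv
  have k := assocNat_comp f (𝟙 y) (𝟙 z) f' (𝟙 y) (𝟙 z)
  refine (((e (f ≫ f')).symm _ _).comp (h.comp (k.comp
    (((e f).sqH_right _).comp ((e f').sqH_left _))))).of_eq ?_ ?_
  · rw [im12_tensR_hom, wrComp, wrComp]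
    simp only [Iso.refl_inv, Iso.refl_hom, Iso.trans_hom, tIso_hom, Iso.symm_hom]
    simp only [← Category.assoc, ← tMap₂_comp]
    simp
  · simpa using wrComp_inner f f'

theorem ascM_comp (x : K) {y y' y'' : K} (g : y ⟶ y') (g' : y' ⟶ y'') (z : K) :
    IsNat (ascM x (g ≫ g') z) (sqH (ascM x g z) (ascM x g' z))
      (im12 (tensR z) (wlComp x g g')).hom (im12 (tensL x) (wrComp g g' z)).hom := by
  have h := assocNat_nat (λ_ (𝟙 x)).inv (𝟙 (g ≫ g')) (λ_ (𝟙 z)).inv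
  have k := assocNat_comp (𝟙 x) g (𝟙 z) (𝟙 x) g' (𝟙 z)
  refine (h.comp k).of_eq ?_ ?_
  · rw [im12_tensR_hom, wrComp, wlComp]
    simp only [Iso.refl_hom, Iso.trans_hom, tIso_hom, Iso.symm_hom]
    simp only [← Category.assoc, ← tMap₂_comp]
    simp
  · rw [im12_tensL_hom, wrComp, wlComp]
    simp only [Iso.refl_hom, Iso.trans_hom, tIso_hom, Iso.symm_hom]
    simp only [← Category.assoc, ← tMap₂_comp]
    simp

theorem ascR_comp (x y : K) {z z' z'' : K} (h : z ⟶ z') (h' : z' ⟶ z'') :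
    IsNat (ascR x y (h ≫ h')) (sqH (ascR x y h) (ascR x y h'))
      (wlComp (x ⊠ₒ y) h h').hom (im12 (tensL x) (wlComp y h h')).hom := by
  have e {w w' : K} (k : w ⟶ w') : IsNat (assocNat (𝟙 x) (𝟙 y) k) (ascR x y k)
      (tId x y ⊠ᵢ Iso.refl k).hom (Iso.refl _).hom := by
    simp [IsNat, ascR, ← comp_whiskerRight_assoc, ← tMap₂_comp, tMap₂_id]
  have n := assocNat_nat (λ_ (𝟙 x)).inv (λ_ (𝟙 y)).inv (𝟙 (h ≫ h'))
  have k := assocNat_comp (𝟙 x) (𝟙 y) h (𝟙 x) (𝟙 y) h'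
  refine (((e (h ≫ h')).symm _ _).comp (n.comp (k.comp
    (((e h).sqH_right _).comp ((e h').sqH_left _))))).of_eq ?_ ?_
  · simpa using wlComp_inner h h'
  · rw [im12_tensL_hom, wlComp, wlComp]
    simp only [Iso.refl_inv, Iso.refl_hom, Iso.trans_hom, tIso_hom, Iso.symm_hom]
    simp only [← Category.assoc, ← tMap₂_comp]
    simp

end

section

variable {K : Type u₁} [Bicategory.{w₁, v₁} K] [BraidedMonoidalBicategory K]

theorem braidNat_comp_left {x x' x'' : K} (f : x ⟶ x') (f' : x' ⟶ x'') (y : K) :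
    IsNat (braidNat (f ≫ f') (𝟙 y)) (sqH (braidNat f (𝟙 y)) (braidNat f' (𝟙 y)))
      (wrComp f f' y).hom (wlComp y f f').hom := by
  have h := braidNat_nat (𝟙 (f ≫ f')) (λ_ (𝟙 y)).inv
  refine (h.comp (braidNat_comp f (𝟙 y) f' (𝟙 y))).of_eq ?_ ?_
  · simp [wrComp]
  · simp [wlComp]

theorem braidNat_comp_right (x : K) {y y' y'' : K} (g : y ⟶ y') (g' : y' ⟶ y'') :
    IsNat (braidNat (𝟙 x) (g ≫ g')) (sqH (braidNat (𝟙 x) g) (braidNat (𝟙 x) g'))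
      (wlComp x g g').hom (wrComp g g' x).hom := by
  have h := braidNat_nat (λ_ (𝟙 x)).inv (𝟙 (g ≫ g'))
  refine (h.comp (braidNat_comp (𝟙 x) g (𝟙 x) g')).of_eq ?_ ?_
  · simp [wlComp]
  · simp [wrComp]

end

section PsNat

/-- A pseudonatural family, without the unit axiom. -/
structure PsNat {B : Type u₁} [Bicategory.{w₁, v₁} B] {C : Type u₂} [Bicategory.{w₂, v₂} C]
    (P Q : Pseudofunctor B C) where
  /-- The components. -/
  app (a : B) : P.obj a ⟶ Q.obj a
  /-- The pseudonaturality cells. -/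
  sq {a b : B} (f : a ⟶ b) : P.map f ≫ app b ≅ app a ≫ Q.map f
  sq_nat {a b : B} {f g : a ⟶ b} (σ : f ⟶ g) : IsNat (sq f) (sq g) (P.map₂ σ) (Q.map₂ σ)
  sq_comp {a b c : B} (f : a ⟶ b) (g : b ⟶ c) :
    IsNat (sq (f ≫ g)) (sqH (sq f) (sq g)) (P.mapComp f g).hom (Q.mapComp f g).hom

variable {B : Type u₁} [Bicategory.{w₁, v₁} B] {C : Type u₂} [Bicategory.{w₂, v₂} C]

theorem tMap₂_comp_rev {K : Type u₁} [Bicategory.{w₁, v₁} K] [TensorBicategory K]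
    {x x' y y' : K} {f f' f'' : x ⟶ x'} {g g' g'' : y ⟶ y'} (σ : f ⟶ f')
    (σ' : f' ⟶ f'') (τ : g ⟶ g') (τ' : g' ⟶ g'') :
    σ ⊠₂ τ ≫ σ' ⊠₂ τ' = (σ ≫ σ') ⊠₂ (τ ≫ τ') := (tMap₂_comp σ σ' τ τ').symm

theorem tl21_eq (P : Pseudofunctor B C) {a b c : B} {z : C} {f : a ⟶ c} {u : a ⟶ b} {g : b ⟶ c}
    (s : u ≫ g ≅ f) (k : P.obj c ⟶ z) :
    (tl21 (im21 P s) k).hom = (tl12 (P.mapComp u g) k).inv ≫ P.map₂ s.hom ▷ k := by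
  simp [tl21, im21, tl12]

theorem tl23_eq (P : Pseudofunctor B C) {a b b' c' d : B} {z : C} {f : a ⟶ b} {g : b ⟶ d}
    {f' : a ⟶ b'} {g' : b' ⟶ c'} {h' : c' ⟶ d} (s : f ≫ g ≅ f' ≫ g' ≫ h') (k : P.obj d ⟶ z) :
    (tl23 (im23 P s) k).hom = (tl12 (P.mapComp f g) k).inv ≫ P.map₂ s.hom ▷ k ≫
      (tl12 (P.mapComp f' (g' ≫ h')) k).hom ≫ P.map f' ◁ (tl12 (P.mapComp g' h') k).hom := by
  simp [tl23, im23, tl12, mc₃]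

namespace PsNat

variable {P Q : Pseudofunctor B C} (θ : PsNat P Q)

theorem tl_nat {a b : B} {f g : a ⟶ b} (σ : f ⟶ g) {z : C} (k : Q.obj b ⟶ z) :
    P.map₂ σ ▷ (θ.app b ≫ k) ≫ (tl22 (θ.sq g) k).hom =
      (tl22 (θ.sq f) k).hom ≫ θ.app a ◁ Q.map₂ σ ▷ k :=
  (θ.sq_nat σ).tl k

theorem tl_comp {a b c : B} (f : a ⟶ b) (g : b ⟶ c) {z : C} (k : Q.obj c ⟶ z) :
    (tl22 (θ.sq (f ≫ g)) k).hom ≫ θ.app a ◁ (tl12 (Q.mapComp f g) k).hom =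
      (tl12 (P.mapComp f g) (θ.app c ≫ k)).hom ≫ P.map f ◁ (tl22 (θ.sq g) k).hom ≫
        (tl22 (θ.sq f) (Q.map g ≫ k)).hom :=
  (θ.sq_comp f g).tl_comp k

theorem tl21_nat {a b c : B} {f : a ⟶ c} {u : a ⟶ b} {g : b ⟶ c} (s : u ≫ g ≅ f) {z : C}
    (k : Q.obj c ⟶ z) :
    P.map u ◁ (tl22 (θ.sq g) k).hom ≫ (tl22 (θ.sq u) (Q.map g ≫ k)).hom ≫
        θ.app a ◁ (tl21 (im21 Q s) k).hom =
      (tl21 (im21 P s) (θ.app c ≫ k)).hom ≫ (tl22 (θ.sq f) k).hom := by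
  rw [tl21_eq, tl21_eq, ← cancel_epi (tl12 (P.mapComp u g) (θ.app c ≫ k)).hom,
    whiskerLeft_comp, Category.assoc, Iso.hom_inv_id_assoc, θ.tl_nat,
    ← reassoc_of% (θ.tl_comp u g k), ← whiskerLeft_comp_assoc]
  simp

theorem tl23_nat {a b b' c' d : B} {f : a ⟶ b} {g : b ⟶ d} {f' : a ⟶ b'} {g' : b' ⟶ c'}
    {h' : c' ⟶ d} (s : f ≫ g ≅ f' ≫ g' ≫ h') {z : C} (k : Q.obj d ⟶ z) :
    P.map f ◁ (tl22 (θ.sq g) k).hom ≫ (tl22 (θ.sq f) (Q.map g ≫ k)).hom ≫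
        θ.app a ◁ (tl23 (im23 Q s) k).hom =
      (tl23 (im23 P s) (θ.app d ≫ k)).hom ≫ P.map f' ◁ P.map g' ◁ (tl22 (θ.sq h') k).hom ≫
        P.map f' ◁ (tl22 (θ.sq g') (Q.map h' ≫ k)).hom ≫
        (tl22 (θ.sq f') (Q.map g' ≫ Q.map h' ≫ k)).hom := by
  rw [tl23_eq, tl23_eq, ← cancel_epi (tl12 (P.mapComp f g) (θ.app d ≫ k)).hom]
  simp only [whiskerLeft_comp, Category.assoc, Iso.hom_inv_id_assoc]
  rw [← reassoc_of% (θ.tl_comp f g k)]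
  have e := congrArg (fun t => P.map f' ◁ t) (θ.tl_comp g' h' k)
  simp only [whiskerLeft_comp] at e
  rw [← reassoc_of% e, tl22_nat, ← reassoc_of% (θ.tl_comp f' (g' ≫ h') k),
    reassoc_of% (θ.tl_nat s.hom k), whiskerLeft_hom_inv_assoc]

end PsNat

theorem im21_comp {D : Type u₃} [Bicategory.{w₃, v₃} D] (P : Pseudofunctor B C)
    (Q : Pseudofunctor C D) {a b c : B} {f : a ⟶ c} {u : a ⟶ b} {g : b ⟶ c} (s : u ≫ g ≅ f) :
    im21 (P.comp Q) s = im21 Q (im21 P s) := by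
  ext
  change ((Q.mapComp (P.map u) (P.map g)).inv ≫ Q.map₂ (P.mapComp u g).inv) ≫
    Q.map₂ (P.map₂ s.hom) = (Q.mapComp (P.map u) (P.map g)).inv ≫
      Q.map₂ ((P.mapComp u g).inv ≫ P.map₂ s.hom)
  simp

theorem im22_comp {D : Type u₃} [Bicategory.{w₃, v₃} D] (P : Pseudofunctor B C)
    (Q : Pseudofunctor C D) {a b a' b' : B} {f : a ⟶ a'} {g : b ⟶ b'} {u : a ⟶ b} {v : a' ⟶ b'}
    (s : f ≫ v ≅ u ≫ g) : im22 (P.comp Q) s = im22 Q (im22 P s) := by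
  ext
  change ((Q.mapComp (P.map f) (P.map v)).inv ≫ Q.map₂ (P.mapComp f v).inv) ≫
    Q.map₂ (P.map₂ s.hom) ≫ Q.map₂ (P.mapComp u g).hom ≫ (Q.mapComp (P.map u) (P.map g)).hom =
    (Q.mapComp (P.map f) (P.map v)).inv ≫ Q.map₂ ((P.mapComp f v).inv ≫ P.map₂ s.hom ≫
      (P.mapComp u g).hom) ≫ (Q.mapComp (P.map u) (P.map g)).hom
  simp

theorem im23_comp {D : Type u₃} [Bicategory.{w₃, v₃} D] (P : Pseudofunctor B C)
    (Q : Pseudofunctor C D) {a b b' c' d : B} {f : a ⟶ b} {g : b ⟶ d}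
    {f' : a ⟶ b'} {g' : b' ⟶ c'} {h' : c' ⟶ d} (s : f ≫ g ≅ f' ≫ g' ≫ h') :
    im23 (P.comp Q) s = im23 Q (im23 P s) := by
  ext
  change ((Q.mapComp (P.map f) (P.map g)).inv ≫ Q.map₂ (P.mapComp f g).inv) ≫
    Q.map₂ (P.map₂ s.hom) ≫ (Q.map₂ (P.mapComp f' (g' ≫ h')).hom ≫
      (Q.mapComp (P.map f') (P.map (g' ≫ h'))).hom) ≫ Q.map (P.map f') ◁
        (Q.map₂ (P.mapComp g' h').hom ≫ (Q.mapComp (P.map g') (P.map h')).hom) =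
    (Q.mapComp (P.map f) (P.map g)).inv ≫ Q.map₂ ((P.mapComp f g).inv ≫ P.map₂ s.hom ≫
      (P.mapComp f' (g' ≫ h')).hom ≫ P.map f' ◁ (P.mapComp g' h').hom) ≫
      (Q.mapComp (P.map f') (P.map g' ≫ P.map h')).hom ≫
        Q.map (P.map f') ◁ (Q.mapComp (P.map g') (P.map h')).hom
  simp

end PsNat

section Lax

variable {K : Type u₁} [Bicategory.{w₁, v₁} K] {L : Type u₂} [Bicategory.{w₂, v₂} L]
  [MonoidalBicategory K] [MonoidalBicategory L] {F : StrictPseudofunctor K L}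

namespace LaxMonoidal

variable (m : LaxMonoidal F)

theorem isNat_μL {a a' : K} (f : a ⟶ a') (b : K) :
    IsNat (m.μNat f (𝟙 b)) (m.μL f b) (𝟙 (F.map f) ⊠₂ (F.mapId b).hom) (𝟙 _) := by
  simp [IsNat, LaxMonoidalData.μL, ← comp_whiskerRight_assoc, ← tMap₂_comp, tMap₂_id]

theorem isNat_μR (a : K) {b b' : K} (g : b ⟶ b') :
    IsNat (m.μNat (𝟙 a) g) (m.μR a g) ((F.mapId a).hom ⊠₂ 𝟙 (F.map g)) (𝟙 _) := by
  simp [IsNat, LaxMonoidalData.μR, ← comp_whiskerRight_assoc, ← tMap₂_comp, tMap₂_id]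

theorem mapId_unitor_inv {b : K} :
    (F.mapId b).inv ≫ F.map₂ (λ_ (𝟙 b)).inv ≫ (F.mapComp (𝟙 b) (𝟙 b)).hom ≫
      ((F.mapId b).hom ▷ F.map (𝟙 b) ≫ 𝟙 (F.obj b) ◁ (F.mapId b).hom) =
    (λ_ (𝟙 (F.obj b))).inv := by
  have := F.map₂_left_unitor (𝟙 b)
  rw [← cancel_mono (λ_ (𝟙 (F.obj b))).hom, ← cancel_epi (F.mapId b).hom, Iso.inv_hom_id,
    Category.comp_id]
  simp only [Category.assoc, Iso.hom_inv_id_assoc, leftUnitor_naturality]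
  rw [← Category.assoc, ← Category.assoc, ← Category.assoc]
  refine (Eq.trans ?_ (Category.id_comp _))
  congr 1
  rw [← F.map₂_id, ← Iso.inv_hom_id (λ_ (𝟙 b)), F.map₂_comp, this]
  simp

theorem μL_nat {a a' : K} {f g : a ⟶ a'} (σ : f ⟶ g) (b : K) :
    IsNat (m.μL f b) (m.μL g b) (F.map₂ σ ⊠₂ 𝟙 (𝟙 (F.obj b))) (F.map₂ (σ ⊠₂ 𝟙 (𝟙 b))) := by
  have h := m.μNat_nat σ (𝟙 (𝟙 b))
  refine ((((m.isNat_μL f b).symm (Iso.refl _ ⊠ᵢ F.mapId b) (Iso.refl _)).comp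
      (h.comp (m.isNat_μL g b)))).of_eq ?_ ?_
  · simp [← tMap₂_comp]
  · simp

theorem μR_nat (a : K) {b b' : K} {f g : b ⟶ b'} (σ : f ⟶ g) :
    IsNat (m.μR a f) (m.μR a g) (𝟙 (𝟙 (F.obj a)) ⊠₂ F.map₂ σ) (F.map₂ (𝟙 (𝟙 a) ⊠₂ σ)) := by
  have h := m.μNat_nat (𝟙 (𝟙 a)) σ
  refine ((((m.isNat_μR a f).symm (F.mapId a ⊠ᵢ Iso.refl _) (Iso.refl _)).comp
      (h.comp (m.isNat_μR a g)))).of_eq ?_ ?_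
  · simp [← tMap₂_comp]
  · simp

theorem μL_comp {a a' a'' : K} (f : a ⟶ a') (g : a' ⟶ a'') (b : K) :
    IsNat (m.μL (f ≫ g) b) (sqH (m.μL f b) (m.μL g b))
      (im12 (tensR (F.obj b)) (F.mapComp f g)).hom (im12 F.toPseudofunctor (wrComp f g b)).hom := by
  have h := m.μNat_nat (𝟙 (f ≫ g)) (λ_ (𝟙 b)).inv
  refine ((((m.isNat_μL (f ≫ g) b).symm (Iso.refl _ ⊠ᵢ F.mapId b) (Iso.refl _)).comp
      (h.comp ((m.μNat_comp f (𝟙 b) g (𝟙 b)).comp (((m.isNat_μL f b).sqH_right _).comp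
        ((m.isNat_μL g b).sqH_left _)))))).of_eq ?_ ?_
  · have e := tComp_nat (𝟙 (F.map f)) (𝟙 (F.map g)) (F.mapId b).hom (F.mapId b).hom
    rw [im12_tensR_hom, wrComp, Iso.trans_hom, tIso_hom, Iso.symm_hom, Iso.refl_hom,
      ← mapId_unitor_inv (F := F), reassoc_of% @tMap₂_comp_rev, Category.comp_id, Category.id_comp]
    have e' : (F.mapComp f g).hom ⊠₂ ((F.mapId b).inv ≫ F.map₂ (λ_ (𝟙 b)).inv ≫
        (F.mapComp (𝟙 b) (𝟙 b)).hom ≫ ((F.mapId b).hom ▷ F.map (𝟙 b) ≫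
          𝟙 (F.obj b) ◁ (F.mapId b).hom)) ≫
        (tComp (F.map f) (𝟙 (F.obj b)) (F.map g) (𝟙 (F.obj b))).hom =
        (F.mapComp f g).hom ⊠₂ ((F.mapId b).inv ≫ F.map₂ (λ_ (𝟙 b)).inv ≫
        (F.mapComp (𝟙 b) (𝟙 b)).hom) ≫ (𝟙 (F.map f) ▷ F.map g ≫ F.map f ◁ 𝟙 (F.map g)) ⊠₂
          ((F.mapId b).hom ▷ F.map (𝟙 b) ≫ 𝟙 (F.obj b) ◁ (F.mapId b).hom) ≫
        (tComp (F.map f) (𝟙 (F.obj b)) (F.map g) (𝟙 (F.obj b))).hom := by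
      rw [reassoc_of% @tMap₂_comp_rev]
      simp
    rw [e', e]
    simp only [Category.assoc, Iso.refl_inv, tIso_inv, F.map₂_id,
      Category.id_comp, reassoc_of% @tMap₂_comp_rev]
  · simp only [im12, Iso.trans_hom, PrelaxFunctor.map₂Iso_hom, wrComp, tIso_hom, Iso.refl_hom,
      Iso.symm_hom]
    simp

theorem μR_comp (a : K) {b b' b'' : K} (f : b ⟶ b') (g : b' ⟶ b'') :
    IsNat (m.μR a (f ≫ g)) (sqH (m.μR a f) (m.μR a g))
      (im12 (tensL (F.obj a)) (F.mapComp f g)).hom (im12 F.toPseudofunctor (wlComp a f g)).hom := by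
  have h := m.μNat_nat (λ_ (𝟙 a)).inv (𝟙 (f ≫ g))
  refine ((((m.isNat_μR a (f ≫ g)).symm (F.mapId a ⊠ᵢ Iso.refl _) (Iso.refl _)).comp
      (h.comp ((m.μNat_comp (𝟙 a) f (𝟙 a) g).comp (((m.isNat_μR a f).sqH_right _).comp
        ((m.isNat_μR a g).sqH_left _)))))).of_eq ?_ ?_
  · have e := tComp_nat (F.mapId a).hom (F.mapId a).hom (𝟙 (F.map f)) (𝟙 (F.map g))
    rw [im12_tensL_hom, wlComp, Iso.trans_hom, tIso_hom, Iso.symm_hom, Iso.refl_hom,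
      ← mapId_unitor_inv (F := F), reassoc_of% @tMap₂_comp_rev, Category.comp_id, Category.id_comp]
    have e' : ((F.mapId a).inv ≫ F.map₂ (λ_ (𝟙 a)).inv ≫
        (F.mapComp (𝟙 a) (𝟙 a)).hom ≫ ((F.mapId a).hom ▷ F.map (𝟙 a) ≫
          𝟙 (F.obj a) ◁ (F.mapId a).hom)) ⊠₂ (F.mapComp f g).hom ≫
        (tComp (𝟙 (F.obj a)) (F.map f) (𝟙 (F.obj a)) (F.map g)).hom =
        ((F.mapId a).inv ≫ F.map₂ (λ_ (𝟙 a)).inv ≫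
        (F.mapComp (𝟙 a) (𝟙 a)).hom) ⊠₂ (F.mapComp f g).hom ≫
        ((F.mapId a).hom ▷ F.map (𝟙 a) ≫ 𝟙 (F.obj a) ◁ (F.mapId a).hom) ⊠₂
          (𝟙 (F.map f) ▷ F.map g ≫ F.map f ◁ 𝟙 (F.map g)) ≫
        (tComp (𝟙 (F.obj a)) (F.map f) (𝟙 (F.obj a)) (F.map g)).hom := by
      rw [reassoc_of% @tMap₂_comp_rev]
      simp
    rw [e', e]
    simp only [Category.assoc, Iso.refl_inv, tIso_inv, F.map₂_id,
      Category.id_comp, reassoc_of% @tMap₂_comp_rev]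
  · simp only [im12, Iso.trans_hom, PrelaxFunctor.map₂Iso_hom, wlComp, tIso_hom, Iso.refl_hom,
      Iso.symm_hom]
    simp

/-- The pseudonatural family `μ` in its first variable. -/
def psNatL (b : K) : PsNat (F.toPseudofunctor.comp (tensR (F.obj b)))
    ((tensR b).comp F.toPseudofunctor) where
  app a := m.μ a b
  sq f := m.μL f b
  sq_nat σ := m.μL_nat σ b
  sq_comp f g := m.μL_comp f g b

/-- The pseudonatural family `μ` in its second variable. -/
def psNatR (a : K) : PsNat (F.toPseudofunctor.comp (tensL (F.obj a)))
    ((tensL a).comp F.toPseudofunctor) where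
  app b := m.μ a b
  sq g := m.μR a g
  sq_nat σ := m.μR_nat a σ
  sq_comp f g := m.μR_comp a f g

section

variable {a b c : K} {f : a ⟶ b} {g : b ⟶ c} {z : L}

theorem μL_tl21 {h : a ⟶ c} (s : f ≫ g ≅ h) (x : K) (k : F.obj (c ⊠ₒ x) ⟶ z) :
    F.map f ⊠ 𝟙 (F.obj x) ◁ (tl22 (m.μL g x) k).hom ≫
        (tl22 (m.μL f x) (F.map (g ⊠ 𝟙 x) ≫ k)).hom ≫
        m.μ a x ◁ (tl21 (im21 F.toPseudofunctor (im21 (tensR x) s)) k).hom =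
      (tl21 (im21 (tensR (F.obj x)) (im21 F.toPseudofunctor s)) (m.μ c x ≫ k)).hom ≫
        (tl22 (m.μL h x) k).hom := by
  have := (m.psNatL x).tl21_nat s k
  rw [im21_comp, im21_comp] at this
  exact this

theorem μR_tl21 {h : a ⟶ c} (s : f ≫ g ≅ h) (x : K) (k : F.obj (x ⊠ₒ c) ⟶ z) :
    𝟙 (F.obj x) ⊠ F.map f ◁ (tl22 (m.μR x g) k).hom ≫
        (tl22 (m.μR x f) (F.map (𝟙 x ⊠ g) ≫ k)).hom ≫
        m.μ x a ◁ (tl21 (im21 F.toPseudofunctor (im21 (tensL x) s)) k).hom =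
      (tl21 (im21 (tensL (F.obj x)) (im21 F.toPseudofunctor s)) (m.μ x c ≫ k)).hom ≫
        (tl22 (m.μR x h) k).hom := by
  have := (m.psNatR x).tl21_nat s k
  rw [im21_comp, im21_comp] at this
  exact this

variable {b' c' : K} {f' : a ⟶ b'} {g' : b' ⟶ c'} {h' : c' ⟶ c}

theorem μL_tl23 (s : f ≫ g ≅ f' ≫ g' ≫ h') (x : K) (k : F.obj (c ⊠ₒ x) ⟶ z) :
    F.map f ⊠ 𝟙 (F.obj x) ◁ (tl22 (m.μL g x) k).hom ≫
        (tl22 (m.μL f x) (F.map (g ⊠ 𝟙 x) ≫ k)).hom ≫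
        m.μ a x ◁ (tl23 (im23 F.toPseudofunctor (im23 (tensR x) s)) k).hom =
      (tl23 (im23 (tensR (F.obj x)) (im23 F.toPseudofunctor s)) (m.μ c x ≫ k)).hom ≫
        F.map f' ⊠ 𝟙 (F.obj x) ◁ F.map g' ⊠ 𝟙 (F.obj x) ◁ (tl22 (m.μL h' x) k).hom ≫
        F.map f' ⊠ 𝟙 (F.obj x) ◁ (tl22 (m.μL g' x) (F.map (h' ⊠ 𝟙 x) ≫ k)).hom ≫
        (tl22 (m.μL f' x) (F.map (g' ⊠ 𝟙 x) ≫ F.map (h' ⊠ 𝟙 x) ≫ k)).hom := by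
  have := (m.psNatL x).tl23_nat s k
  rw [im23_comp, im23_comp] at this
  exact this

theorem μR_tl23 (s : f ≫ g ≅ f' ≫ g' ≫ h') (x : K) (k : F.obj (x ⊠ₒ c) ⟶ z) :
    𝟙 (F.obj x) ⊠ F.map f ◁ (tl22 (m.μR x g) k).hom ≫
        (tl22 (m.μR x f) (F.map (𝟙 x ⊠ g) ≫ k)).hom ≫
        m.μ x a ◁ (tl23 (im23 F.toPseudofunctor (im23 (tensL x) s)) k).hom =
      (tl23 (im23 (tensL (F.obj x)) (im23 F.toPseudofunctor s)) (m.μ x c ≫ k)).hom ≫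
        𝟙 (F.obj x) ⊠ F.map f' ◁ 𝟙 (F.obj x) ⊠ F.map g' ◁ (tl22 (m.μR x h') k).hom ≫
        𝟙 (F.obj x) ⊠ F.map f' ◁ (tl22 (m.μR x g') (F.map (𝟙 x ⊠ h') ≫ k)).hom ≫
        (tl22 (m.μR x f') (F.map (𝟙 x ⊠ g') ≫ F.map (𝟙 x ⊠ h') ≫ k)).hom := by
  have := (m.psNatR x).tl23_nat s k
  rw [im23_comp, im23_comp] at this
  exact this

end

end LaxMonoidal

end Lax

section CylTails

variable {B : Type u₁} [Bicategory.{w₁, v₁} B]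

theorem IsCyl.tl33 {a b c d a' b' c' d' p q p' q' z : B} {f : a ⟶ a'} {g : b ⟶ b'} {h : c ⟶ c'}
    {l : d ⟶ d'} {u : a ⟶ b} {v : b ⟶ c} {w : c ⟶ d} {u' : a' ⟶ b'} {v' : b' ⟶ c'}
    {w' : c' ⟶ d'} {r : p ⟶ p'} {s : q ⟶ q'} {x : a ⟶ p} {y : p ⟶ q} {t : q ⟶ d} {x' : a' ⟶ p'}
    {y' : p' ⟶ q'} {t' : q' ⟶ d'} {A₁ : f ≫ u' ≅ u ≫ g} {A₂ : g ≫ v' ≅ v ≫ h}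
    {A₃ : h ≫ w' ≅ w ≫ l} {C₁ : f ≫ x' ≅ x ≫ r} {C₂ : r ≫ y' ≅ y ≫ s} {C₃ : s ≫ t' ≅ t ≫ l}
    {θ : u ≫ v ≫ w ≅ x ≫ y ≫ t} {θ' : u' ≫ v' ≫ w' ≅ x' ≫ y' ≫ t'}
    (H : IsCyl (sqV A₁ (sqV A₂ A₃)) (sqV C₁ (sqV C₂ C₃)) θ.hom θ'.hom) (k : d' ⟶ z) :
    f ◁ (tl33 θ' k).hom ≫ (tl22 C₁ (y' ≫ t' ≫ k)).hom ≫ x ◁ (tl22 C₂ (t' ≫ k)).hom ≫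
        x ◁ y ◁ (tl22 C₃ k).hom =
      (tl22 A₁ (v' ≫ w' ≫ k)).hom ≫ u ◁ (tl22 A₂ (w' ≫ k)).hom ≫ u ◁ v ◁ (tl22 A₃ k).hom ≫
        (MonTwoCat.tl33 θ (l ≫ k)).hom := by
  have h := congrArg (fun x => (f ◁ u' ◁ (α_ v' w' k).inv ≫ f ◁ (α_ u' (v' ≫ w') k).inv ≫
    (α_ f _ k).inv) ≫ x ▷ k ≫ (α_ _ l k).hom ≫ (α_ _ _ _).hom ≫ _ ◁ (α_ _ _ _).hom) H
  simp only [tl22, MonTwoCat.tl33, sqV, Iso.trans_hom, Iso.symm_hom, whiskerRightIso_hom,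
    whiskerLeftIso_hom] at h ⊢
  refine Eq.trans ?_ (h.trans ?_) <;> bicategory

theorem IsCyl.tl22 {a b c a' b' c' p p' z : B} {f : a ⟶ a'} {g : b ⟶ b'}
    {l : c ⟶ c'} {u : a ⟶ b} {v : b ⟶ c} {u' : a' ⟶ b'} {v' : b' ⟶ c'}
    {r : p ⟶ p'} {x : a ⟶ p} {y : p ⟶ c} {x' : a' ⟶ p'}
    {y' : p' ⟶ c'} {A₁ : f ≫ u' ≅ u ≫ g} {A₂ : g ≫ v' ≅ v ≫ l}
    {C₁ : f ≫ x' ≅ x ≫ r} {C₂ : r ≫ y' ≅ y ≫ l}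
    {θ : u ≫ v ≅ x ≫ y} {θ' : u' ≫ v' ≅ x' ≫ y'}
    (H : IsCyl (sqV A₁ A₂) (sqV C₁ C₂) θ.hom θ'.hom) (k : c' ⟶ z) :
    f ◁ (tl22 θ' k).hom ≫ (MonTwoCat.tl22 C₁ (y' ≫ k)).hom ≫ x ◁ (MonTwoCat.tl22 C₂ k).hom =
      (MonTwoCat.tl22 A₁ (v' ≫ k)).hom ≫ u ◁ (MonTwoCat.tl22 A₂ k).hom ≫
        (MonTwoCat.tl22 θ (l ≫ k)).hom := by
  have h := congrArg (fun x => (f ◁ (α_ u' v' k).inv ≫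
    (α_ f _ k).inv) ≫ x ▷ k ≫ (α_ _ l k).hom ≫ (α_ _ _ _).hom) H
  simp only [MonTwoCat.tl22, sqV, Iso.trans_hom, Iso.symm_hom, whiskerRightIso_hom,
    whiskerLeftIso_hom] at h ⊢
  refine Eq.trans ?_ (h.trans ?_) <;> bicategory

end CylTails

theorem IsNat.im22 {B : Type u₁} [Bicategory.{w₁, v₁} B] {C : Type u₂} [Bicategory.{w₂, v₂} C]
    {a b a' b' : B} {f f' : a ⟶ a'} {g g' : b ⟶ b'} {u : a ⟶ b} {v : a' ⟶ b'}
    {s : f ≫ v ≅ u ≫ g} {t : f' ≫ v ≅ u ≫ g'} {σ : f ⟶ f'} {σ' : g ⟶ g'} (H : IsNat s t σ σ')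
    (P : Pseudofunctor B C) :
    IsNat (MonTwoCat.im22 P s) (MonTwoCat.im22 P t) (P.map₂ σ) (P.map₂ σ') := by
  have e := congrArg (fun t => (P.mapComp f v).inv ≫ P.map₂ t ≫ (P.mapComp u g').hom) H
  simp only [P.map₂_comp] at e
  simpa [IsNat, MonTwoCat.im22] using e

theorem xch_symm_eq {K : Type u₁} [Bicategory.{w₁, v₁} K] [TensorBicategory K] {x x' y y' : K}
    (f : x ⟶ x') (g : y ⟶ y') : (xch f g).symm = tSq (idSqH f) (idSqV g) := by
  ext
  simp [xch, tSq, idSqV, idSqH, tSplit, tSplit', tMap₂_comp]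

section Lax

variable {K : Type u₁} [Bicategory.{w₁, v₁} K] {L : Type u₂} [Bicategory.{w₂, v₂} L]
  [MonoidalBicategory K] [MonoidalBicategory L] {F : StrictPseudofunctor K L}

theorem isNat_ascL {x x' : K} (f : x ⟶ x') (y z : K) :
    IsNat (assocNat f (𝟙 y) (𝟙 z)) (ascL f y z) (𝟙 _) (𝟙 f ⊠₂ (tId y z).hom) := by
  simp [IsNat, ascL]

theorem isNat_ascR (x y : K) {z z' : K} (h : z ⟶ z') :
    IsNat (assocNat (𝟙 x) (𝟙 y) h) (ascR x y h) ((tId x y).hom ⊠₂ 𝟙 h) (𝟙 _) := by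
  simp [IsNat, ascR, ← comp_whiskerRight_assoc, ← tMap₂_comp, tMap₂_id]

namespace LaxMonoidal

variable (m : LaxMonoidal F)

theorem isNat_mapId (b : K) :
    IsNat (idSqV (F.map (𝟙 b))) (idSqV (𝟙 (F.obj b))) (F.mapId b).hom (F.mapId b).hom :=
  isNat_idSqV _

theorem ω_natL {a a' : K} (f : a ⟶ a') (b c : K) :
    IsCyl
      (sqV (im22 (tensR (F.obj c)) (m.μL f b))
        (sqV (m.μL (f ⊠ 𝟙 b) c) (im22 F.toPseudofunctor (ascL f b c))))
      (sqV (ascL (F.map f) (F.obj b) (F.obj c))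
        (sqV (xch (F.map f) (m.μ b c)) (m.μL f (b ⊠ₒ c)))) (m.ω a b c).hom (m.ω a' b c).hom := by
  rw [im22_tensR, xch_eq]
  refine (m.ω_modif f (𝟙 b) (𝟙 c)).of_isNat ((Iso.refl _ ⊠ᵢ F.mapId b) ⊠ᵢ F.mapId c)
    (F.map₂Iso (Iso.refl _ ⊠ᵢ tId b c)) ?_ ?_
  · refine IsNat.sqV (τ := 𝟙 _ ⊠₂ (F.mapId c).hom) ?_ (IsNat.sqV (τ := 𝟙 _) ?_ ?_)
    · exact (m.isNat_μL f b).tSq (isNat_mapId c)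
    · exact m.isNat_μL _ c
    · exact ((isNat_ascL f b c).im22 F.toPseudofunctor).of_eq (F.map₂_id _) rfl
  · refine IsNat.sqV (τ := 𝟙 _ ⊠₂ ((F.mapId b).hom ⊠₂ (F.mapId c).hom ≫ (tId _ _).hom)) ?_
      (IsNat.sqV (τ := 𝟙 _ ⊠₂ (F.map₂ (tId b c).hom ≫ (F.mapId _).hom)) ?_ ?_)
    · refine ((assocNat_nat (𝟙 (F.map f)) (F.mapId b).hom (F.mapId c).hom).comp
        (isNat_ascL _ _ _)).of_eq ?_ ?_
      · simp
      · simp [← tMap₂_comp]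
    · exact (isNat_idSqV _).tSq (m.μNat_id b c)
    · refine ((m.μNat_nat (𝟙 f) (tId b c).hom).comp (m.isNat_μL f _)).of_eq ?_ ?_
      · simp [← tMap₂_comp]
      · simp

theorem ω_natM (a : K) {b b' : K} (f : b ⟶ b') (c : K) :
    IsCyl
      (sqV (im22 (tensR (F.obj c)) (m.μR a f))
        (sqV (m.μL (𝟙 a ⊠ f) c) (im22 F.toPseudofunctor (ascM a f c))))
      (sqV (ascM (F.obj a) (F.map f) (F.obj c))
        (sqV (im22 (tensL (F.obj a)) (m.μL f c)) (m.μR a (f ⊠ 𝟙 c))))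
      (m.ω a b c).hom (m.ω a b' c).hom := by
  rw [im22_tensR, im22_tensL]
  refine (m.ω_modif (𝟙 a) f (𝟙 c)).of_isNat ((F.mapId a ⊠ᵢ Iso.refl _) ⊠ᵢ F.mapId c)
    (Iso.refl _) ?_ ?_
  · refine IsNat.sqV (τ := 𝟙 _ ⊠₂ (F.mapId c).hom) ?_ (IsNat.sqV (τ := 𝟙 _) ?_ ?_)
    · exact (m.isNat_μR a f).tSq (isNat_mapId c)
    · exact m.isNat_μL _ c
    · exact isNat_id _
  · refine IsNat.sqV (τ := (F.mapId a).hom ⊠₂ (𝟙 _ ⊠₂ (F.mapId c).hom)) ?_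
      (IsNat.sqV (τ := (F.mapId a).hom ⊠₂ 𝟙 _) ?_ ?_)
    · exact assocNat_nat _ _ _
    · exact (isNat_mapId a).tSq (m.isNat_μL f c)
    · exact m.isNat_μR a _

theorem ω_natR (a b : K) {c c' : K} (f : c ⟶ c') :
    IsCyl
      (sqV (xch (m.μ a b) (F.map f)).symm
        (sqV (m.μR (a ⊠ₒ b) f) (im22 F.toPseudofunctor (ascR a b f))))
      (sqV (ascR (F.obj a) (F.obj b) (F.map f))
        (sqV (im22 (tensL (F.obj a)) (m.μR b f)) (m.μR a (𝟙 b ⊠ f))))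
      (m.ω a b c).hom (m.ω a b c').hom := by
  rw [xch_symm_eq, im22_tensL]
  refine (m.ω_modif (𝟙 a) (𝟙 b) f).of_isNat
    ((F.mapId a ⊠ᵢ F.mapId b ≪≫ tId _ _) ⊠ᵢ Iso.refl _) (Iso.refl _) ?_ ?_
  · refine IsNat.sqV (τ := (F.map₂ (tId a b).hom ≫ (F.mapId _).hom) ⊠₂ 𝟙 _) ?_
      (IsNat.sqV (τ := F.map₂ ((tId a b).hom ⊠₂ 𝟙 f)) ?_ ?_)
    · exact (m.μNat_id a b).tSq (isNat_idSqV _)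
    · refine ((m.μNat_nat (tId a b).hom (𝟙 f)).comp (m.isNat_μR _ f)).of_eq ?_ ?_
      · simp [← tMap₂_comp]
      · simp
    · exact ((isNat_ascR a b f).im22 F.toPseudofunctor).of_eq rfl (F.map₂_id _)
  · refine IsNat.sqV (τ := (F.mapId a).hom ⊠₂ ((F.mapId b).hom ⊠₂ 𝟙 _)) ?_
      (IsNat.sqV (τ := (F.mapId a).hom ⊠₂ 𝟙 _) ?_ ?_)
    · refine ((assocNat_nat (F.mapId a).hom (F.mapId b).hom (𝟙 (F.map f))).comp
        (isNat_ascR _ _ _)).of_eq ?_ ?_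
      · simp [← tMap₂_comp]
      · simp
    · exact (isNat_mapId a).tSq (m.isNat_μR b f)
    · exact m.isNat_μR a _

end LaxMonoidal

end Lax

section TensorImages

variable {K : Type u₁} [Bicategory.{w₁, v₁} K] [TensorBicategory K]

/-- `im12` for tensoring on the right. -/
def r12 {a b c : K} {f : a ⟶ c} {u : a ⟶ b} {g : b ⟶ c} (s : f ≅ u ≫ g) (z : K) :
    f ⊠ 𝟙 z ≅ u ⊠ 𝟙 z ≫ g ⊠ 𝟙 z :=
  im12 (tensR z) s

/-- `im21` for tensoring on the right. -/
def r21 {a b c : K} {f : a ⟶ c} {u : a ⟶ b} {g : b ⟶ c} (s : u ≫ g ≅ f) (z : K) :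
    u ⊠ 𝟙 z ≫ g ⊠ 𝟙 z ≅ f ⊠ 𝟙 z :=
  im21 (tensR z) s

/-- `im22` for tensoring on the right. -/
def r22 {a b a' b' : K} {f : a ⟶ a'} {g : b ⟶ b'} {u : a ⟶ b} {v : a' ⟶ b'}
    (s : f ≫ v ≅ u ≫ g) (z : K) :
    f ⊠ 𝟙 z ≫ v ⊠ 𝟙 z ≅ u ⊠ 𝟙 z ≫ g ⊠ 𝟙 z :=
  im22 (tensR z) s

/-- `im23` for tensoring on the right. -/
def r23 {a b b' c' d : K} {f : a ⟶ b} {g : b ⟶ d} {f' : a ⟶ b'} {g' : b' ⟶ c'}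
    {h' : c' ⟶ d} (s : f ≫ g ≅ f' ≫ g' ≫ h') (z : K) :
    f ⊠ 𝟙 z ≫ g ⊠ 𝟙 z ≅ f' ⊠ 𝟙 z ≫ g' ⊠ 𝟙 z ≫ h' ⊠ 𝟙 z :=
  im23 (tensR z) s

/-- `im12` for tensoring on the left. -/
def l12 {a b c : K} {f : a ⟶ c} {u : a ⟶ b} {g : b ⟶ c} (s : f ≅ u ≫ g) (z : K) :
    𝟙 z ⊠ f ≅ 𝟙 z ⊠ u ≫ 𝟙 z ⊠ g :=
  im12 (tensL z) s

/-- `im21` for tensoring on the left. -/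
def l21 {a b c : K} {f : a ⟶ c} {u : a ⟶ b} {g : b ⟶ c} (s : u ≫ g ≅ f) (z : K) :
    𝟙 z ⊠ u ≫ 𝟙 z ⊠ g ≅ 𝟙 z ⊠ f :=
  im21 (tensL z) s

/-- `im22` for tensoring on the left. -/
def l22 {a b a' b' : K} {f : a ⟶ a'} {g : b ⟶ b'} {u : a ⟶ b} {v : a' ⟶ b'}
    (s : f ≫ v ≅ u ≫ g) (z : K) :
    𝟙 z ⊠ f ≫ 𝟙 z ⊠ v ≅ 𝟙 z ⊠ u ≫ 𝟙 z ⊠ g :=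
  im22 (tensL z) s

/-- `im23` for tensoring on the left. -/
def l23 {a b b' c' d : K} {f : a ⟶ b} {g : b ⟶ d} {f' : a ⟶ b'} {g' : b' ⟶ c'}
    {h' : c' ⟶ d} (s : f ≫ g ≅ f' ≫ g' ≫ h') (z : K) :
    𝟙 z ⊠ f ≫ 𝟙 z ⊠ g ≅ 𝟙 z ⊠ f' ≫ 𝟙 z ⊠ g' ≫ 𝟙 z ⊠ h' :=
  im23 (tensL z) s

/-- `im31` for tensoring on the right. -/
def r31 {a b c d : K} {f : a ⟶ b} {g : b ⟶ c} {h : c ⟶ d} {f' : a ⟶ d}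
    (s : f ≫ g ≫ h ≅ f') (z : K) :
    f ⊠ 𝟙 z ≫ g ⊠ 𝟙 z ≫ h ⊠ 𝟙 z ≅ f' ⊠ 𝟙 z :=
  im31 (tensR z) s

/-- `im33` for tensoring on the right. -/
def r33 {a b b' c c' d : K} {f : a ⟶ b} {g : b ⟶ c} {h : c ⟶ d} {f' : a ⟶ b'}
    {g' : b' ⟶ c'} {h' : c' ⟶ d} (s : f ≫ g ≫ h ≅ f' ≫ g' ≫ h') (z : K) :
    f ⊠ 𝟙 z ≫ g ⊠ 𝟙 z ≫ h ⊠ 𝟙 z ≅ f' ⊠ 𝟙 z ≫ g' ⊠ 𝟙 z ≫ h' ⊠ 𝟙 z :=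
  im33 (tensR z) s

/-- `im31` for tensoring on the left. -/
def l31 {a b c d : K} {f : a ⟶ b} {g : b ⟶ c} {h : c ⟶ d} {f' : a ⟶ d}
    (s : f ≫ g ≫ h ≅ f') (z : K) :
    𝟙 z ⊠ f ≫ 𝟙 z ⊠ g ≫ 𝟙 z ⊠ h ≅ 𝟙 z ⊠ f' :=
  im31 (tensL z) s

/-- `im33` for tensoring on the left. -/
def l33 {a b b' c c' d : K} {f : a ⟶ b} {g : b ⟶ c} {h : c ⟶ d} {f' : a ⟶ b'}
    {g' : b' ⟶ c'} {h' : c' ⟶ d} (s : f ≫ g ≫ h ≅ f' ≫ g' ≫ h') (z : K) :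
    𝟙 z ⊠ f ≫ 𝟙 z ⊠ g ≫ 𝟙 z ⊠ h ≅ 𝟙 z ⊠ f' ≫ 𝟙 z ⊠ g' ≫ 𝟙 z ⊠ h' :=
  im33 (tensL z) s

end TensorImages

section Lax

variable {K : Type u₁} [Bicategory.{w₁, v₁} K] {L : Type u₂} [Bicategory.{w₂, v₂} L]
  [MonoidalBicategory K] [MonoidalBicategory L] {F : StrictPseudofunctor K L}

namespace LaxMonoidal

variable (m : LaxMonoidal F)

section

variable {T : L} {b x : K} (t : T ⟶ F.obj b) (q : b ⟶ x) {z : L}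

/-- Moving the second factor of `t ≫ F.map q` past `μ`, in the first variable. -/
def cL (c : K) (k : F.obj (x ⊠ₒ c) ⟶ z) :
    (t ≫ F.map q) ⊠ 𝟙 (F.obj c) ≫ m.μ x c ≫ k ≅
      t ⊠ 𝟙 (F.obj c) ≫ m.μ b c ≫ F.map (q ⊠ 𝟙 c) ≫ k :=
  tl12 (wrComp t (F.map q) (F.obj c)) (m.μ x c ≫ k) ≪≫
    whiskerLeftIso (t ⊠ 𝟙 (F.obj c)) (tl22 (m.μL q c) k)

/-- Moving the second factor of `t ≫ F.map q` past `μ`, in the second variable. -/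
def cR (a : K) (k : F.obj (a ⊠ₒ x) ⟶ z) :
    𝟙 (F.obj a) ⊠ (t ≫ F.map q) ≫ m.μ a x ≫ k ≅
      𝟙 (F.obj a) ⊠ t ≫ m.μ a b ≫ F.map (𝟙 a ⊠ q) ≫ k :=
  tl12 (wlComp (F.obj a) t (F.map q)) (m.μ a x ≫ k) ≪≫
    whiskerLeftIso (𝟙 (F.obj a) ⊠ t) (tl22 (m.μR a q) k)

/-- Moving the second factor of `t ≫ F.map q` past two instances of `μ`, in the first variable
of a left bracketing. -/
def cLL (c d : K) (k : F.obj ((x ⊠ₒ c) ⊠ₒ d) ⟶ z) :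
    ((t ≫ F.map q) ⊠ 𝟙 (F.obj c)) ⊠ 𝟙 (F.obj d) ≫ m.μ x c ⊠ 𝟙 (F.obj d) ≫
        m.μ (x ⊠ₒ c) d ≫ k ≅
      (t ⊠ 𝟙 (F.obj c)) ⊠ 𝟙 (F.obj d) ≫ m.μ b c ⊠ 𝟙 (F.obj d) ≫ m.μ (b ⊠ₒ c) d ≫
        F.map ((q ⊠ 𝟙 c) ⊠ 𝟙 d) ≫ k :=
  tl12 (r12 (wrComp t (F.map q) (F.obj c)) (F.obj d)) _ ≪≫
    whiskerLeftIso ((t ⊠ 𝟙 (F.obj c)) ⊠ 𝟙 (F.obj d))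
      (tl22 (r22 (m.μL q c) (F.obj d)) _ ≪≫
        whiskerLeftIso (m.μ b c ⊠ 𝟙 (F.obj d)) (tl22 (m.μL (q ⊠ 𝟙 c) d) k))

/-- Moving the second factor of `t ≫ F.map q` past two instances of `μ`, in the second variable
of a left bracketing. -/
def cML (a d : K) (k : F.obj ((a ⊠ₒ x) ⊠ₒ d) ⟶ z) :
    (𝟙 (F.obj a) ⊠ (t ≫ F.map q)) ⊠ 𝟙 (F.obj d) ≫ m.μ a x ⊠ 𝟙 (F.obj d) ≫
        m.μ (a ⊠ₒ x) d ≫ k ≅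
      (𝟙 (F.obj a) ⊠ t) ⊠ 𝟙 (F.obj d) ≫ m.μ a b ⊠ 𝟙 (F.obj d) ≫ m.μ (a ⊠ₒ b) d ≫
        F.map ((𝟙 a ⊠ q) ⊠ 𝟙 d) ≫ k :=
  tl12 (r12 (wlComp (F.obj a) t (F.map q)) (F.obj d)) _ ≪≫
    whiskerLeftIso ((𝟙 (F.obj a) ⊠ t) ⊠ 𝟙 (F.obj d))
      (tl22 (r22 (m.μR a q) (F.obj d)) _ ≪≫
        whiskerLeftIso (m.μ a b ⊠ 𝟙 (F.obj d)) (tl22 (m.μL (𝟙 a ⊠ q) d) k))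

/-- Moving the second factor of `t ≫ F.map q` past two instances of `μ`, in the second variable
of a right bracketing. -/
def cMR (a d : K) (k : F.obj (a ⊠ₒ x ⊠ₒ d) ⟶ z) :
    𝟙 (F.obj a) ⊠ ((t ≫ F.map q) ⊠ 𝟙 (F.obj d)) ≫ 𝟙 (F.obj a) ⊠ m.μ x d ≫
        m.μ a (x ⊠ₒ d) ≫ k ≅
      𝟙 (F.obj a) ⊠ (t ⊠ 𝟙 (F.obj d)) ≫ 𝟙 (F.obj a) ⊠ m.μ b d ≫ m.μ a (b ⊠ₒ d) ≫
        F.map (𝟙 a ⊠ (q ⊠ 𝟙 d)) ≫ k :=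
  tl12 (l12 (wrComp t (F.map q) (F.obj d)) (F.obj a)) _ ≪≫
    whiskerLeftIso (𝟙 (F.obj a) ⊠ (t ⊠ 𝟙 (F.obj d)))
      (tl22 (l22 (m.μL q d) (F.obj a)) _ ≪≫
        whiskerLeftIso (𝟙 (F.obj a) ⊠ m.μ b d) (tl22 (m.μR a (q ⊠ 𝟙 d)) k))

/-- Moving the second factor of `t ≫ F.map q` past two instances of `μ`, in the third variable
of a right bracketing. -/
def cRR (a c : K) (k : F.obj (a ⊠ₒ c ⊠ₒ x) ⟶ z) :
    𝟙 (F.obj a) ⊠ (𝟙 (F.obj c) ⊠ (t ≫ F.map q)) ≫ 𝟙 (F.obj a) ⊠ m.μ c x ≫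
        m.μ a (c ⊠ₒ x) ≫ k ≅
      𝟙 (F.obj a) ⊠ (𝟙 (F.obj c) ⊠ t) ≫ 𝟙 (F.obj a) ⊠ m.μ c b ≫ m.μ a (c ⊠ₒ b) ≫
        F.map (𝟙 a ⊠ (𝟙 c ⊠ q)) ≫ k :=
  tl12 (l12 (wlComp (F.obj c) t (F.map q)) (F.obj a)) _ ≪≫
    whiskerLeftIso (𝟙 (F.obj a) ⊠ (𝟙 (F.obj c) ⊠ t))
      (tl22 (l22 (m.μR c q) (F.obj a)) _ ≪≫
        whiskerLeftIso (𝟙 (F.obj a) ⊠ m.μ c b) (tl22 (m.μR a (𝟙 c ⊠ q)) k))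

/-- Moving the second factor of `t ≫ F.map q`, in the second variable, past a 1-cell in the first
variable and `μ`. -/
def cRL {S : L} {a : K} (s : S ⟶ F.obj a) (k : F.obj (a ⊠ₒ x) ⟶ z) :
    𝟙 S ⊠ (t ≫ F.map q) ≫ s ⊠ 𝟙 (F.obj x) ≫ m.μ a x ≫ k ≅
      𝟙 S ⊠ t ≫ s ⊠ 𝟙 (F.obj b) ≫ m.μ a b ≫ F.map (𝟙 a ⊠ q) ≫ k :=
  tl12 (wlComp S t (F.map q)) _ ≪≫ whiskerLeftIso (𝟙 S ⊠ t)
    (tl22 (xch s (F.map q)).symm _ ≪≫ whiskerLeftIso (s ⊠ 𝟙 (F.obj b)) (tl22 (m.μR a q) k))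

section

variable {z' : L}

theorem cL_nat (c : K) {k k' : F.obj (x ⊠ₒ c) ⟶ z} (σ : k ⟶ k') :
    (t ≫ F.map q) ⊠ 𝟙 (F.obj c) ◁ m.μ x c ◁ σ ≫ (m.cL t q c k').hom =
      (m.cL t q c k).hom ≫ t ⊠ 𝟙 (F.obj c) ◁ m.μ b c ◁ F.map (q ⊠ 𝟙 c) ◁ σ := by
  simp only [cL, Iso.trans_hom, whiskerLeftIso_hom, Category.assoc, reassoc_of% @tl12_nat,
    ← whiskerLeft_comp, tl22_nat]

theorem cR_nat (a : K) {k k' : F.obj (a ⊠ₒ x) ⟶ z} (σ : k ⟶ k') :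
    𝟙 (F.obj a) ⊠ (t ≫ F.map q) ◁ m.μ a x ◁ σ ≫ (m.cR t q a k').hom =
      (m.cR t q a k).hom ≫ 𝟙 (F.obj a) ⊠ t ◁ m.μ a b ◁ F.map (𝟙 a ⊠ q) ◁ σ := by
  simp only [cR, Iso.trans_hom, whiskerLeftIso_hom, Category.assoc, reassoc_of% @tl12_nat,
    ← whiskerLeft_comp, tl22_nat]

theorem cLL_nat (c d : K) {k k' : F.obj ((x ⊠ₒ c) ⊠ₒ d) ⟶ z} (σ : k ⟶ k') :
    ((t ≫ F.map q) ⊠ 𝟙 (F.obj c)) ⊠ 𝟙 (F.obj d) ◁ m.μ x c ⊠ 𝟙 (F.obj d) ◁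
        m.μ (x ⊠ₒ c) d ◁ σ ≫ (m.cLL t q c d k').hom =
      (m.cLL t q c d k).hom ≫ (t ⊠ 𝟙 (F.obj c)) ⊠ 𝟙 (F.obj d) ◁ m.μ b c ⊠ 𝟙 (F.obj d) ◁
        m.μ (b ⊠ₒ c) d ◁ F.map ((q ⊠ 𝟙 c) ⊠ 𝟙 d) ◁ σ := by
  simp only [cLL, Iso.trans_hom, whiskerLeftIso_hom, Category.assoc, reassoc_of% @tl12_nat,
    ← whiskerLeft_comp, tl22_nat, reassoc_of% @tl22_nat]

theorem cML_nat (a d : K) {k k' : F.obj ((a ⊠ₒ x) ⊠ₒ d) ⟶ z} (σ : k ⟶ k') :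
    (𝟙 (F.obj a) ⊠ (t ≫ F.map q)) ⊠ 𝟙 (F.obj d) ◁ m.μ a x ⊠ 𝟙 (F.obj d) ◁
        m.μ (a ⊠ₒ x) d ◁ σ ≫ (m.cML t q a d k').hom =
      (m.cML t q a d k).hom ≫ (𝟙 (F.obj a) ⊠ t) ⊠ 𝟙 (F.obj d) ◁ m.μ a b ⊠ 𝟙 (F.obj d) ◁
        m.μ (a ⊠ₒ b) d ◁ F.map ((𝟙 a ⊠ q) ⊠ 𝟙 d) ◁ σ := by
  simp only [cML, Iso.trans_hom, whiskerLeftIso_hom, Category.assoc, reassoc_of% @tl12_nat,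
    ← whiskerLeft_comp, tl22_nat, reassoc_of% @tl22_nat]

theorem cRL_nat {S : L} {a : K} (s : S ⟶ F.obj a) {k k' : F.obj (a ⊠ₒ x) ⟶ z} (σ : k ⟶ k') :
    𝟙 S ⊠ (t ≫ F.map q) ◁ s ⊠ 𝟙 (F.obj x) ◁ m.μ a x ◁ σ ≫ (m.cRL t q s k').hom =
      (m.cRL t q s k).hom ≫ 𝟙 S ⊠ t ◁ s ⊠ 𝟙 (F.obj b) ◁ m.μ a b ◁ F.map (𝟙 a ⊠ q) ◁ σ := by
  simp only [cRL, Iso.trans_hom, whiskerLeftIso_hom, Category.assoc, reassoc_of% @tl12_nat,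
    ← whiskerLeft_comp, tl22_nat, reassoc_of% @tl22_nat]

end

theorem ω_cL (c d : K) (k : F.obj (x ⊠ₒ c ⊠ₒ d) ⟶ z) :
    ((t ≫ F.map q) ⊠ 𝟙 (F.obj c)) ⊠ 𝟙 (F.obj d) ◁ (tl33 (m.ω x c d) k).hom ≫
        (tl22 (ascL (t ≫ F.map q) (F.obj c) (F.obj d)) _).hom ≫
        asc T (F.obj c) (F.obj d) ◁ (tl22 (xch (t ≫ F.map q) (m.μ c d)) _).hom ≫
        asc T (F.obj c) (F.obj d) ◁ 𝟙 T ⊠ m.μ c d ◁ (m.cL t q (c ⊠ₒ d) k).hom =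
      (m.cLL t q c d (F.map (asc x c d) ≫ k)).hom ≫
        (t ⊠ 𝟙 (F.obj c)) ⊠ 𝟙 (F.obj d) ◁ m.μ b c ⊠ 𝟙 (F.obj d) ◁ m.μ (b ⊠ₒ c) d ◁
          (tl22 (im22 F.toPseudofunctor (ascL q c d)) k).hom ≫
        (t ⊠ 𝟙 (F.obj c)) ⊠ 𝟙 (F.obj d) ◁ (tl33 (m.ω b c d) (F.map (q ⊠ 𝟙 (c ⊠ₒ d)) ≫ k)).hom ≫
        (tl22 (ascL t (F.obj c) (F.obj d)) _).hom ≫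
        asc T (F.obj c) (F.obj d) ◁ (tl22 (xch t (m.μ c d)) _).hom := by
  have e1 := IsNat.tl_comp (σ := r12 (wrComp t (F.map q) (F.obj c)) (F.obj d))
    (ascL_comp t (F.map q) (F.obj c) (F.obj d)) (𝟙 (F.obj x) ⊠ m.μ c d ≫ m.μ x (c ⊠ₒ d) ≫ k)
  have e2 := congrArg (fun y => asc T (F.obj c) (F.obj d) ◁ y)
    ((xch_comp_left t (F.map q) (m.μ c d)).tl_comp (m.μ x (c ⊠ₒ d) ≫ k))
  have e3 := congrArg (fun y => (t ⊠ 𝟙 (F.obj c)) ⊠ 𝟙 (F.obj d) ◁ y)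
    (IsCyl.tl33 (A₁ := r22 (m.μL q c) (F.obj d)) (m.ω_natL q c d) k)
  have e4 := congrArg (fun y => asc T (F.obj c) (F.obj d) ◁ y)
    (tl22_nat (xch t (m.μ c d)) (tl22 (m.μL q (c ⊠ₒ d)) k).hom)
  simp only [whiskerLeft_comp] at e2 e3 e4
  simp only [cL, cLL, Iso.trans_hom, whiskerLeftIso_hom, whiskerLeft_comp, Category.assoc]
  rw [reassoc_of% e2, reassoc_of% e1, reassoc_of% @tl12_nat, ← e4, ← reassoc_of% @tl22_nat, ← reassoc_of% @tl22_nat,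
    reassoc_of% e3]

theorem ω_cM (a d : K) (k : F.obj (a ⊠ₒ x ⊠ₒ d) ⟶ z) :
    (𝟙 (F.obj a) ⊠ (t ≫ F.map q)) ⊠ 𝟙 (F.obj d) ◁ (tl33 (m.ω a x d) k).hom ≫
        (tl22 (ascM (F.obj a) (t ≫ F.map q) (F.obj d)) _).hom ≫
        asc (F.obj a) T (F.obj d) ◁ (m.cMR t q a d k).hom =
      (m.cML t q a d (F.map (asc a x d) ≫ k)).hom ≫
        (𝟙 (F.obj a) ⊠ t) ⊠ 𝟙 (F.obj d) ◁ m.μ a b ⊠ 𝟙 (F.obj d) ◁ m.μ (a ⊠ₒ b) d ◁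
          (tl22 (im22 F.toPseudofunctor (ascM a q d)) k).hom ≫
        (𝟙 (F.obj a) ⊠ t) ⊠ 𝟙 (F.obj d) ◁ (tl33 (m.ω a b d) (F.map (𝟙 a ⊠ (q ⊠ 𝟙 d)) ≫ k)).hom ≫
        (tl22 (ascM (F.obj a) t (F.obj d)) _).hom := by
  have e1 := IsNat.tl_comp (σ := r12 (wlComp (F.obj a) t (F.map q)) (F.obj d))
    (σ' := l12 (wrComp t (F.map q) (F.obj d)) (F.obj a)) (ascM_comp (F.obj a) t (F.map q) (F.obj d))
    (𝟙 (F.obj a) ⊠ m.μ x d ≫ m.μ a (x ⊠ₒ d) ≫ k)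
  have e3 := congrArg (fun y => (𝟙 (F.obj a) ⊠ t) ⊠ 𝟙 (F.obj d) ◁ y)
    (IsCyl.tl33 (A₁ := r22 (m.μR a q) (F.obj d)) (C₂ := l22 (m.μL q d) (F.obj a)) (m.ω_natM a q d) k)
  simp only [whiskerLeft_comp] at e3
  simp only [cMR, cML, Iso.trans_hom, whiskerLeftIso_hom, whiskerLeft_comp, Category.assoc]
  rw [reassoc_of% e1, reassoc_of% @tl12_nat, ← reassoc_of% @tl22_nat, ← tl22_nat, reassoc_of% e3]

theorem ω_cR (a c : K) (k : F.obj (a ⊠ₒ c ⊠ₒ x) ⟶ z) :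
    𝟙 (F.obj a ⊠ₒ F.obj c) ⊠ (t ≫ F.map q) ◁ (tl33 (m.ω a c x) k).hom ≫
        (tl22 (ascR (F.obj a) (F.obj c) (t ≫ F.map q)) _).hom ≫
        asc (F.obj a) (F.obj c) T ◁ (m.cRR t q a c k).hom =
      (m.cRL t q (m.μ a c) (F.map (asc a c x) ≫ k)).hom ≫
        𝟙 (F.obj a ⊠ₒ F.obj c) ⊠ t ◁ m.μ a c ⊠ 𝟙 (F.obj b) ◁ m.μ (a ⊠ₒ c) b ◁
          (tl22 (im22 F.toPseudofunctor (ascR a c q)) k).hom ≫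
        𝟙 (F.obj a ⊠ₒ F.obj c) ⊠ t ◁ (tl33 (m.ω a c b) (F.map (𝟙 a ⊠ (𝟙 c ⊠ q)) ≫ k)).hom ≫
        (tl22 (ascR (F.obj a) (F.obj c) t) _).hom := by
  have e1 := IsNat.tl_comp (σ' := l12 (wlComp (F.obj c) t (F.map q)) (F.obj a))
    (ascR_comp (F.obj a) (F.obj c) t (F.map q)) (𝟙 (F.obj a) ⊠ m.μ c x ≫ m.μ a (c ⊠ₒ x) ≫ k)
  have e3 := congrArg (fun y => 𝟙 (F.obj a ⊠ₒ F.obj c) ⊠ t ◁ y)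
    (IsCyl.tl33 (C₂ := l22 (m.μR c q) (F.obj a)) (m.ω_natR a c q) k)
  simp only [whiskerLeft_comp] at e3
  simp only [cRR, cRL, Iso.trans_hom, whiskerLeftIso_hom, whiskerLeft_comp, Category.assoc]
  rw [reassoc_of% e1, reassoc_of% @tl12_nat, ← reassoc_of% @tl22_nat, ← tl22_nat, reassoc_of% e3]

end

end LaxMonoidal

end Lax

section

variable {B : Type u₁} [Bicategory.{w₁, v₁} B]

theorem IsNat.tl_exchange {a b c d a' b' c' d' z : B} {f : a ⟶ b} {g : b ⟶ d} {f' : a ⟶ c}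
    {g' : c ⟶ d} {u : a ⟶ a'} {v : b ⟶ b'} {w : c ⟶ c'} {x : d ⟶ d'} {p : a' ⟶ b'} {q : b' ⟶ d'}
    {p' : a' ⟶ c'} {q' : c' ⟶ d'} {s₁ : f ≫ v ≅ u ≫ p} {s₂ : g ≫ x ≅ v ≫ q}
    {t₁ : f' ≫ w ≅ u ≫ p'} {t₂ : g' ≫ x ≅ w ≫ q'} {σ : f ≫ g ≅ f' ≫ g'} {τ : p ≫ q ≅ p' ≫ q'}
    (H : IsNat (sqH s₁ s₂) (sqH t₁ t₂) σ.hom τ.hom) (k : d' ⟶ z) :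
    (tl22 σ (x ≫ k)).hom ≫ f' ◁ (tl22 t₂ k).hom ≫ (tl22 t₁ (q' ≫ k)).hom =
      f ◁ (tl22 s₂ k).hom ≫ (tl22 s₁ (q ≫ k)).hom ≫ u ◁ (tl22 τ k).hom := by
  have h := congrArg (fun y => f ◁ (α_ g x k).inv ≫ (α_ f (g ≫ x) k).inv ≫ (α_ f g x).inv ▷ k ≫
    y ▷ k ≫ (α_ u _ k).hom ≫ u ◁ (α_ p' q' k).hom) H
  simp only [tl22, sqH, Iso.trans_hom, Iso.symm_hom, whiskerRightIso_hom,
    whiskerLeftIso_hom] at h ⊢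
  refine Eq.trans ?_ (h.trans ?_) <;> bicategory

section WhiskerCancel

variable {a b c d e : B} (f : a ⟶ b) (g : b ⟶ c) (h : c ⟶ d) {k l : d ⟶ e} {m n : c ⟶ d} (α : k ≅ l) (β : m ≅ n)

theorem whiskerLeft₂_hom_inv : f ◁ g ◁ β.hom ≫ f ◁ g ◁ β.inv = 𝟙 _ := by
  simp [← whiskerLeft_comp]

theorem whiskerLeft₂_inv_hom : f ◁ g ◁ β.inv ≫ f ◁ g ◁ β.hom = 𝟙 _ := by
  simp [← whiskerLeft_comp]

theorem whiskerLeft₃_hom_inv : f ◁ g ◁ h ◁ α.hom ≫ f ◁ g ◁ h ◁ α.inv = 𝟙 _ := by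
  simp [← whiskerLeft_comp]

theorem whiskerLeft₃_inv_hom : f ◁ g ◁ h ◁ α.inv ≫ f ◁ g ◁ h ◁ α.hom = 𝟙 _ := by
  simp [← whiskerLeft_comp]

end WhiskerCancel

section AssocImage

variable {a a' b b₁ b₂ e e₁ e₂ d z : B} {f : a ⟶ b} {g : b ⟶ e} {g' : e ⟶ d} {p : a ⟶ a'}
  {n : a' ⟶ b} {c : a ⟶ b₁} {c' : b₁ ⟶ b} {h : b₁ ⟶ e₁} {q : e₁ ⟶ e} {r : e₁ ⟶ e₂} {l : e₂ ⟶ e}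
  {n₁ : a' ⟶ b₂} {n₂ : b₂ ⟶ b} {h' : b₂ ⟶ e₂} {α : f ≫ g ≫ g' ≅ p ≫ n ≫ g ≫ g'}
  {w : n ≅ n₁ ≫ n₂} {s : n₂ ≫ g ≅ h' ≫ l} {w' : f ≅ c ≫ c'} {s' : c' ≫ g ≅ h ≫ q}
  {β : q ≫ g' ≅ r ≫ l ≫ g'} {ω : c ≫ h ≫ r ≅ p ≫ n₁ ≫ h'}

theorem im_assoc {C : Type u₂} [Bicategory.{w₂, v₂} C] (P : Pseudofunctor B C)
    (H : α.hom ≫ p ◁ ((tl12 w (g ≫ g')).hom ≫ n₁ ◁ (tl22 s g').hom) =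
      ((tl12 w' (g ≫ g')).hom ≫ c ◁ (tl22 s' g').hom) ≫ c ◁ h ◁ β.hom ≫ (tl33 ω (l ≫ g')).hom)
    {z : C} (k : P.obj d ⟶ z) :
    (tl23 (im23 P α) k).hom ≫ P.map p ◁ P.map n ◁ (tl12 (P.mapComp g g') k).hom ≫
        P.map p ◁ (tl12 (im12 P w) (P.map g ≫ P.map g' ≫ k)).hom ≫
        P.map p ◁ P.map n₁ ◁ (tl22 (im22 P s) (P.map g' ≫ k)).hom =
      P.map f ◁ (tl12 (P.mapComp g g') k).hom ≫
        (tl12 (im12 P w') (P.map g ≫ P.map g' ≫ k)).hom ≫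
        P.map c ◁ (tl22 (im22 P s') (P.map g' ≫ k)).hom ≫
        P.map c ◁ P.map h ◁ (tl23 (im23 P β) k).hom ≫
        (tl33 (im33 P ω) (P.map l ≫ P.map g' ≫ k)).hom := by
  have := congrArg (fun y => (P.mapComp f (g ≫ g')).inv ≫ P.map₂ y ≫
    (mc₄ P p n₁ h' (l ≫ g')).hom ≫ P.map p ◁ P.map n₁ ◁ P.map h' ◁ (P.mapComp l g').hom) H
  simp only [P.map₂_comp, P.map₂_whisker_left, map₂_tl12, map₂_tl22, map₂_tl33, mc₃, mc₄, Iso.trans_hom, Iso.trans_inv,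
    whiskerLeftIso_hom, whiskerLeftIso_inv, Category.assoc, Iso.inv_hom_id_assoc, whiskerLeft_comp,
    whiskerLeft_inv_hom_assoc, Category.comp_id,
    whiskerLeft₃_inv_hom,
    reassoc_of% @whiskerLeft₂_inv_hom] at this
  replace this := congrArg (fun y => (α_ _ _ k).inv ≫ y ▷ k ≫
    (α_ _ _ k).hom ≫ P.map p ◁ (α_ _ _ k).hom ≫ P.map p ◁ P.map n₁ ◁ (α_ _ _ k).hom ≫
      P.map p ◁ P.map n₁ ◁ P.map h' ◁ (α_ _ _ k).hom) this
  have e1 := congrArg (fun y => P.map p ◁ y)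
    (tl12_nat (im12 P w) (tl12 (P.mapComp g g') k).hom)
  have e2 : (tl23 (im23 P β) k).hom =
      (tl22 (im22 P β) k).hom ≫ P.map r ◁ (tl12 (P.mapComp l g') k).hom := by
    simp [tl12, tl22, tl23, im22, im23, mc₃]
  simp only [whiskerLeft_comp] at e1
  rw [reassoc_of% e1, reassoc_of% @tl12_nat, e2]
  simp only [whiskerLeft_comp, Category.assoc]
  rw [tl33_nat]
  simp only [mc₃, im12, im22, im23, im33, Iso.trans_hom, Iso.symm_hom, Iso.trans_inv,
    whiskerLeftIso_hom, whiskerLeftIso_inv, Category.assoc, comp_whiskerRight, whiskerLeft_comp, tl12, tl22, tl23, tl33,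
    whiskerRightIso_hom] at this ⊢
  refine Eq.trans ?_ (this.trans ?_) <;> bicategory

theorem im_unit {C : Type u₂} [Bicategory.{w₂, v₂} C] (P : Pseudofunctor B C) {x : a ⟶ d}
    {y : e₁ ⟶ d} {ρ : f ≫ g ≫ g' ≅ x} {β : q ≫ g' ≅ y} {ζ : c ≫ h ≫ y ≅ x}
    (H : ρ.hom = ((tl12 w' (g ≫ g')).hom ≫ c ◁ (tl22 s' g').hom) ≫ c ◁ h ◁ β.hom ≫ ζ.hom)
    {z : C} (k : P.obj d ⟶ z) :
    (tl21 (im21 P ρ) k).hom =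
      P.map f ◁ (tl12 (P.mapComp g g') k).hom ≫
        (tl12 (im12 P w') (P.map g ≫ P.map g' ≫ k)).hom ≫
        P.map c ◁ (tl22 (im22 P s') (P.map g' ≫ k)).hom ≫
        P.map c ◁ P.map h ◁ (tl21 (im21 P β) k).hom ≫ (tl31 (im31 P ζ) k).hom := by
  have := congrArg (fun y => (P.mapComp f (g ≫ g')).inv ≫ P.map₂ y) H
  simp only [P.map₂_comp, P.map₂_whisker_left, map₂_tl12, map₂_tl22, mc₃, Iso.trans_hom,
    Iso.trans_inv,
    whiskerLeftIso_hom, whiskerLeftIso_inv, Category.assoc, Iso.inv_hom_id_assoc, whiskerLeft_comp,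
    whiskerLeft_inv_hom_assoc] at this
  replace this := congrArg (fun y => (α_ _ _ k).inv ≫ y ▷ k) this
  rw [reassoc_of% @tl12_nat]
  simp only [mc₃, im12, im21, im22, im31, Iso.trans_hom, Iso.symm_hom, Iso.trans_inv,
    whiskerLeftIso_hom, whiskerLeftIso_inv, Category.assoc, comp_whiskerRight, whiskerLeft_comp, tl12, tl22, tl21, tl31,
    PrelaxFunctor.map₂Iso_hom,
    whiskerRightIso_hom]
    at this ⊢
  refine Eq.trans ?_ (this.trans ?_) <;> bicategory

end AssocImage

end

section Lax

variable {K : Type u₁} [Bicategory.{w₁, v₁} K] {L : Type u₂} [Bicategory.{w₂, v₂} L]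
  [MonoidalBicategory K] [MonoidalBicategory L] {F : StrictPseudofunctor K L}

namespace LaxMonoidal

variable (m : LaxMonoidal F)

theorem map₂_rightUnitor_inv' {a b : K} (f : a ⟶ b) :
    F.map₂ (ρ_ f).inv ≫ (F.mapComp f (𝟙 b)).hom ≫ F.map f ◁ (F.mapId b).hom =
      (ρ_ (F.map f)).inv := by
  rw [← cancel_mono (ρ_ (F.map f)).hom, Iso.inv_hom_id, ← F.map₂_id, ← Iso.inv_hom_id (ρ_ f),
    F.map₂_comp, F.map₂_right_unitor]
  simp

theorem map₂_leftUnitor_inv' {a b : K} (f : a ⟶ b) :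
    F.map₂ (λ_ f).inv ≫ (F.mapComp (𝟙 a) f).hom ≫ (F.mapId a).hom ▷ F.map f =
      (λ_ (F.map f)).inv := by
  rw [← cancel_mono (λ_ (F.map f)).hom, Iso.inv_hom_id, ← F.map₂_id, ← Iso.inv_hom_id (λ_ f),
    F.map₂_comp, F.map₂_left_unitor]
  simp

theorem μNat_split {a a' b b' : K} (f : a ⟶ a') (g : b ⟶ b') :
    IsNat (m.μNat f g) (sqH (m.μL f b) (m.μR a' g)) (tSplit (F.map f) (F.map g)).hom
      (im12 F.toPseudofunctor (tSplit f g)).hom := by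
  refine ((m.μNat_nat (ρ_ f).inv (λ_ g).inv).comp ((m.μNat_comp f (𝟙 b) (𝟙 a') g).comp
    (((m.isNat_μL f b).sqH_right _).comp ((m.isNat_μR a' g).sqH_left _)))).of_eq ?_ ?_
  · have e := tComp_nat (𝟙 (F.map f)) (F.mapId a').hom (F.mapId b).hom (𝟙 (F.map g))
    simp only [Category.assoc]
    rw [← e]
    simp only [reassoc_of% @tMap₂_comp_rev]
    simp only [id_whiskerRight, whiskerLeft_id, Category.id_comp, Category.comp_id,
      map₂_rightUnitor_inv', map₂_leftUnitor_inv']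
    simp [tSplit]
  · simp only [im12, tSplit, Iso.trans_hom, PrelaxFunctor.map₂Iso_hom, F.map₂_comp, Category.assoc, tIso_hom, Iso.symm_hom, id_whiskerRight,
      whiskerLeft_id, Category.comp_id]

theorem μNat_split' {a a' b b' : K} (f : a ⟶ a') (g : b ⟶ b') :
    IsNat (m.μNat f g) (sqH (m.μR a g) (m.μL f b')) (tSplit' (F.map f) (F.map g)).hom
      (im12 F.toPseudofunctor (tSplit' f g)).hom := by
  refine ((m.μNat_nat (λ_ f).inv (ρ_ g).inv).comp ((m.μNat_comp (𝟙 a) g f (𝟙 b')).comp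
    (((m.isNat_μR a g).sqH_right _).comp ((m.isNat_μL f b').sqH_left _)))).of_eq ?_ ?_
  · have e := tComp_nat (F.mapId a).hom (𝟙 (F.map f)) (𝟙 (F.map g)) (F.mapId b').hom
    simp only [Category.assoc]
    rw [← e]
    simp only [reassoc_of% @tMap₂_comp_rev]
    simp only [id_whiskerRight, whiskerLeft_id, Category.id_comp, Category.comp_id,
      map₂_rightUnitor_inv', map₂_leftUnitor_inv']
    simp [tSplit']
  · simp only [im12, tSplit', Iso.trans_hom, PrelaxFunctor.map₂Iso_hom, F.map₂_comp, Category.assoc, tIso_hom, Iso.symm_hom, id_whiskerRight,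
      whiskerLeft_id, Category.comp_id]

theorem μ_xch {a a' b b' : K} (f : a ⟶ a') (g : b ⟶ b') :
    IsNat (sqH (m.μL f b) (m.μR a' g)) (sqH (m.μR a g) (m.μL f b'))
      (xch (F.map f) (F.map g)).hom (im22 F.toPseudofunctor (xch f g)).hom := by
  refine (((m.μNat_split f g).symm (tSplit _ _) (im12 _ _)).comp (m.μNat_split' f g)).of_eq ?_ ?_
  · simp [xch]
  · simp only [im12, im22, xch, Iso.trans_hom, Iso.trans_inv, PrelaxFunctor.map₂Iso_hom, PrelaxFunctor.map₂Iso_inv,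
      F.map₂_comp, Category.assoc, Iso.symm_hom]

theorem xch_cL_cRL {S T : L} {a b x y : K} (t : T ⟶ F.obj a) (p : a ⟶ x) (s : S ⟶ F.obj b)
    (q : b ⟶ y) {z : L} (k : F.obj (x ⊠ₒ y) ⟶ z) :
    (tl22 (xch (t ≫ F.map p) (s ≫ F.map q)) (m.μ x y ≫ k)).hom ≫
        𝟙 T ⊠ (s ≫ F.map q) ◁ (m.cL t p y k).hom ≫ (m.cRL s q t (F.map (p ⊠ 𝟙 y) ≫ k)).hom =
      (t ≫ F.map p) ⊠ 𝟙 S ◁ (m.cR s q x k).hom ≫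
        (tl22 (xch (t ≫ F.map p) s) (m.μ x b ≫ F.map (𝟙 x ⊠ q) ≫ k)).hom ≫
        𝟙 T ⊠ s ◁ (m.cL t p b (F.map (𝟙 x ⊠ q) ≫ k)).hom ≫
        𝟙 T ⊠ s ◁ t ⊠ 𝟙 (F.obj b) ◁ m.μ a b ◁
          (tl22 (im22 F.toPseudofunctor (xch p q)) k).hom := by
  have e1 := (xch_comp_left t (F.map p) (s ≫ F.map q)).tl_comp (m.μ x y ≫ k)
  have e2 := (xch_comp_right t s (F.map q)).tl_comp (m.μ a y ≫ F.map (p ⊠ 𝟙 y) ≫ k)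
  have e3 := (xch_comp_right (F.map p) s (F.map q)).tl_comp (m.μ x y ≫ k)
  have e4 := (m.μ_xch p q).tl_exchange (k := k)
  have e5 := (xch_comp_left t (F.map p) s).tl_comp (m.μ x b ≫ F.map (𝟙 x ⊠ q) ≫ k)
  have i1 : 𝟙 T ⊠ s ◁ (tl22 (xch t (F.map q)) (m.μ a y ≫ F.map (p ⊠ 𝟙 y) ≫ k)).hom ≫
      𝟙 T ⊠ s ◁ (tl22 (xch t (F.map q)).symm (m.μ a y ≫ F.map (p ⊠ 𝟙 y) ≫ k)).hom = 𝟙 _ := by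
    rw [← whiskerLeft_comp]
    simp [tl22]
  have n1 := congrArg (fun w => t ⊠ 𝟙 _ ◁ w)
    (tl12_nat (wlComp (F.obj a) s (F.map q)) (tl22 (m.μL p y) k).hom)
  have n2 := congrArg (fun w => t ⊠ 𝟙 _ ◁ w)
    (tl22_nat (xch (F.map p) s) (tl22 (m.μR x q) k).hom)
  replace e3 := congrArg (fun w => t ⊠ 𝟙 _ ◁ w) e3
  replace e4 := congrArg (fun w => t ⊠ 𝟙 _ ◁ 𝟙 _ ⊠ s ◁ w) e4
  simp only [whiskerLeft_comp] at n1 n2 e3 e4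
  simp only [cL, cR, cRL, Iso.trans_hom, whiskerLeftIso_hom, whiskerLeft_comp, Category.assoc]
  rw [reassoc_of% e1, ← reassoc_of% @tl22_nat, ← reassoc_of% e2, reassoc_of% i1, ← tl22_nat,
    reassoc_of% n1, ← reassoc_of% e3, reassoc_of% e4, ← reassoc_of% n2, reassoc_of% e5,
    reassoc_of% @tl12_nat, reassoc_of% @tl12_nat, ← reassoc_of% @tl22_nat, ← tl22_nat]

section

variable (A : PsMonData K)

/-- The associativity 2-cell of the image of a pseudomonoid. -/
def mapAssoc : (m.μ A.X A.X ≫ F.map A.mul) ⊠ 𝟙 (F.obj A.X) ≫ m.μ A.X A.X ≫ F.map A.mul ≅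
    asc (F.obj A.X) (F.obj A.X) (F.obj A.X) ≫ 𝟙 (F.obj A.X) ⊠ (m.μ A.X A.X ≫ F.map A.mul) ≫
      m.μ A.X A.X ≫ F.map A.mul :=
  (m.mapObj A).mulAssoc

/-- The left unit 2-cell of the image of a pseudomonoid. -/
def mapOneMul : (m.ι ≫ F.map A.one) ⊠ 𝟙 (F.obj A.X) ≫ m.μ A.X A.X ≫ F.map A.mul ≅
    lun (F.obj A.X) :=
  (m.mapObj A).oneMul

/-- The right unit 2-cell of the image of a pseudomonoid. -/
def mapMulOne : 𝟙 (F.obj A.X) ⊠ (m.ι ≫ F.map A.one) ≫ m.μ A.X A.X ≫ F.map A.mul ≅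
    run (F.obj A.X) :=
  (m.mapObj A).mulOne

theorem mapAssoc_cR :
    (m.mapAssoc A).hom ≫ asc (F.obj A.X) (F.obj A.X) (F.obj A.X) ◁
        (m.cR (m.μ A.X A.X) A.mul A.X (F.map A.mul)).hom =
      (m.cL (m.μ A.X A.X) A.mul A.X (F.map A.mul)).hom ≫
        m.μ A.X A.X ⊠ 𝟙 (F.obj A.X) ◁ m.μ (A.X ⊠ₒ A.X) A.X ◁
          (im23 F.toPseudofunctor A.mulAssoc).hom ≫
        (tl33 (m.ω A.X A.X A.X) (F.map (𝟙 A.X ⊠ A.mul) ≫ F.map A.mul)).hom := by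
  rw [← whiskerLeftIso_hom _ (m.cR _ _ _ _), ← Iso.eq_comp_inv]
  simp only [mapAssoc, LaxMonoidalData.mapObj, cL, cR, tl12, tl22, tl33, im23, mapComp₃, mc₃, bicategoricalIsoComp, Iso.trans_hom,
    Iso.trans_inv, Iso.symm_hom, Iso.symm_inv, whiskerLeftIso_hom, whiskerLeftIso_inv,
    whiskerRightIso_hom, whiskerRightIso_inv, Category.assoc, BicategoricalCoherence.iso]
  bicategory

theorem mapOneMul_hom :
    (m.mapOneMul A).hom = (m.cL m.ι A.one A.X (F.map A.mul)).hom ≫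
        m.ι ⊠ 𝟙 (F.obj A.X) ◁ m.μ I A.X ◁ (im21 F.toPseudofunctor A.oneMul).hom ≫
        (m.ξ A.X).hom := by
  simp only [mapOneMul, LaxMonoidalData.mapObj, cL, tl12, tl22, im21, bicategoricalIsoComp, Iso.trans_hom,
    Iso.symm_hom, whiskerLeftIso_hom,
    whiskerRightIso_hom, Category.assoc, BicategoricalCoherence.iso]
  bicategory

theorem mapMulOne_hom :
    (m.mapMulOne A).hom = (m.cR m.ι A.one A.X (F.map A.mul)).hom ≫
        𝟙 (F.obj A.X) ⊠ m.ι ◁ m.μ A.X I ◁ (im21 F.toPseudofunctor A.mulOne).hom ≫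
        (m.ζ A.X).hom := by
  simp only [mapMulOne, LaxMonoidalData.mapObj, cR, tl12, tl22, im21, bicategoricalIsoComp, Iso.trans_hom,
    Iso.symm_hom, whiskerLeftIso_hom,
    whiskerRightIso_hom, Category.assoc, BicategoricalCoherence.iso]
  bicategory

section TensorImage

variable (b : K) {z : L}

theorem mapAssoc_tensR (k : F.obj A.X ⊠ₒ F.obj b ⟶ z) :
    (tl23 (r23 (m.mapAssoc A) (F.obj b)) k).hom ≫
        asc (F.obj A.X) (F.obj A.X) (F.obj A.X) ⊠ 𝟙 (F.obj b) ◁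
          (𝟙 (F.obj A.X) ⊠ (m.μ A.X A.X ≫ F.map A.mul)) ⊠ 𝟙 (F.obj b) ◁
          (tl12 (wrComp (m.μ A.X A.X) (F.map A.mul) (F.obj b)) k).hom ≫
        asc (F.obj A.X) (F.obj A.X) (F.obj A.X) ⊠ 𝟙 (F.obj b) ◁
          (tl12 (r12 (wlComp (F.obj A.X) (m.μ A.X A.X) (F.map A.mul)) (F.obj b))
            (m.μ A.X A.X ⊠ 𝟙 (F.obj b) ≫ F.map A.mul ⊠ 𝟙 (F.obj b) ≫ k)).hom ≫
        asc (F.obj A.X) (F.obj A.X) (F.obj A.X) ⊠ 𝟙 (F.obj b) ◁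
          (𝟙 (F.obj A.X) ⊠ m.μ A.X A.X) ⊠ 𝟙 (F.obj b) ◁
          (tl22 (r22 (m.μR A.X A.mul) (F.obj b)) (F.map A.mul ⊠ 𝟙 (F.obj b) ≫ k)).hom =
      ((m.μ A.X A.X ≫ F.map A.mul) ⊠ 𝟙 (F.obj A.X)) ⊠ 𝟙 (F.obj b) ◁
          (tl12 (wrComp (m.μ A.X A.X) (F.map A.mul) (F.obj b)) k).hom ≫
        (tl12 (r12 (wrComp (m.μ A.X A.X) (F.map A.mul) (F.obj A.X)) (F.obj b))
            (m.μ A.X A.X ⊠ 𝟙 (F.obj b) ≫ F.map A.mul ⊠ 𝟙 (F.obj b) ≫ k)).hom ≫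
        (m.μ A.X A.X ⊠ 𝟙 (F.obj A.X)) ⊠ 𝟙 (F.obj b) ◁
          (tl22 (r22 (m.μL A.mul A.X) (F.obj b)) (F.map A.mul ⊠ 𝟙 (F.obj b) ≫ k)).hom ≫
        (m.μ A.X A.X ⊠ 𝟙 (F.obj A.X)) ⊠ 𝟙 (F.obj b) ◁ m.μ (A.X ⊠ₒ A.X) A.X ⊠ 𝟙 (F.obj b) ◁
          (tl23 (r23 (im23 F.toPseudofunctor A.mulAssoc) (F.obj b)) k).hom ≫
        (tl33 (r33 (m.ω A.X A.X A.X) (F.obj b))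
          (F.map (𝟙 A.X ⊠ A.mul) ⊠ 𝟙 (F.obj b) ≫ F.map A.mul ⊠ 𝟙 (F.obj b) ≫ k)).hom :=
  im_assoc (tensR (F.obj b)) (m.mapAssoc_cR A) k

theorem mapAssoc_tensL (k : F.obj b ⊠ₒ F.obj A.X ⟶ z) :
    (tl23 (l23 (m.mapAssoc A) (F.obj b)) k).hom ≫
        𝟙 (F.obj b) ⊠ asc (F.obj A.X) (F.obj A.X) (F.obj A.X) ◁
          𝟙 (F.obj b) ⊠ (𝟙 (F.obj A.X) ⊠ (m.μ A.X A.X ≫ F.map A.mul)) ◁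
          (tl12 (wlComp (F.obj b) (m.μ A.X A.X) (F.map A.mul)) k).hom ≫
        𝟙 (F.obj b) ⊠ asc (F.obj A.X) (F.obj A.X) (F.obj A.X) ◁
          (tl12 (l12 (wlComp (F.obj A.X) (m.μ A.X A.X) (F.map A.mul)) (F.obj b))
            (𝟙 (F.obj b) ⊠ m.μ A.X A.X ≫ 𝟙 (F.obj b) ⊠ F.map A.mul ≫ k)).hom ≫
        𝟙 (F.obj b) ⊠ asc (F.obj A.X) (F.obj A.X) (F.obj A.X) ◁
          𝟙 (F.obj b) ⊠ (𝟙 (F.obj A.X) ⊠ m.μ A.X A.X) ◁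
          (tl22 (l22 (m.μR A.X A.mul) (F.obj b)) (𝟙 (F.obj b) ⊠ F.map A.mul ≫ k)).hom =
      𝟙 (F.obj b) ⊠ ((m.μ A.X A.X ≫ F.map A.mul) ⊠ 𝟙 (F.obj A.X)) ◁
          (tl12 (wlComp (F.obj b) (m.μ A.X A.X) (F.map A.mul)) k).hom ≫
        (tl12 (l12 (wrComp (m.μ A.X A.X) (F.map A.mul) (F.obj A.X)) (F.obj b))
            (𝟙 (F.obj b) ⊠ m.μ A.X A.X ≫ 𝟙 (F.obj b) ⊠ F.map A.mul ≫ k)).hom ≫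
        𝟙 (F.obj b) ⊠ (m.μ A.X A.X ⊠ 𝟙 (F.obj A.X)) ◁
          (tl22 (l22 (m.μL A.mul A.X) (F.obj b)) (𝟙 (F.obj b) ⊠ F.map A.mul ≫ k)).hom ≫
        𝟙 (F.obj b) ⊠ (m.μ A.X A.X ⊠ 𝟙 (F.obj A.X)) ◁ 𝟙 (F.obj b) ⊠ m.μ (A.X ⊠ₒ A.X) A.X ◁
          (tl23 (l23 (im23 F.toPseudofunctor A.mulAssoc) (F.obj b)) k).hom ≫
        (tl33 (l33 (m.ω A.X A.X A.X) (F.obj b))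
          (𝟙 (F.obj b) ⊠ F.map (𝟙 A.X ⊠ A.mul) ≫ 𝟙 (F.obj b) ⊠ F.map A.mul ≫ k)).hom :=
  im_assoc (tensL (F.obj b)) (m.mapAssoc_cR A) k

theorem mapMulOne_tensR (k : F.obj A.X ⊠ₒ F.obj b ⟶ z) :
    (tl21 (r21 (m.mapMulOne A) (F.obj b)) k).hom =
      (𝟙 (F.obj A.X) ⊠ (m.ι ≫ F.map A.one)) ⊠ 𝟙 (F.obj b) ◁
          (tl12 (wrComp (m.μ A.X A.X) (F.map A.mul) (F.obj b)) k).hom ≫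
        (tl12 (r12 (wlComp (F.obj A.X) m.ι (F.map A.one)) (F.obj b))
            (m.μ A.X A.X ⊠ 𝟙 (F.obj b) ≫ F.map A.mul ⊠ 𝟙 (F.obj b) ≫ k)).hom ≫
        (𝟙 (F.obj A.X) ⊠ m.ι) ⊠ 𝟙 (F.obj b) ◁
          (tl22 (r22 (m.μR A.X A.one) (F.obj b)) (F.map A.mul ⊠ 𝟙 (F.obj b) ≫ k)).hom ≫
        (𝟙 (F.obj A.X) ⊠ m.ι) ⊠ 𝟙 (F.obj b) ◁ m.μ A.X I ⊠ 𝟙 (F.obj b) ◁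
          (tl21 (r21 (im21 F.toPseudofunctor A.mulOne) (F.obj b)) k).hom ≫
        (tl31 (r31 (m.ζ A.X) (F.obj b)) k).hom :=
  im_unit (tensR (F.obj b)) (m.mapMulOne_hom A) k

theorem mapOneMul_tensL (k : F.obj b ⊠ₒ F.obj A.X ⟶ z) :
    (tl21 (l21 (m.mapOneMul A) (F.obj b)) k).hom =
      𝟙 (F.obj b) ⊠ ((m.ι ≫ F.map A.one) ⊠ 𝟙 (F.obj A.X)) ◁
          (tl12 (wlComp (F.obj b) (m.μ A.X A.X) (F.map A.mul)) k).hom ≫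
        (tl12 (l12 (wrComp m.ι (F.map A.one) (F.obj A.X)) (F.obj b))
            (𝟙 (F.obj b) ⊠ m.μ A.X A.X ≫ 𝟙 (F.obj b) ⊠ F.map A.mul ≫ k)).hom ≫
        𝟙 (F.obj b) ⊠ (m.ι ⊠ 𝟙 (F.obj A.X)) ◁
          (tl22 (l22 (m.μL A.one A.X) (F.obj b)) (𝟙 (F.obj b) ⊠ F.map A.mul ≫ k)).hom ≫
        𝟙 (F.obj b) ⊠ (m.ι ⊠ 𝟙 (F.obj A.X)) ◁ 𝟙 (F.obj b) ⊠ m.μ I A.X ◁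
          (tl21 (l21 (im21 F.toPseudofunctor A.oneMul) (F.obj b)) k).hom ≫
        (tl31 (l31 (m.ξ A.X) (F.obj b)) k).hom :=
  im_unit (tensL (F.obj b)) (m.mapOneMul_hom A) k

end TensorImage

end

end LaxMonoidal

end Lax

section Lax

variable {K : Type u₁} [Bicategory.{w₁, v₁} K] {L : Type u₂} [Bicategory.{w₂, v₂} L]
  [MonoidalBicategory K] [MonoidalBicategory L] {F : StrictPseudofunctor K L}

namespace LaxMonoidal

variable (m : LaxMonoidal F)

section

variable {a b c : K} {f : a ⟶ b} {g : b ⟶ c} {z : L}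

theorem μL_r21 {h : a ⟶ c} (s : f ≫ g ≅ h) (x : K) (k : F.obj (c ⊠ₒ x) ⟶ z) :
    F.map f ⊠ 𝟙 (F.obj x) ◁ (tl22 (m.μL g x) k).hom ≫
        (tl22 (m.μL f x) (F.map (g ⊠ 𝟙 x) ≫ k)).hom ≫
        m.μ a x ◁ (tl21 (im21 F.toPseudofunctor (r21 s x)) k).hom =
      (tl21 (r21 (im21 F.toPseudofunctor s) (F.obj x)) (m.μ c x ≫ k)).hom ≫
        (tl22 (m.μL h x) k).hom :=
  m.μL_tl21 s x k

theorem μR_l21 {h : a ⟶ c} (s : f ≫ g ≅ h) (x : K) (k : F.obj (x ⊠ₒ c) ⟶ z) :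
    𝟙 (F.obj x) ⊠ F.map f ◁ (tl22 (m.μR x g) k).hom ≫
        (tl22 (m.μR x f) (F.map (𝟙 x ⊠ g) ≫ k)).hom ≫
        m.μ x a ◁ (tl21 (im21 F.toPseudofunctor (l21 s x)) k).hom =
      (tl21 (l21 (im21 F.toPseudofunctor s) (F.obj x)) (m.μ x c ≫ k)).hom ≫
        (tl22 (m.μR x h) k).hom :=
  m.μR_tl21 s x k

variable {b' c' : K} {f' : a ⟶ b'} {g' : b' ⟶ c'} {h' : c' ⟶ c}

theorem μL_r23 (s : f ≫ g ≅ f' ≫ g' ≫ h') (x : K) (k : F.obj (c ⊠ₒ x) ⟶ z) :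
    F.map f ⊠ 𝟙 (F.obj x) ◁ (tl22 (m.μL g x) k).hom ≫
        (tl22 (m.μL f x) (F.map (g ⊠ 𝟙 x) ≫ k)).hom ≫
        m.μ a x ◁ (tl23 (im23 F.toPseudofunctor (r23 s x)) k).hom =
      (tl23 (r23 (im23 F.toPseudofunctor s) (F.obj x)) (m.μ c x ≫ k)).hom ≫
        F.map f' ⊠ 𝟙 (F.obj x) ◁ F.map g' ⊠ 𝟙 (F.obj x) ◁ (tl22 (m.μL h' x) k).hom ≫
        F.map f' ⊠ 𝟙 (F.obj x) ◁ (tl22 (m.μL g' x) (F.map (h' ⊠ 𝟙 x) ≫ k)).hom ≫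
        (tl22 (m.μL f' x) (F.map (g' ⊠ 𝟙 x) ≫ F.map (h' ⊠ 𝟙 x) ≫ k)).hom :=
  m.μL_tl23 s x k

theorem μR_l23 (s : f ≫ g ≅ f' ≫ g' ≫ h') (x : K) (k : F.obj (x ⊠ₒ c) ⟶ z) :
    𝟙 (F.obj x) ⊠ F.map f ◁ (tl22 (m.μR x g) k).hom ≫
        (tl22 (m.μR x f) (F.map (𝟙 x ⊠ g) ≫ k)).hom ≫
        m.μ x a ◁ (tl23 (im23 F.toPseudofunctor (l23 s x)) k).hom =
      (tl23 (l23 (im23 F.toPseudofunctor s) (F.obj x)) (m.μ x c ≫ k)).hom ≫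
        𝟙 (F.obj x) ⊠ F.map f' ◁ 𝟙 (F.obj x) ⊠ F.map g' ◁ (tl22 (m.μR x h') k).hom ≫
        𝟙 (F.obj x) ⊠ F.map f' ◁ (tl22 (m.μR x g') (F.map (𝟙 x ⊠ h') ≫ k)).hom ≫
        (tl22 (m.μR x f') (F.map (𝟙 x ⊠ g') ≫ F.map (𝟙 x ⊠ h') ≫ k)).hom :=
  m.μR_tl23 s x k

end

variable (A : PsMonData K) (b : K) {z : L}

theorem mapAssoc_cML (k : F.obj (A.X ⊠ₒ b) ⟶ z) :
    (tl23 (r23 (m.mapAssoc A) (F.obj b)) (m.μ A.X b ≫ k)).hom ≫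
        asc (F.obj A.X) (F.obj A.X) (F.obj A.X) ⊠ 𝟙 (F.obj b) ◁
          (𝟙 (F.obj A.X) ⊠ (m.μ A.X A.X ≫ F.map A.mul)) ⊠ 𝟙 (F.obj b) ◁
          (m.cL (m.μ A.X A.X) A.mul b k).hom ≫
        asc (F.obj A.X) (F.obj A.X) (F.obj A.X) ⊠ 𝟙 (F.obj b) ◁
          (m.cML (m.μ A.X A.X) A.mul A.X b (F.map (A.mul ⊠ 𝟙 b) ≫ k)).hom =
      ((m.μ A.X A.X ≫ F.map A.mul) ⊠ 𝟙 (F.obj A.X)) ⊠ 𝟙 (F.obj b) ◁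
          (m.cL (m.μ A.X A.X) A.mul b k).hom ≫
        (m.cLL (m.μ A.X A.X) A.mul A.X b (F.map (A.mul ⊠ 𝟙 b) ≫ k)).hom ≫
        (m.μ A.X A.X ⊠ 𝟙 (F.obj A.X)) ⊠ 𝟙 (F.obj b) ◁ m.μ (A.X ⊠ₒ A.X) A.X ⊠ 𝟙 (F.obj b) ◁
          m.μ ((A.X ⊠ₒ A.X) ⊠ₒ A.X) b ◁
          (tl23 (im23 F.toPseudofunctor (r23 A.mulAssoc b)) k).hom ≫
        (m.μ A.X A.X ⊠ 𝟙 (F.obj A.X)) ⊠ 𝟙 (F.obj b) ◁ m.μ (A.X ⊠ₒ A.X) A.X ⊠ 𝟙 (F.obj b) ◁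
          (tl22 (m.μL (asc A.X A.X A.X) b)
            (F.map ((𝟙 A.X ⊠ A.mul) ⊠ 𝟙 b) ≫ F.map (A.mul ⊠ 𝟙 b) ≫ k)).inv ≫
        (tl33 (r33 (m.ω A.X A.X A.X) (F.obj b))
          (m.μ (A.X ⊠ₒ A.X ⊠ₒ A.X) b ≫ F.map ((𝟙 A.X ⊠ A.mul) ⊠ 𝟙 b) ≫
            F.map (A.mul ⊠ 𝟙 b) ≫ k)).hom := by
  have e := m.μL_r23 A.mulAssoc b k
  rw [← Category.assoc, ← Category.assoc, ← Category.assoc, ← Iso.comp_inv_eq] at e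
  simp only [Category.assoc] at e
  replace e := congrArg (fun w => (m.μ A.X A.X ⊠ 𝟙 (F.obj A.X)) ⊠ 𝟙 (F.obj b) ◁
    m.μ (A.X ⊠ₒ A.X) A.X ⊠ 𝟙 (F.obj b) ◁ w) e
  have n1 := congrArg (fun w => asc (F.obj A.X) (F.obj A.X) (F.obj A.X) ⊠ 𝟙 (F.obj b) ◁ w)
    (tl12_nat (r12 (wlComp (F.obj A.X) (m.μ A.X A.X) (F.map A.mul)) (F.obj b))
      (m.μ A.X A.X ⊠ 𝟙 (F.obj b) ◁ (tl22 (m.μL A.mul b) k).hom))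
  have n2 := congrArg (fun w => asc (F.obj A.X) (F.obj A.X) (F.obj A.X) ⊠ 𝟙 (F.obj b) ◁
      (𝟙 (F.obj A.X) ⊠ m.μ A.X A.X) ⊠ 𝟙 (F.obj b) ◁ w)
    (tl22_nat (r22 (m.μR A.X A.mul) (F.obj b)) (tl22 (m.μL A.mul b) k).hom)
  have n3 := congrArg (fun w => (m.μ A.X A.X ⊠ 𝟙 (F.obj A.X)) ⊠ 𝟙 (F.obj b) ◁ w)
    (tl22_nat (r22 (m.μL A.mul A.X) (F.obj b)) (tl22 (m.μL A.mul b) k).hom)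
  have n0 := tl12_nat (r12 (wrComp (m.μ A.X A.X) (F.map A.mul) (F.obj A.X)) (F.obj b))
    (m.μ A.X A.X ⊠ 𝟙 (F.obj b) ◁ (tl22 (m.μL A.mul b) k).hom)
  simp only [whiskerLeft_comp] at e n0 n1 n2 n3
  simp only [cL, cML, cLL, Iso.trans_hom, whiskerLeftIso_hom, whiskerLeft_comp, Category.assoc]
  rw [reassoc_of% n1, reassoc_of% n2, reassoc_of% (m.mapAssoc_tensR A b), ← reassoc_of% @tl33_nat,
    ← tl33_nat, reassoc_of% n0, reassoc_of% n3, reassoc_of% e]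

theorem mapAssoc_cRR (k : F.obj (b ⊠ₒ A.X) ⟶ z) :
    (tl23 (l23 (m.mapAssoc A) (F.obj b)) (m.μ b A.X ≫ k)).hom ≫
        𝟙 (F.obj b) ⊠ asc (F.obj A.X) (F.obj A.X) (F.obj A.X) ◁
          𝟙 (F.obj b) ⊠ (𝟙 (F.obj A.X) ⊠ (m.μ A.X A.X ≫ F.map A.mul)) ◁
          (m.cR (m.μ A.X A.X) A.mul b k).hom ≫
        𝟙 (F.obj b) ⊠ asc (F.obj A.X) (F.obj A.X) (F.obj A.X) ◁
          (m.cRR (m.μ A.X A.X) A.mul b A.X (F.map (𝟙 b ⊠ A.mul) ≫ k)).hom =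
      𝟙 (F.obj b) ⊠ ((m.μ A.X A.X ≫ F.map A.mul) ⊠ 𝟙 (F.obj A.X)) ◁
          (m.cR (m.μ A.X A.X) A.mul b k).hom ≫
        (m.cMR (m.μ A.X A.X) A.mul b A.X (F.map (𝟙 b ⊠ A.mul) ≫ k)).hom ≫
        𝟙 (F.obj b) ⊠ (m.μ A.X A.X ⊠ 𝟙 (F.obj A.X)) ◁ 𝟙 (F.obj b) ⊠ m.μ (A.X ⊠ₒ A.X) A.X ◁
          m.μ b ((A.X ⊠ₒ A.X) ⊠ₒ A.X) ◁
          (tl23 (im23 F.toPseudofunctor (l23 A.mulAssoc b)) k).hom ≫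
        𝟙 (F.obj b) ⊠ (m.μ A.X A.X ⊠ 𝟙 (F.obj A.X)) ◁ 𝟙 (F.obj b) ⊠ m.μ (A.X ⊠ₒ A.X) A.X ◁
          (tl22 (m.μR b (asc A.X A.X A.X))
            (F.map (𝟙 b ⊠ (𝟙 A.X ⊠ A.mul)) ≫ F.map (𝟙 b ⊠ A.mul) ≫ k)).inv ≫
        (tl33 (l33 (m.ω A.X A.X A.X) (F.obj b))
          (m.μ b (A.X ⊠ₒ A.X ⊠ₒ A.X) ≫ F.map (𝟙 b ⊠ (𝟙 A.X ⊠ A.mul)) ≫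
            F.map (𝟙 b ⊠ A.mul) ≫ k)).hom := by
  have e := m.μR_l23 A.mulAssoc b k
  rw [← Category.assoc, ← Category.assoc, ← Category.assoc, ← Iso.comp_inv_eq] at e
  simp only [Category.assoc] at e
  replace e := congrArg (fun w => 𝟙 (F.obj b) ⊠ (m.μ A.X A.X ⊠ 𝟙 (F.obj A.X)) ◁
    𝟙 (F.obj b) ⊠ m.μ (A.X ⊠ₒ A.X) A.X ◁ w) e
  have n1 := congrArg (fun w => 𝟙 (F.obj b) ⊠ asc (F.obj A.X) (F.obj A.X) (F.obj A.X) ◁ w)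
    (tl12_nat (l12 (wlComp (F.obj A.X) (m.μ A.X A.X) (F.map A.mul)) (F.obj b))
      (𝟙 (F.obj b) ⊠ m.μ A.X A.X ◁ (tl22 (m.μR b A.mul) k).hom))
  have n2 := congrArg (fun w => 𝟙 (F.obj b) ⊠ asc (F.obj A.X) (F.obj A.X) (F.obj A.X) ◁
      𝟙 (F.obj b) ⊠ (𝟙 (F.obj A.X) ⊠ m.μ A.X A.X) ◁ w)
    (tl22_nat (l22 (m.μR A.X A.mul) (F.obj b)) (tl22 (m.μR b A.mul) k).hom)
  have n3 := congrArg (fun w => 𝟙 (F.obj b) ⊠ (m.μ A.X A.X ⊠ 𝟙 (F.obj A.X)) ◁ w)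
    (tl22_nat (l22 (m.μL A.mul A.X) (F.obj b)) (tl22 (m.μR b A.mul) k).hom)
  have n0 := tl12_nat (l12 (wrComp (m.μ A.X A.X) (F.map A.mul) (F.obj A.X)) (F.obj b))
    (𝟙 (F.obj b) ⊠ m.μ A.X A.X ◁ (tl22 (m.μR b A.mul) k).hom)
  simp only [whiskerLeft_comp] at e n0 n1 n2 n3
  simp only [cR, cMR, cRR, Iso.trans_hom, whiskerLeftIso_hom, whiskerLeft_comp, Category.assoc]
  rw [reassoc_of% n1, reassoc_of% n2, reassoc_of% (m.mapAssoc_tensL A b), ← reassoc_of% @tl33_nat,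
    ← tl33_nat, reassoc_of% n0, reassoc_of% n3, reassoc_of% e]

theorem mapMulOne_cL (k : F.obj (A.X ⊠ₒ b) ⟶ z) :
    (tl21 (r21 (m.mapMulOne A) (F.obj b)) (m.μ A.X b ≫ k)).hom =
      (𝟙 (F.obj A.X) ⊠ (m.ι ≫ F.map A.one)) ⊠ 𝟙 (F.obj b) ◁
          (m.cL (m.μ A.X A.X) A.mul b k).hom ≫
        (m.cML m.ι A.one A.X b (F.map (A.mul ⊠ 𝟙 b) ≫ k)).hom ≫
        (𝟙 (F.obj A.X) ⊠ m.ι) ⊠ 𝟙 (F.obj b) ◁ m.μ A.X I ⊠ 𝟙 (F.obj b) ◁ m.μ (A.X ⊠ₒ I) b ◁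
          (tl21 (im21 F.toPseudofunctor (r21 A.mulOne b)) k).hom ≫
        (𝟙 (F.obj A.X) ⊠ m.ι) ⊠ 𝟙 (F.obj b) ◁ m.μ A.X I ⊠ 𝟙 (F.obj b) ◁
          (tl22 (m.μL (run A.X) b) k).inv ≫
        (tl31 (r31 (m.ζ A.X) (F.obj b)) (m.μ A.X b ≫ k)).hom := by
  have e := m.μL_r21 A.mulOne b k
  rw [← Iso.comp_inv_eq] at e
  simp only [Category.assoc] at e
  replace e := congrArg (fun w => (𝟙 (F.obj A.X) ⊠ m.ι) ⊠ 𝟙 (F.obj b) ◁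
    m.μ A.X I ⊠ 𝟙 (F.obj b) ◁ w) e
  have n3 := congrArg (fun w => (𝟙 (F.obj A.X) ⊠ m.ι) ⊠ 𝟙 (F.obj b) ◁ w)
    (tl22_nat (r22 (m.μR A.X A.one) (F.obj b)) (tl22 (m.μL A.mul b) k).hom)
  have n0 := tl12_nat (r12 (wlComp (F.obj A.X) m.ι (F.map A.one)) (F.obj b))
    (m.μ A.X A.X ⊠ 𝟙 (F.obj b) ◁ (tl22 (m.μL A.mul b) k).hom)
  simp only [whiskerLeft_comp] at e n0 n3
  simp only [cL, cML, Iso.trans_hom, whiskerLeftIso_hom, whiskerLeft_comp, Category.assoc]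
  rw [m.mapMulOne_tensR A b, reassoc_of% n0, reassoc_of% n3, reassoc_of% e]

theorem mapOneMul_cR (k : F.obj (b ⊠ₒ A.X) ⟶ z) :
    (tl21 (l21 (m.mapOneMul A) (F.obj b)) (m.μ b A.X ≫ k)).hom =
      𝟙 (F.obj b) ⊠ ((m.ι ≫ F.map A.one) ⊠ 𝟙 (F.obj A.X)) ◁
          (m.cR (m.μ A.X A.X) A.mul b k).hom ≫
        (m.cMR m.ι A.one b A.X (F.map (𝟙 b ⊠ A.mul) ≫ k)).hom ≫
        𝟙 (F.obj b) ⊠ (m.ι ⊠ 𝟙 (F.obj A.X)) ◁ 𝟙 (F.obj b) ⊠ m.μ I A.X ◁ m.μ b (I ⊠ₒ A.X) ◁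
          (tl21 (im21 F.toPseudofunctor (l21 A.oneMul b)) k).hom ≫
        𝟙 (F.obj b) ⊠ (m.ι ⊠ 𝟙 (F.obj A.X)) ◁ 𝟙 (F.obj b) ⊠ m.μ I A.X ◁
          (tl22 (m.μR b (lun A.X)) k).inv ≫
        (tl31 (l31 (m.ξ A.X) (F.obj b)) (m.μ b A.X ≫ k)).hom := by
  have e := m.μR_l21 A.oneMul b k
  rw [← Iso.comp_inv_eq] at e
  simp only [Category.assoc] at e
  replace e := congrArg (fun w => 𝟙 (F.obj b) ⊠ (m.ι ⊠ 𝟙 (F.obj A.X)) ◁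
    𝟙 (F.obj b) ⊠ m.μ I A.X ◁ w) e
  have n3 := congrArg (fun w => 𝟙 (F.obj b) ⊠ (m.ι ⊠ 𝟙 (F.obj A.X)) ◁ w)
    (tl22_nat (l22 (m.μL A.one A.X) (F.obj b)) (tl22 (m.μR b A.mul) k).hom)
  have n0 := tl12_nat (l12 (wrComp m.ι (F.map A.one) (F.obj A.X)) (F.obj b))
    (𝟙 (F.obj b) ⊠ m.μ A.X A.X ◁ (tl22 (m.μR b A.mul) k).hom)
  simp only [whiskerLeft_comp] at e n0 n3
  simp only [cR, cMR, Iso.trans_hom, whiskerLeftIso_hom, whiskerLeft_comp, Category.assoc]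
  rw [m.mapOneMul_tensL A b, reassoc_of% n0, reassoc_of% n3, reassoc_of% e]

end LaxMonoidal

end Lax

section Tails

variable {K : Type u₁} [Bicategory.{w₁, v₁} K] [MonoidalBicategory K]

/-- The pentagon axiom of a pseudomonoid, without associators. -/
def PsMonData.Pentagon (A : PsMonData K) : Prop :=
  (A.mul ⊠ 𝟙 A.X) ⊠ 𝟙 A.X ◁ A.mulAssoc.hom ≫
      (tl22 (ascL A.mul A.X A.X) (𝟙 A.X ⊠ A.mul ≫ A.mul)).hom ≫
      asc (A.X ⊠ₒ A.X) A.X A.X ◁ (tl22 (xch A.mul A.mul) A.mul).hom ≫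
      asc (A.X ⊠ₒ A.X) A.X A.X ◁ 𝟙 (A.X ⊠ₒ A.X) ⊠ A.mul ◁ A.mulAssoc.hom ≫
      asc (A.X ⊠ₒ A.X) A.X A.X ◁ (tl22 (ascR A.X A.X A.mul) (𝟙 A.X ⊠ A.mul ≫ A.mul)).hom =
    (tl23 (r23 A.mulAssoc A.X) A.mul).hom ≫
      asc A.X A.X A.X ⊠ 𝟙 A.X ◁ (𝟙 A.X ⊠ A.mul) ⊠ 𝟙 A.X ◁ A.mulAssoc.hom ≫
      asc A.X A.X A.X ⊠ 𝟙 A.X ◁ (tl22 (ascM A.X A.mul A.X) (𝟙 A.X ⊠ A.mul ≫ A.mul)).hom ≫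
      asc A.X A.X A.X ⊠ 𝟙 A.X ◁ asc A.X (A.X ⊠ₒ A.X) A.X ◁
        (tl23 (l23 A.mulAssoc A.X) A.mul).hom ≫
      (tl32 (pent A.X A.X A.X A.X) (𝟙 A.X ⊠ (𝟙 A.X ⊠ A.mul) ≫ 𝟙 A.X ⊠ A.mul ≫ A.mul)).hom

/-- The triangle axiom of a pseudomonoid, without associators. -/
def PsMonData.Triangle (A : PsMonData K) : Prop :=
  (tl21 (r21 A.mulOne A.X) A.mul).hom =
    (𝟙 A.X ⊠ A.one) ⊠ 𝟙 A.X ◁ A.mulAssoc.hom ≫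
      (tl22 (ascM A.X A.one A.X) (𝟙 A.X ⊠ A.mul ≫ A.mul)).hom ≫
      asc A.X I A.X ◁ (tl21 (l21 A.oneMul A.X) A.mul).hom ≫
      (tl21 (midU A.X A.X) A.mul).hom

theorem r23_hom {a b b' c' d : K} {f : a ⟶ b} {g : b ⟶ d} {f' : a ⟶ b'} {g' : b' ⟶ c'}
    {h' : c' ⟶ d} (s : f ≫ g ≅ f' ≫ g' ≫ h') (z : K) :
    (r23 s z).hom = (wrComp f g z).inv ≫ s.hom ⊠₂ 𝟙 (𝟙 z) ≫ (wrComp₃ f' g' h' z).hom := rfl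

theorem l23_hom {a b b' c' d : K} {f : a ⟶ b} {g : b ⟶ d} {f' : a ⟶ b'} {g' : b' ⟶ c'}
    {h' : c' ⟶ d} (s : f ≫ g ≅ f' ≫ g' ≫ h') (z : K) :
    (l23 s z).hom = (wlComp z f g).inv ≫ 𝟙 (𝟙 z) ⊠₂ s.hom ≫ (wlComp₃ z f' g' h').hom := rfl

theorem r33_hom {a b b' c c' d : K} {f : a ⟶ b} {g : b ⟶ c} {h : c ⟶ d} {f' : a ⟶ b'}
    {g' : b' ⟶ c'} {h' : c' ⟶ d} (s : f ≫ g ≫ h ≅ f' ≫ g' ≫ h') (z : K) :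
    (r33 s z).hom = (wrComp₃ f g h z).inv ≫ s.hom ⊠₂ 𝟙 (𝟙 z) ≫ (wrComp₃ f' g' h' z).hom := rfl

theorem l33_hom {a b b' c c' d : K} {f : a ⟶ b} {g : b ⟶ c} {h : c ⟶ d} {f' : a ⟶ b'}
    {g' : b' ⟶ c'} {h' : c' ⟶ d} (s : f ≫ g ≫ h ≅ f' ≫ g' ≫ h') (z : K) :
    (l33 s z).hom = (wlComp₃ z f g h).inv ≫ 𝟙 (𝟙 z) ⊠₂ s.hom ≫ (wlComp₃ z f' g' h').hom := rfl

theorem r31_hom {a b c d : K} {f : a ⟶ b} {g : b ⟶ c} {h : c ⟶ d} {f' : a ⟶ d}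
    (s : f ≫ g ≫ h ≅ f') (z : K) :
    (r31 s z).hom = (wrComp₃ f g h z).inv ≫ s.hom ⊠₂ 𝟙 (𝟙 z) := rfl

theorem l31_hom {a b c d : K} {f : a ⟶ b} {g : b ⟶ c} {h : c ⟶ d} {f' : a ⟶ d}
    (s : f ≫ g ≫ h ≅ f') (z : K) :
    (l31 s z).hom = (wlComp₃ z f g h).inv ≫ 𝟙 (𝟙 z) ⊠₂ s.hom := rfl

theorem r21_hom {a b c : K} {f : a ⟶ c} {u : a ⟶ b} {g : b ⟶ c} (s : u ≫ g ≅ f) (z : K) :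
    (r21 s z).hom = (wrComp u g z).inv ≫ s.hom ⊠₂ 𝟙 (𝟙 z) := rfl

theorem l21_hom {a b c : K} {f : a ⟶ c} {u : a ⟶ b} {g : b ⟶ c} (s : u ≫ g ≅ f) (z : K) :
    (l21 s z).hom = (wlComp z u g).inv ≫ 𝟙 (𝟙 z) ⊠₂ s.hom := rfl

theorem PsMonData.pentagon_iff (A : PsMonData K) :
    A.Pentagon ↔
      (𝟙 ((A.mul ⊠ 𝟙 A.X) ⊠ 𝟙 A.X ≫ A.mul ⊠ 𝟙 A.X ≫ A.mul) ⊗≫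
        (A.mul ⊠ 𝟙 A.X) ⊠ 𝟙 A.X ◁ A.mulAssoc.hom ⊗≫
        (ascL A.mul A.X A.X).hom ▷ (𝟙 A.X ⊠ A.mul ≫ A.mul) ⊗≫
        asc (A.X ⊠ₒ A.X) A.X A.X ◁ (xch A.mul A.mul).hom ▷ A.mul ⊗≫
        (asc (A.X ⊠ₒ A.X) A.X A.X ≫ 𝟙 (A.X ⊠ₒ A.X) ⊠ A.mul) ◁ A.mulAssoc.hom ⊗≫
        asc (A.X ⊠ₒ A.X) A.X A.X ◁ (ascR A.X A.X A.mul).hom ▷ (𝟙 A.X ⊠ A.mul ≫ A.mul) ⊗≫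
        𝟙 (asc (A.X ⊠ₒ A.X) A.X A.X ≫ asc A.X A.X (A.X ⊠ₒ A.X) ≫ 𝟙 A.X ⊠ (𝟙 A.X ⊠ A.mul) ≫ 𝟙 A.X ⊠ A.mul ≫ A.mul)) =
      (𝟙 ((A.mul ⊠ 𝟙 A.X) ⊠ 𝟙 A.X ≫ A.mul ⊠ 𝟙 A.X ≫ A.mul) ⊗≫
        ((wrComp (A.mul ⊠ 𝟙 A.X) A.mul A.X).inv ≫ A.mulAssoc.hom ⊠₂ 𝟙 (𝟙 A.X) ≫
          (wrComp₃ (asc A.X A.X A.X) (𝟙 A.X ⊠ A.mul) A.mul A.X).hom) ▷ A.mul ⊗≫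
        (asc A.X A.X A.X ⊠ 𝟙 A.X ≫ (𝟙 A.X ⊠ A.mul) ⊠ 𝟙 A.X) ◁ A.mulAssoc.hom ⊗≫
        asc A.X A.X A.X ⊠ 𝟙 A.X ◁ (ascM A.X A.mul A.X).hom ▷ (𝟙 A.X ⊠ A.mul ≫ A.mul) ⊗≫
        (asc A.X A.X A.X ⊠ 𝟙 A.X ≫ asc A.X (A.X ⊠ₒ A.X) A.X) ◁
          ((wlComp A.X (A.mul ⊠ 𝟙 A.X) A.mul).inv ≫ 𝟙 (𝟙 A.X) ⊠₂ A.mulAssoc.hom ≫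
            (wlComp₃ A.X (asc A.X A.X A.X) (𝟙 A.X ⊠ A.mul) A.mul).hom) ▷ A.mul ⊗≫
        (pent A.X A.X A.X A.X).hom ▷ (𝟙 A.X ⊠ (𝟙 A.X ⊠ A.mul) ≫ 𝟙 A.X ⊠ A.mul ≫ A.mul) ⊗≫
        𝟙 (asc (A.X ⊠ₒ A.X) A.X A.X ≫ asc A.X A.X (A.X ⊠ₒ A.X) ≫ 𝟙 A.X ⊠ (𝟙 A.X ⊠ A.mul) ≫ 𝟙 A.X ⊠ A.mul ≫ A.mul)) := by
  have e₁ {p q : ((A.mul ⊠ 𝟙 A.X) ⊠ 𝟙 A.X ≫ A.mul ⊠ 𝟙 A.X ≫ A.mul) ⟶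
      (asc (A.X ⊠ₒ A.X) A.X A.X ≫ asc A.X A.X (A.X ⊠ₒ A.X) ≫ 𝟙 A.X ⊠ (𝟙 A.X ⊠ A.mul) ≫
        𝟙 A.X ⊠ A.mul ≫ A.mul)} {p' q'} (h : p = p') (h' : q = q') : p = q ↔ p' = q' := by
    rw [h, h']
  simp only [PsMonData.Pentagon, tl22, tl23, tl32, Iso.trans_hom, Iso.symm_hom,
    whiskerLeftIso_hom, whiskerRightIso_hom, r23_hom, l23_hom]
  exact e₁ (by bicategory) (by bicategory)

theorem PsMonData.triangle_iff (A : PsMonData K) :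
    A.Triangle ↔
      (𝟙 ((𝟙 A.X ⊠ A.one) ⊠ 𝟙 A.X ≫ A.mul ⊠ 𝟙 A.X ≫ A.mul) ⊗≫
        ((wrComp (𝟙 A.X ⊠ A.one) A.mul A.X).inv ≫ A.mulOne.hom ⊠₂ 𝟙 (𝟙 A.X)) ▷ A.mul ⊗≫
        𝟙 (run A.X ⊠ 𝟙 A.X ≫ A.mul)) =
      (𝟙 ((𝟙 A.X ⊠ A.one) ⊠ 𝟙 A.X ≫ A.mul ⊠ 𝟙 A.X ≫ A.mul) ⊗≫
        (𝟙 A.X ⊠ A.one) ⊠ 𝟙 A.X ◁ A.mulAssoc.hom ⊗≫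
        (ascM A.X A.one A.X).hom ▷ (𝟙 A.X ⊠ A.mul ≫ A.mul) ⊗≫
        asc A.X I A.X ◁ ((wlComp A.X (A.one ⊠ 𝟙 A.X) A.mul).inv ≫ 𝟙 (𝟙 A.X) ⊠₂ A.oneMul.hom) ▷ A.mul ⊗≫
        (midU A.X A.X).hom ▷ A.mul ⊗≫
        𝟙 (run A.X ⊠ 𝟙 A.X ≫ A.mul)) := by
  have e₁ {p q : ((𝟙 A.X ⊠ A.one) ⊠ 𝟙 A.X ≫ A.mul ⊠ 𝟙 A.X ≫ A.mul) ⟶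
      run A.X ⊠ 𝟙 A.X ≫ A.mul} {p' q'} (h : p = p') (h' : q = q') : p = q ↔ p' = q' := by
    rw [h, h']
  simp only [PsMonData.Triangle, tl22, tl21, Iso.trans_hom, Iso.symm_hom,
    whiskerRightIso_hom, r21_hom, l21_hom]
  exact e₁ (by bicategory) (by bicategory)

theorem PsMon.pentagon' (A : PsMon K) : A.Pentagon :=
  A.pentagon_iff.2 A.pentagon

theorem PsMon.triangle' (A : PsMon K) : A.Triangle :=
  A.triangle_iff.2 A.triangle

end Tails

section Lax

variable {K : Type u₁} [Bicategory.{w₁, v₁} K] {L : Type u₂} [Bicategory.{w₂, v₂} L]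
  [MonoidalBicategory K] [MonoidalBicategory L] {F : StrictPseudofunctor K L}

theorem PsMonData.Pentagon.map {A : PsMonData K} (H : A.Pentagon)
    (F : StrictPseudofunctor K L) :
    F.map ((A.mul ⊠ 𝟙 A.X) ⊠ 𝟙 A.X) ◁ (im23 F.toPseudofunctor A.mulAssoc).hom ≫
      (tl22 (im22 F.toPseudofunctor (ascL A.mul A.X A.X))
        (F.map (𝟙 A.X ⊠ A.mul) ≫ F.map A.mul)).hom ≫
      F.map (asc (A.X ⊠ₒ A.X) A.X A.X) ◁
        (tl22 (im22 F.toPseudofunctor (xch A.mul A.mul)) (F.map A.mul)).hom ≫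
      F.map (asc (A.X ⊠ₒ A.X) A.X A.X) ◁ F.map (𝟙 (A.X ⊠ₒ A.X) ⊠ A.mul) ◁
        (im23 F.toPseudofunctor A.mulAssoc).hom ≫
      F.map (asc (A.X ⊠ₒ A.X) A.X A.X) ◁
        (tl22 (im22 F.toPseudofunctor (ascR A.X A.X A.mul))
          (F.map (𝟙 A.X ⊠ A.mul) ≫ F.map A.mul)).hom =
    (tl23 (im23 F.toPseudofunctor (r23 A.mulAssoc A.X)) (F.map A.mul)).hom ≫
      F.map (asc A.X A.X A.X ⊠ 𝟙 A.X) ◁ F.map ((𝟙 A.X ⊠ A.mul) ⊠ 𝟙 A.X) ◁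
        (im23 F.toPseudofunctor A.mulAssoc).hom ≫
      F.map (asc A.X A.X A.X ⊠ 𝟙 A.X) ◁
        (tl22 (im22 F.toPseudofunctor (ascM A.X A.mul A.X))
          (F.map (𝟙 A.X ⊠ A.mul) ≫ F.map A.mul)).hom ≫
      F.map (asc A.X A.X A.X ⊠ 𝟙 A.X) ◁ F.map (asc A.X (A.X ⊠ₒ A.X) A.X) ◁
        (tl23 (im23 F.toPseudofunctor (l23 A.mulAssoc A.X)) (F.map A.mul)).hom ≫
      (tl32 (im32 F.toPseudofunctor (pent A.X A.X A.X A.X))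
        (F.map (𝟙 A.X ⊠ (𝟙 A.X ⊠ A.mul)) ≫ F.map (𝟙 A.X ⊠ A.mul) ≫ F.map A.mul)).hom := by
  have h := congrArg (fun y => (mc₃ F.toPseudofunctor _ _ _).inv ≫ F.map₂ y ≫
    (mc₄ F.toPseudofunctor _ _ _ _).hom ≫ _ ◁ _ ◁ _ ◁ (F.mapComp _ _).hom) H
  have e : (im23 F.toPseudofunctor A.mulAssoc).hom = (F.mapComp _ _).inv ≫ F.map₂ A.mulAssoc.hom ≫
      (F.mapComp _ _).hom ≫ F.map (asc A.X A.X A.X) ◁ (F.mapComp (𝟙 A.X ⊠ A.mul) A.mul).hom := rfl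
  have e2 := tl32_nat (im32 F.toPseudofunctor (pent A.X A.X A.X A.X))
    (mc₃ F.toPseudofunctor (𝟙 A.X ⊠ (𝟙 A.X ⊠ A.mul)) (𝟙 A.X ⊠ A.mul) A.mul).hom
  have e2' := (whiskerLeftIso _ (whiskerLeftIso _ (whiskerLeftIso _
    (mc₃ F.toPseudofunctor (𝟙 A.X ⊠ (𝟙 A.X ⊠ A.mul)) (𝟙 A.X ⊠ A.mul) A.mul)))).eq_inv_comp.mpr e2
  have e3 := tl22_nat (im22 F.toPseudofunctor (ascL A.mul A.X A.X))
    (F.mapComp (𝟙 A.X ⊠ A.mul) A.mul).hom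
  have e4 := congrArg (fun y => F.map (asc (A.X ⊠ₒ A.X) A.X A.X) ◁ y)
    (tl22_nat (im22 F.toPseudofunctor (ascR A.X A.X A.mul)) (F.mapComp (𝟙 A.X ⊠ A.mul) A.mul).hom)
  have e5 := congrArg (fun y => F.map (asc A.X A.X A.X ⊠ 𝟙 A.X) ◁ y)
    (tl22_nat (im22 F.toPseudofunctor (ascM A.X A.mul A.X)) (F.mapComp (𝟙 A.X ⊠ A.mul) A.mul).hom)
  simp only [whiskerLeft_comp] at e4 e5
  simp only [F.map₂_comp, F.map₂_whisker_left, map₂_tl22, map₂_tl23, map₂_tl32, mc₄,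
    Iso.trans_hom, whiskerLeftIso_hom, whiskerLeft_comp,
    whiskerLeft_inv_hom_assoc, Category.assoc,
    Iso.inv_hom_id_assoc] at h
  rw [e]
  simp only [whiskerLeft_comp, Category.assoc]
  rw [reassoc_of% e3, e4, reassoc_of% e5, e2']
  simp only [mc₃, Iso.trans_hom, Iso.trans_inv, whiskerLeftIso_hom,
    whiskerLeftIso_inv, Category.assoc, Iso.inv_hom_id_assoc, whiskerLeft_comp, whiskerLeft_inv_hom_assoc, reassoc_of% @whiskerLeft₂_inv_hom] at h ⊢
  exact h

theorem PsMonData.Triangle.map {A : PsMonData K} (H : A.Triangle)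
    (F : StrictPseudofunctor K L) :
    (tl21 (im21 F.toPseudofunctor (r21 A.mulOne A.X)) (F.map A.mul)).hom =
      F.map ((𝟙 A.X ⊠ A.one) ⊠ 𝟙 A.X) ◁ (im23 F.toPseudofunctor A.mulAssoc).hom ≫
      (tl22 (im22 F.toPseudofunctor (ascM A.X A.one A.X))
        (F.map (𝟙 A.X ⊠ A.mul) ≫ F.map A.mul)).hom ≫
      F.map (asc A.X I A.X) ◁
        (tl21 (im21 F.toPseudofunctor (l21 A.oneMul A.X)) (F.map A.mul)).hom ≫
      (tl21 (im21 F.toPseudofunctor (midU A.X A.X)) (F.map A.mul)).hom := by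
  have h := congrArg (fun y => (mc₃ F.toPseudofunctor _ _ _).inv ≫ F.map₂ y ≫
    (F.mapComp _ _).hom) H
  have e : (im23 F.toPseudofunctor A.mulAssoc).hom = (F.mapComp _ _).inv ≫ F.map₂ A.mulAssoc.hom ≫
      (F.mapComp _ _).hom ≫ F.map (asc A.X A.X A.X) ◁ (F.mapComp (𝟙 A.X ⊠ A.mul) A.mul).hom := rfl
  have e3 := tl22_nat (im22 F.toPseudofunctor (ascM A.X A.one A.X))
    (F.mapComp (𝟙 A.X ⊠ A.mul) A.mul).hom
  simp only [F.map₂_comp, F.map₂_whisker_left, map₂_tl22, map₂_tl21] at h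
  rw [e]
  simp only [whiskerLeft_comp, Category.assoc]
  rw [reassoc_of% e3]
  simp only [mc₃, Iso.trans_hom, Iso.trans_inv, whiskerLeftIso_hom,
    whiskerLeftIso_inv, Category.assoc, Iso.inv_hom_id_assoc, Iso.inv_hom_id,
    whiskerLeft_comp, whiskerLeft_inv_hom_assoc, Category.comp_id] at h ⊢
  exact h

namespace LaxMonoidal

variable (m : LaxMonoidal F)

theorem assoc_coherence_tail (a b c d : K) {z : L} (k : F.obj (a ⊠ₒ b ⊠ₒ c ⊠ₒ d) ⟶ z) :
    (m.μ a b ⊠ 𝟙 (F.obj c)) ⊠ 𝟙 (F.obj d) ◁ m.μ (a ⊠ₒ b) c ⊠ 𝟙 (F.obj d) ◁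
        m.μ ((a ⊠ₒ b) ⊠ₒ c) d ◁ (tl32 (im32 F.toPseudofunctor (pent a b c d)) k).hom ≫
      (m.μ a b ⊠ 𝟙 (F.obj c)) ⊠ 𝟙 (F.obj d) ◁
        (tl33 (m.ω (a ⊠ₒ b) c d) (F.map (asc a b (c ⊠ₒ d)) ≫ k)).hom ≫
      (tl22 (ascL (m.μ a b) (F.obj c) (F.obj d)) (𝟙 (F.obj (a ⊠ₒ b)) ⊠ m.μ c d ≫
        m.μ (a ⊠ₒ b) (c ⊠ₒ d) ≫ F.map (asc a b (c ⊠ₒ d)) ≫ k)).hom ≫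
      asc (F.obj a ⊠ₒ F.obj b) (F.obj c) (F.obj d) ◁ (tl22 (xch (m.μ a b) (m.μ c d))
        (m.μ (a ⊠ₒ b) (c ⊠ₒ d) ≫ F.map (asc a b (c ⊠ₒ d)) ≫ k)).hom ≫
      asc (F.obj a ⊠ₒ F.obj b) (F.obj c) (F.obj d) ◁ 𝟙 (F.obj a ⊠ₒ F.obj b) ⊠ m.μ c d ◁
        (tl33 (m.ω a b (c ⊠ₒ d)) k).hom ≫
      asc (F.obj a ⊠ₒ F.obj b) (F.obj c) (F.obj d) ◁ (tl22 (ascR (F.obj a) (F.obj b) (m.μ c d))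
        (𝟙 (F.obj a) ⊠ m.μ b (c ⊠ₒ d) ≫ m.μ a (b ⊠ₒ c ⊠ₒ d) ≫ k)).hom =
    (m.μ a b ⊠ 𝟙 (F.obj c)) ⊠ 𝟙 (F.obj d) ◁ m.μ (a ⊠ₒ b) c ⊠ 𝟙 (F.obj d) ◁
        (tl22 (m.μL (asc a b c) d) (F.map (asc a (b ⊠ₒ c) d) ≫ F.map (𝟙 a ⊠ asc b c d) ≫ k)).inv ≫
      (tl33 (r33 (m.ω a b c) (F.obj d)) (m.μ (a ⊠ₒ b ⊠ₒ c) d ≫ F.map (asc a (b ⊠ₒ c) d) ≫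
        F.map (𝟙 a ⊠ asc b c d) ≫ k)).hom ≫
      asc (F.obj a) (F.obj b) (F.obj c) ⊠ 𝟙 (F.obj d) ◁ (𝟙 (F.obj a) ⊠ m.μ b c) ⊠ 𝟙 (F.obj d) ◁
        (tl33 (m.ω a (b ⊠ₒ c) d) (F.map (𝟙 a ⊠ asc b c d) ≫ k)).hom ≫
      asc (F.obj a) (F.obj b) (F.obj c) ⊠ 𝟙 (F.obj d) ◁ (𝟙 (F.obj a) ⊠ m.μ b c) ⊠ 𝟙 (F.obj d) ◁
        asc (F.obj a) (F.obj (b ⊠ₒ c)) (F.obj d) ◁ 𝟙 (F.obj a) ⊠ m.μ (b ⊠ₒ c) d ◁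
        (tl22 (m.μR a (asc b c d)) k).inv ≫
      asc (F.obj a) (F.obj b) (F.obj c) ⊠ 𝟙 (F.obj d) ◁
        (tl22 (ascM (F.obj a) (m.μ b c) (F.obj d)) (𝟙 (F.obj a) ⊠ m.μ (b ⊠ₒ c) d ≫
          𝟙 (F.obj a) ⊠ F.map (asc b c d) ≫ m.μ a (b ⊠ₒ c ⊠ₒ d) ≫ k)).hom ≫
      asc (F.obj a) (F.obj b) (F.obj c) ⊠ 𝟙 (F.obj d) ◁
        asc (F.obj a) (F.obj b ⊠ₒ F.obj c) (F.obj d) ◁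
        (tl33 (l33 (m.ω b c d) (F.obj a)) (m.μ a (b ⊠ₒ c ⊠ₒ d) ≫ k)).hom ≫
      (tl32 (pent (F.obj a) (F.obj b) (F.obj c) (F.obj d)) (𝟙 (F.obj a) ⊠ (𝟙 (F.obj b) ⊠ m.μ c d) ≫
        𝟙 (F.obj a) ⊠ m.μ b (c ⊠ₒ d) ≫ m.μ a (b ⊠ₒ c ⊠ₒ d) ≫ k)).hom := by
  have h := congrArg (fun y => 𝟙 ((m.μ a b ⊠ 𝟙 (F.obj c)) ⊠ 𝟙 (F.obj d) ≫ m.μ (a ⊠ₒ b) c ⊠ 𝟙 (F.obj d) ≫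
    m.μ ((a ⊠ₒ b) ⊠ₒ c) d ≫ F.map (asc a b c ⊠ 𝟙 d) ≫ F.map (asc a (b ⊠ₒ c) d) ≫
    F.map (𝟙 a ⊠ asc b c d) ≫ k) ⊗≫ y ▷ k ⊗≫
    𝟙 (asc (F.obj a ⊠ₒ F.obj b) (F.obj c) (F.obj d) ≫
    asc (F.obj a) (F.obj b) (F.obj c ⊠ₒ F.obj d) ≫ 𝟙 (F.obj a) ⊠ (𝟙 (F.obj b) ⊠ m.μ c d) ≫
    𝟙 (F.obj a) ⊠ m.μ b (c ⊠ₒ d) ≫ m.μ a (b ⊠ₒ c ⊠ₒ d) ≫ k))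
    (m.assoc_coherence a b c d)
  simp only [tl22, tl32, tl33, Iso.trans_hom, Iso.trans_inv, Iso.symm_hom, Iso.symm_inv,
    whiskerLeftIso_hom, whiskerRightIso_hom, whiskerLeftIso_inv, whiskerRightIso_inv, r33_hom,
    l33_hom, im32, mc₃, mapComp₃, PrelaxFunctor.map₂Iso_hom] at h ⊢
  refine Eq.trans ?_ (h.trans ?_) <;> bicategory

theorem unit_coherence_tail (a b : K) {z : L} (k : F.obj (a ⊠ₒ b) ⟶ z) :
    (𝟙 (F.obj a) ⊠ m.ι) ⊠ 𝟙 (F.obj b) ◁ m.μ a I ⊠ 𝟙 (F.obj b) ◁ m.μ (a ⊠ₒ I) b ◁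
        (tl21 (im21 F.toPseudofunctor (midU a b)) k).hom ≫
      (𝟙 (F.obj a) ⊠ m.ι) ⊠ 𝟙 (F.obj b) ◁ m.μ a I ⊠ 𝟙 (F.obj b) ◁ (tl22 (m.μL (run a) b) k).inv ≫
      (tl31 (r31 (m.ζ a) (F.obj b)) (m.μ a b ≫ k)).hom =
    (𝟙 (F.obj a) ⊠ m.ι) ⊠ 𝟙 (F.obj b) ◁ (tl33 (m.ω a I b) (F.map (𝟙 a ⊠ lun b) ≫ k)).hom ≫
      (tl22 (ascM (F.obj a) m.ι (F.obj b)) (𝟙 (F.obj a) ⊠ m.μ I b ≫ m.μ a (I ⊠ₒ b) ≫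
        F.map (𝟙 a ⊠ lun b) ≫ k)).hom ≫
      asc (F.obj a) I (F.obj b) ◁ 𝟙 (F.obj a) ⊠ (m.ι ⊠ 𝟙 (F.obj b)) ◁ 𝟙 (F.obj a) ⊠ m.μ I b ◁
        (tl22 (m.μR a (lun b)) k).inv ≫
      asc (F.obj a) I (F.obj b) ◁ (tl31 (l31 (m.ξ b) (F.obj a)) (m.μ a b ≫ k)).hom ≫
      (tl21 (midU (F.obj a) (F.obj b)) (m.μ a b ≫ k)).hom := by
  have h := congrArg (fun y => 𝟙 ((𝟙 (F.obj a) ⊠ m.ι) ⊠ 𝟙 (F.obj b) ≫ m.μ a I ⊠ 𝟙 (F.obj b) ≫ m.μ (a ⊠ₒ I) b ≫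
    F.map (asc a I b) ≫ F.map (𝟙 a ⊠ lun b) ≫ k) ⊗≫ y ▷ k ⊗≫
    𝟙 (run (F.obj a) ⊠ 𝟙 (F.obj b) ≫ m.μ a b ≫ k))
    (m.unit_coherence a b)
  simp only [tl22, tl21, tl31, tl33, Iso.trans_hom, Iso.trans_inv, Iso.symm_hom, Iso.symm_inv,
    whiskerLeftIso_hom, whiskerRightIso_hom, whiskerRightIso_inv, r31_hom,
    l31_hom, im21, PrelaxFunctor.map₂Iso_hom] at h ⊢
  refine Eq.trans ?_ (h.trans ?_) <;> bicategory

end LaxMonoidal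

end Lax

section Lax

variable {K : Type u₁} [Bicategory.{w₁, v₁} K] {L : Type u₂} [Bicategory.{w₂, v₂} L]
  [MonoidalBicategory K] [MonoidalBicategory L] {F : StrictPseudofunctor K L}

theorem tl22_inv_nat {B : Type u₁} [Bicategory.{w₁, v₁} B] {a b b' d z : B} {f : a ⟶ b} {f' : a ⟶ b'}
    {q : b ⟶ d} {q' : b' ⟶ d} (s : f ≫ q ≅ f' ≫ q') {k k' : d ⟶ z} (σ : k ⟶ k') :
    (tl22 s k).inv ≫ f ◁ q ◁ σ = f' ◁ q' ◁ σ ≫ (tl22 s k').inv := by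
  rw [Iso.inv_comp_eq, ← reassoc_of% @tl22_nat, Iso.hom_inv_id, Category.comp_id]

namespace LaxMonoidal

variable (m : LaxMonoidal F) (A : PsMonData K)

theorem mapAssoc_pentagon_left :
    ((m.μ A.X A.X ≫ F.map A.mul) ⊠ 𝟙 (F.obj A.X)) ⊠ 𝟙 (F.obj A.X) ◁ (m.mapAssoc A).hom ≫
      (tl22 (ascL (m.μ A.X A.X ≫ F.map A.mul) (F.obj A.X) (F.obj A.X)) (𝟙 (F.obj A.X) ⊠ (m.μ A.X A.X ≫ F.map A.mul) ≫ m.μ A.X A.X ≫ F.map A.mul)).hom ≫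
      asc (F.obj A.X ⊠ₒ F.obj A.X) (F.obj A.X) (F.obj A.X) ◁ (tl22 (xch (m.μ A.X A.X ≫ F.map A.mul) (m.μ A.X A.X ≫ F.map A.mul)) (m.μ A.X A.X ≫ F.map A.mul)).hom ≫
      asc (F.obj A.X ⊠ₒ F.obj A.X) (F.obj A.X) (F.obj A.X) ◁ 𝟙 (F.obj A.X ⊠ₒ F.obj A.X) ⊠ (m.μ A.X A.X ≫ F.map A.mul) ◁ (m.mapAssoc A).hom ≫
      asc (F.obj A.X ⊠ₒ F.obj A.X) (F.obj A.X) (F.obj A.X) ◁ (tl22 (ascR (F.obj A.X) (F.obj A.X) (m.μ A.X A.X ≫ F.map A.mul)) (𝟙 (F.obj A.X) ⊠ (m.μ A.X A.X ≫ F.map A.mul) ≫ m.μ A.X A.X ≫ F.map A.mul)).hom ≫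
      asc (F.obj A.X ⊠ₒ F.obj A.X) (F.obj A.X) (F.obj A.X) ◁ asc (F.obj A.X) (F.obj A.X) (F.obj A.X ⊠ₒ F.obj A.X) ◁ 𝟙 (F.obj A.X) ⊠ (𝟙 (F.obj A.X) ⊠ (m.μ A.X A.X ≫ F.map A.mul)) ◁ (m.cR (m.μ A.X A.X) A.mul A.X (F.map A.mul)).hom ≫
      asc (F.obj A.X ⊠ₒ F.obj A.X) (F.obj A.X) (F.obj A.X) ◁ asc (F.obj A.X) (F.obj A.X) (F.obj A.X ⊠ₒ F.obj A.X) ◁ (m.cRR (m.μ A.X A.X) A.mul A.X A.X (F.map (𝟙 A.X ⊠ A.mul) ≫ F.map A.mul)).hom =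
    ((m.μ A.X A.X ≫ F.map A.mul) ⊠ 𝟙 (F.obj A.X)) ⊠ 𝟙 (F.obj A.X) ◁ (m.cL (m.μ A.X A.X) A.mul A.X (F.map A.mul)).hom ≫ (m.cLL (m.μ A.X A.X) A.mul A.X A.X (F.map (A.mul ⊠ 𝟙 A.X) ≫ F.map A.mul)).hom ≫
      (m.μ A.X A.X ⊠ 𝟙 (F.obj A.X)) ⊠ 𝟙 (F.obj A.X) ◁ m.μ (A.X ⊠ₒ A.X) A.X ⊠ 𝟙 (F.obj A.X) ◁ m.μ ((A.X ⊠ₒ A.X) ⊠ₒ A.X) A.X ◁ F.map ((A.mul ⊠ 𝟙 A.X) ⊠ 𝟙 A.X) ◁ (im23 F.toPseudofunctor A.mulAssoc).hom ≫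
      (m.μ A.X A.X ⊠ 𝟙 (F.obj A.X)) ⊠ 𝟙 (F.obj A.X) ◁ m.μ (A.X ⊠ₒ A.X) A.X ⊠ 𝟙 (F.obj A.X) ◁ m.μ ((A.X ⊠ₒ A.X) ⊠ₒ A.X) A.X ◁
        (tl22 (im22 F.toPseudofunctor (ascL A.mul A.X A.X)) (F.map (𝟙 A.X ⊠ A.mul) ≫ F.map A.mul)).hom ≫
      (m.μ A.X A.X ⊠ 𝟙 (F.obj A.X)) ⊠ 𝟙 (F.obj A.X) ◁ (tl33 (m.ω (A.X ⊠ₒ A.X) A.X A.X) (F.map (A.mul ⊠ 𝟙 (A.X ⊠ₒ A.X)) ≫ F.map (𝟙 A.X ⊠ A.mul) ≫ F.map A.mul)).hom ≫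
      (tl22 (ascL (m.μ A.X A.X) (F.obj A.X) (F.obj A.X)) (𝟙 (F.obj (A.X ⊠ₒ A.X)) ⊠ m.μ A.X A.X ≫ m.μ (A.X ⊠ₒ A.X) (A.X ⊠ₒ A.X) ≫
        F.map (A.mul ⊠ 𝟙 (A.X ⊠ₒ A.X)) ≫ F.map (𝟙 A.X ⊠ A.mul) ≫ F.map A.mul)).hom ≫
      asc (F.obj A.X ⊠ₒ F.obj A.X) (F.obj A.X) (F.obj A.X) ◁ (tl22 (xch (m.μ A.X A.X) (m.μ A.X A.X)) (m.μ (A.X ⊠ₒ A.X) (A.X ⊠ₒ A.X) ≫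
        F.map (A.mul ⊠ 𝟙 (A.X ⊠ₒ A.X)) ≫ F.map (𝟙 A.X ⊠ A.mul) ≫ F.map A.mul)).hom ≫
      asc (F.obj A.X ⊠ₒ F.obj A.X) (F.obj A.X) (F.obj A.X) ◁ 𝟙 (F.obj A.X ⊠ₒ F.obj A.X) ⊠ m.μ A.X A.X ◁ m.μ A.X A.X ⊠ 𝟙 (F.obj (A.X ⊠ₒ A.X)) ◁ m.μ (A.X ⊠ₒ A.X) (A.X ⊠ₒ A.X) ◁
        (tl22 (im22 F.toPseudofunctor (xch A.mul A.mul)) (F.map A.mul)).hom ≫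
      asc (F.obj A.X ⊠ₒ F.obj A.X) (F.obj A.X) (F.obj A.X) ◁ 𝟙 (F.obj A.X ⊠ₒ F.obj A.X) ⊠ m.μ A.X A.X ◁ m.μ A.X A.X ⊠ 𝟙 (F.obj (A.X ⊠ₒ A.X)) ◁ m.μ (A.X ⊠ₒ A.X) (A.X ⊠ₒ A.X) ◁
        F.map (𝟙 (A.X ⊠ₒ A.X) ⊠ A.mul) ◁ (im23 F.toPseudofunctor A.mulAssoc).hom ≫
      asc (F.obj A.X ⊠ₒ F.obj A.X) (F.obj A.X) (F.obj A.X) ◁ 𝟙 (F.obj A.X ⊠ₒ F.obj A.X) ⊠ m.μ A.X A.X ◁ m.μ A.X A.X ⊠ 𝟙 (F.obj (A.X ⊠ₒ A.X)) ◁ m.μ (A.X ⊠ₒ A.X) (A.X ⊠ₒ A.X) ◁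
        (tl22 (im22 F.toPseudofunctor (ascR A.X A.X A.mul)) (F.map (𝟙 A.X ⊠ A.mul) ≫ F.map A.mul)).hom ≫
      asc (F.obj A.X ⊠ₒ F.obj A.X) (F.obj A.X) (F.obj A.X) ◁ 𝟙 (F.obj A.X ⊠ₒ F.obj A.X) ⊠ m.μ A.X A.X ◁ (tl33 (m.ω A.X A.X (A.X ⊠ₒ A.X)) (F.map (𝟙 A.X ⊠ (𝟙 A.X ⊠ A.mul)) ≫ F.map (𝟙 A.X ⊠ A.mul) ≫ F.map A.mul)).hom ≫
      asc (F.obj A.X ⊠ₒ F.obj A.X) (F.obj A.X) (F.obj A.X) ◁ (tl22 (ascR (F.obj A.X) (F.obj A.X) (m.μ A.X A.X)) (𝟙 (F.obj A.X) ⊠ m.μ A.X (A.X ⊠ₒ A.X) ≫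
        m.μ A.X (A.X ⊠ₒ A.X ⊠ₒ A.X) ≫ F.map (𝟙 A.X ⊠ (𝟙 A.X ⊠ A.mul)) ≫ F.map (𝟙 A.X ⊠ A.mul) ≫ F.map A.mul)).hom := by
  have n5 := congrArg (fun y => asc (F.obj A.X ⊠ₒ F.obj A.X) (F.obj A.X) (F.obj A.X) ◁ y) (tl22_nat (ascR (F.obj A.X) (F.obj A.X) (m.μ A.X A.X ≫ F.map A.mul)) (m.cR (m.μ A.X A.X) A.mul A.X (F.map A.mul)).hom)
  have e4 := congrArg (fun y => asc (F.obj A.X ⊠ₒ F.obj A.X) (F.obj A.X) (F.obj A.X) ◁ 𝟙 (F.obj A.X ⊠ₒ F.obj A.X) ⊠ (m.μ A.X A.X ≫ F.map A.mul) ◁ y) (m.mapAssoc_cR A)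
  have eR := congrArg (fun y => asc (F.obj A.X ⊠ₒ F.obj A.X) (F.obj A.X) (F.obj A.X) ◁ y)
    (m.ω_cR (m.μ A.X A.X) A.mul A.X A.X (F.map (𝟙 A.X ⊠ A.mul) ≫ F.map A.mul))
  have nRL := congrArg (fun y => asc (F.obj A.X ⊠ₒ F.obj A.X) (F.obj A.X) (F.obj A.X) ◁ y)
    (m.cRL_nat (m.μ A.X A.X) A.mul (m.μ A.X A.X) (im23 F.toPseudofunctor A.mulAssoc).hom)
  have eX := congrArg (fun y => asc (F.obj A.X ⊠ₒ F.obj A.X) (F.obj A.X) (F.obj A.X) ◁ y)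
    (m.xch_cL_cRL (m.μ A.X A.X) A.mul (m.μ A.X A.X) A.mul (F.map A.mul))
  have n2 := tl22_nat (ascL (m.μ A.X A.X ≫ F.map A.mul) (F.obj A.X) (F.obj A.X)) (m.cR (m.μ A.X A.X) A.mul A.X (F.map A.mul)).hom
  have e1 := congrArg (fun y => ((m.μ A.X A.X ≫ F.map A.mul) ⊠ 𝟙 (F.obj A.X)) ⊠ 𝟙 (F.obj A.X) ◁ y) (m.mapAssoc_cR A)
  have eL := m.ω_cL (m.μ A.X A.X) A.mul A.X A.X (F.map (𝟙 A.X ⊠ A.mul) ≫ F.map A.mul)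
  simp only [whiskerLeft_comp] at n5 e4 eR nRL eX e1
  rw [← reassoc_of% n5, reassoc_of% e4, eR, reassoc_of% nRL, reassoc_of% eX, ← reassoc_of% n2,
    reassoc_of% e1, reassoc_of% eL, reassoc_of% @cLL_nat]

theorem mapAssoc_pentagon_right :
    (tl23 (r23 (m.mapAssoc A) (F.obj A.X)) (m.μ A.X A.X ≫ F.map A.mul)).hom ≫
      asc (F.obj A.X) (F.obj A.X) (F.obj A.X) ⊠ 𝟙 (F.obj A.X) ◁ (𝟙 (F.obj A.X) ⊠ (m.μ A.X A.X ≫ F.map A.mul)) ⊠ 𝟙 (F.obj A.X) ◁ (m.mapAssoc A).hom ≫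
      asc (F.obj A.X) (F.obj A.X) (F.obj A.X) ⊠ 𝟙 (F.obj A.X) ◁ (tl22 (ascM (F.obj A.X) (m.μ A.X A.X ≫ F.map A.mul) (F.obj A.X)) (𝟙 (F.obj A.X) ⊠ (m.μ A.X A.X ≫ F.map A.mul) ≫ m.μ A.X A.X ≫ F.map A.mul)).hom ≫
      asc (F.obj A.X) (F.obj A.X) (F.obj A.X) ⊠ 𝟙 (F.obj A.X) ◁ asc (F.obj A.X) (F.obj A.X ⊠ₒ F.obj A.X) (F.obj A.X) ◁ (tl23 (l23 (m.mapAssoc A) (F.obj A.X)) (m.μ A.X A.X ≫ F.map A.mul)).hom ≫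
      (tl32 (pent (F.obj A.X) (F.obj A.X) (F.obj A.X) (F.obj A.X)) (𝟙 (F.obj A.X) ⊠ (𝟙 (F.obj A.X) ⊠ (m.μ A.X A.X ≫ F.map A.mul)) ≫ 𝟙 (F.obj A.X) ⊠ (m.μ A.X A.X ≫ F.map A.mul) ≫ m.μ A.X A.X ≫ F.map A.mul)).hom ≫
      asc (F.obj A.X ⊠ₒ F.obj A.X) (F.obj A.X) (F.obj A.X) ◁ asc (F.obj A.X) (F.obj A.X) (F.obj A.X ⊠ₒ F.obj A.X) ◁ 𝟙 (F.obj A.X) ⊠ (𝟙 (F.obj A.X) ⊠ (m.μ A.X A.X ≫ F.map A.mul)) ◁ (m.cR (m.μ A.X A.X) A.mul A.X (F.map A.mul)).hom ≫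
      asc (F.obj A.X ⊠ₒ F.obj A.X) (F.obj A.X) (F.obj A.X) ◁ asc (F.obj A.X) (F.obj A.X) (F.obj A.X ⊠ₒ F.obj A.X) ◁ (m.cRR (m.μ A.X A.X) A.mul A.X A.X (F.map (𝟙 A.X ⊠ A.mul) ≫ F.map A.mul)).hom =
    ((m.μ A.X A.X ≫ F.map A.mul) ⊠ 𝟙 (F.obj A.X)) ⊠ 𝟙 (F.obj A.X) ◁ (m.cL (m.μ A.X A.X) A.mul A.X (F.map A.mul)).hom ≫ (m.cLL (m.μ A.X A.X) A.mul A.X A.X (F.map (A.mul ⊠ 𝟙 A.X) ≫ F.map A.mul)).hom ≫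
      (m.μ A.X A.X ⊠ 𝟙 (F.obj A.X)) ⊠ 𝟙 (F.obj A.X) ◁ m.μ (A.X ⊠ₒ A.X) A.X ⊠ 𝟙 (F.obj A.X) ◁ m.μ ((A.X ⊠ₒ A.X) ⊠ₒ A.X) A.X ◁ (tl23 (im23 F.toPseudofunctor (r23 A.mulAssoc A.X)) (F.map A.mul)).hom ≫
      (m.μ A.X A.X ⊠ 𝟙 (F.obj A.X)) ⊠ 𝟙 (F.obj A.X) ◁ m.μ (A.X ⊠ₒ A.X) A.X ⊠ 𝟙 (F.obj A.X) ◁ (tl22 (m.μL (asc A.X A.X A.X) A.X) (F.map ((𝟙 A.X ⊠ A.mul) ⊠ 𝟙 A.X) ≫ F.map (A.mul ⊠ 𝟙 A.X) ≫ F.map A.mul)).inv ≫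
      (tl33 (r33 (m.ω A.X A.X A.X) (F.obj A.X))
        (m.μ (A.X ⊠ₒ A.X ⊠ₒ A.X) A.X ≫ F.map ((𝟙 A.X ⊠ A.mul) ⊠ 𝟙 A.X) ≫ F.map (A.mul ⊠ 𝟙 A.X) ≫ F.map A.mul)).hom ≫
      asc (F.obj A.X) (F.obj A.X) (F.obj A.X) ⊠ 𝟙 (F.obj A.X) ◁ (𝟙 (F.obj A.X) ⊠ m.μ A.X A.X) ⊠ 𝟙 (F.obj A.X) ◁ m.μ A.X (A.X ⊠ₒ A.X) ⊠ 𝟙 (F.obj A.X) ◁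
        m.μ (A.X ⊠ₒ A.X ⊠ₒ A.X) A.X ◁ F.map ((𝟙 A.X ⊠ A.mul) ⊠ 𝟙 A.X) ◁ (im23 F.toPseudofunctor A.mulAssoc).hom ≫
      asc (F.obj A.X) (F.obj A.X) (F.obj A.X) ⊠ 𝟙 (F.obj A.X) ◁ (𝟙 (F.obj A.X) ⊠ m.μ A.X A.X) ⊠ 𝟙 (F.obj A.X) ◁ m.μ A.X (A.X ⊠ₒ A.X) ⊠ 𝟙 (F.obj A.X) ◁
        m.μ (A.X ⊠ₒ A.X ⊠ₒ A.X) A.X ◁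
        (tl22 (im22 F.toPseudofunctor (ascM A.X A.mul A.X)) (F.map (𝟙 A.X ⊠ A.mul) ≫ F.map A.mul)).hom ≫
      asc (F.obj A.X) (F.obj A.X) (F.obj A.X) ⊠ 𝟙 (F.obj A.X) ◁ (𝟙 (F.obj A.X) ⊠ m.μ A.X A.X) ⊠ 𝟙 (F.obj A.X) ◁
        (tl33 (m.ω A.X (A.X ⊠ₒ A.X) A.X) (F.map (𝟙 A.X ⊠ (A.mul ⊠ 𝟙 A.X)) ≫ F.map (𝟙 A.X ⊠ A.mul) ≫ F.map A.mul)).hom ≫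
      asc (F.obj A.X) (F.obj A.X) (F.obj A.X) ⊠ 𝟙 (F.obj A.X) ◁ (tl22 (ascM (F.obj A.X) (m.μ A.X A.X) (F.obj A.X)) (𝟙 (F.obj A.X) ⊠ m.μ (A.X ⊠ₒ A.X) A.X ≫
        m.μ A.X ((A.X ⊠ₒ A.X) ⊠ₒ A.X) ≫ F.map (𝟙 A.X ⊠ (A.mul ⊠ 𝟙 A.X)) ≫ F.map (𝟙 A.X ⊠ A.mul) ≫ F.map A.mul)).hom ≫
      asc (F.obj A.X) (F.obj A.X) (F.obj A.X) ⊠ 𝟙 (F.obj A.X) ◁ asc (F.obj A.X) (F.obj A.X ⊠ₒ F.obj A.X) (F.obj A.X) ◁ 𝟙 (F.obj A.X) ⊠ (m.μ A.X A.X ⊠ 𝟙 (F.obj A.X)) ◁ 𝟙 (F.obj A.X) ⊠ m.μ (A.X ⊠ₒ A.X) A.X ◁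
        m.μ A.X ((A.X ⊠ₒ A.X) ⊠ₒ A.X) ◁ (tl23 (im23 F.toPseudofunctor (l23 A.mulAssoc A.X)) (F.map A.mul)).hom ≫
      asc (F.obj A.X) (F.obj A.X) (F.obj A.X) ⊠ 𝟙 (F.obj A.X) ◁ asc (F.obj A.X) (F.obj A.X ⊠ₒ F.obj A.X) (F.obj A.X) ◁ 𝟙 (F.obj A.X) ⊠ (m.μ A.X A.X ⊠ 𝟙 (F.obj A.X)) ◁ 𝟙 (F.obj A.X) ⊠ m.μ (A.X ⊠ₒ A.X) A.X ◁
        (tl22 (m.μR A.X (asc A.X A.X A.X)) (F.map (𝟙 A.X ⊠ (𝟙 A.X ⊠ A.mul)) ≫ F.map (𝟙 A.X ⊠ A.mul) ≫ F.map A.mul)).inv ≫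
      asc (F.obj A.X) (F.obj A.X) (F.obj A.X) ⊠ 𝟙 (F.obj A.X) ◁ asc (F.obj A.X) (F.obj A.X ⊠ₒ F.obj A.X) (F.obj A.X) ◁ (tl33 (l33 (m.ω A.X A.X A.X) (F.obj A.X))
        (m.μ A.X (A.X ⊠ₒ A.X ⊠ₒ A.X) ≫ F.map (𝟙 A.X ⊠ (𝟙 A.X ⊠ A.mul)) ≫ F.map (𝟙 A.X ⊠ A.mul) ≫ F.map A.mul)).hom ≫
      (tl32 (pent (F.obj A.X) (F.obj A.X) (F.obj A.X) (F.obj A.X)) (𝟙 (F.obj A.X) ⊠ (𝟙 (F.obj A.X) ⊠ m.μ A.X A.X) ≫ 𝟙 (F.obj A.X) ⊠ m.μ A.X (A.X ⊠ₒ A.X) ≫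
        m.μ A.X (A.X ⊠ₒ A.X ⊠ₒ A.X) ≫ F.map (𝟙 A.X ⊠ (𝟙 A.X ⊠ A.mul)) ≫ F.map (𝟙 A.X ⊠ A.mul) ≫ F.map A.mul)).hom := by
  have na := tl32_nat (pent (F.obj A.X) (F.obj A.X) (F.obj A.X) (F.obj A.X)) (𝟙 (F.obj A.X) ⊠ (𝟙 (F.obj A.X) ⊠ (m.μ A.X A.X ≫ F.map A.mul)) ◁ (m.cR (m.μ A.X A.X) A.mul A.X (F.map A.mul)).hom)
  have nb := tl32_nat (pent (F.obj A.X) (F.obj A.X) (F.obj A.X) (F.obj A.X)) (m.cRR (m.μ A.X A.X) A.mul A.X A.X (F.map (𝟙 A.X ⊠ A.mul) ≫ F.map A.mul)).hom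
  have eRR := congrArg (fun y => asc (F.obj A.X) (F.obj A.X) (F.obj A.X) ⊠ 𝟙 (F.obj A.X) ◁ asc (F.obj A.X) (F.obj A.X ⊠ₒ F.obj A.X) (F.obj A.X) ◁ y) (m.mapAssoc_cRR A A.X (F.map A.mul))
  have n3 := congrArg (fun y => asc (F.obj A.X) (F.obj A.X) (F.obj A.X) ⊠ 𝟙 (F.obj A.X) ◁ y) (tl22_nat (ascM (F.obj A.X) (m.μ A.X A.X ≫ F.map A.mul) (F.obj A.X)) (m.cR (m.μ A.X A.X) A.mul A.X (F.map A.mul)).hom)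
  have e2 := congrArg (fun y => asc (F.obj A.X) (F.obj A.X) (F.obj A.X) ⊠ 𝟙 (F.obj A.X) ◁ (𝟙 (F.obj A.X) ⊠ (m.μ A.X A.X ≫ F.map A.mul)) ⊠ 𝟙 (F.obj A.X) ◁ y) (m.mapAssoc_cR A)
  have eM := congrArg (fun y => asc (F.obj A.X) (F.obj A.X) (F.obj A.X) ⊠ 𝟙 (F.obj A.X) ◁ y)
    (m.ω_cM (m.μ A.X A.X) A.mul A.X A.X (F.map (𝟙 A.X ⊠ A.mul) ≫ F.map A.mul))
  have nML := congrArg (fun y => asc (F.obj A.X) (F.obj A.X) (F.obj A.X) ⊠ 𝟙 (F.obj A.X) ◁ y) (m.cML_nat (m.μ A.X A.X) A.mul A.X A.X (im23 F.toPseudofunctor A.mulAssoc).hom)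
  have e1 := m.mapAssoc_cML A A.X (F.map A.mul)
  simp only [whiskerLeft_comp] at eRR n3 e2 eM nML
  rw [← reassoc_of% na, ← nb, reassoc_of% eRR, ← reassoc_of% n3, reassoc_of% e2, reassoc_of% eM,
    reassoc_of% nML, reassoc_of% e1]

theorem mapAssoc_slide_left {z : L} {k k' : F.obj ((A.X ⊠ₒ A.X) ⊠ₒ A.X ⊠ₒ A.X) ⟶ z} (σ : k ⟶ k') :
    (m.μ A.X A.X ⊠ 𝟙 (F.obj A.X)) ⊠ 𝟙 (F.obj A.X) ◁ (tl33 (m.ω (A.X ⊠ₒ A.X) A.X A.X) k).hom ≫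
      (tl22 (ascL (m.μ A.X A.X) (F.obj A.X) (F.obj A.X)) (𝟙 (F.obj (A.X ⊠ₒ A.X)) ⊠ m.μ A.X A.X ≫ m.μ (A.X ⊠ₒ A.X) (A.X ⊠ₒ A.X) ≫ k)).hom ≫
      asc (F.obj A.X ⊠ₒ F.obj A.X) (F.obj A.X) (F.obj A.X) ◁ (tl22 (xch (m.μ A.X A.X) (m.μ A.X A.X)) (m.μ (A.X ⊠ₒ A.X) (A.X ⊠ₒ A.X) ≫ k)).hom ≫
      asc (F.obj A.X ⊠ₒ F.obj A.X) (F.obj A.X) (F.obj A.X) ◁ 𝟙 (F.obj A.X ⊠ₒ F.obj A.X) ⊠ m.μ A.X A.X ◁ m.μ A.X A.X ⊠ 𝟙 (F.obj (A.X ⊠ₒ A.X)) ◁ m.μ (A.X ⊠ₒ A.X) (A.X ⊠ₒ A.X) ◁ σ =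
    (m.μ A.X A.X ⊠ 𝟙 (F.obj A.X)) ⊠ 𝟙 (F.obj A.X) ◁ m.μ (A.X ⊠ₒ A.X) A.X ⊠ 𝟙 (F.obj A.X) ◁ m.μ ((A.X ⊠ₒ A.X) ⊠ₒ A.X) A.X ◁ F.map (asc (A.X ⊠ₒ A.X) A.X A.X) ◁ σ ≫
      (m.μ A.X A.X ⊠ 𝟙 (F.obj A.X)) ⊠ 𝟙 (F.obj A.X) ◁ (tl33 (m.ω (A.X ⊠ₒ A.X) A.X A.X) k').hom ≫
      (tl22 (ascL (m.μ A.X A.X) (F.obj A.X) (F.obj A.X)) (𝟙 (F.obj (A.X ⊠ₒ A.X)) ⊠ m.μ A.X A.X ≫ m.μ (A.X ⊠ₒ A.X) (A.X ⊠ₒ A.X) ≫ k')).hom ≫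
      asc (F.obj A.X ⊠ₒ F.obj A.X) (F.obj A.X) (F.obj A.X) ◁ (tl22 (xch (m.μ A.X A.X) (m.μ A.X A.X)) (m.μ (A.X ⊠ₒ A.X) (A.X ⊠ₒ A.X) ≫ k')).hom := by
  have n1 := congrArg (fun y => asc (F.obj A.X ⊠ₒ F.obj A.X) (F.obj A.X) (F.obj A.X) ◁ y) (tl22_nat (xch (m.μ A.X A.X) (m.μ A.X A.X)) (m.μ (A.X ⊠ₒ A.X) (A.X ⊠ₒ A.X) ◁ σ))
  have n3 := congrArg (fun y => (m.μ A.X A.X ⊠ 𝟙 (F.obj A.X)) ⊠ 𝟙 (F.obj A.X) ◁ y) (tl33_nat (m.ω (A.X ⊠ₒ A.X) A.X A.X) σ)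
  simp only [whiskerLeft_comp] at n1 n3
  rw [← n1, ← reassoc_of% @tl22_nat, ← reassoc_of% n3]

theorem mapAssoc_slide_right {z : L} {k k' : F.obj ((A.X ⊠ₒ A.X ⊠ₒ A.X) ⊠ₒ A.X) ⟶ z} (σ : k ⟶ k') :
    (m.μ A.X A.X ⊠ 𝟙 (F.obj A.X)) ⊠ 𝟙 (F.obj A.X) ◁ m.μ (A.X ⊠ₒ A.X) A.X ⊠ 𝟙 (F.obj A.X) ◁ (tl22 (m.μL (asc A.X A.X A.X) A.X) k).inv ≫
      (tl33 (r33 (m.ω A.X A.X A.X) (F.obj A.X)) (m.μ (A.X ⊠ₒ A.X ⊠ₒ A.X) A.X ≫ k)).hom ≫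
      asc (F.obj A.X) (F.obj A.X) (F.obj A.X) ⊠ 𝟙 (F.obj A.X) ◁ (𝟙 (F.obj A.X) ⊠ m.μ A.X A.X) ⊠ 𝟙 (F.obj A.X) ◁ m.μ A.X (A.X ⊠ₒ A.X) ⊠ 𝟙 (F.obj A.X) ◁
        m.μ (A.X ⊠ₒ A.X ⊠ₒ A.X) A.X ◁ σ =
    (m.μ A.X A.X ⊠ 𝟙 (F.obj A.X)) ⊠ 𝟙 (F.obj A.X) ◁ m.μ (A.X ⊠ₒ A.X) A.X ⊠ 𝟙 (F.obj A.X) ◁ m.μ ((A.X ⊠ₒ A.X) ⊠ₒ A.X) A.X ◁ F.map (asc A.X A.X A.X ⊠ 𝟙 A.X) ◁ σ ≫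
      (m.μ A.X A.X ⊠ 𝟙 (F.obj A.X)) ⊠ 𝟙 (F.obj A.X) ◁ m.μ (A.X ⊠ₒ A.X) A.X ⊠ 𝟙 (F.obj A.X) ◁ (tl22 (m.μL (asc A.X A.X A.X) A.X) k').inv ≫
      (tl33 (r33 (m.ω A.X A.X A.X) (F.obj A.X)) (m.μ (A.X ⊠ₒ A.X ⊠ₒ A.X) A.X ≫ k')).hom := by
  have n1 := congrArg (fun y => (m.μ A.X A.X ⊠ 𝟙 (F.obj A.X)) ⊠ 𝟙 (F.obj A.X) ◁ m.μ (A.X ⊠ₒ A.X) A.X ⊠ 𝟙 (F.obj A.X) ◁ y) (tl22_inv_nat (m.μL (asc A.X A.X A.X) A.X) σ)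
  have n2 := tl33_nat (r33 (m.ω A.X A.X A.X) (F.obj A.X)) (m.μ (A.X ⊠ₒ A.X ⊠ₒ A.X) A.X ◁ σ)
  simp only [whiskerLeft_comp] at n1
  rw [← n2, reassoc_of% n1]

theorem mapAssoc_pentagon {A : PsMonData K} (H : A.Pentagon) :
    ((m.μ A.X A.X ≫ F.map A.mul) ⊠ 𝟙 (F.obj A.X)) ⊠ 𝟙 (F.obj A.X) ◁ (m.mapAssoc A).hom ≫
      (tl22 (ascL (m.μ A.X A.X ≫ F.map A.mul) (F.obj A.X) (F.obj A.X)) (𝟙 (F.obj A.X) ⊠ (m.μ A.X A.X ≫ F.map A.mul) ≫ m.μ A.X A.X ≫ F.map A.mul)).hom ≫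
      asc (F.obj A.X ⊠ₒ F.obj A.X) (F.obj A.X) (F.obj A.X) ◁ (tl22 (xch (m.μ A.X A.X ≫ F.map A.mul) (m.μ A.X A.X ≫ F.map A.mul)) (m.μ A.X A.X ≫ F.map A.mul)).hom ≫
      asc (F.obj A.X ⊠ₒ F.obj A.X) (F.obj A.X) (F.obj A.X) ◁ 𝟙 (F.obj A.X ⊠ₒ F.obj A.X) ⊠ (m.μ A.X A.X ≫ F.map A.mul) ◁ (m.mapAssoc A).hom ≫
      asc (F.obj A.X ⊠ₒ F.obj A.X) (F.obj A.X) (F.obj A.X) ◁ (tl22 (ascR (F.obj A.X) (F.obj A.X) (m.μ A.X A.X ≫ F.map A.mul)) (𝟙 (F.obj A.X) ⊠ (m.μ A.X A.X ≫ F.map A.mul) ≫ m.μ A.X A.X ≫ F.map A.mul)).hom =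
    (tl23 (r23 (m.mapAssoc A) (F.obj A.X)) (m.μ A.X A.X ≫ F.map A.mul)).hom ≫
      asc (F.obj A.X) (F.obj A.X) (F.obj A.X) ⊠ 𝟙 (F.obj A.X) ◁ (𝟙 (F.obj A.X) ⊠ (m.μ A.X A.X ≫ F.map A.mul)) ⊠ 𝟙 (F.obj A.X) ◁ (m.mapAssoc A).hom ≫
      asc (F.obj A.X) (F.obj A.X) (F.obj A.X) ⊠ 𝟙 (F.obj A.X) ◁ (tl22 (ascM (F.obj A.X) (m.μ A.X A.X ≫ F.map A.mul) (F.obj A.X)) (𝟙 (F.obj A.X) ⊠ (m.μ A.X A.X ≫ F.map A.mul) ≫ m.μ A.X A.X ≫ F.map A.mul)).hom ≫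
      asc (F.obj A.X) (F.obj A.X) (F.obj A.X) ⊠ 𝟙 (F.obj A.X) ◁ asc (F.obj A.X) (F.obj A.X ⊠ₒ F.obj A.X) (F.obj A.X) ◁ (tl23 (l23 (m.mapAssoc A) (F.obj A.X)) (m.μ A.X A.X ≫ F.map A.mul)).hom ≫
      (tl32 (pent (F.obj A.X) (F.obj A.X) (F.obj A.X) (F.obj A.X)) (𝟙 (F.obj A.X) ⊠ (𝟙 (F.obj A.X) ⊠ (m.μ A.X A.X ≫ F.map A.mul)) ≫ 𝟙 (F.obj A.X) ⊠ (m.μ A.X A.X ≫ F.map A.mul) ≫ m.μ A.X A.X ≫ F.map A.mul)).hom := by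
  have hL := m.mapAssoc_pentagon_left A
  have hR := m.mapAssoc_pentagon_right A
  have hP := congrArg (fun y => (m.μ A.X A.X ⊠ 𝟙 (F.obj A.X)) ⊠ 𝟙 (F.obj A.X) ◁ m.μ (A.X ⊠ₒ A.X) A.X ⊠ 𝟙 (F.obj A.X) ◁ m.μ ((A.X ⊠ₒ A.X) ⊠ₒ A.X) A.X ◁ y) (H.map F)
  have hA := m.assoc_coherence_tail A.X A.X A.X A.X (F.map (𝟙 A.X ⊠ (𝟙 A.X ⊠ A.mul)) ≫ F.map (𝟙 A.X ⊠ A.mul) ≫ F.map A.mul)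
  have sl1 := congrArg (fun y => asc (F.obj A.X) (F.obj A.X) (F.obj A.X) ⊠ 𝟙 (F.obj A.X) ◁ y) (tl22_nat (ascM (F.obj A.X) (m.μ A.X A.X) (F.obj A.X))
    (𝟙 (F.obj A.X) ⊠ m.μ (A.X ⊠ₒ A.X) A.X ◁ m.μ A.X ((A.X ⊠ₒ A.X) ⊠ₒ A.X) ◁
      (tl23 (im23 F.toPseudofunctor (l23 A.mulAssoc A.X)) (F.map A.mul)).hom))
  have sl2 := congrArg (fun y => asc (F.obj A.X) (F.obj A.X) (F.obj A.X) ⊠ 𝟙 (F.obj A.X) ◁ (𝟙 (F.obj A.X) ⊠ m.μ A.X A.X) ⊠ 𝟙 (F.obj A.X) ◁ y) (tl33_nat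
    (m.ω A.X (A.X ⊠ₒ A.X) A.X) (tl23 (im23 F.toPseudofunctor (l23 A.mulAssoc A.X)) (F.map A.mul)).hom)
  have sl3 := congrArg (fun y => asc (F.obj A.X) (F.obj A.X) (F.obj A.X) ⊠ 𝟙 (F.obj A.X) ◁ y) (tl22_nat (ascM (F.obj A.X) (m.μ A.X A.X) (F.obj A.X))
    (𝟙 (F.obj A.X) ⊠ m.μ (A.X ⊠ₒ A.X) A.X ◁
      (tl22 (m.μR A.X (asc A.X A.X A.X)) (F.map (𝟙 A.X ⊠ (𝟙 A.X ⊠ A.mul)) ≫ F.map (𝟙 A.X ⊠ A.mul) ≫ F.map A.mul)).inv))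
  simp only [whiskerLeft_comp] at hP sl1 sl2 sl3
  rw [reassoc_of% m.mapAssoc_slide_left, reassoc_of% m.mapAssoc_slide_left, reassoc_of% m.mapAssoc_slide_left,
    reassoc_of% hP, hA] at hL
  rw [← reassoc_of% sl1, ← reassoc_of% sl2, reassoc_of% m.mapAssoc_slide_right,
    reassoc_of% m.mapAssoc_slide_right, reassoc_of% m.mapAssoc_slide_right, ← reassoc_of% sl3] at hR
  have h := hL.trans hR.symm
  refine (cancel_mono (whiskerLeftIso (asc (F.obj A.X ⊠ₒ F.obj A.X) (F.obj A.X) (F.obj A.X)) (whiskerLeftIso (asc (F.obj A.X) (F.obj A.X) (F.obj A.X ⊠ₒ F.obj A.X)) (whiskerLeftIso (𝟙 (F.obj A.X) ⊠ (𝟙 (F.obj A.X) ⊠ (m.μ A.X A.X ≫ F.map A.mul)))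
    (m.cR (m.μ A.X A.X) A.mul A.X (F.map A.mul)) ≪≫ m.cRR (m.μ A.X A.X) A.mul A.X A.X (F.map (𝟙 A.X ⊠ A.mul) ≫ F.map A.mul)))).hom).mp ?_
  simpa only [whiskerLeftIso_hom, Iso.trans_hom, whiskerLeft_comp, Category.assoc] using h

theorem mapAssoc_triangle {A : PsMonData K} (H : A.Triangle) :
    (tl21 (r21 (m.mapMulOne A) (F.obj A.X)) (m.μ A.X A.X ≫ F.map A.mul)).hom =
      (𝟙 (F.obj A.X) ⊠ (m.ι ≫ F.map A.one)) ⊠ 𝟙 (F.obj A.X) ◁ (m.mapAssoc A).hom ≫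
      (tl22 (ascM (F.obj A.X) (m.ι ≫ F.map A.one) (F.obj A.X)) (𝟙 (F.obj A.X) ⊠ (m.μ A.X A.X ≫ F.map A.mul) ≫ m.μ A.X A.X ≫ F.map A.mul)).hom ≫
      asc (F.obj A.X) I (F.obj A.X) ◁ (tl21 (l21 (m.mapOneMul A) (F.obj A.X)) (m.μ A.X A.X ≫ F.map A.mul)).hom ≫
      (tl21 (midU (F.obj A.X) (F.obj A.X)) (m.μ A.X A.X ≫ F.map A.mul)).hom := by
  have n1 := tl22_nat (ascM (F.obj A.X) (m.ι ≫ F.map A.one) (F.obj A.X)) (m.cR (m.μ A.X A.X) A.mul A.X (F.map A.mul)).hom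
  have e1 := congrArg (fun y => (𝟙 (F.obj A.X) ⊠ (m.ι ≫ F.map A.one)) ⊠ 𝟙 (F.obj A.X) ◁ y) (m.mapAssoc_cR A)
  have eM := m.ω_cM m.ι A.one A.X A.X (F.map (𝟙 A.X ⊠ A.mul) ≫ F.map A.mul)
  have eR := congrArg (fun y => asc (F.obj A.X) I (F.obj A.X) ◁ y) (m.mapOneMul_cR A A.X (F.map A.mul))
  have n2 := tl22_nat (ascM (F.obj A.X) m.ι (F.obj A.X)) (𝟙 (F.obj A.X) ⊠ m.μ I A.X ◁ m.μ A.X (I ⊠ₒ A.X) ◁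
    (tl21 (im21 F.toPseudofunctor (l21 A.oneMul A.X)) (F.map A.mul)).hom)
  have n3 := congrArg (fun y => (𝟙 (F.obj A.X) ⊠ m.ι) ⊠ 𝟙 (F.obj A.X) ◁ y) (tl33_nat (m.ω A.X I A.X)
    (tl21 (im21 F.toPseudofunctor (l21 A.oneMul A.X)) (F.map A.mul)).hom)
  have hT := congrArg (fun y => (𝟙 (F.obj A.X) ⊠ m.ι) ⊠ 𝟙 (F.obj A.X) ◁ m.μ A.X I ⊠ 𝟙 (F.obj A.X) ◁
    m.μ (A.X ⊠ₒ I) A.X ◁ y) (H.map F)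
  have hU := m.unit_coherence_tail A.X A.X (F.map A.mul)
  simp only [whiskerLeft_comp] at e1 eR n2 n3 hT
  simp only [eR, Category.assoc]
  rw [m.mapMulOne_cL, hT, ← reassoc_of% n1, reassoc_of% e1, reassoc_of% eM, reassoc_of% @cML_nat,
    ← reassoc_of% n2, ← reassoc_of% n3]
  simp only [Category.assoc]
  rw [hU]

theorem mapObj_pentagon {A : PsMonData K} (H : A.Pentagon) : (m.mapObj A).Pentagon :=
  m.mapAssoc_pentagon H

theorem mapObj_triangle {A : PsMonData K} (H : A.Triangle) : (m.mapObj A).Triangle :=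
  m.mapAssoc_triangle H

end LaxMonoidal

end Lax

section Cyl

variable {B : Type u₁} [Bicategory.{w₁, v₁} B]

section

variable {a b c a' b' c' : B} {f : a ⟶ a'} {g : b ⟶ b'} {h : c ⟶ c'} {u u' : a ⟶ b}
  {v v' : a' ⟶ b'} {w w' : b ⟶ c} {x x' : b' ⟶ c'}

theorem IsCyl.symm {s : f ≫ v ≅ u ≫ g} {t : f ≫ v' ≅ u' ≫ g} {θ : u ≅ u'} {θ' : v ≅ v'}
    (H : IsCyl s t θ.hom θ'.hom) : IsCyl t s θ.inv θ'.inv := by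
  simp only [IsCyl] at H ⊢
  rw [← cancel_epi (whiskerLeftIso f θ').hom, whiskerLeftIso_hom, reassoc_of% H]
  simp

theorem IsCyl.whiskerLeft {s : g ≫ x ≅ w ≫ h} {t : g ≫ x' ≅ w' ≫ h} {θ : w ⟶ w'} {θ' : x ⟶ x'}
    (H : IsCyl s t θ θ') (q : f ≫ v ≅ u ≫ g) :
    IsCyl (sqV q s) (sqV q t) (u ◁ θ) (v ◁ θ') := by
  have e := congrArg (fun y => (α_ f v x).inv ≫ q.hom ▷ x ≫ (α_ u g x).hom ≫ u ◁ y ≫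
    (α_ u w' h).inv) H
  have e' := congrArg (fun y => (α_ f v x).inv ≫ y ≫ (α_ u g x').hom ≫ u ◁ t.hom ≫
    (α_ u w' h).inv) (whisker_exchange q.hom θ')
  simp only [IsCyl, sqV, Iso.trans_hom, Iso.symm_hom, whiskerRightIso_hom, whiskerLeftIso_hom]
  refine Eq.trans ?_ (e'.trans (Eq.trans ?_ (e.trans ?_))) <;> bicategory

theorem IsCyl.whiskerRight {s : f ≫ v ≅ u ≫ g} {t : f ≫ v' ≅ u' ≫ g} {θ : u ⟶ u'} {θ' : v ⟶ v'}
    (H : IsCyl s t θ θ') (q : g ≫ x ≅ w ≫ h) :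
    IsCyl (sqV s q) (sqV t q) (θ ▷ w) (θ' ▷ x) := by
  have e := congrArg (fun y => (α_ f v x).inv ≫ y ▷ x ≫ (α_ u' g x).hom ≫ u' ◁ q.hom ≫
    (α_ u' w h).inv) H
  have e' := congrArg (fun y => (α_ f v x).inv ≫ s.hom ▷ x ≫ (α_ u g x).hom ≫ y ≫
    (α_ u' w h).inv) (whisker_exchange θ q.hom)
  simp only [IsCyl, sqV, Iso.trans_hom, Iso.symm_hom, whiskerRightIso_hom, whiskerLeftIso_hom]
  refine Eq.trans ?_ (e.trans (Eq.trans ?_ (e'.symm.trans ?_))) <;> bicategory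

end

theorem isCyl_associator {a b c d a' b' c' d' : B} {f : a ⟶ a'} {g : b ⟶ b'} {h : c ⟶ c'}
    {k : d ⟶ d'} {u : a ⟶ b} {v : b ⟶ c} {w : c ⟶ d} {u' : a' ⟶ b'} {v' : b' ⟶ c'} {w' : c' ⟶ d'}
    (s : f ≫ u' ≅ u ≫ g) (t : g ≫ v' ≅ v ≫ h) (r : h ≫ w' ≅ w ≫ k) :
    IsCyl (sqV (sqV s t) r) (sqV s (sqV t r)) (α_ u v w).hom (α_ u' v' w').hom := by
  simp only [IsCyl, sqV, Iso.trans_hom, Iso.symm_hom, whiskerRightIso_hom, whiskerLeftIso_hom]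
  bicategory

theorem isCyl_associator_inv {a b c d a' b' c' d' : B} {f : a ⟶ a'} {g : b ⟶ b'} {h : c ⟶ c'}
    {k : d ⟶ d'} {u : a ⟶ b} {v : b ⟶ c} {w : c ⟶ d} {u' : a' ⟶ b'} {v' : b' ⟶ c'} {w' : c' ⟶ d'}
    (s : f ≫ u' ≅ u ≫ g) (t : g ≫ v' ≅ v ≫ h) (r : h ≫ w' ≅ w ≫ k) :
    IsCyl (sqV s (sqV t r)) (sqV (sqV s t) r) (α_ u v w).inv (α_ u' v' w').inv :=
  (isCyl_associator s t r).symm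

/-- The symmetry of the cylinder condition in the two directions of a cube. -/
theorem IsCyl.transpose {a b c a' b' c' p p' : B} {f : a ⟶ a'} {g : b ⟶ b'} {h : c ⟶ c'}
    {u : a ⟶ b} {v : b ⟶ c} {u' : a' ⟶ b'} {v' : b' ⟶ c'} {r : p ⟶ p'} {x : a ⟶ p} {y : p ⟶ c}
    {x' : a' ⟶ p'} {y' : p' ⟶ c'} {A : f ≫ u' ≅ u ≫ g} {A' : g ≫ v' ≅ v ≫ h}
    {C : f ≫ x' ≅ x ≫ r} {C' : r ≫ y' ≅ y ≫ h} {θ : u ≫ v ≅ x ≫ y} {θ' : u' ≫ v' ≅ x' ≫ y'}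
    (H : IsCyl (sqV A A') (sqV C C') θ.hom θ'.hom) :
    IsCyl (sqV A.symm θ') (sqV θ C'.symm) C.hom A'.hom := by
  have e : (α_ f u' v').inv ≫ A.hom ▷ v' ≫ (α_ u g v').hom ≫ u ◁ A'.hom ≫ (α_ u v h).inv ≫
      θ.hom ▷ h ≫ (α_ x y h).hom = f ◁ θ'.hom ≫ (α_ f x' y').inv ≫ C.hom ▷ y' ≫
        (α_ x r y').hom ≫ x ◁ C'.hom := by
    have e := congrArg (fun z => z ≫ (α_ x y h).hom) H
    simp only [sqV, Iso.trans_hom, Iso.symm_hom, whiskerRightIso_hom, whiskerLeftIso_hom,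
      Category.assoc, Iso.inv_hom_id, Category.comp_id] at e
    exact e.symm
  have e' := congrArg (fun z => (α_ u g v').inv ≫ A.inv ▷ v' ≫ (α_ f u' v').hom ≫ z ≫
    x ◁ C'.inv ≫ (α_ x r y').inv) e
  simp only [Category.assoc, Iso.hom_inv_id_assoc, inv_hom_whiskerRight_assoc,
    Iso.inv_hom_id_assoc, whiskerLeft_hom_inv_assoc, Iso.hom_inv_id, Category.comp_id] at e'
  simp only [IsCyl, sqV, Iso.trans_hom, Iso.symm_hom, whiskerRightIso_hom, whiskerLeftIso_hom,
    Category.assoc]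
  exact e'

theorem IsNat.transpose {a b c d a' b' c' d' : B} {f : a ⟶ b} {v : b ⟶ d} {u : a ⟶ c}
    {g : c ⟶ d} {f' : a' ⟶ b'} {v' : b' ⟶ d'} {u' : a' ⟶ c'} {g' : c' ⟶ d'} {x₀ : a ⟶ a'}
    {x₁ : b ⟶ b'} {y₁ : c ⟶ c'} {x₂ : d ⟶ d'} {P : f ≫ x₁ ≅ x₀ ≫ f'} {Q : v ≫ x₂ ≅ x₁ ≫ v'}
    {P' : u ≫ y₁ ≅ x₀ ≫ u'} {Q' : g ≫ x₂ ≅ y₁ ≫ g'} {σ : f ≫ v ≅ u ≫ g} {σ' : f' ≫ v' ≅ u' ≫ g'}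
    (H : IsNat (MonTwoCat.sqH P Q) (MonTwoCat.sqH P' Q') σ.hom σ'.hom) :
    IsCyl (MonTwoCat.sqV σ Q') (MonTwoCat.sqV P σ') P'.hom Q.hom := by
  have e := congrArg (fun y => (α_ f v x₂).inv ≫ y ≫ (α_ x₀ u' g').inv) H
  simp only [IsCyl, MonTwoCat.sqV, MonTwoCat.sqH, Iso.trans_hom, Iso.symm_hom, whiskerRightIso_hom,
    whiskerLeftIso_hom] at e ⊢
  refine Eq.trans ?_ (e.symm.trans ?_) <;> bicategory

section Tails

variable {a b c a' b' c' : B} {f : a ⟶ a'} {g : b ⟶ b'} {h : c ⟶ c'} {u : a ⟶ b} {w : b ⟶ c}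
  {v : a' ⟶ b'} {x : b' ⟶ c'} {z z' : B} {m : z ⟶ z'} {k : c ⟶ z} {k' : c' ⟶ z'}
  {s : f ≫ v ≅ u ≫ g} {t : g ≫ x ≅ w ≫ h}

theorem IsCyl.tl12_hom {U : a ⟶ c} {V : a' ⟶ c'} {S : f ≫ V ≅ U ≫ h} {σ : U ≅ u ≫ w}
    {σ' : V ≅ v ≫ x} (H : IsCyl S (sqV s t) σ.hom σ'.hom) (q : h ≫ k' ≅ k ≫ m) :
    IsCyl (sqV S q) (sqV s (sqV t q)) (tl12 σ k).hom (tl12 σ' k').hom :=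
  (H.whiskerRight q).comp (isCyl_associator s t q)

theorem IsCyl.tl22_hom {p p' : B} {y : a ⟶ p} {y' : a' ⟶ p'} {l : p ⟶ p'} {o : p ⟶ c}
    {o' : p' ⟶ c'} {s' : f ≫ y' ≅ y ≫ l} {t' : l ≫ o' ≅ o ≫ h} {σ : u ≫ w ≅ y ≫ o}
    {σ' : v ≫ x ≅ y' ≫ o'} (H : IsCyl (sqV s t) (sqV s' t') σ.hom σ'.hom) (q : h ≫ k' ≅ k ≫ m) :
    IsCyl (sqV s (sqV t q)) (sqV s' (sqV t' q)) (MonTwoCat.tl22 σ k).hom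
      (MonTwoCat.tl22 σ' k').hom :=
  (isCyl_associator_inv s t q).comp ((H.whiskerRight q).comp (isCyl_associator s' t' q))

theorem IsCyl.tl33_hom {d d' : B} {i : d ⟶ d'} {o : c ⟶ d} {o' : c' ⟶ d'} {p p' q q' : B}
    {u₁ : a ⟶ p} {u₁' : a' ⟶ p'} {w₁ : p ⟶ q} {w₁' : p' ⟶ q'} {o₁ : q ⟶ d} {o₁' : q' ⟶ d'}
    {g₁ : p ⟶ p'} {h₁ : q ⟶ q'} {r : h ≫ o' ≅ o ≫ i} {s₁ : f ≫ u₁' ≅ u₁ ≫ g₁}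
    {t₁ : g₁ ≫ w₁' ≅ w₁ ≫ h₁} {r₁ : h₁ ≫ o₁' ≅ o₁ ≫ i} {σ : u ≫ w ≫ o ≅ u₁ ≫ w₁ ≫ o₁}
    {σ' : v ≫ x ≫ o' ≅ u₁' ≫ w₁' ≫ o₁'}
    (H : IsCyl (sqV s (sqV t r)) (sqV s₁ (sqV t₁ r₁)) σ.hom σ'.hom) {k : d ⟶ z} {k' : d' ⟶ z'}
    (y : i ≫ k' ≅ k ≫ m) :
    IsCyl (sqV s (sqV t (sqV r y))) (sqV s₁ (sqV t₁ (sqV r₁ y))) (MonTwoCat.tl33 σ k).hom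
      (MonTwoCat.tl33 σ' k').hom :=
  ((isCyl_associator_inv t r y).whiskerLeft s).comp ((isCyl_associator_inv s (sqV t r) y).comp
    ((H.whiskerRight y).comp ((isCyl_associator s₁ (sqV t₁ r₁) y).comp
      ((isCyl_associator t₁ r₁ y).whiskerLeft s₁))))

end Tails

theorem isCyl_idSqV {a b : B} (f : a ⟶ b) :
    IsCyl (idSqV f) (sqV (idSqV f) (idSqV f)) (λ_ (𝟙 a)).inv (λ_ (𝟙 b)).inv := by
  simp only [IsCyl, sqV, idSqV, Iso.trans_hom, Iso.symm_hom, whiskerRightIso_hom,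
    whiskerLeftIso_hom]
  bicategory

theorem isCyl_refl {a b a' b' : B} {f : a ⟶ a'} {g : b ⟶ b'} {u : a ⟶ b} {v : a' ⟶ b'}
    (s : f ≫ v ≅ u ≫ g) : IsCyl s s (𝟙 u) (𝟙 v) := by
  simp [IsCyl]

end Cyl

section TensorCyl

variable {K : Type u₁} [Bicategory.{w₁, v₁} K] [TensorBicategory K]
  {a b c a' b' c' d d' : K} {f : a ⟶ a'} {h : b ⟶ b'} {k : c ⟶ c'}
  {u : a ⟶ b} {u' : b ⟶ c} {v : a' ⟶ b'} {v' : b' ⟶ c'}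

theorem isCyl_wrComp (p : f ≫ v ≅ u ≫ h) (q : h ≫ v' ≅ u' ≫ k) (g : d ⟶ d') :
    IsCyl (tSq (sqV p q) (idSqV g)) (sqV (tSq p (idSqV g)) (tSq q (idSqV g)))
      (wrComp u u' d).hom (wrComp v v' d').hom :=
  ((isCyl_refl (sqV p q)).tSq (isCyl_idSqV g)).comp (tSq_sqV p q (idSqV g) (idSqV g))

theorem isCyl_wlComp (p : f ≫ v ≅ u ≫ h) (q : h ≫ v' ≅ u' ≫ k) (g : d ⟶ d') :
    IsCyl (tSq (idSqV g) (sqV p q)) (sqV (tSq (idSqV g) p) (tSq (idSqV g) q))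
      (wlComp d u u').hom (wlComp d' v v').hom :=
  ((isCyl_idSqV g).tSq (isCyl_refl (sqV p q))).comp (tSq_sqV (idSqV g) (idSqV g) p q)

end TensorCyl

section Image

variable {K : Type u₁} [Bicategory.{w₁, v₁} K] [MonoidalBicategory K] {L : Type u₂}
  [Bicategory.{w₂, v₂} L] [MonoidalBicategory L] {F G : StrictPseudofunctor K L}

namespace LaxMonoidalData

variable (m : LaxMonoidalData F) (n : LaxMonoidalData G) (A B : PsMonData K)

theorem mapObj_mulAssoc_hom :
    (m.mapObj A).mulAssoc.hom =
      (tl12 (wrComp (m.μ A.X A.X) (F.map A.mul) (F.obj A.X)) (m.μ A.X A.X ≫ F.map A.mul)).hom ≫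
        m.μ A.X A.X ⊠ 𝟙 (F.obj A.X) ◁ (tl22 (m.μL A.mul A.X) (F.map A.mul)).hom ≫
        m.μ A.X A.X ⊠ 𝟙 (F.obj A.X) ◁ m.μ (A.X ⊠ₒ A.X) A.X ◁
          (im23 F.toPseudofunctor A.mulAssoc).hom ≫
        (tl33 (m.ω A.X A.X A.X) (F.map (𝟙 A.X ⊠ A.mul) ≫ F.map A.mul)).hom ≫
        asc (F.obj A.X) (F.obj A.X) (F.obj A.X) ◁ 𝟙 (F.obj A.X) ⊠ m.μ A.X A.X ◁
          (tl22 (m.μR A.X A.mul) (F.map A.mul)).inv ≫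
        asc (F.obj A.X) (F.obj A.X) (F.obj A.X) ◁
          (tl12 (wlComp (F.obj A.X) (m.μ A.X A.X) (F.map A.mul)) (m.μ A.X A.X ≫ F.map A.mul)).inv := by
  simp only [LaxMonoidalData.mapObj, tl12, tl22, tl33, im23, mapComp₃, mc₃,
    bicategoricalIsoComp, Iso.trans_hom, Iso.trans_inv, Iso.symm_hom, Iso.symm_inv,
    whiskerLeftIso_hom, whiskerRightIso_hom, whiskerRightIso_inv,
    Category.assoc, BicategoricalCoherence.iso]
  bicategory

theorem mapObj_oneMul_hom :
    (m.mapObj A).oneMul.hom =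
      (tl12 (wrComp m.ι (F.map A.one) (F.obj A.X)) (m.μ A.X A.X ≫ F.map A.mul)).hom ≫
        m.ι ⊠ 𝟙 (F.obj A.X) ◁ (tl22 (m.μL A.one A.X) (F.map A.mul)).hom ≫
        m.ι ⊠ 𝟙 (F.obj A.X) ◁ m.μ I A.X ◁ (im21 F.toPseudofunctor A.oneMul).hom ≫
        (m.ξ A.X).hom := by
  simp only [LaxMonoidalData.mapObj, tl12, tl22, im21, bicategoricalIsoComp, Iso.trans_hom,
    Iso.symm_hom, whiskerLeftIso_hom, whiskerRightIso_hom, Category.assoc,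
    BicategoricalCoherence.iso]
  bicategory

theorem mapObj_mulOne_hom :
    (m.mapObj A).mulOne.hom =
      (tl12 (wlComp (F.obj A.X) m.ι (F.map A.one)) (m.μ A.X A.X ≫ F.map A.mul)).hom ≫
        𝟙 (F.obj A.X) ⊠ m.ι ◁ (tl22 (m.μR A.X A.one) (F.map A.mul)).hom ≫
        𝟙 (F.obj A.X) ⊠ m.ι ◁ m.μ A.X I ◁ (im21 F.toPseudofunctor A.mulOne).hom ≫
        (m.ζ A.X).hom := by
  simp only [LaxMonoidalData.mapObj, tl12, tl22, im21, bicategoricalIsoComp, Iso.trans_hom,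
    Iso.symm_hom, whiskerLeftIso_hom, whiskerRightIso_hom, Category.assoc,
    BicategoricalCoherence.iso]
  bicategory

variable {m n A B}
variable {g : F.obj A.X ⟶ G.obj B.X} {g₂ : F.obj (A.X ⊠ₒ A.X) ⟶ G.obj (B.X ⊠ₒ B.X)}
  {U : g ⊠ g ≫ n.μ B.X B.X ≅ m.μ A.X A.X ≫ g₂} {S : g₂ ≫ G.map B.mul ≅ F.map A.mul ≫ g}

/-- The cylinder condition between the associativity 2-cells of the images of two pseudomonoids. -/
theorem isCyl_mapObj_mulAssoc {gL : F.obj ((A.X ⊠ₒ A.X) ⊠ₒ A.X) ⟶ G.obj ((B.X ⊠ₒ B.X) ⊠ₒ B.X)}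
    {gR : F.obj (A.X ⊠ₒ A.X ⊠ₒ A.X) ⟶ G.obj (B.X ⊠ₒ B.X ⊠ₒ B.X)}
    {UL : g₂ ⊠ g ≫ n.μ (B.X ⊠ₒ B.X) B.X ≅ m.μ (A.X ⊠ₒ A.X) A.X ≫ gL}
    {UR : g ⊠ g₂ ≫ n.μ B.X (B.X ⊠ₒ B.X) ≅ m.μ A.X (A.X ⊠ₒ A.X) ≫ gR}
    {SL : gL ≫ G.map (B.mul ⊠ 𝟙 B.X) ≅ F.map (A.mul ⊠ 𝟙 A.X) ≫ g₂}
    {SR : gR ≫ G.map (𝟙 B.X ⊠ B.mul) ≅ F.map (𝟙 A.X ⊠ A.mul) ≫ g₂}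
    {Sa : gL ≫ G.map (asc B.X B.X B.X) ≅ F.map (asc A.X A.X A.X) ≫ gR}
    (hL : IsCyl (sqV (tSq S (idSqV g)) U) (sqV UL SL) (m.μL A.mul A.X).hom (n.μL B.mul B.X).hom)
    (hR : IsCyl (sqV (tSq (idSqV g) S) U) (sqV UR SR) (m.μR A.X A.mul).hom (n.μR B.X B.mul).hom)
    (hω : IsCyl (sqV (tSq U (idSqV g)) (sqV UL Sa))
      (sqV (assocNat g g g) (sqV (tSq (idSqV g) U) UR))
      (m.ω A.X A.X A.X).hom (n.ω B.X B.X B.X).hom)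
    (hα : IsCyl (sqV SL S) (sqV Sa (sqV SR S)) (im23 F.toPseudofunctor A.mulAssoc).hom
      (im23 G.toPseudofunctor B.mulAssoc).hom) :
    IsCyl (sqV (tSq (sqV U S) (idSqV g)) (sqV U S))
      (sqV (assocNat g g g) (sqV (tSq (idSqV g) (sqV U S)) (sqV U S)))
      (m.mapObj A).mulAssoc.hom (n.mapObj B).mulAssoc.hom := by
  rw [mapObj_mulAssoc_hom, mapObj_mulAssoc_hom]
  exact ((isCyl_wrComp U S g).tl12_hom (sqV U S)).comp <|
    ((hL.tl22_hom S).whiskerLeft (tSq U (idSqV g))).comp <|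
    ((hα.whiskerLeft UL).whiskerLeft (tSq U (idSqV g))).comp <|
    (hω.tl33_hom (sqV SR S)).comp <|
    (((hR.tl22_hom S).symm.whiskerLeft (tSq (idSqV g) U)).whiskerLeft (assocNat g g g)).comp <|
    ((isCyl_wlComp U S g).tl12_hom (sqV U S)).symm.whiskerLeft (assocNat g g g)

variable {g₀ : F.obj (I : K) ⟶ G.obj (I : K)} {U₀ : 𝟙 (I : L) ≫ n.ι ≅ m.ι ≫ g₀}
  {S₁ : g₀ ≫ G.map B.one ≅ F.map A.one ≫ g}

/-- The cylinder condition between the left unit 2-cells of the images of two pseudomonoids. -/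
theorem isCyl_mapObj_oneMul {gI : F.obj (I ⊠ₒ A.X) ⟶ G.obj (I ⊠ₒ B.X)}
    {UI : g₀ ⊠ g ≫ n.μ I B.X ≅ m.μ I A.X ≫ gI}
    {SI : gI ≫ G.map (B.one ⊠ 𝟙 B.X) ≅ F.map (A.one ⊠ 𝟙 A.X) ≫ g₂}
    {Sl : gI ≫ G.map (lun B.X) ≅ F.map (lun A.X) ≫ g}
    (hL : IsCyl (sqV (tSq S₁ (idSqV g)) U) (sqV UI SI) (m.μL A.one A.X).hom (n.μL B.one B.X).hom)
    (hξ : IsCyl (sqV (tSq U₀ (idSqV g)) (sqV UI Sl)) (lUnitNat g) (m.ξ A.X).hom (n.ξ B.X).hom)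
    (h₁ : IsCyl (sqV SI S) Sl (im21 F.toPseudofunctor A.oneMul).hom
      (im21 G.toPseudofunctor B.oneMul).hom) :
    IsCyl (sqV (tSq (sqV U₀ S₁) (idSqV g)) (sqV U S)) (lUnitNat g)
      (m.mapObj A).oneMul.hom (n.mapObj B).oneMul.hom := by
  rw [mapObj_oneMul_hom, mapObj_oneMul_hom]
  exact ((isCyl_wrComp U₀ S₁ g).tl12_hom (sqV U S)).comp <|
    ((hL.tl22_hom S).whiskerLeft (tSq U₀ (idSqV g))).comp <|
    ((h₁.whiskerLeft UI).whiskerLeft (tSq U₀ (idSqV g))).comp hξ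

/-- The cylinder condition between the right unit 2-cells of the images of two pseudomonoids. -/
theorem isCyl_mapObj_mulOne {gI : F.obj (A.X ⊠ₒ I) ⟶ G.obj (B.X ⊠ₒ I)}
    {UI : g ⊠ g₀ ≫ n.μ B.X I ≅ m.μ A.X I ≫ gI}
    {SI : gI ≫ G.map (𝟙 B.X ⊠ B.one) ≅ F.map (𝟙 A.X ⊠ A.one) ≫ g₂}
    {Sr : gI ≫ G.map (run B.X) ≅ F.map (run A.X) ≫ g}
    (hR : IsCyl (sqV (tSq (idSqV g) S₁) U) (sqV UI SI) (m.μR A.X A.one).hom (n.μR B.X B.one).hom)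
    (hζ : IsCyl (sqV (tSq (idSqV g) U₀) (sqV UI Sr)) (rUnitNat g) (m.ζ A.X).hom (n.ζ B.X).hom)
    (h₁ : IsCyl (sqV SI S) Sr (im21 F.toPseudofunctor A.mulOne).hom
      (im21 G.toPseudofunctor B.mulOne).hom) :
    IsCyl (sqV (tSq (idSqV g) (sqV U₀ S₁)) (sqV U S)) (rUnitNat g)
      (m.mapObj A).mulOne.hom (n.mapObj B).mulOne.hom := by
  rw [mapObj_mulOne_hom, mapObj_mulOne_hom]
  exact ((isCyl_wlComp U₀ S₁ g).tl12_hom (sqV U S)).comp <|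
    ((hR.tl22_hom S).whiskerLeft (tSq (idSqV g) U₀)).comp <|
    ((h₁.whiskerLeft UI).whiskerLeft (tSq (idSqV g) U₀)).comp hζ

end LaxMonoidalData

end Image

section MapSq

variable {B : Type u₁} [Bicategory.{w₁, v₁} B] {C : Type u₂} [Bicategory.{w₂, v₂} C]
  (P : Pseudofunctor B C) {a b c a' b' c' : B} {f : a ⟶ a'} {g : b ⟶ b'} {h : c ⟶ c'}
  {u u' : a ⟶ b} {v v' : a' ⟶ b'}

theorem IsCyl.im22 {s : f ≫ v ≅ u ≫ g} {t : f ≫ v' ≅ u' ≫ g} {θ : u ⟶ u'} {θ' : v ⟶ v'}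
    (H : IsCyl s t θ θ') :
    IsCyl (MonTwoCat.im22 P s) (MonTwoCat.im22 P t) (P.map₂ θ) (P.map₂ θ') := by
  have e := congrArg (fun y => (P.mapComp f v).inv ≫ P.map₂ y ≫ (P.mapComp u' g).hom) H
  simp only [P.map₂_comp, P.map₂_whisker_left, P.map₂_whisker_right, Category.assoc,
    Iso.inv_hom_id_assoc, Iso.inv_hom_id, Category.comp_id] at e
  simpa [IsCyl, MonTwoCat.im22] using e

theorem isCyl_mapComp {w : b ⟶ c} {x : b' ⟶ c'} (s : f ≫ v ≅ u ≫ g) (t : g ≫ x ≅ w ≫ h) :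
    IsCyl (im22 P (sqV s t)) (sqV (im22 P s) (im22 P t)) (P.mapComp u w).hom
      (P.mapComp v x).hom := by
  simp only [IsCyl, im22, sqV, Iso.trans_hom, Iso.symm_hom, PrelaxFunctor.map₂Iso_hom,
    whiskerRightIso_hom, whiskerLeftIso_hom, P.map₂_comp, P.map₂_whisker_left,
    P.map₂_whisker_right, P.map₂_associator, map₂_assocInv]
  simp

theorem IsCyl.im21 {w : b ⟶ c} {x : b' ⟶ c'} {s : f ≫ v ≅ u ≫ g} {t : g ≫ x ≅ w ≫ h}
    {y : a ⟶ c} {z : a' ⟶ c'} {r : f ≫ z ≅ y ≫ h} {θ : u ≫ w ≅ y} {θ' : v ≫ x ≅ z}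
    (H : IsCyl (MonTwoCat.sqV s t) r θ.hom θ'.hom) :
    IsCyl (MonTwoCat.sqV (MonTwoCat.im22 P s) (MonTwoCat.im22 P t)) (MonTwoCat.im22 P r)
      (MonTwoCat.im21 P θ).hom (MonTwoCat.im21 P θ').hom :=
  (isCyl_mapComp P s t).symm.comp (H.im22 P)

theorem IsCyl.im23 {w : b ⟶ c} {x : b' ⟶ c'} {s : f ≫ v ≅ u ≫ g} {t : g ≫ x ≅ w ≫ h}
    {p p' q q' : B} {u₁ : a ⟶ p} {v₁ : a' ⟶ p'} {u₂ : p ⟶ q} {v₂ : p' ⟶ q'} {u₃ : q ⟶ c}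
    {v₃ : q' ⟶ c'} {k : p ⟶ p'} {l : q ⟶ q'} {r₁ : f ≫ v₁ ≅ u₁ ≫ k} {r₂ : k ≫ v₂ ≅ u₂ ≫ l}
    {r₃ : l ≫ v₃ ≅ u₃ ≫ h} {θ : u ≫ w ≅ u₁ ≫ u₂ ≫ u₃} {θ' : v ≫ x ≅ v₁ ≫ v₂ ≫ v₃}
    (H : IsCyl (MonTwoCat.sqV s t) (MonTwoCat.sqV r₁ (MonTwoCat.sqV r₂ r₃)) θ.hom θ'.hom) :
    IsCyl (MonTwoCat.sqV (MonTwoCat.im22 P s) (MonTwoCat.im22 P t))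
      (MonTwoCat.sqV (MonTwoCat.im22 P r₁) (MonTwoCat.sqV (MonTwoCat.im22 P r₂)
        (MonTwoCat.im22 P r₃)))
      (MonTwoCat.im23 P θ).hom (MonTwoCat.im23 P θ').hom :=
  (isCyl_mapComp P s t).symm.comp ((H.im22 P).comp ((isCyl_mapComp P r₁ (MonTwoCat.sqV r₂ r₃)).comp
    ((isCyl_mapComp P r₂ r₃).whiskerLeft (MonTwoCat.im22 P r₁))))

theorem isCyl_mapId (f : a ⟶ a') :
    IsCyl (im22 P (idSqV f)) (idSqV (P.map f)) (P.mapId a).hom (P.mapId a').hom := by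
  have e : P.map₂ (λ_ f).inv ≫ (P.mapComp (𝟙 a) f).hom ≫ (P.mapId a).hom ▷ P.map f =
      (λ_ (P.map f)).inv := by
    rw [← cancel_mono (λ_ (P.map f)).hom, Iso.inv_hom_id, ← P.map₂_id, ← Iso.inv_hom_id (λ_ f),
      P.map₂_comp, P.map₂_left_unitor]
    simp
  simp only [IsCyl, im22, idSqV, Iso.trans_hom, Iso.symm_hom, PrelaxFunctor.map₂Iso_hom,
    P.map₂_comp, P.map₂_right_unitor, Category.assoc]
  rw [e]
  simp

end MapSq

section Strong

variable {K : Type u₁} [Bicategory.{w₁, v₁} K] [MonoidalBicategory K] {A B : PsMonData K}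

/-- The axioms of a strong morphism of pseudomonoids. -/
structure StrongMorData.IsStrong (f : StrongMorData A B) : Prop where
  assoc_compat :
    IsCyl (sqV (tSq f.φ (idSqV f.f)) f.φ)
      (sqV (assocNat f.f f.f f.f) (sqV (tSq (idSqV f.f) f.φ) f.φ))
      A.mulAssoc.hom B.mulAssoc.hom
  one_mul_compat :
    IsCyl (sqV (tSq f.unitSq (idSqV f.f)) f.φ) (lUnitNat f.f) A.oneMul.hom B.oneMul.hom
  mul_one_compat :
    IsCyl (sqV (tSq (idSqV f.f) f.unitSq) f.φ) (rUnitNat f.f) A.mulOne.hom B.mulOne.hom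

end Strong

section Image

variable {K : Type u₁} [Bicategory.{w₁, v₁} K] [MonoidalBicategory K] {L : Type u₂}
  [Bicategory.{w₂, v₂} L] [MonoidalBicategory L] {F : StrictPseudofunctor K L}

namespace LaxMonoidal

variable (m : LaxMonoidal F)

section

variable {a b a' b' c d c' d' : K} {f : a ⟶ a'} {g : b ⟶ b'} {u : a ⟶ b} {v : a' ⟶ b'}
  {h : c ⟶ c'} {k : d ⟶ d'} {w : c ⟶ d} {x : c' ⟶ d'}

theorem isNat_μNat_tSq (s : f ≫ v ≅ u ≫ g) (t : h ≫ x ≅ w ≫ k) :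
    IsNat (sqH (m.μNat f h) (m.μNat v x)) (sqH (m.μNat u w) (m.μNat g k))
      (tSq (mapSq F s) (mapSq F t)).hom (mapSq F (tSq s t)).hom := by
  refine (((m.μNat_comp f h v x).symm
    ((F.mapComp f v ⊠ᵢ F.mapComp h x) ≪≫ tComp _ _ _ _)
    (F.map₂Iso (tComp f h v x) ≪≫ F.mapComp _ _)).comp ((m.μNat_nat s.hom t.hom).comp
      (m.μNat_comp u w g k))).of_eq ?_ ?_
  · simp [tSq, mapSq, tMap₂_comp]
  · simp only [tSq, mapSq, F.map₂_comp, Iso.trans_hom, Iso.trans_inv, Iso.symm_hom,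
      PrelaxFunctor.map₂Iso_hom, PrelaxFunctor.map₂Iso_inv, Category.assoc,
      tIso_hom]

theorem isCyl_μL (s : f ≫ v ≅ u ≫ g) (k : c ⟶ c') :
    IsCyl (sqV (tSq (mapSq F s) (idSqV (F.map k))) (m.μNat g k))
      (sqV (m.μNat f k) (mapSq F (tSq s (idSqV k)))) (m.μL u c).hom (m.μL v c').hom := by
  refine IsNat.transpose ((((((m.isNat_μL v c').symm (Iso.refl _ ⊠ᵢ F.mapId _)
    (Iso.refl _)).sqH_left (m.μNat f k)).comp
    ((m.isNat_μNat_tSq s (idSqV k)).comp ((m.isNat_μL u c).sqH_right (m.μNat g k))))).of_eq ?_ ?_)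
  · have e := (isCyl_refl (mapSq F s)).tSq (isCyl_mapId F.toPseudofunctor k)
    rw [← cancel_epi (whiskerLeftIso (F.map f ⊠ F.map k) (Iso.refl (F.map v) ⊠ᵢ F.mapId c')).hom]
    refine Eq.trans ?_ (Eq.symm e)
    have c := (whiskerLeftIso (F.map f ⊠ F.map k)
      (Iso.refl (F.map v) ⊠ᵢ F.mapId c')).hom_inv_id
    simp only [whiskerLeftIso_hom, whiskerLeftIso_inv] at c
    simp only [whiskerLeftIso_hom]
    erw [reassoc_of% c]
    rfl
  · simp

theorem isCyl_μR (s : f ≫ v ≅ u ≫ g) (k : c ⟶ c') :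
    IsCyl (sqV (tSq (idSqV (F.map k)) (mapSq F s)) (m.μNat k g))
      (sqV (m.μNat k f) (mapSq F (tSq (idSqV k) s))) (m.μR c u).hom (m.μR c' v).hom := by
  refine IsNat.transpose ((((((m.isNat_μR c' v).symm (F.mapId _ ⊠ᵢ Iso.refl _)
    (Iso.refl _)).sqH_left (m.μNat k f)).comp
    ((m.isNat_μNat_tSq (idSqV k) s).comp ((m.isNat_μR c u).sqH_right (m.μNat k g))))).of_eq ?_ ?_)
  · have e := (isCyl_mapId F.toPseudofunctor k).tSq (isCyl_refl (mapSq F s))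
    rw [← cancel_epi (whiskerLeftIso (F.map k ⊠ F.map f) (F.mapId c' ⊠ᵢ Iso.refl (F.map v))).hom]
    refine Eq.trans ?_ (Eq.symm e)
    have c := (whiskerLeftIso (F.map k ⊠ F.map f)
      (F.mapId c' ⊠ᵢ Iso.refl (F.map v))).hom_inv_id
    simp only [whiskerLeftIso_hom, whiskerLeftIso_inv] at c
    simp only [whiskerLeftIso_hom]
    erw [reassoc_of% c]
    rfl
  · simp

end

variable {A B : PsMonData K} (f : StrongMorData A B)

theorem mapMor_unitSq : (m.mapMor f).unitSq = sqV m.ιSq (mapSq F f.unitSq) := by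
  ext
  have e : (F.mapComp (𝟙 (I : K)) B.one).inv ≫ F.map₂ (λ_ B.one).hom =
     (F.mapId I).hom ▷ F.map B.one ≫ (λ_ (F.map B.one)).hom := by
    rw [F.map₂_left_unitor]; simp
  change (λ_ (m.ι ≫ F.map B.one)).hom ≫ m.ι ◁ (F.map₂ f.φ₀.hom ≫ (F.mapComp A.one f.f).hom) ≫
    (α_ m.ι (F.map A.one) (F.map f.f)).inv = _
  simp only [StrongMorData.unitSq, sqV,
    LaxMonoidalData.ιSq, mapSq, idSqH, Iso.trans_hom, Iso.symm_hom, PrelaxFunctor.map₂Iso_hom,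
    whiskerLeftIso_hom, whiskerRightIso_hom, F.map₂_comp, Category.assoc, reassoc_of% e]
  have c : m.ι ◁ (F.mapId I).inv ▷ F.map B.one ≫ m.ι ◁ (F.mapId I).hom ▷ F.map B.one = 𝟙 _ := by
    rw [← whiskerLeft_comp, ← comp_whiskerRight, Iso.inv_hom_id, id_whiskerRight, whiskerLeft_id]
  simp [reassoc_of% c]

variable {f} in
theorem isStrong_mapMor (H : f.IsStrong) : (m.mapMor f).IsStrong where
  assoc_compat := LaxMonoidalData.isCyl_mapObj_mulAssoc (m.isCyl_μL f.φ f.f)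
    (m.isCyl_μR f.φ f.f) (m.ω_modif f.f f.f f.f) (H.assoc_compat.im23 F.toPseudofunctor)
  one_mul_compat := by
    rw [mapMor_unitSq]
    exact LaxMonoidalData.isCyl_mapObj_oneMul (m.isCyl_μL f.unitSq f.f) (m.ξ_modif f.f)
      (H.one_mul_compat.im21 F.toPseudofunctor)
  mul_one_compat := by
    rw [mapMor_unitSq]
    exact LaxMonoidalData.isCyl_mapObj_mulOne (m.isCyl_μR f.unitSq f.f) (m.ζ_modif f.f)
      (H.mul_one_compat.im21 F.toPseudofunctor)

end LaxMonoidal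

end Image

section Trans

variable {K : Type u₁} [Bicategory.{w₁, v₁} K] {L : Type u₂} [Bicategory.{w₂, v₂} L]
  {F G : StrictPseudofunctor K L}

namespace TwoNatTrans

variable (τ : TwoNatTrans F G)

theorem isCyl_sq {a b : K} {f g : a ⟶ b} (σ : f ⟶ g) :
    IsCyl (τ.sq f) (τ.sq g) (F.map₂ σ) (G.map₂ σ) := by
  have e := τ.naturality₂ σ
  rw [IsCyl, ← cancel_epi (eqToHom (τ.naturality f))]
  simp only [ sq, eqToIso.hom, eqToHom_trans_assoc, eqToHom_refl, Category.id_comp]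
  rw [← reassoc_of% e]
  simp

theorem isCyl_mapComp [Bicategory.Strict L] {a b c : K} (f : a ⟶ b) (g : b ⟶ c) :
    IsCyl (τ.sq (f ≫ g)) (sqV (τ.sq f) (τ.sq g)) (F.mapComp f g).hom (G.mapComp f g).hom := by
  simp only [IsCyl, sq, sqV, F.mapComp_eq_eqToIso, G.mapComp_eq_eqToIso,
    Strict.associator_eqToIso, eqToIso.hom, Iso.trans_hom, Iso.symm_hom, whiskerRightIso_hom,
    whiskerLeftIso_hom, eqToIso.inv, Bicategory.whiskerLeft_eqToHom, Bicategory.eqToHom_whiskerRight,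
    eqToHom_trans]

theorem isCyl_mapId [Bicategory.Strict L] (a : K) :
    IsCyl (τ.sq (𝟙 a)) (idSqV (τ.app a)) (F.mapId a).hom (G.mapId a).hom := by
  simp only [IsCyl, sq, idSqV, F.mapId_eq_eqToIso, G.mapId_eq_eqToIso,
    Strict.leftUnitor_eqToIso, Strict.rightUnitor_eqToIso, eqToIso.hom, Iso.trans_hom, Iso.symm_hom,
     eqToIso.inv, Bicategory.whiskerLeft_eqToHom, Bicategory.eqToHom_whiskerRight,
    eqToHom_trans]

theorem isCyl_im21 [Bicategory.Strict L] {a b c : K} {f : a ⟶ b} {g : b ⟶ c} {h : a ⟶ c}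
    (s : f ≫ g ≅ h) :
    IsCyl (sqV (τ.sq f) (τ.sq g)) (τ.sq h) (im21 F.toPseudofunctor s).hom
      (im21 G.toPseudofunctor s).hom :=
  (τ.isCyl_mapComp f g).symm.comp (τ.isCyl_sq s.hom)

theorem isCyl_im22 [Bicategory.Strict L] {a b a' b' : K} {f : a ⟶ a'} {g : b ⟶ b'} {u : a ⟶ b}
    {v : a' ⟶ b'} (s : f ≫ v ≅ u ≫ g) :
    IsCyl (sqV (τ.sq f) (τ.sq v)) (sqV (τ.sq u) (τ.sq g)) (im22 F.toPseudofunctor s).hom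
      (im22 G.toPseudofunctor s).hom :=
  (τ.isCyl_mapComp f v).symm.comp ((τ.isCyl_sq s.hom).comp (τ.isCyl_mapComp u g))

theorem isCyl_im23 [Bicategory.Strict L] {a b c p q : K} {f : a ⟶ b} {g : b ⟶ c} {f' : a ⟶ p}
    {g' : p ⟶ q} {h' : q ⟶ c} (s : f ≫ g ≅ f' ≫ g' ≫ h') :
    IsCyl (sqV (τ.sq f) (τ.sq g)) (sqV (τ.sq f') (sqV (τ.sq g') (τ.sq h')))
      (im23 F.toPseudofunctor s).hom (im23 G.toPseudofunctor s).hom :=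
  (τ.isCyl_mapComp f g).symm.comp ((τ.isCyl_sq s.hom).comp ((τ.isCyl_mapComp f' (g' ≫ h')).comp
    ((τ.isCyl_mapComp g' h').whiskerLeft (τ.sq f'))))

end TwoNatTrans

theorem tSq_symm [TensorBicategory L] {a b a' b' c d c' d' : L} {f : a ⟶ a'} {g : b ⟶ b'}
    {u : a ⟶ b} {v : a' ⟶ b'} {h : c ⟶ c'} {k : d ⟶ d'} {s : c ⟶ d} {t : c' ⟶ d'}
    (p : f ≫ v ≅ u ≫ g) (q : h ≫ t ≅ s ≫ k) : (tSq p q).symm = tSq p.symm q.symm := by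
  ext
  simp [tSq]

namespace MonoidalTrans

variable [MonoidalBicategory K] [MonoidalBicategory L] [Bicategory.Strict L] {τ : TwoNatTrans F G}
  {m : LaxMonoidalData F} {n : LaxMonoidalData G} (t : MonoidalTrans τ m n)

theorem isCyl_μNat {a a' b b' : K} (f : a ⟶ a') (g : b ⟶ b') :
    IsCyl (sqV (tSq (τ.sq f) (τ.sq g)) (t.u a' b')) (sqV (t.u a b) (τ.sq (f ⊠ g)))
      (m.μNat f g).hom (n.μNat f g).hom := by
  have h := (t.u_modif f g).transpose
  rwa [tSq_symm] at h

theorem isCyl_μL {a a' : K} (f : a ⟶ a') (b : K) :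
    IsCyl (sqV (tSq (τ.sq f) (idSqV (τ.app b))) (t.u a' b)) (sqV (t.u a b) (τ.sq (f ⊠ 𝟙 b)))
      (m.μL f b).hom (n.μL f b).hom :=
  (((isCyl_refl (τ.sq f)).tSq (τ.isCyl_mapId b).symm).whiskerRight (t.u a' b)).comp
    (t.isCyl_μNat f (𝟙 b))

theorem isCyl_μR (a : K) {b b' : K} (f : b ⟶ b') :
    IsCyl (sqV (tSq (idSqV (τ.app a)) (τ.sq f)) (t.u a b')) (sqV (t.u a b) (τ.sq (𝟙 a ⊠ f)))
      (m.μR a f).hom (n.μR a f).hom :=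
  (((τ.isCyl_mapId a).symm.tSq (isCyl_refl (τ.sq f))).whiskerRight (t.u a b')).comp
    (t.isCyl_μNat (𝟙 a) f)

variable (A : PsMonData K)

theorem component_unitSq :
    (t.component A).unitSq = sqV (λ_ n.ι ≪≫ t.u₀) (τ.sq A.one) := by
  ext
  change (λ_ (n.ι ≫ G.map A.one)).hom ≫ t.u₀.hom ▷ G.map A.one ≫ (α_ _ _ _).hom ≫
    m.ι ◁ (τ.sq A.one).hom ≫ (α_ _ _ _).inv = _
  simp [sqV]

theorem isStrong_component : (t.component A).IsStrong where
  assoc_compat := LaxMonoidalData.isCyl_mapObj_mulAssoc (t.isCyl_μL A.mul A.X)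
    (t.isCyl_μR A.X A.mul) (t.assoc_compat A.X A.X A.X) (τ.isCyl_im23 A.mulAssoc)
  one_mul_compat := by
    rw [component_unitSq]
    exact LaxMonoidalData.isCyl_mapObj_oneMul (t.isCyl_μL A.one A.X) (t.left_unit_compat A.X)
      (τ.isCyl_im21 A.oneMul)
  mul_one_compat := by
    rw [component_unitSq]
    exact LaxMonoidalData.isCyl_mapObj_mulOne (t.isCyl_μR A.X A.one) (t.right_unit_compat A.X)
      (τ.isCyl_im21 A.mulOne)

end MonoidalTrans

end Trans

section Tails

variable {B : Type u₁} [Bicategory.{w₁, v₁} B] {C : Type u₂} [Bicategory.{w₂, v₂} C]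

theorem tl22_sqV {a b c a' b' c' z : B} {f : a ⟶ a'} {g : b ⟶ b'} {h : c ⟶ c'} {u : a ⟶ b}
    {u' : b ⟶ c} {v : a' ⟶ b'} {v' : b' ⟶ c'} (s : f ≫ v ≅ u ≫ g) (t : g ≫ v' ≅ u' ≫ h)
    (k : c' ⟶ z) :
    (tl22 (sqV s t) k).hom ≫ (α_ u u' (h ≫ k)).hom =
      f ◁ (α_ v v' k).hom ≫ (tl22 s (v' ≫ k)).hom ≫ u ◁ (tl22 t k).hom := by
  simp only [tl22, sqV, Iso.trans_hom, Iso.symm_hom, whiskerRightIso_hom, whiskerLeftIso_hom]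
  bicategory

/-- Reassociating a composite whose last two factors are the image of a composite. -/
def reassocMap (P : Pseudofunctor B C) {a b c : B} {x : C} (t : x ⟶ P.obj a) (q : a ⟶ b)
    (p : b ⟶ c) : (t ≫ P.map q) ≫ P.map p ≅ t ≫ P.map (q ≫ p) :=
  α_ t (P.map q) (P.map p) ≪≫ whiskerLeftIso t (P.mapComp q p).symm

theorem tl12_mapComp_assoc (Q : Pseudofunctor B C) {x a b c : B} {z : C} (t : x ⟶ a) {r : a ⟶ c}
    {q : a ⟶ b} {p : b ⟶ c} (e : r ≅ q ≫ p) (k : Q.obj c ⟶ z) :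
    Q.map₂ ((α_ t q p).hom ≫ t ◁ e.inv) ▷ k ≫ (tl12 (Q.mapComp t r) k).hom ≫
        Q.map t ◁ (tl12 (im12 Q e) k).hom =
      (tl12 (Q.mapComp (t ≫ q) p) k).hom ≫ (tl12 (Q.mapComp t q) (Q.map p ≫ k)).hom := by
  have c : Q.map t ◁ Q.map₂ e.inv ▷ k ≫ Q.map t ◁ Q.map₂ e.hom ▷ k = 𝟙 _ := by
    rw [← whiskerLeft_comp, ← comp_whiskerRight, ← Q.map₂_comp, e.inv_hom_id, Q.map₂_id,
      id_whiskerRight, whiskerLeft_id]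
  simp only [tl12, im12, Iso.trans_hom, whiskerRightIso_hom, Q.map₂_comp,
    PrelaxFunctor.map₂Iso_hom, Q.map₂_associator, Q.map₂_whisker_left, comp_whiskerRight,
    whiskerLeft_comp, Category.assoc]
  simp [reassoc_of% c]

end Tails

section Comp

variable {K : Type u₁} [Bicategory.{w₁, v₁} K] {L : Type u₂} [Bicategory.{w₂, v₂} L]
  {M : Type u₃} [Bicategory.{w₃, v₃} M]
  [MonoidalBicategory K] [MonoidalBicategory L] [MonoidalBicategory M]
  {F : StrictPseudofunctor K L} {G : StrictPseudofunctor L M}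

namespace LaxMonoidal

variable (m : LaxMonoidal F) (n : LaxMonoidal G)

theorem comp_μL {a a' : K} (f : a ⟶ a') (b : K) :
    (m.toLaxMonoidalData.comp n.toLaxMonoidalData).μL f b =
      sqV (n.μL (F.map f) (F.obj b)) (im22 G.toPseudofunctor (m.μL f b)) := by
  have h := (IsNat.sqV ((n.μNat_nat (𝟙 (F.map f)) (F.mapId b).hom).comp
    (n.isNat_μL (F.map f) (F.obj b))) (((m.isNat_μL f b).im22 G.toPseudofunctor).of_eq
      (Category.comp_id _).symm rfl)).of_eq (τ := 𝟙 (G.map (F.map f)) ⊠₂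
        (G.map₂Iso (F.mapId b) ≪≫ G.mapId (F.obj b)).hom)
      (by simp [← tMap₂_comp]) (G.map₂_id _)
  have h' := h.symm (Iso.refl (G.map (F.map f)) ⊠ᵢ (G.map₂Iso (F.mapId b) ≪≫ G.mapId (F.obj b)))
    (Iso.refl _)
  ext
  rw [IsNat, Iso.refl_inv, whiskerLeft_id, Category.comp_id] at h'
  exact h'

theorem comp_μR (a : K) {b b' : K} (f : b ⟶ b') :
    (m.toLaxMonoidalData.comp n.toLaxMonoidalData).μR a f =
      sqV (n.μR (F.obj a) (F.map f)) (im22 G.toPseudofunctor (m.μR a f)) := by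
  have h := (IsNat.sqV ((n.μNat_nat (F.mapId a).hom (𝟙 (F.map f))).comp
    (n.isNat_μR (F.obj a) (F.map f))) (((m.isNat_μR a f).im22 G.toPseudofunctor).of_eq
      (Category.comp_id _).symm rfl)).of_eq (τ :=
        (G.map₂Iso (F.mapId a) ≪≫ G.mapId (F.obj a)).hom ⊠₂ 𝟙 (G.map (F.map f)))
      (by simp [← tMap₂_comp]) (G.map₂_id _)
  have h' := h.symm ((G.map₂Iso (F.mapId a) ≪≫ G.mapId (F.obj a)) ⊠ᵢ Iso.refl (G.map (F.map f)))
    (Iso.refl _)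
  ext
  rw [IsNat, Iso.refl_inv, whiskerLeft_id, Category.comp_id] at h'
  exact h'

theorem wrComp_assoc_tail {x : M} {a b c : L} (y : M) {z : M} (t : x ⟶ G.obj a) (q : a ⟶ b) (p : b ⟶ c)
    (k : G.obj c ⊠ₒ y ⟶ z) :
    ((reassocMap G.toPseudofunctor t q p).hom ⊠₂ 𝟙 (𝟙 y)) ▷ k ≫
        (tl12 (wrComp t (G.map (q ≫ p)) y) k).hom ≫
        t ⊠ 𝟙 y ◁ (tl12 (r12 (G.mapComp q p) y) k).hom =
      (tl12 (wrComp (t ≫ G.map q) (G.map p) y) k).hom ≫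
        (tl12 (wrComp t (G.map q) y) (G.map p ⊠ 𝟙 y ≫ k)).hom :=
  tl12_mapComp_assoc (tensR y) t (G.mapComp q p) k

theorem wlComp_assoc_tail {x : M} {a b c : L} (y : M) {z : M} (t : x ⟶ G.obj a) (q : a ⟶ b) (p : b ⟶ c)
    (k : y ⊠ₒ G.obj c ⟶ z) :
    (𝟙 (𝟙 y) ⊠₂ (reassocMap G.toPseudofunctor t q p).hom) ▷ k ≫
        (tl12 (wlComp y t (G.map (q ≫ p))) k).hom ≫
        𝟙 y ⊠ t ◁ (tl12 (l12 (G.mapComp q p) y) k).hom =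
      (tl12 (wlComp y (t ≫ G.map q) (G.map p)) k).hom ≫
        (tl12 (wlComp y t (G.map q)) (𝟙 y ⊠ G.map p ≫ k)).hom :=
  tl12_mapComp_assoc (tensL y) t (G.mapComp q p) k

section

variable {x : M} {w : L} {a b : K} (t : x ⟶ G.obj w) (q : w ⟶ F.obj a) (p : a ⟶ b) (y : K) {z : M}

theorem cL_comp (k : G.obj (F.obj (b ⊠ₒ y)) ⟶ z) :
    (tl12 (wrComp (t ≫ G.map q) (G.map (F.map p)) (G.obj (F.obj y)))
          ((n.μ (F.obj b) (F.obj y) ≫ G.map (m.μ b y)) ≫ k)).hom ≫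
        (t ≫ G.map q) ⊠ 𝟙 (G.obj (F.obj y)) ◁
          (tl22 (sqV (n.μL (F.map p) (F.obj y)) (im22 G.toPseudofunctor (m.μL p y))) k).hom ≫
        (t ≫ G.map q) ⊠ 𝟙 (G.obj (F.obj y)) ◁
          (α_ (n.μ (F.obj a) (F.obj y)) (G.map (m.μ a y)) (G.map (F.map (p ⊠ 𝟙 y)) ≫ k)).hom ≫
        (n.cL t q (F.obj y) (G.map (m.μ a y) ≫ G.map (F.map (p ⊠ 𝟙 y)) ≫ k)).hom =
      ((reassocMap G.toPseudofunctor t q (F.map p)).hom ⊠₂ 𝟙 (𝟙 (G.obj (F.obj y)))) ▷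
          ((n.μ (F.obj b) (F.obj y) ≫ G.map (m.μ b y)) ≫ k) ≫
        (t ≫ G.map (q ≫ F.map p)) ⊠ 𝟙 (G.obj (F.obj y)) ◁
          (α_ (n.μ (F.obj b) (F.obj y)) (G.map (m.μ b y)) k).hom ≫
        (n.cL t (q ≫ F.map p) (F.obj y) (G.map (m.μ b y) ≫ k)).hom ≫
        t ⊠ 𝟙 (G.obj (F.obj y)) ◁ n.μ w (F.obj y) ◁
          ((tl12 (im12 G.toPseudofunctor (wrComp q (F.map p) (F.obj y)))
              (G.map (m.μ b y) ≫ k)).hom ≫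
            G.map (q ⊠ 𝟙 (F.obj y)) ◁ (tl22 (im22 G.toPseudofunctor (m.μL p y)) k).hom) := by
  have e1 := congrArg (fun v => (t ≫ G.map q) ⊠ 𝟙 (G.obj (F.obj y)) ◁ v)
    (tl22_sqV (n.μL (F.map p) (F.obj y)) (im22 G.toPseudofunctor (m.μL p y)) k)
  have e2 := congrArg (fun v => t ⊠ 𝟙 (G.obj (F.obj y)) ◁ v)
    ((n.μL_comp q (F.map p) (F.obj y)).tl_comp (G.map (m.μ b y) ≫ k))
  have e3 := wrComp_assoc_tail (G.obj (F.obj y)) t q (F.map p)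
    (n.μ (F.obj b) (F.obj y) ≫ G.map (m.μ b y) ≫ k)
  have n1 := tl12_nat (wrComp (t ≫ G.map q) (G.map (F.map p)) (G.obj (F.obj y)))
    (α_ (n.μ (F.obj b) (F.obj y)) (G.map (m.μ b y)) k).hom
  have n2 := congrArg (fun v => t ⊠ 𝟙 (G.obj (F.obj y)) ◁ v) (tl22_nat (n.μL q (F.obj y))
    (tl22 (im22 G.toPseudofunctor (m.μL p y)) k).hom)
  have n3 := whisker_exchange ((reassocMap G.toPseudofunctor t q (F.map p)).hom ⊠₂
    𝟙 (𝟙 (G.obj (F.obj y)))) (α_ (n.μ (F.obj b) (F.obj y)) (G.map (m.μ b y)) k).hom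
  have n4 := tl12_nat (wrComp t (G.map q) (G.obj (F.obj y)))
    (tl22 (n.μL (F.map p) (F.obj y)) (G.map (m.μ b y) ≫ k)).hom
  have n5 := tl12_nat (wrComp t (G.map q) (G.obj (F.obj y)))
    (n.μ (F.obj a) (F.obj y) ◁ (tl22 (im22 G.toPseudofunctor (m.μL p y)) k).hom)
  simp only [whiskerLeft_comp] at e1 e2 n2
  simp only [cL, Iso.trans_hom, whiskerLeftIso_hom, whiskerLeft_comp, Category.assoc]
  rw [reassoc_of% e1, ← reassoc_of% n1, ← reassoc_of% n3]
  erw [reassoc_of% e2]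
  erw [reassoc_of% e3]
  rw [reassoc_of% n5, n2, reassoc_of% n4]

theorem cR_comp (k : G.obj (F.obj (y ⊠ₒ b)) ⟶ z) :
    (tl12 (wlComp (G.obj (F.obj y)) (t ≫ G.map q) (G.map (F.map p)))
          ((n.μ (F.obj y) (F.obj b) ≫ G.map (m.μ y b)) ≫ k)).hom ≫
        𝟙 (G.obj (F.obj y)) ⊠ (t ≫ G.map q) ◁
          (tl22 (sqV (n.μR (F.obj y) (F.map p)) (im22 G.toPseudofunctor (m.μR y p))) k).hom ≫
        𝟙 (G.obj (F.obj y)) ⊠ (t ≫ G.map q) ◁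
          (α_ (n.μ (F.obj y) (F.obj a)) (G.map (m.μ y a)) (G.map (F.map (𝟙 y ⊠ p)) ≫ k)).hom ≫
        (n.cR t q (F.obj y) (G.map (m.μ y a) ≫ G.map (F.map (𝟙 y ⊠ p)) ≫ k)).hom =
      (𝟙 (𝟙 (G.obj (F.obj y))) ⊠₂ (reassocMap G.toPseudofunctor t q (F.map p)).hom) ▷
          ((n.μ (F.obj y) (F.obj b) ≫ G.map (m.μ y b)) ≫ k) ≫
        𝟙 (G.obj (F.obj y)) ⊠ (t ≫ G.map (q ≫ F.map p)) ◁
          (α_ (n.μ (F.obj y) (F.obj b)) (G.map (m.μ y b)) k).hom ≫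
        (n.cR t (q ≫ F.map p) (F.obj y) (G.map (m.μ y b) ≫ k)).hom ≫
        𝟙 (G.obj (F.obj y)) ⊠ t ◁ n.μ (F.obj y) w ◁
          ((tl12 (im12 G.toPseudofunctor (wlComp (F.obj y) q (F.map p)))
              (G.map (m.μ y b) ≫ k)).hom ≫
            G.map (𝟙 (F.obj y) ⊠ q) ◁ (tl22 (im22 G.toPseudofunctor (m.μR y p)) k).hom) := by
  have e1 := congrArg (fun v => 𝟙 (G.obj (F.obj y)) ⊠ (t ≫ G.map q) ◁ v)
    (tl22_sqV (n.μR (F.obj y) (F.map p)) (im22 G.toPseudofunctor (m.μR y p)) k)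
  have e2 := congrArg (fun v => 𝟙 (G.obj (F.obj y)) ⊠ t ◁ v)
    ((n.μR_comp (F.obj y) q (F.map p)).tl_comp (G.map (m.μ y b) ≫ k))
  have e3 := wlComp_assoc_tail (G.obj (F.obj y)) t q (F.map p)
    (n.μ (F.obj y) (F.obj b) ≫ G.map (m.μ y b) ≫ k)
  have n1 := tl12_nat (wlComp (G.obj (F.obj y)) (t ≫ G.map q) (G.map (F.map p)))
    (α_ (n.μ (F.obj y) (F.obj b)) (G.map (m.μ y b)) k).hom
  have n2 := congrArg (fun v => 𝟙 (G.obj (F.obj y)) ⊠ t ◁ v) (tl22_nat (n.μR (F.obj y) q)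
    (tl22 (im22 G.toPseudofunctor (m.μR y p)) k).hom)
  have n3 := whisker_exchange (𝟙 (𝟙 (G.obj (F.obj y))) ⊠₂
    (reassocMap G.toPseudofunctor t q (F.map p)).hom)
    (α_ (n.μ (F.obj y) (F.obj b)) (G.map (m.μ y b)) k).hom
  have n4 := tl12_nat (wlComp (G.obj (F.obj y)) t (G.map q))
    (tl22 (n.μR (F.obj y) (F.map p)) (G.map (m.μ y b) ≫ k)).hom
  have n5 := tl12_nat (wlComp (G.obj (F.obj y)) t (G.map q))
    (n.μ (F.obj y) (F.obj a) ◁ (tl22 (im22 G.toPseudofunctor (m.μR y p)) k).hom)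
  simp only [whiskerLeft_comp] at e1 e2 n2
  simp only [cR, Iso.trans_hom, whiskerLeftIso_hom, whiskerLeft_comp, Category.assoc]
  rw [reassoc_of% e1, ← reassoc_of% n1, ← reassoc_of% n3]
  erw [reassoc_of% e2]
  erw [reassoc_of% e3]
  rw [reassoc_of% n5, n2, reassoc_of% n4]

end

variable (a b c : K) {z : M}

/-- The associativity 2-cell of a composite lax monoidal 2-functor. -/
def compω : (n.μ (F.obj a) (F.obj b) ≫ G.map (m.μ a b)) ⊠ 𝟙 (G.obj (F.obj c)) ≫
      (n.μ (F.obj (a ⊠ₒ b)) (F.obj c) ≫ G.map (m.μ (a ⊠ₒ b) c)) ≫ G.map (F.map (asc a b c)) ≅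
    asc (G.obj (F.obj a)) (G.obj (F.obj b)) (G.obj (F.obj c)) ≫
      𝟙 (G.obj (F.obj a)) ⊠ (n.μ (F.obj b) (F.obj c) ≫ G.map (m.μ b c)) ≫
        n.μ (F.obj a) (F.obj (b ⊠ₒ c)) ≫ G.map (m.μ a (b ⊠ₒ c)) :=
  (m.toLaxMonoidalData.comp n.toLaxMonoidalData).ω a b c

/-- The left unit 2-cell of a composite lax monoidal 2-functor. -/
def compξ : (n.ι ≫ G.map m.ι) ⊠ 𝟙 (G.obj (F.obj a)) ≫
      (n.μ (F.obj I) (F.obj a) ≫ G.map (m.μ I a)) ≫ G.map (F.map (lun a)) ≅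
    lun (G.obj (F.obj a)) :=
  (m.toLaxMonoidalData.comp n.toLaxMonoidalData).ξ a

/-- The right unit 2-cell of a composite lax monoidal 2-functor. -/
def compζ : 𝟙 (G.obj (F.obj a)) ⊠ (n.ι ≫ G.map m.ι) ≫
      (n.μ (F.obj a) (F.obj I) ≫ G.map (m.μ a I)) ≫ G.map (F.map (run a)) ≅
    run (G.obj (F.obj a)) :=
  (m.toLaxMonoidalData.comp n.toLaxMonoidalData).ζ a

theorem comp_ω_tail (k : G.obj (F.obj (a ⊠ₒ b ⊠ₒ c)) ⟶ z) :
    (tl33 (m.compω n a b c) k).hom =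
      (n.μ (F.obj a) (F.obj b) ≫ G.map (m.μ a b)) ⊠ 𝟙 (G.obj (F.obj c)) ◁
          (α_ (n.μ (F.obj (a ⊠ₒ b)) (F.obj c)) (G.map (m.μ (a ⊠ₒ b) c))
            (G.map (F.map (asc a b c)) ≫ k)).hom ≫
        (n.cL (n.μ (F.obj a) (F.obj b)) (m.μ a b) (F.obj c)
          (G.map (m.μ (a ⊠ₒ b) c) ≫ G.map (F.map (asc a b c)) ≫ k)).hom ≫
        n.μ (F.obj a) (F.obj b) ⊠ 𝟙 (G.obj (F.obj c)) ◁ n.μ (F.obj a ⊠ₒ F.obj b) (F.obj c) ◁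
          (tl33 (im33 G.toPseudofunctor (m.ω a b c)) k).hom ≫
        (tl33 (n.ω (F.obj a) (F.obj b) (F.obj c))
          (G.map (𝟙 (F.obj a) ⊠ m.μ b c) ≫ G.map (m.μ a (b ⊠ₒ c)) ≫ k)).hom ≫
        asc (G.obj (F.obj a)) (G.obj (F.obj b)) (G.obj (F.obj c)) ◁
          (n.cR (n.μ (F.obj b) (F.obj c)) (m.μ b c) (F.obj a) (G.map (m.μ a (b ⊠ₒ c)) ≫ k)).inv ≫
        asc (G.obj (F.obj a)) (G.obj (F.obj b)) (G.obj (F.obj c)) ◁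
          𝟙 (G.obj (F.obj a)) ⊠ (n.μ (F.obj b) (F.obj c) ≫ G.map (m.μ b c)) ◁
          (α_ (n.μ (F.obj a) (F.obj (b ⊠ₒ c))) (G.map (m.μ a (b ⊠ₒ c))) k).inv := by
  simp only [compω, tl33, tl12, tl22, LaxMonoidalData.comp, bicategoricalIsoComp, Iso.trans_hom, Iso.symm_hom,
    Iso.trans_inv, Iso.symm_inv, whiskerLeftIso_inv, whiskerRightIso_inv, mapComp₃, mc₃, im33,
    whiskerLeftIso_hom, whiskerRightIso_hom, Category.assoc, BicategoricalCoherence.iso, cL, cR]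
  bicategory

theorem comp_ξ_hom :
    (m.compξ n a).hom =
      (n.ι ≫ G.map m.ι) ⊠ 𝟙 (G.obj (F.obj a)) ◁
          (α_ (n.μ (F.obj I) (F.obj a)) (G.map (m.μ I a)) (G.map (F.map (lun a)))).hom ≫
        (n.cL n.ι m.ι (F.obj a) (G.map (m.μ I a) ≫ G.map (F.map (lun a)))).hom ≫
        n.ι ⊠ 𝟙 (G.obj (F.obj a)) ◁ n.μ I (F.obj a) ◁ (im31 G.toPseudofunctor (m.ξ a)).hom ≫
        (n.ξ (F.obj a)).hom := by
  simp only [compξ, tl12, tl22, LaxMonoidalData.comp, bicategoricalIsoComp, Iso.trans_hom, Iso.symm_hom,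
    Iso.trans_inv, mapComp₃, mc₃, im31, whiskerLeftIso_inv,
    whiskerLeftIso_hom, whiskerRightIso_hom, Category.assoc, BicategoricalCoherence.iso, cL]
  bicategory

theorem comp_ζ_hom :
    (m.compζ n a).hom =
      𝟙 (G.obj (F.obj a)) ⊠ (n.ι ≫ G.map m.ι) ◁
          (α_ (n.μ (F.obj a) (F.obj I)) (G.map (m.μ a I)) (G.map (F.map (run a)))).hom ≫
        (n.cR n.ι m.ι (F.obj a) (G.map (m.μ a I) ≫ G.map (F.map (run a)))).hom ≫
        𝟙 (G.obj (F.obj a)) ⊠ n.ι ◁ n.μ (F.obj a) I ◁ (im31 G.toPseudofunctor (m.ζ a)).hom ≫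
        (n.ζ (F.obj a)).hom := by
  simp only [compζ, tl12, tl22, LaxMonoidalData.comp, bicategoricalIsoComp, Iso.trans_hom, Iso.symm_hom,
    Iso.trans_inv, mapComp₃, mc₃, im31, whiskerLeftIso_inv,
    whiskerLeftIso_hom, whiskerRightIso_hom, Category.assoc, BicategoricalCoherence.iso, cR]
  bicategory

end LaxMonoidal

end Comp

section AssocImage

variable {B : Type u₁} [Bicategory.{w₁, v₁} B] {C : Type u₂} [Bicategory.{w₂, v₂} C]
  {a a' b b₁ b₂ e e₁ e₂ d z : B} {f : a ⟶ b} {g : b ⟶ e} {g' : e ⟶ d} {p : a ⟶ a'}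
  {n : a' ⟶ b} {c : a ⟶ b₁} {c' : b₁ ⟶ b} {h : b₁ ⟶ e₁} {q : e₁ ⟶ e} {r : e₁ ⟶ e₂} {l : e₂ ⟶ e}
  {n₁ : a' ⟶ b₂} {n₂ : b₂ ⟶ b} {h' : b₂ ⟶ e₂} {α : f ≫ g ≫ g' ≅ p ≫ n ≫ g ≫ g'}
  {w : n ≅ n₁ ≫ n₂} {s : n₂ ≫ g ≅ h' ≫ l} {w' : f ≅ c ≫ c'} {s' : c' ≫ g ≅ h ≫ q}
  {β : q ≫ g' ≅ r ≫ l ≫ g'} {ω : c ≫ h ≫ r ≅ p ≫ n₁ ≫ h'}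

theorem im_assoc' (P : Pseudofunctor B C)
    (H : α.hom ≫ p ◁ ((tl12 w (g ≫ g')).hom ≫ n₁ ◁ (tl22 s g').hom) =
      ((tl12 w' (g ≫ g')).hom ≫ c ◁ (tl22 s' g').hom) ≫ c ◁ h ◁ β.hom ≫ (tl33 ω (l ≫ g')).hom) :
    (im23 P α).hom ≫ P.map p ◁ P.map n ◁ (P.mapComp g g').hom ≫
        P.map p ◁ (tl12 (im12 P w) (P.map g ≫ P.map g')).hom ≫
        P.map p ◁ P.map n₁ ◁ (tl22 (im22 P s) (P.map g')).hom =
      P.map f ◁ (P.mapComp g g').hom ≫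
        (tl12 (im12 P w') (P.map g ≫ P.map g')).hom ≫
        P.map c ◁ (tl22 (im22 P s') (P.map g')).hom ≫
        P.map c ◁ P.map h ◁ (im23 P β).hom ≫
        (tl33 (im33 P ω) (P.map l ≫ P.map g')).hom := by
  have := congrArg (fun y => (P.mapComp f (g ≫ g')).inv ≫ P.map₂ y ≫
    (mc₄ P p n₁ h' (l ≫ g')).hom ≫ P.map p ◁ P.map n₁ ◁ P.map h' ◁ (P.mapComp l g').hom) H
  simp only [P.map₂_comp, P.map₂_whisker_left, map₂_tl12, map₂_tl22, map₂_tl33, mc₃, mc₄, Iso.trans_hom, Iso.trans_inv,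
    whiskerLeftIso_hom, whiskerLeftIso_inv, Category.assoc, Iso.inv_hom_id_assoc, whiskerLeft_comp,
    whiskerLeft_inv_hom_assoc, Category.comp_id,
    whiskerLeft₃_inv_hom,
    reassoc_of% @whiskerLeft₂_inv_hom] at this
  have e1 := congrArg (fun y => P.map p ◁ y)
    (tl12_nat (im12 P w) (P.mapComp g g').hom)
  have e2 : (im23 P β).hom =
      (im22 P β).hom ≫ P.map r ◁ (P.mapComp l g').hom := by
    simp [im22, im23, mc₃]
  simp only [whiskerLeft_comp] at e1
  rw [reassoc_of% e1, reassoc_of% @tl12_nat, e2]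
  simp only [whiskerLeft_comp, Category.assoc]
  rw [tl33_nat]
  simp only [mc₃, im12, im22, im23, im33, Iso.trans_hom, Iso.symm_hom, Iso.trans_inv,
    whiskerLeftIso_hom, whiskerLeftIso_inv, Category.assoc, comp_whiskerRight, whiskerLeft_comp, tl12, tl22, tl33,
    whiskerRightIso_hom] at this ⊢
  refine Eq.trans ?_ (this.trans ?_) <;> bicategory

theorem im_unit' (P : Pseudofunctor B C) {x : a ⟶ d}
    {y : e₁ ⟶ d} {ρ : f ≫ g ≫ g' ≅ x} {β : q ≫ g' ≅ y} {ζ : c ≫ h ≫ y ≅ x}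
    (H : ρ.hom = ((tl12 w' (g ≫ g')).hom ≫ c ◁ (tl22 s' g').hom) ≫ c ◁ h ◁ β.hom ≫ ζ.hom) :
    (im21 P ρ).hom =
      P.map f ◁ (P.mapComp g g').hom ≫
        (tl12 (im12 P w') (P.map g ≫ P.map g')).hom ≫
        P.map c ◁ (tl22 (im22 P s') (P.map g')).hom ≫
        P.map c ◁ P.map h ◁ (im21 P β).hom ≫ (im31 P ζ).hom := by
  have := congrArg (fun y => (P.mapComp f (g ≫ g')).inv ≫ P.map₂ y) H
  simp only [P.map₂_comp, P.map₂_whisker_left, map₂_tl12, map₂_tl22, mc₃, Iso.trans_hom,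
    Iso.trans_inv,
    whiskerLeftIso_hom, whiskerLeftIso_inv, Category.assoc, Iso.inv_hom_id_assoc, whiskerLeft_comp,
    whiskerLeft_inv_hom_assoc] at this
  rw [reassoc_of% @tl12_nat]
  simp only [mc₃, im12, im21, im22, im31, Iso.trans_hom, Iso.symm_hom, Iso.trans_inv,
    whiskerLeftIso_inv, Category.assoc, comp_whiskerRight, whiskerLeft_comp, tl12, tl22, PrelaxFunctor.map₂Iso_hom,
    whiskerRightIso_hom]
    at this ⊢
  refine Eq.trans ?_ (this.trans ?_) <;> bicategory

theorem reassocMap_exchange (P : Pseudofunctor B C) {a b c : B} {x y : C} {f f' : y ⟶ x}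
    (η : f ⟶ f') (t : x ⟶ P.obj a) (q : a ⟶ b) (p : b ⟶ c) :
    f ◁ (reassocMap P t q p).hom ≫ η ▷ (t ≫ P.map (q ≫ p)) ≫ f' ◁ t ◁ (P.mapComp q p).hom =
      η ▷ ((t ≫ P.map q) ≫ P.map p) ≫ f' ◁ (α_ t (P.map q) (P.map p)).hom := by
  rw [← whisker_exchange, ← whisker_exchange, ← whiskerLeft_comp_assoc]
  simp [reassocMap]

end AssocImage

section Comp

variable {K : Type u₁} [Bicategory.{w₁, v₁} K] {L : Type u₂} [Bicategory.{w₂, v₂} L]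
  {M : Type u₃} [Bicategory.{w₃, v₃} M]
  [MonoidalBicategory K] [MonoidalBicategory L] [MonoidalBicategory M]
  {F : StrictPseudofunctor K L} {G : StrictPseudofunctor L M}

namespace LaxMonoidal

variable (m : LaxMonoidal F) (n : LaxMonoidal G) (A : PsMonData K)

/-- The associativity 2-cell of the image of a pseudomonoid under a composite. -/
def compMapAssoc : ((n.μ (F.obj A.X) (F.obj A.X) ≫ G.map (m.μ A.X A.X)) ≫ G.map (F.map A.mul)) ⊠ 𝟙 (G.obj (F.obj A.X)) ≫ ((n.μ (F.obj A.X) (F.obj A.X) ≫ G.map (m.μ A.X A.X)) ≫ G.map (F.map A.mul)) ≅ asc (G.obj (F.obj A.X)) (G.obj (F.obj A.X)) (G.obj (F.obj A.X)) ≫ 𝟙 (G.obj (F.obj A.X)) ⊠ ((n.μ (F.obj A.X) (F.obj A.X) ≫ G.map (m.μ A.X A.X)) ≫ G.map (F.map A.mul)) ≫ ((n.μ (F.obj A.X) (F.obj A.X) ≫ G.map (m.μ A.X A.X)) ≫ G.map (F.map A.mul)) :=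
  ((m.toLaxMonoidalData.comp n.toLaxMonoidalData).mapObj A).mulAssoc

/-- The left unit 2-cell of the image of a pseudomonoid under a composite. -/
def compMapOneMul : ((n.ι ≫ G.map m.ι) ≫ G.map (F.map A.one)) ⊠ 𝟙 (G.obj (F.obj A.X)) ≫ ((n.μ (F.obj A.X) (F.obj A.X) ≫ G.map (m.μ A.X A.X)) ≫ G.map (F.map A.mul)) ≅ lun (G.obj (F.obj A.X)) :=
  ((m.toLaxMonoidalData.comp n.toLaxMonoidalData).mapObj A).oneMul

/-- The right unit 2-cell of the image of a pseudomonoid under a composite. -/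
def compMapMulOne : 𝟙 (G.obj (F.obj A.X)) ⊠ ((n.ι ≫ G.map m.ι) ≫ G.map (F.map A.one)) ≫ ((n.μ (F.obj A.X) (F.obj A.X) ≫ G.map (m.μ A.X A.X)) ≫ G.map (F.map A.mul)) ≅ run (G.obj (F.obj A.X)) :=
  ((m.toLaxMonoidalData.comp n.toLaxMonoidalData).mapObj A).mulOne

theorem compMapAssoc_hom :
    (m.compMapAssoc n A).hom =
      (tl12 (wrComp (n.μ (F.obj A.X) (F.obj A.X) ≫ G.map (m.μ A.X A.X)) (G.map (F.map A.mul)) (G.obj (F.obj A.X))) ((n.μ (F.obj A.X) (F.obj A.X) ≫ G.map (m.μ A.X A.X)) ≫ G.map (F.map A.mul))).hom ≫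
        (n.μ (F.obj A.X) (F.obj A.X) ≫ G.map (m.μ A.X A.X)) ⊠ 𝟙 (G.obj (F.obj A.X)) ◁ (tl22 (sqV (n.μL (F.map A.mul) (F.obj A.X)) (im22 G.toPseudofunctor (m.μL A.mul A.X))) (G.map (F.map A.mul))).hom ≫
        (n.μ (F.obj A.X) (F.obj A.X) ≫ G.map (m.μ A.X A.X)) ⊠ 𝟙 (G.obj (F.obj A.X)) ◁ (n.μ (F.obj (A.X ⊠ₒ A.X)) (F.obj A.X) ≫ G.map (m.μ (A.X ⊠ₒ A.X) A.X)) ◁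
          (im23 G.toPseudofunctor (im23 F.toPseudofunctor A.mulAssoc)).hom ≫
        (tl33 (m.compω n A.X A.X A.X) (G.map (F.map (𝟙 A.X ⊠ A.mul)) ≫ (G.map (F.map A.mul)))).hom ≫
        asc (G.obj (F.obj A.X)) (G.obj (F.obj A.X)) (G.obj (F.obj A.X)) ◁ 𝟙 (G.obj (F.obj A.X)) ⊠ (n.μ (F.obj A.X) (F.obj A.X) ≫ G.map (m.μ A.X A.X)) ◁ (tl22 (sqV (n.μR (F.obj A.X) (F.map A.mul)) (im22 G.toPseudofunctor (m.μR A.X A.mul))) (G.map (F.map A.mul))).inv ≫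
        asc (G.obj (F.obj A.X)) (G.obj (F.obj A.X)) (G.obj (F.obj A.X)) ◁ (tl12 (wlComp (G.obj (F.obj A.X)) (n.μ (F.obj A.X) (F.obj A.X) ≫ G.map (m.μ A.X A.X)) (G.map (F.map A.mul))) ((n.μ (F.obj A.X) (F.obj A.X) ≫ G.map (m.μ A.X A.X)) ≫ G.map (F.map A.mul))).inv := by
  have h := (m.toLaxMonoidalData.comp n.toLaxMonoidalData).mapObj_mulAssoc_hom A
  rw [comp_μL, comp_μR] at h
  have e := im23_comp F.toPseudofunctor G.toPseudofunctor A.mulAssoc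
  refine h.trans ?_
  rw [← e]
  rfl

theorem compMapOneMul_hom :
    (m.compMapOneMul n A).hom =
      (tl12 (wrComp (n.ι ≫ G.map m.ι) (G.map (F.map A.one)) (G.obj (F.obj A.X))) ((n.μ (F.obj A.X) (F.obj A.X) ≫ G.map (m.μ A.X A.X)) ≫ G.map (F.map A.mul))).hom ≫
        (n.ι ≫ G.map m.ι) ⊠ 𝟙 (G.obj (F.obj A.X)) ◁ (tl22 (sqV (n.μL (F.map A.one) (F.obj A.X)) (im22 G.toPseudofunctor (m.μL A.one A.X))) (G.map (F.map A.mul))).hom ≫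
        (n.ι ≫ G.map m.ι) ⊠ 𝟙 (G.obj (F.obj A.X)) ◁ (n.μ (F.obj I) (F.obj A.X) ≫ G.map (m.μ I A.X)) ◁
          (im21 G.toPseudofunctor (im21 F.toPseudofunctor A.oneMul)).hom ≫
        (m.compξ n A.X).hom := by
  have h := (m.toLaxMonoidalData.comp n.toLaxMonoidalData).mapObj_oneMul_hom A
  rw [comp_μL] at h
  have e := im21_comp F.toPseudofunctor G.toPseudofunctor A.oneMul
  refine h.trans ?_
  rw [← e]
  rfl

theorem compMapMulOne_hom :
    (m.compMapMulOne n A).hom =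
      (tl12 (wlComp (G.obj (F.obj A.X)) (n.ι ≫ G.map m.ι) (G.map (F.map A.one))) ((n.μ (F.obj A.X) (F.obj A.X) ≫ G.map (m.μ A.X A.X)) ≫ G.map (F.map A.mul))).hom ≫
        𝟙 (G.obj (F.obj A.X)) ⊠ (n.ι ≫ G.map m.ι) ◁ (tl22 (sqV (n.μR (F.obj A.X) (F.map A.one)) (im22 G.toPseudofunctor (m.μR A.X A.one))) (G.map (F.map A.mul))).hom ≫
        𝟙 (G.obj (F.obj A.X)) ⊠ (n.ι ≫ G.map m.ι) ◁ (n.μ (F.obj A.X) (F.obj I) ≫ G.map (m.μ A.X I)) ◁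
          (im21 G.toPseudofunctor (im21 F.toPseudofunctor A.mulOne)).hom ≫
        (m.compζ n A.X).hom := by
  have h := (m.toLaxMonoidalData.comp n.toLaxMonoidalData).mapObj_mulOne_hom A
  rw [comp_μR] at h
  have e := im21_comp F.toPseudofunctor G.toPseudofunctor A.mulOne
  refine h.trans ?_
  rw [← e]
  rfl

theorem compMapOneMul_reassoc :
    ((n.ι ≫ G.map m.ι) ≫ G.map (F.map A.one)) ⊠ 𝟙 (G.obj (F.obj A.X)) ◁ (reassocMap G.toPseudofunctor (n.μ (F.obj A.X) (F.obj A.X)) (m.μ A.X A.X) (F.map A.mul)).hom ≫ ((reassocMap G.toPseudofunctor n.ι m.ι (F.map A.one)).hom ⊠₂ 𝟙 (𝟙 (G.obj (F.obj A.X)))) ▷ (n.μ (F.obj A.X) (F.obj A.X) ≫ G.map (m.μ A.X A.X ≫ F.map A.mul)) ≫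
        (n.mapOneMul (m.mapObj A)).hom = (m.compMapOneMul n A).hom := by
  have x := reassocMap_exchange G.toPseudofunctor ((reassocMap G.toPseudofunctor n.ι m.ι (F.map A.one)).hom ⊠₂ 𝟙 (𝟙 (G.obj (F.obj A.X)))) (n.μ (F.obj A.X) (F.obj A.X)) (m.μ A.X A.X)
    (F.map A.mul)
  have i := im_unit' G.toPseudofunctor (m.mapOneMul_hom A)
  replace i := congrArg (fun v => n.ι ⊠ 𝟙 (G.obj (F.obj A.X)) ◁ n.μ I (F.obj A.X) ◁ v) i
  have y := m.cL_comp n n.ι m.ι A.one A.X (G.map (F.map A.mul))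
  have c := n.cL_nat n.ι (m.ι ≫ F.map A.one) (F.obj A.X) (G.mapComp (m.μ A.X A.X) (F.map A.mul)).hom
  have u := n.cL_nat n.ι m.ι (F.obj A.X) (G.map (m.μ I A.X) ◁
    (im21 G.toPseudofunctor (im21 F.toPseudofunctor A.oneMul)).hom)
  have v := congrArg (fun v => (n.ι ≫ G.map m.ι) ⊠ 𝟙 (G.obj (F.obj A.X)) ◁ v) (associator_naturality_right
    (n.μ (F.obj I) (F.obj A.X)) (G.map (m.μ I A.X))
    (im21 G.toPseudofunctor (im21 F.toPseudofunctor A.oneMul)).hom)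
  simp only [whiskerLeft_comp] at i y v
  have hh := n.mapOneMul_hom (m.mapObj A)
  rw [compMapOneMul_hom, comp_ξ_hom]
  rw [reassoc_of% v, reassoc_of% u, reassoc_of% y, ← reassoc_of% x]
  erw [reassoc_of% c, ← reassoc_of% i, ← hh]
  rfl

theorem compMapMulOne_reassoc :
    𝟙 (G.obj (F.obj A.X)) ⊠ ((n.ι ≫ G.map m.ι) ≫ G.map (F.map A.one)) ◁ (reassocMap G.toPseudofunctor (n.μ (F.obj A.X) (F.obj A.X)) (m.μ A.X A.X) (F.map A.mul)).hom ≫ (𝟙 (𝟙 (G.obj (F.obj A.X))) ⊠₂ (reassocMap G.toPseudofunctor n.ι m.ι (F.map A.one)).hom) ▷ (n.μ (F.obj A.X) (F.obj A.X) ≫ G.map (m.μ A.X A.X ≫ F.map A.mul)) ≫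
        (n.mapMulOne (m.mapObj A)).hom = (m.compMapMulOne n A).hom := by
  have x := reassocMap_exchange G.toPseudofunctor (𝟙 (𝟙 (G.obj (F.obj A.X))) ⊠₂ (reassocMap G.toPseudofunctor n.ι m.ι (F.map A.one)).hom) (n.μ (F.obj A.X) (F.obj A.X)) (m.μ A.X A.X)
    (F.map A.mul)
  have i := im_unit' G.toPseudofunctor (m.mapMulOne_hom A)
  replace i := congrArg (fun v => 𝟙 (G.obj (F.obj A.X)) ⊠ n.ι ◁ n.μ (F.obj A.X) I ◁ v) i
  have y := m.cR_comp n n.ι m.ι A.one A.X (G.map (F.map A.mul))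
  have c := n.cR_nat n.ι (m.ι ≫ F.map A.one) (F.obj A.X) (G.mapComp (m.μ A.X A.X) (F.map A.mul)).hom
  have u := n.cR_nat n.ι m.ι (F.obj A.X) (G.map (m.μ A.X I) ◁
    (im21 G.toPseudofunctor (im21 F.toPseudofunctor A.mulOne)).hom)
  have v := congrArg (fun v => 𝟙 (G.obj (F.obj A.X)) ⊠ (n.ι ≫ G.map m.ι) ◁ v) (associator_naturality_right
    (n.μ (F.obj A.X) (F.obj I)) (G.map (m.μ A.X I))
    (im21 G.toPseudofunctor (im21 F.toPseudofunctor A.mulOne)).hom)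
  simp only [whiskerLeft_comp] at i y v
  have hh := n.mapMulOne_hom (m.mapObj A)
  rw [compMapMulOne_hom, comp_ζ_hom]
  rw [reassoc_of% v, reassoc_of% u, reassoc_of% y, ← reassoc_of% x]
  erw [reassoc_of% c, ← reassoc_of% i, ← hh]
  rfl

/-- The associativity 2-cell of an iterated image of a pseudomonoid. -/
def mapMapAssoc : (n.μ (F.obj A.X) (F.obj A.X) ≫ G.map (m.μ A.X A.X ≫ F.map A.mul)) ⊠ 𝟙 (G.obj (F.obj A.X)) ≫ (n.μ (F.obj A.X) (F.obj A.X) ≫ G.map (m.μ A.X A.X ≫ F.map A.mul)) ≅ asc (G.obj (F.obj A.X)) (G.obj (F.obj A.X)) (G.obj (F.obj A.X)) ≫ 𝟙 (G.obj (F.obj A.X)) ⊠ (n.μ (F.obj A.X) (F.obj A.X) ≫ G.map (m.μ A.X A.X ≫ F.map A.mul)) ≫ (n.μ (F.obj A.X) (F.obj A.X) ≫ G.map (m.μ A.X A.X ≫ F.map A.mul)) :=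
  (n.mapObj (m.mapObj A)).mulAssoc

theorem mapMapAssoc_cR :
    (m.mapMapAssoc n A).hom ≫ asc (G.obj (F.obj A.X)) (G.obj (F.obj A.X)) (G.obj (F.obj A.X)) ◁
        (n.cR (n.μ (F.obj A.X) (F.obj A.X)) (m.μ A.X A.X ≫ F.map A.mul) (F.obj A.X)
          (G.map (m.μ A.X A.X ≫ F.map A.mul))).hom =
      (n.cL (n.μ (F.obj A.X) (F.obj A.X)) (m.μ A.X A.X ≫ F.map A.mul) (F.obj A.X)
          (G.map (m.μ A.X A.X ≫ F.map A.mul))).hom ≫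
        (n.μ (F.obj A.X) (F.obj A.X)) ⊠ 𝟙 (G.obj (F.obj A.X)) ◁ n.μ ((F.obj A.X) ⊠ₒ (F.obj A.X)) (F.obj A.X) ◁ (im23 G.toPseudofunctor (m.mapAssoc A)).hom ≫
        (tl33 (n.ω (F.obj A.X) (F.obj A.X) (F.obj A.X)) (G.map (𝟙 (F.obj A.X) ⊠ (m.μ A.X A.X ≫ F.map A.mul)) ≫
          G.map (m.μ A.X A.X ≫ F.map A.mul))).hom :=
  n.mapAssoc_cR (m.mapObj A)

theorem compMapAssoc_reassoc :
    (m.compMapAssoc n A).hom ≫ asc (G.obj (F.obj A.X)) (G.obj (F.obj A.X)) (G.obj (F.obj A.X)) ◁ (𝟙 (G.obj (F.obj A.X)) ⊠ ((n.μ (F.obj A.X) (F.obj A.X) ≫ G.map (m.μ A.X A.X)) ≫ G.map (F.map A.mul)) ◁ (reassocMap G.toPseudofunctor (n.μ (F.obj A.X) (F.obj A.X)) (m.μ A.X A.X) (F.map A.mul)).hom ≫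
        (𝟙 (𝟙 (G.obj (F.obj A.X))) ⊠₂ (reassocMap G.toPseudofunctor (n.μ (F.obj A.X) (F.obj A.X)) (m.μ A.X A.X) (F.map A.mul)).hom) ▷ (n.μ (F.obj A.X) (F.obj A.X) ≫ G.map (m.μ A.X A.X ≫ F.map A.mul))) =
      (((n.μ (F.obj A.X) (F.obj A.X) ≫ G.map (m.μ A.X A.X)) ≫ G.map (F.map A.mul)) ⊠ 𝟙 (G.obj (F.obj A.X)) ◁ (reassocMap G.toPseudofunctor (n.μ (F.obj A.X) (F.obj A.X)) (m.μ A.X A.X) (F.map A.mul)).hom ≫ ((reassocMap G.toPseudofunctor (n.μ (F.obj A.X) (F.obj A.X)) (m.μ A.X A.X) (F.map A.mul)).hom ⊠₂ 𝟙 (𝟙 (G.obj (F.obj A.X)))) ▷ (n.μ (F.obj A.X) (F.obj A.X) ≫ G.map (m.μ A.X A.X ≫ F.map A.mul))) ≫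
        (m.mapMapAssoc n A).hom := by
  have xL := reassocMap_exchange G.toPseudofunctor ((reassocMap G.toPseudofunctor (n.μ (F.obj A.X) (F.obj A.X)) (m.μ A.X A.X) (F.map A.mul)).hom ⊠₂ 𝟙 (𝟙 (G.obj (F.obj A.X)))) (n.μ (F.obj A.X) (F.obj A.X)) (m.μ A.X A.X)
    (F.map A.mul)
  have xR := reassocMap_exchange G.toPseudofunctor (𝟙 (𝟙 (G.obj (F.obj A.X))) ⊠₂ (reassocMap G.toPseudofunctor (n.μ (F.obj A.X) (F.obj A.X)) (m.μ A.X A.X) (F.map A.mul)).hom) (n.μ (F.obj A.X) (F.obj A.X)) (m.μ A.X A.X)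
    (F.map A.mul)
  replace xR := congrArg (fun v => asc (G.obj (F.obj A.X)) (G.obj (F.obj A.X)) (G.obj (F.obj A.X)) ◁ v) xR
  have i := im_assoc' G.toPseudofunctor (m.mapAssoc_cR A)
  replace i := congrArg (fun v => (n.μ (F.obj A.X) (F.obj A.X)) ⊠ 𝟙 (G.obj (F.obj A.X)) ◁ n.μ ((F.obj A.X) ⊠ₒ (F.obj A.X)) (F.obj A.X) ◁ v) i
  have yL := m.cL_comp n (n.μ (F.obj A.X) (F.obj A.X)) (m.μ A.X A.X) A.mul A.X (G.map (F.map A.mul))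
  have yR := congrArg (fun v => asc (G.obj (F.obj A.X)) (G.obj (F.obj A.X)) (G.obj (F.obj A.X)) ◁ v)
    (m.cR_comp n (n.μ (F.obj A.X) (F.obj A.X)) (m.μ A.X A.X) A.mul A.X (G.map (F.map A.mul)))
  have cL := n.cL_nat (n.μ (F.obj A.X) (F.obj A.X)) (m.μ A.X A.X ≫ F.map A.mul) (F.obj A.X)
    (G.mapComp (m.μ A.X A.X) (F.map A.mul)).hom
  have cR := congrArg (fun v => asc (G.obj (F.obj A.X)) (G.obj (F.obj A.X)) (G.obj (F.obj A.X)) ◁ v)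
    (n.cR_nat (n.μ (F.obj A.X) (F.obj A.X)) (m.μ A.X A.X ≫ F.map A.mul) (F.obj A.X)
      (G.mapComp (m.μ A.X A.X) (F.map A.mul)).hom)
  have u := n.cL_nat (n.μ (F.obj A.X) (F.obj A.X)) (m.μ A.X A.X) (F.obj A.X) (G.map (m.μ (A.X ⊠ₒ A.X) A.X) ◁
    (im23 G.toPseudofunctor (im23 F.toPseudofunctor A.mulAssoc)).hom)
  have v := congrArg (fun v => (n.μ (F.obj A.X) (F.obj A.X) ≫ G.map (m.μ A.X A.X)) ⊠ 𝟙 (G.obj (F.obj A.X)) ◁ v) (associator_naturality_right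
    (n.μ (F.obj (A.X ⊠ₒ A.X)) (F.obj A.X)) (G.map (m.μ (A.X ⊠ₒ A.X) A.X))
    (im23 G.toPseudofunctor (im23 F.toPseudofunctor A.mulAssoc)).hom)
  have w := m.comp_ω_tail n A.X A.X A.X (G.map (F.map (𝟙 A.X ⊠ A.mul)) ≫ (G.map (F.map A.mul)))
  have hh := m.mapMapAssoc_cR n A
  simp only [whiskerLeft_comp] at i yL yR xL xR cR v
  let Z := whiskerLeftIso (asc (G.obj (F.obj A.X)) (G.obj (F.obj A.X)) (G.obj (F.obj A.X))) (whiskerLeftIso (𝟙 (G.obj (F.obj A.X)) ⊠ (n.μ (F.obj A.X) (F.obj A.X) ≫ G.map (m.μ A.X A.X ≫ F.map A.mul)))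
      (whiskerLeftIso (n.μ (F.obj A.X) (F.obj A.X)) (G.mapComp (m.μ A.X A.X) (F.map A.mul))) ≪≫
    n.cR (n.μ (F.obj A.X) (F.obj A.X)) (m.μ A.X A.X ≫ F.map A.mul) (F.obj A.X) (G.map (m.μ A.X A.X) ≫ (G.map (F.map A.mul))) ≪≫
    whiskerLeftIso (𝟙 (G.obj (F.obj A.X)) ⊠ (n.μ (F.obj A.X) (F.obj A.X))) (whiskerLeftIso (n.μ (F.obj A.X) ((F.obj A.X) ⊠ₒ (F.obj A.X)))
      (tl12 (im12 G.toPseudofunctor (wlComp (F.obj A.X) (m.μ A.X A.X) (F.map A.mul)))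
          (G.map (m.μ A.X A.X) ≫ (G.map (F.map A.mul))) ≪≫
        whiskerLeftIso (G.map (𝟙 (F.obj A.X) ⊠ m.μ A.X A.X))
          (tl22 (im22 G.toPseudofunctor (m.μR A.X A.mul)) (G.map (F.map A.mul))))))
  rw [← cancel_mono Z.hom]
  simp only [Z, whiskerLeftIso_hom, Iso.trans_hom, whiskerLeft_comp, Category.assoc]
  rw [reassoc_of% xR, ← yR, compMapAssoc_hom]
  simp only [Category.assoc]
  rw [whiskerLeft_inv_hom_assoc, reassoc_of% @whiskerLeft₂_inv_hom, w]
  simp only [Category.assoc, reassoc_of% @whiskerLeft₂_inv_hom, whiskerLeft_inv_hom, Category.comp_id]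
  rw [reassoc_of% v, reassoc_of% u, reassoc_of% yL, ← reassoc_of% xL, reassoc_of% cR,
    reassoc_of% hh, ← reassoc_of% @tl33_nat]
  rw [← reassoc_of% @tl33_nat, ← tl33_nat, reassoc_of% i, ← reassoc_of% cL]

end LaxMonoidal

end Comp

section Agrees

variable {K : Type u₁} [Bicategory.{w₁, v₁} K] [MonoidalBicategory K]
  {A B C A' B' C' A'' B'' : PsMonData K}

namespace StrongMorData

theorem Agrees.refl (f : StrongMorData A B) : f.Agrees f := ⟨HEq.rfl, HEq.rfl, HEq.rfl⟩

theorem Agrees.symm {f : StrongMorData A B} {g : StrongMorData A' B'} (h : f.Agrees g) :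
    g.Agrees f := ⟨h.1.symm, h.2.symm, h.3.symm⟩

theorem Agrees.trans {f : StrongMorData A B} {g : StrongMorData A' B'} {k : StrongMorData A'' B''}
    (h : f.Agrees g) (h' : g.Agrees k) : f.Agrees k :=
  ⟨h.1.trans h'.1, h.2.trans h'.2, h.3.trans h'.3⟩

theorem Agrees.eq {f g : StrongMorData A B} (h : f.Agrees g) : f = g :=
  StrongMorData.ext (eq_of_heq h.1) h.2 h.3

/-- The data of the identity strong morphism. -/
def id (A : PsMonData K) : StrongMorData A A where
  f := 𝟙 A.X
  φ := sqConj (tId A.X A.X) (Iso.refl _) (idSqH A.mul)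
  φ₀ := (ρ_ A.one).symm

/-- The data of the composite of two strong morphisms. -/
def comp (F : StrongMorData A B) (G : StrongMorData B C) : StrongMorData A C where
  f := F.f ≫ G.f
  φ := sqConj (tComp F.f F.f G.f G.f) (Iso.refl _) (sqH F.φ G.φ)
  φ₀ := G.φ₀ ≪≫ whiskerRightIso F.φ₀ G.f ≪≫ α_ _ _ _

theorem Agrees.comp {f : StrongMorData A B} {g : StrongMorData B C} {f' : StrongMorData A' B'}
    {g' : StrongMorData B' C'} (hf : f.Agrees f') (hg : g.Agrees g') (hA : A = A') (hB : B = B')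
    (hC : C = C') : (f.comp g).Agrees (f'.comp g') := by
  subst hA hB hC
  rw [hf.eq, hg.eq]
  exact Agrees.refl _

/-- Two strong morphisms between the same pseudomonoids are equal if they are related by a 2-cell
that is an identity. -/
theorem eq_of_cell {f g : StrongMorData A B} (h : f.f = g.f) {σ : f.f ⟶ g.f}
    (hσ : σ = eqToHom h) (e : IsNat f.φ g.φ (σ ⊠₂ σ) σ)
    (e₀ : f.φ₀.hom ≫ A.one ◁ σ = g.φ₀.hom) : f = g := by
  obtain ⟨f, φ, φ₀⟩ := f
  obtain ⟨g, ψ, ψ₀⟩ := g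
  dsimp only at h
  subst h hσ
  have e₁ : φ = ψ := by
    ext
    simpa [IsNat, tMap₂_id, Bicategory.id_whiskerRight] using (Eq.symm e)
  have e₂ : φ₀ = ψ₀ := by
    ext
    simpa using e₀
  subst e₁ e₂
  rfl

theorem comp_unitSq (F : StrongMorData A B) (G : StrongMorData B C) :
    (F.comp G).unitSq = sqConj (λ_ (𝟙 I)).symm (Iso.refl _) (sqH F.unitSq G.unitSq) := by
  ext
  simp [StrongMorData.unitSq, comp, sqConj, sqH]

end StrongMorData

theorem exists_strongMor {A B : PsMon K} {A' B' : PsMonData K} (f : StrongMorData A' B')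
    (H : f.IsStrong) (hA : A.toPsMonData = A') (hB : B.toPsMonData = B') :
    ∃ g : StrongMor A B, g.toStrongMorData.Agrees f := by
  subst hA hB
  exact ⟨⟨f, H.1, H.2, H.3⟩, .refl f⟩

theorem StrongMor.isStrong {A B : PsMon K} (f : StrongMor A B) : f.toStrongMorData.IsStrong :=
  ⟨f.assoc_compat, f.one_mul_compat, f.mul_one_compat⟩

theorem StrongMor.eq_of_data {A B : PsMon K} {f g : StrongMor A B}
    (h : f.toStrongMorData = g.toStrongMorData) : f = g := by
  cases f
  cases g
  dsimp only at h
  subst h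
  rfl

end Agrees

section QuasiInverse

variable {B : Type u₁} [Bicategory.{w₁, v₁} B] {a b c : B} {f : a ⟶ b} {g : b ⟶ a}

/-- A 1-cell with an inverse up to invertible 2-cells. -/
def HasQuasiInverse (f : a ⟶ b) : Prop :=
  ∃ g : b ⟶ a, Nonempty (f ≫ g ≅ 𝟙 a) ∧ Nonempty (g ≫ f ≅ 𝟙 b)

theorem whiskerLeft_injective_of_retraction (u : g ≫ f ≅ 𝟙 b) {p q : b ⟶ c} {σ τ : p ⟶ q}
    (h : f ◁ σ = f ◁ τ) : σ = τ := by
  have e (σ : p ⟶ q) : σ = (λ_ p).inv ≫ u.inv ▷ p ≫ (α_ g f p).hom ≫ g ◁ f ◁ σ ≫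
      (α_ g f q).inv ≫ u.hom ▷ q ≫ (λ_ q).hom := by
    rw [associator_inv_naturality_right_assoc, whisker_exchange_assoc, Iso.hom_inv_id_assoc,
      inv_hom_whiskerRight_assoc, id_whiskerLeft]
    simp
  rw [e σ, h, ← e τ]

namespace HasQuasiInverse

theorem whiskerLeft_injective (H : HasQuasiInverse f) {p q : b ⟶ c} {σ τ : p ⟶ q}
    (h : f ◁ σ = f ◁ τ) : σ = τ := by
  obtain ⟨g, -, ⟨u⟩⟩ := H
  exact whiskerLeft_injective_of_retraction u h

theorem whiskerLeft_surjective (H : HasQuasiInverse f) {p q : b ⟶ c} (t : f ≫ p ⟶ f ≫ q) :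
    ∃ σ : p ⟶ q, f ◁ σ = t := by
  obtain ⟨g, ⟨v⟩, ⟨u⟩⟩ := H
  refine ⟨(λ_ p).inv ≫ u.inv ▷ p ≫ (α_ g f p).hom ≫ g ◁ t ≫
      (α_ g f q).inv ≫ u.hom ▷ q ≫ (λ_ q).hom, whiskerLeft_injective_of_retraction v ?_⟩
  have e (σ : p ⟶ q) : g ◁ f ◁ σ = (α_ g f p).inv ≫ u.hom ▷ p ≫ (λ_ p).hom ≫ σ ≫ (λ_ q).inv ≫
      u.inv ▷ q ≫ (α_ g f q).hom := by
    rw [← leftUnitor_naturality_assoc, ← whisker_exchange_assoc]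
    simp
  rw [e]
  simp

theorem exists_iso (H : HasQuasiInverse f) {p q : b ⟶ c} (t : f ≫ p ≅ f ≫ q) :
    ∃ s : p ≅ q, whiskerLeftIso f s = t := by
  obtain ⟨σ, hσ⟩ := H.whiskerLeft_surjective t.hom
  obtain ⟨τ, hτ⟩ := H.whiskerLeft_surjective t.inv
  exact ⟨⟨σ, τ, H.whiskerLeft_injective (by simp [hσ, hτ]),
    H.whiskerLeft_injective (by simp [hσ, hτ])⟩, Iso.ext hσ⟩

end HasQuasiInverse

theorem HasQuasiInverse.of_inverse (h : f ≫ g = 𝟙 a) (h' : g ≫ f = 𝟙 b) : HasQuasiInverse f :=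
  ⟨g, ⟨eqToIso h⟩, ⟨eqToIso h'⟩⟩

theorem HasQuasiInverse.tensor [TensorBicategory B] {a' b' : B} {f' : a' ⟶ b'}
    (H : HasQuasiInverse f) (H' : HasQuasiInverse f') : HasQuasiInverse (f ⊠ f') := by
  obtain ⟨g, ⟨v⟩, ⟨u⟩⟩ := H
  obtain ⟨g', ⟨v'⟩, ⟨u'⟩⟩ := H'
  exact ⟨g ⊠ g', ⟨(tComp f f' g g').symm ≪≫ v ⊠ᵢ v' ≪≫ tId a a'⟩,
    ⟨(tComp g g' f f').symm ≪≫ u ⊠ᵢ u' ≪≫ tId b b'⟩⟩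

theorem IsCyl.of_conj {a b a' b' : B} {f f' : a ⟶ a'} {g g' : b ⟶ b'} {u u' : a ⟶ b}
    {v v' : a' ⟶ b'} {s : f ≫ v ≅ u ≫ g} {t : f ≫ v' ≅ u' ≫ g} {θ : u ⟶ u'} {θ' : v ⟶ v'}
    {e : f' ≅ f} {e' : g ≅ g'} (h : IsCyl (sqConj e e' s) (sqConj e e' t) θ θ') :
    IsCyl s t θ θ' := by
  have := h.conj e.symm e'.symm
  rw [sqConj_conj, sqConj_conj, Iso.symm_self_id, Iso.self_symm_id, sqConj_refl, sqConj_refl]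
    at this
  exact this

theorem IsCyl.of_sqH {a b a' b' a'' b'' : B} {f : a ⟶ a'} {f' : a' ⟶ a''} {g : b ⟶ b'}
    {g' : b' ⟶ b''} {u u' : a ⟶ b} {v v' : a' ⟶ b'} {w w' : a'' ⟶ b''}
    {s : f ≫ v ≅ u ≫ g} {t : f ≫ v' ≅ u' ≫ g} {s' : f' ≫ w ≅ v ≫ g'} {t' : f' ≫ w' ≅ v' ≫ g'}
    {θ : u ⟶ u'} {θ' : v ⟶ v'} {θ'' : w ⟶ w'} (H : HasQuasiInverse f)
    (h : IsCyl s t θ θ') (h' : IsCyl (MonTwoCat.sqH s s') (MonTwoCat.sqH t t') θ θ'') :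
    IsCyl s' t' θ' θ'' := by
  simp only [IsCyl, MonTwoCat.sqH, Iso.trans_hom, Iso.symm_hom, whiskerRightIso_hom,
    whiskerLeftIso_hom, Category.assoc] at h h' ⊢
  apply H.whiskerLeft_injective
  have h1 := congrArg (fun z => z ▷ g') h
  simp only [comp_whiskerRight] at h1
  rw [← cancel_epi (α_ f f' w).hom,
    ← cancel_mono ((α_ f v' g').inv ≫ t.hom ▷ g' ≫ (α_ u' g g').hom)]
  refine Eq.trans ?_ (h'.trans (Eq.trans ?_
    (congrArg (fun z => (α_ f f' w).hom ≫ f ◁ s'.hom ≫ (α_ f v g').inv ≫ z ≫ (α_ u' g g').hom)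
      (Eq.symm h1) |>.trans ?_))) <;> simp

end QuasiInverse

section Inverse

theorem HasQuasiInverse.id {B : Type u₁} [Bicategory.{w₁, v₁} B] (a : B) :
    HasQuasiInverse (𝟙 a) :=
  ⟨𝟙 a, ⟨λ_ _⟩, ⟨λ_ _⟩⟩

variable {K : Type u₁} [Bicategory.{w₁, v₁} K] [MonoidalBicategory K] {A B C : PsMonData K}

namespace StrongMorData

theorem exists_comp_eq_id (F : StrongMorData A B) {g : B.X ⟶ A.X} (h : F.f ≫ g = 𝟙 A.X)
    (h' : g ≫ F.f = 𝟙 B.X) : ∃ G : StrongMorData B A, G.f = g ∧ F.comp G = id A := by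
  have H := HasQuasiInverse.of_inverse h h'
  obtain ⟨φ, hφ⟩ := (H.tensor H).exists_iso ((α_ _ _ _).symm ≪≫
    sqConj ((tComp F.f F.f g g).symm ≪≫ eqToIso h ⊠ᵢ eqToIso h) (eqToIso h).symm
        (sqConj (tId A.X A.X) (Iso.refl _) (idSqH A.mul)) ≪≫
    (α_ _ _ _).symm ≪≫ whiskerRightIso F.φ.symm g ≪≫ α_ _ _ _)
  refine ⟨⟨g, φ, (ρ_ A.one).symm ≪≫ whiskerLeftIso A.one (eqToIso h).symm ≪≫ (α_ _ _ _).symm ≪≫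
    whiskerRightIso F.φ₀.symm g⟩, rfl, eq_of_cell h (σ := (eqToIso h).hom) rfl ?_ ?_⟩
  · have e : sqH F.φ φ = sqConj ((tComp F.f F.f g g).symm ≪≫ eqToIso h ⊠ᵢ eqToIso h)
        (eqToIso h).symm
        (sqConj (tId A.X A.X) (Iso.refl _) (idSqH A.mul)) := by
      have hφ' := congrArg Iso.hom hφ
      simp only [whiskerLeftIso_hom] at hφ'
      ext
      simp only [sqH, Iso.trans_hom, whiskerLeftIso_hom, hφ']
      simp
    change IsNat (sqConj (tComp F.f F.f g g) (Iso.refl _) (sqH F.φ φ))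
      (sqConj (tId A.X A.X) (Iso.refl _) (idSqH A.mul)) ((eqToIso h).hom ⊠₂ (eqToIso h).hom)
      (eqToIso h).hom
    rw [e, sqConj_conj]
    generalize eqToIso h = i
    simp [IsNat, sqConj]
  · simp [comp, id]

theorem isStrong_of_comp {F : StrongMorData A B} {G : StrongMorData B C}
    (H : HasQuasiInverse F.f) (hF : F.IsStrong) (hFG : (F.comp G).IsStrong) : G.IsStrong where
  assoc_compat := by
    have h : IsCyl
      (sqV (tSq (sqConj (tComp F.f F.f G.f G.f) (Iso.refl _) (sqH F.φ G.φ))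
          (idSqV (F.f ≫ G.f)))
        (sqConj (tComp F.f F.f G.f G.f) (Iso.refl _) (sqH F.φ G.φ)))
      (sqV (assocNat (F.f ≫ G.f) (F.f ≫ G.f) (F.f ≫ G.f))
        (sqV (tSq (idSqV (F.f ≫ G.f))
            (sqConj (tComp F.f F.f G.f G.f) (Iso.refl _) (sqH F.φ G.φ)))
          (sqConj (tComp F.f F.f G.f G.f) (Iso.refl _) (sqH F.φ G.φ)))) _ _ := hFG.assoc_compat
    rw [tSq_conj_left, tSq_conj_right, assocNat_comp_eq, idSqV_comp, tSq_sqH, tSq_sqH,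
      sqConj_conj, sqConj_conj, Iso.trans_refl, sqV_conj, sqV_conj, sqV_conj,
      sqV_sqH, sqV_sqH, sqV_sqH] at h
    exact IsCyl.of_sqH ((H.tensor H).tensor H) hF.assoc_compat h.of_conj
  one_mul_compat := by
    have h := hFG.one_mul_compat
    rw [comp_unitSq] at h
    change IsCyl
      (sqV (tSq (sqConj (λ_ (𝟙 I)).symm (Iso.refl _) (sqH F.unitSq G.unitSq))
          (idSqV (F.f ≫ G.f)))
        (sqConj (tComp F.f F.f G.f G.f) (Iso.refl _) (sqH F.φ G.φ)))
      (lUnitNat (F.f ≫ G.f)) _ _ at h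
    rw [lUnitNat_comp_eq, tSq_conj_left, idSqV_comp, tSq_sqH, sqConj_conj, Iso.trans_refl,
      sqV_conj, sqV_sqH] at h
    exact IsCyl.of_sqH ((HasQuasiInverse.id _).tensor H) hF.one_mul_compat h.of_conj
  mul_one_compat := by
    have h := hFG.mul_one_compat
    rw [comp_unitSq] at h
    change IsCyl
      (sqV (tSq (idSqV (F.f ≫ G.f))
          (sqConj (λ_ (𝟙 I)).symm (Iso.refl _) (sqH F.unitSq G.unitSq)))
        (sqConj (tComp F.f F.f G.f G.f) (Iso.refl _) (sqH F.φ G.φ)))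
      (rUnitNat (F.f ≫ G.f)) _ _ at h
    rw [rUnitNat_comp_eq, tSq_conj_right, idSqV_comp, tSq_sqH, sqConj_conj, Iso.trans_refl,
      sqV_conj, sqV_sqH] at h
    exact IsCyl.of_sqH (H.tensor (HasQuasiInverse.id _)) hF.mul_one_compat h.of_conj

end StrongMorData

/-- A strong morphism whose underlying 1-cell is an isomorphism is an isomorphism. -/
theorem StrongMor.exists_inverse [Bicategory.Strict K] {A B : PsMon K} (F : A ⟶ B)
    {g : B.X ⟶ A.X} (h : StrongMorData.f (StrongMor.toStrongMorData F) ≫ g = 𝟙 A.X)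
    (h' : g ≫ StrongMorData.f (StrongMor.toStrongMorData F) = 𝟙 B.X) :
    ∃ G : B ⟶ A, F ≫ G = 𝟙 A ∧ G ≫ F = 𝟙 B := by
  have key {A B : PsMon K} (F : A ⟶ B) {g : B.X ⟶ A.X}
      (h : StrongMorData.f (StrongMor.toStrongMorData F) ≫ g = 𝟙 A.X)
      (h' : g ≫ StrongMorData.f (StrongMor.toStrongMorData F) = 𝟙 B.X) :
      ∃ G : B ⟶ A, StrongMorData.f (StrongMor.toStrongMorData G) = g ∧ F ≫ G = 𝟙 A := by
    obtain ⟨G, hG, e⟩ := (StrongMor.toStrongMorData F).exists_comp_eq_id h h'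
    have s : G.IsStrong := StrongMorData.isStrong_of_comp (.of_inverse h h')
      (StrongMor.isStrong F) (e ▸ (StrongMor.id A).isStrong)
    exact ⟨⟨G, s.1, s.2, s.3⟩, hG, StrongMor.eq_of_data e⟩
  obtain ⟨G, hG, e⟩ := key F h h'
  obtain ⟨F', -, e'⟩ := key G (g := StrongMorData.f (StrongMor.toStrongMorData F))
    (by rw [hG, h']) (by rw [hG, h])
  have : F = F' := by
    rw [← Strict.comp_id F, ← e', ← Strict.assoc, e, Strict.id_comp]
  exact ⟨G, e, this ▸ e'⟩

end Inverse

section Calculus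

variable {B : Type u₁} [Bicategory.{w₁, v₁} B] {C : Type u₂} [Bicategory.{w₂, v₂} C]
  (P : Pseudofunctor B C)

theorem isNat_sqConj {a b a' b' : B} {f f' : a ⟶ a'} {g : b ⟶ b'} {u : a ⟶ b} {v : a' ⟶ b'}
    (e : f' ≅ f) (s : f ≫ v ≅ u ≫ g) : IsNat (sqConj e (Iso.refl g) s) s e.hom (𝟙 g) := by
  simp [IsNat, sqConj]

theorem IsNat.to_sqConj {a b a' b' : B} {f f' f'' : a ⟶ a'} {g g' : b ⟶ b'} {u : a ⟶ b}
    {v : a' ⟶ b'} {s : f ≫ v ≅ u ≫ g} {t : f' ≫ v ≅ u ≫ g'} {σ : f ⟶ f''} {σ' : g ⟶ g'}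
    (e : f'' ≅ f') (H : IsNat s t (σ ≫ e.hom) σ') :
    IsNat s (sqConj e (Iso.refl g') t) σ σ' := by
  simpa [IsNat, sqConj] using H

theorem isNat_mapComp {a b a' b' a'' b'' : B} {f : a ⟶ a'} {f' : a' ⟶ a''} {g : b ⟶ b'}
    {g' : b' ⟶ b''} {u : a ⟶ b} {v : a' ⟶ b'} {w : a'' ⟶ b''} (s : f ≫ v ≅ u ≫ g)
    (t : f' ≫ w ≅ v ≫ g') :
    IsNat (im22 P (sqH s t)) (sqH (im22 P s) (im22 P t)) (P.mapComp f f').hom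
      (P.mapComp g g').hom := by
  simp only [IsNat, im22, sqH, Iso.trans_hom, Iso.symm_hom, PrelaxFunctor.map₂Iso_hom,
    whiskerRightIso_hom, whiskerLeftIso_hom, P.map₂_comp, P.map₂_whisker_left,
    P.map₂_whisker_right, P.map₂_associator, map₂_assocInv]
  simp

theorem isNat_mapId_idSqH {a b : B} (u : a ⟶ b) :
    IsNat (im22 P (idSqH u)) (idSqH (P.map u)) (P.mapId a).hom (P.mapId b).hom := by
  have e : P.map₂ (ρ_ u).inv ≫ (P.mapComp u (𝟙 b)).hom ≫ P.map u ◁ (P.mapId b).hom =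
      (ρ_ (P.map u)).inv := by
    rw [← cancel_mono (ρ_ (P.map u)).hom, Iso.inv_hom_id, ← P.map₂_id, ← Iso.inv_hom_id (ρ_ u),
      P.map₂_comp, P.map₂_right_unitor]
    simp
  simp only [IsNat, im22, idSqH, Iso.trans_hom, Iso.symm_hom, PrelaxFunctor.map₂Iso_hom,
    P.map₂_comp, P.map₂_left_unitor, Category.assoc]
  rw [e]
  simp

end Calculus

section Functor

variable {K : Type u₁} [Bicategory.{w₁, v₁} K] {L : Type u₂} [Bicategory.{w₂, v₂} L]
  [MonoidalBicategory K] [MonoidalBicategory L] {F : StrictPseudofunctor K L}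

namespace LaxMonoidal

variable (m : LaxMonoidal F) {A B C : PsMonData K}

theorem mapMor_id (A : PsMonData K) :
    m.mapMor (StrongMorData.id A) = StrongMorData.id (m.mapObj A) := by
  have h : (F.mapId A.X).hom = eqToHom (F.map_id A.X) := by rw [F.mapId_eq_eqToIso]; rfl
  refine StrongMorData.eq_of_cell (F.map_id A.X) h ?_ ?_
  · refine IsNat.to_sqConj _ ?_
    have e := (m.μNat_id A.X A.X).sqV
      (((isNat_sqConj (tId A.X A.X) (idSqH A.mul)).im22 F.toPseudofunctor).comp
        (isNat_mapId_idSqH F.toPseudofunctor A.mul))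
    rw [sqV_idSqH, F.map₂_id, Category.id_comp] at e
    exact e
  · have e : F.map₂ (ρ_ A.one).inv ≫ (F.mapComp A.one (𝟙 A.X)).hom ≫
        F.map A.one ◁ (F.mapId A.X).hom = (ρ_ (F.map A.one)).inv := by
      rw [← cancel_mono (ρ_ (F.map A.one)).hom, Iso.inv_hom_id, ← F.map₂_id,
        ← Iso.inv_hom_id (ρ_ A.one), F.map₂_comp, F.map₂_right_unitor]
      simp
    change (m.ι ◁ (F.map₂ (ρ_ A.one).inv ≫ (F.mapComp A.one (𝟙 A.X)).hom) ≫ (α_ _ _ _).inv) ≫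
      (m.ι ≫ F.map A.one) ◁ (F.mapId A.X).hom = (ρ_ (m.ι ≫ F.map A.one)).inv
    rw [rightUnitor_comp_inv, ← e]
    simp

theorem mapMor_comp (f : StrongMorData A B) (g : StrongMorData B C) :
    m.mapMor (f.comp g) = (m.mapMor f).comp (m.mapMor g) := by
  have h : (F.mapComp f.f g.f).hom = eqToHom (F.map_comp f.f g.f) := by
    rw [F.mapComp_eq_eqToIso]; rfl
  refine StrongMorData.eq_of_cell (F.map_comp f.f g.f) h ?_ ?_
  · refine IsNat.to_sqConj _ ?_
    have e := (m.μNat_comp f.f f.f g.f g.f).sqV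
      (((isNat_sqConj (tComp f.f f.f g.f g.f) (sqH f.φ g.φ)).im22 F.toPseudofunctor).comp
        (isNat_mapComp F.toPseudofunctor f.φ g.φ))
    rw [sqV_sqH, F.map₂_id, Category.id_comp] at e
    exact e
  · change (m.ι ◁ (F.map₂ (g.φ₀.hom ≫ f.φ₀.hom ▷ g.f ≫ (α_ _ _ _).hom) ≫
        (F.mapComp A.one (f.f ≫ g.f)).hom) ≫ (α_ _ _ _).inv) ≫
          (m.ι ≫ F.map A.one) ◁ (F.mapComp f.f g.f).hom =
      (m.ι ◁ (F.map₂ g.φ₀.hom ≫ (F.mapComp B.one g.f).hom) ≫ (α_ _ _ _).inv) ≫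
        (m.ι ◁ (F.map₂ f.φ₀.hom ≫ (F.mapComp A.one f.f).hom) ≫ (α_ _ _ _).inv) ▷ F.map g.f ≫
        (α_ _ _ _).hom
    simp only [F.map₂_comp, F.map₂_whisker_right, F.map₂_associator]
    simp

end LaxMonoidal

end Functor

section Functor

variable {K : Type u₁} [Bicategory.{w₁, v₁} K] {L : Type u₂} [Bicategory.{w₂, v₂} L]
  [MonoidalBicategory K] [MonoidalBicategory L] {F : StrictPseudofunctor K L}

theorem PsMonCell.eqToHom_hom {A B : PsMon K} {f g : A ⟶ B} (h : f = g)
    (h' : StrongMorData.f (StrongMor.toStrongMorData f) =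
      StrongMorData.f (StrongMor.toStrongMorData g)) :
    PsMonCell.hom (eqToHom h) = eqToHom h' := by
  subst h
  rfl

namespace LaxMonoidal

variable (m : LaxMonoidal F)

/-- The image of a pseudomonoid under a lax monoidal 2-functor. -/
def mapPsMon (A : PsMon K) : PsMon L where
  toPsMonData := m.mapObj A.toPsMonData
  pentagon := (PsMonData.pentagon_iff _).1 (m.mapObj_pentagon A.pentagon')
  triangle := (PsMonData.triangle_iff _).1 (m.mapObj_triangle A.triangle')

/-- The image of a strong morphism under a lax monoidal 2-functor. -/
def mapStrongMor {A B : PsMon K} (f : StrongMor A B) : StrongMor (m.mapPsMon A) (m.mapPsMon B) where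
  toStrongMorData := m.mapMor f.toStrongMorData
  assoc_compat := (m.isStrong_mapMor f.isStrong).assoc_compat
  one_mul_compat := (m.isStrong_mapMor f.isStrong).one_mul_compat
  mul_one_compat := (m.isStrong_mapMor f.isStrong).mul_one_compat

/-- The image of a 2-cell of strong morphisms under a lax monoidal 2-functor. -/
def mapCell {A B : PsMon K} {f g : StrongMor A B} (σ : PsMonCell f g) :
    PsMonCell (m.mapStrongMor f) (m.mapStrongMor g) where
  hom := F.map₂ σ.hom
  mul_compat := (m.μNat_nat σ.hom σ.hom).sqV (σ.mul_compat.im22 F.toPseudofunctor)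
  one_compat := by
    change (m.ι ◁ (F.map₂ f.φ₀.hom ≫ (F.mapComp A.one f.f).hom) ≫ (α_ _ _ _).inv) ≫
        (m.ι ≫ F.map A.one) ◁ F.map₂ σ.hom =
      m.ι ◁ (F.map₂ g.φ₀.hom ≫ (F.mapComp A.one g.f).hom) ≫ (α_ _ _ _).inv
    rw [← σ.one_compat, F.map₂_comp, F.map₂_whisker_left]
    simp

/-- The 2-functor between 2-categories of pseudomonoids given by a lax monoidal 2-functor. -/
def psMonFunctor [Bicategory.Strict K] [Bicategory.Strict L] :
    StrictPseudofunctor (PsMon K) (PsMon L) :=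
  StrictPseudofunctor.mk'' {
    obj := m.mapPsMon
    map := fun f => m.mapStrongMor f
    map₂ := fun σ => m.mapCell σ
    map₂_id := fun _ => PsMonCell.hom_ext (F.map₂_id _)
    map₂_comp := fun _ _ => PsMonCell.hom_ext (F.map₂_comp _ _)
    map_id := fun A => StrongMor.eq_of_data (m.mapMor_id A.toPsMonData)
    map_comp := fun f g => StrongMor.eq_of_data
      (m.mapMor_comp (StrongMor.toStrongMorData f) (StrongMor.toStrongMorData g))
    map₂_whisker_left := fun f g g' η => PsMonCell.hom_ext (by
      refine (F.map₂_whisker_left _ _).trans ?_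
      rw [F.mapComp_eq_eqToIso, F.mapComp_eq_eqToIso]
      refine Eq.symm ((PsMonCell.comp_hom _ _).trans ?_)
      refine (congr (congrArg _ (PsMonCell.eqToHom_hom _ (F.map_comp (StrongMorData.f (StrongMor.toStrongMorData f)) (StrongMorData.f (StrongMor.toStrongMorData g)))))
        ((PsMonCell.comp_hom _ _).trans (congrArg _ (PsMonCell.eqToHom_hom _
          (Eq.symm (F.map_comp (StrongMorData.f (StrongMor.toStrongMorData f)) (StrongMorData.f (StrongMor.toStrongMorData g')))))))))
    map₂_whisker_right := fun {_ _ _ f f'} η g => PsMonCell.hom_ext (by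
      refine (F.map₂_whisker_right _ _).trans ?_
      rw [F.mapComp_eq_eqToIso, F.mapComp_eq_eqToIso]
      refine Eq.symm ((PsMonCell.comp_hom _ _).trans ?_)
      refine (congr (congrArg _ (PsMonCell.eqToHom_hom _ (F.map_comp (StrongMorData.f (StrongMor.toStrongMorData f)) (StrongMorData.f (StrongMor.toStrongMorData g)))))
        ((PsMonCell.comp_hom _ _).trans (congrArg _ (PsMonCell.eqToHom_hom _
          (Eq.symm (F.map_comp (StrongMorData.f (StrongMor.toStrongMorData f')) (StrongMorData.f (StrongMor.toStrongMorData g))))))))) }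

theorem psMonFunctor_lifts [Bicategory.Strict K] [Bicategory.Strict L] :
    m.toLaxMonoidalData.Lifts m.psMonFunctor where
  obj_eq _ := rfl
  map_agrees _ := .refl _
  map₂_heq _ := HEq.rfl

end LaxMonoidal

end Functor

section IdentityImage

variable {K : Type u₁} [Bicategory.{w₁, v₁} K] [MonoidalBicategory K]

theorem PsMonData.mk_eq {X : K} {mul mul' : X ⊠ₒ X ⟶ X} {one one' : (I : K) ⟶ X}
    {a : mul ⊠ 𝟙 X ≫ mul ≅ asc X X X ≫ 𝟙 X ⊠ mul ≫ mul}
    {a' : mul' ⊠ 𝟙 X ≫ mul' ≅ asc X X X ≫ 𝟙 X ⊠ mul' ≫ mul'} {l : one ⊠ 𝟙 X ≫ mul ≅ lun X}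
    {l' : one' ⊠ 𝟙 X ≫ mul' ≅ lun X} {r : 𝟙 X ⊠ one ≫ mul ≅ run X}
    {r' : 𝟙 X ⊠ one' ≫ mul' ≅ run X} (h : mul = mul') (h₀ : one = one') {θ : mul ⟶ mul'}
    {θ₀ : one ⟶ one'} (hθ : θ = eqToHom h) (hθ₀ : θ₀ = eqToHom h₀)
    (ea : a.hom ≫ asc X X X ◁ (𝟙 X ⊠ mul ◁ θ ≫ (𝟙 (𝟙 X) ⊠₂ θ) ▷ mul') =
      (mul ⊠ 𝟙 X ◁ θ ≫ (θ ⊠₂ 𝟙 (𝟙 X)) ▷ mul') ≫ a'.hom)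
    (el : one ⊠ 𝟙 X ◁ θ ≫ (θ₀ ⊠₂ 𝟙 (𝟙 X)) ▷ mul' ≫ l'.hom = l.hom)
    (er : 𝟙 X ⊠ one ◁ θ ≫ (𝟙 (𝟙 X) ⊠₂ θ₀) ▷ mul' ≫ r'.hom = r.hom) :
    (⟨X, mul, one, a, l, r⟩ : PsMonData K) = ⟨X, mul', one', a', l', r'⟩ := by
  subst h h₀ hθ hθ₀
  simp only [eqToHom_refl, tMap₂_id, Bicategory.whiskerLeft_id, Bicategory.id_whiskerRight,
    Category.id_comp, Category.comp_id] at ea el er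
  rw [Iso.ext ea, Iso.ext el, Iso.ext er]

theorem wrComp_id_left {a b : K} (f : a ⟶ b) (c : K) :
    (λ_ f).hom ⊠₂ 𝟙 (𝟙 c) =
      (wrComp (𝟙 a) f c).hom ≫ (tId a c).hom ▷ (f ⊠ 𝟙 c) ≫ (λ_ (f ⊠ 𝟙 c)).hom := by
  have e := tMap₂_leftUnitor f (𝟙 c)
  have h : (λ_ f).hom ⊠₂ 𝟙 (𝟙 c) = (𝟙 (𝟙 a ≫ f) ⊠₂ (λ_ (𝟙 c)).inv) ≫ (λ_ f).hom ⊠₂ (λ_ (𝟙 c)).hom := by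
    simp [← tMap₂_comp]
  rw [h, e]
  simp [wrComp]

theorem wlComp_id_left {a b : K} (f : a ⟶ b) (c : K) :
    𝟙 (𝟙 c) ⊠₂ (λ_ f).hom =
      (wlComp c (𝟙 a) f).hom ≫ (tId c a).hom ▷ (𝟙 c ⊠ f) ≫ (λ_ (𝟙 c ⊠ f)).hom := by
  have e := tMap₂_leftUnitor (𝟙 c) f
  have h : 𝟙 (𝟙 c) ⊠₂ (λ_ f).hom = ((λ_ (𝟙 c)).inv ⊠₂ 𝟙 (𝟙 a ≫ f)) ≫ (λ_ (𝟙 c)).hom ⊠₂ (λ_ f).hom := by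
    simp [← tMap₂_comp]
  rw [h, e]
  simp [wlComp]

namespace PsMonData

variable (A : PsMonData K)

/-- The associativity 2-cell of the image under the identity 2-functor. -/
def idAssoc : ((𝟙 (A.X ⊠ₒ A.X)) ≫ A.mul) ⊠ 𝟙 A.X ≫ (𝟙 (A.X ⊠ₒ A.X)) ≫ A.mul ≅
    asc A.X A.X A.X ≫ 𝟙 A.X ⊠ ((𝟙 (A.X ⊠ₒ A.X)) ≫ A.mul) ≫ (𝟙 (A.X ⊠ₒ A.X)) ≫ A.mul :=
  ((LaxMonoidalData.id K).mapObj A).mulAssoc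

/-- The left unit 2-cell of the image under the identity 2-functor. -/
def idOneMul : ((𝟙 (I : K)) ≫ A.one) ⊠ 𝟙 A.X ≫ (𝟙 (A.X ⊠ₒ A.X)) ≫ A.mul ≅ lun A.X :=
  ((LaxMonoidalData.id K).mapObj A).oneMul

/-- The right unit 2-cell of the image under the identity 2-functor. -/
def idMulOne : 𝟙 A.X ⊠ ((𝟙 (I : K)) ≫ A.one) ≫ (𝟙 (A.X ⊠ₒ A.X)) ≫ A.mul ≅ run A.X :=
  ((LaxMonoidalData.id K).mapObj A).mulOne

theorem idAssoc_hom :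
    A.idAssoc.hom = (wrComp (𝟙 (A.X ⊠ₒ A.X)) A.mul A.X).hom ▷ ((𝟙 (A.X ⊠ₒ A.X)) ≫ A.mul) ⊗≫
      (𝟙 (A.X ⊠ₒ A.X)) ⊠ 𝟙 A.X ◁ A.mulAssoc.hom ⊗≫
      (tId (A.X ⊠ₒ A.X) A.X).hom ▷ (asc A.X A.X A.X ≫ 𝟙 A.X ⊠ A.mul ≫ A.mul) ⊗≫
      asc A.X A.X A.X ◁ (tId A.X (A.X ⊠ₒ A.X)).inv ▷ (𝟙 A.X ⊠ A.mul ≫ A.mul) ⊗≫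
      asc A.X A.X A.X ◁ (wlComp A.X (𝟙 (A.X ⊠ₒ A.X)) A.mul).inv ▷ ((𝟙 (A.X ⊠ₒ A.X)) ≫ A.mul) := by
  have e : A.idAssoc.hom = (tl12 (wrComp (𝟙 (A.X ⊠ₒ A.X)) A.mul A.X) ((𝟙 (A.X ⊠ₒ A.X)) ≫ A.mul)).hom ≫
      (𝟙 (A.X ⊠ₒ A.X)) ⊠ 𝟙 A.X ◁ (tl22 (whiskerRightIso (Iso.refl A.mul ⊠ᵢ (Iso.refl (𝟙 A.X)).symm) (𝟙 (A.X ⊠ₒ A.X)) ≪≫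
        idSqV (A.mul ⊠ 𝟙 A.X)) A.mul).hom ≫
      (𝟙 (A.X ⊠ₒ A.X)) ⊠ 𝟙 A.X ◁ (𝟙 ((A.X ⊠ₒ A.X) ⊠ₒ A.X)) ◁ ((Iso.refl (A.mul ⊠ 𝟙 A.X ≫ A.mul)).symm ≪≫ A.mulAssoc ≪≫
        Iso.refl (asc A.X A.X A.X ≫ 𝟙 A.X ⊠ A.mul ≫ A.mul) ≪≫
        whiskerLeftIso (asc A.X A.X A.X) (Iso.refl (𝟙 A.X ⊠ A.mul ≫ A.mul))).hom ≫
      (tl33 (whiskerRightIso (tId (A.X ⊠ₒ A.X) A.X) ((𝟙 ((A.X ⊠ₒ A.X) ⊠ₒ A.X)) ≫ asc A.X A.X A.X) ≪⊗≫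
          whiskerLeftIso (asc A.X A.X A.X)
            (whiskerRightIso (tId A.X (A.X ⊠ₒ A.X)).symm (𝟙 (A.X ⊠ₒ A.X ⊠ₒ A.X))) :
        𝟙 (A.X ⊠ₒ A.X) ⊠ 𝟙 A.X ≫ 𝟙 ((A.X ⊠ₒ A.X) ⊠ₒ A.X) ≫ asc A.X A.X A.X ≅
          asc A.X A.X A.X ≫ 𝟙 A.X ⊠ 𝟙 (A.X ⊠ₒ A.X) ≫ 𝟙 (A.X ⊠ₒ A.X ⊠ₒ A.X)) (𝟙 A.X ⊠ A.mul ≫ A.mul)).hom ≫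
      asc A.X A.X A.X ◁ 𝟙 A.X ⊠ (𝟙 (A.X ⊠ₒ A.X)) ◁ (tl22 (whiskerRightIso
        ((Iso.refl (𝟙 A.X)).symm ⊠ᵢ Iso.refl A.mul) (𝟙 (A.X ⊠ₒ A.X)) ≪≫ idSqV (𝟙 A.X ⊠ A.mul)) A.mul).inv ≫
      asc A.X A.X A.X ◁ (tl12 (wlComp A.X (𝟙 (A.X ⊠ₒ A.X)) A.mul) ((𝟙 (A.X ⊠ₒ A.X)) ≫ A.mul)).inv :=
    (LaxMonoidalData.id K).mapObj_mulAssoc_hom A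
  rw [e]
  simp only [tl12, tl22, tl33, bicategoricalIsoComp, Iso.trans_hom, Iso.trans_inv, Iso.symm_hom,
    Iso.symm_inv, tIso_hom, tIso_inv, Iso.refl_hom, Iso.refl_inv, tMap₂_id,
    whiskerLeftIso_hom, whiskerRightIso_hom, whiskerRightIso_inv,
    Category.assoc, BicategoricalCoherence.iso, idSqV]
  bicategory

theorem idOneMul_hom :
    A.idOneMul.hom = (wrComp (𝟙 (I : K)) A.one A.X).hom ▷ ((𝟙 (A.X ⊠ₒ A.X)) ≫ A.mul) ⊗≫
      (𝟙 (I : K)) ⊠ 𝟙 A.X ◁ A.oneMul.hom ⊗≫ (tId I A.X).hom ▷ lun A.X ⊗≫ 𝟙 (lun A.X) := by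
  have e : A.idOneMul.hom = (tl12 (wrComp (𝟙 (I : K)) A.one A.X) ((𝟙 (A.X ⊠ₒ A.X)) ≫ A.mul)).hom ≫
      (𝟙 (I : K)) ⊠ 𝟙 A.X ◁ (tl22 (whiskerRightIso (Iso.refl A.one ⊠ᵢ (Iso.refl (𝟙 A.X)).symm) (𝟙 (A.X ⊠ₒ A.X)) ≪≫
        idSqV (A.one ⊠ 𝟙 A.X)) A.mul).hom ≫
      (𝟙 (I : K)) ⊠ 𝟙 A.X ◁ (𝟙 (I ⊠ₒ A.X)) ◁ ((Iso.refl (A.one ⊠ 𝟙 A.X ≫ A.mul)).symm ≪≫ A.oneMul).hom ≫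
      ((LaxMonoidalData.id K).ξ A.X).hom :=
    (LaxMonoidalData.id K).mapObj_oneMul_hom A
  rw [e]
  have hω : (LaxMonoidalData.id K).ξ A.X =
      (whiskerRightIso (tId I A.X) ((𝟙 (I ⊠ₒ A.X)) ≫ lun A.X) ≪⊗≫ Iso.refl (lun A.X) :
      (𝟙 (I : K)) ⊠ 𝟙 A.X ≫ (𝟙 (I ⊠ₒ A.X)) ≫ lun A.X ≅ lun A.X) := rfl
  rw [hω]
  simp only [tl12, tl22, bicategoricalIsoComp, Iso.trans_hom, Iso.symm_hom,
    tIso_hom, Iso.refl_hom, Iso.refl_inv, tMap₂_id,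
    whiskerRightIso_hom, Category.assoc, BicategoricalCoherence.iso, idSqV]
  bicategory

theorem idMulOne_hom :
    A.idMulOne.hom = (wlComp A.X (𝟙 (I : K)) A.one).hom ▷ ((𝟙 (A.X ⊠ₒ A.X)) ≫ A.mul) ⊗≫
      𝟙 A.X ⊠ (𝟙 (I : K)) ◁ A.mulOne.hom ⊗≫ (tId A.X I).hom ▷ run A.X ⊗≫ 𝟙 (run A.X) := by
  have e : A.idMulOne.hom = (tl12 (wlComp A.X (𝟙 (I : K)) A.one) ((𝟙 (A.X ⊠ₒ A.X)) ≫ A.mul)).hom ≫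
      𝟙 A.X ⊠ (𝟙 (I : K)) ◁ (tl22 (whiskerRightIso ((Iso.refl (𝟙 A.X)).symm ⊠ᵢ Iso.refl A.one) (𝟙 (A.X ⊠ₒ A.X)) ≪≫
        idSqV (𝟙 A.X ⊠ A.one)) A.mul).hom ≫
      𝟙 A.X ⊠ (𝟙 (I : K)) ◁ (𝟙 (A.X ⊠ₒ I)) ◁ ((Iso.refl (𝟙 A.X ⊠ A.one ≫ A.mul)).symm ≪≫ A.mulOne).hom ≫
      ((LaxMonoidalData.id K).ζ A.X).hom :=
    (LaxMonoidalData.id K).mapObj_mulOne_hom A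
  rw [e]
  have hω : (LaxMonoidalData.id K).ζ A.X =
      (whiskerRightIso (tId A.X I) ((𝟙 (A.X ⊠ₒ I)) ≫ run A.X) ≪⊗≫ Iso.refl (run A.X) :
      𝟙 A.X ⊠ (𝟙 (I : K)) ≫ (𝟙 (A.X ⊠ₒ I)) ≫ run A.X ≅ run A.X) := rfl
  rw [hω]
  simp only [tl12, tl22, bicategoricalIsoComp, Iso.trans_hom, Iso.symm_hom,
    tIso_hom, Iso.refl_hom, Iso.refl_inv, tMap₂_id,
    whiskerRightIso_hom, Category.assoc, BicategoricalCoherence.iso, idSqV]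
  bicategory

theorem idAssoc_leftUnitor :
    A.idAssoc.hom ≫ asc A.X A.X A.X ◁ (𝟙 A.X ⊠ ((𝟙 (A.X ⊠ₒ A.X)) ≫ A.mul) ◁ (λ_ A.mul).hom ≫
        (𝟙 (𝟙 A.X) ⊠₂ (λ_ A.mul).hom) ▷ A.mul) =
      (((𝟙 (A.X ⊠ₒ A.X)) ≫ A.mul) ⊠ 𝟙 A.X ◁ (λ_ A.mul).hom ≫ ((λ_ A.mul).hom ⊠₂ 𝟙 (𝟙 A.X)) ▷ A.mul) ≫
        A.mulAssoc.hom := by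
  have x := whisker_exchange (tId (A.X ⊠ₒ A.X) A.X).hom A.mulAssoc.hom
  rw [idAssoc_hom, wrComp_id_left, wlComp_id_left]
  calc _ = (wrComp (𝟙 (A.X ⊠ₒ A.X)) A.mul A.X).hom ▷ ((𝟙 (A.X ⊠ₒ A.X)) ≫ A.mul) ⊗≫
        ((𝟙 (A.X ⊠ₒ A.X)) ⊠ 𝟙 A.X ◁ A.mulAssoc.hom ≫
        (tId (A.X ⊠ₒ A.X) A.X).hom ▷ (asc A.X A.X A.X ≫ 𝟙 A.X ⊠ A.mul ≫ A.mul)) ⊗≫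
        asc A.X A.X A.X ◁ (tId A.X (A.X ⊠ₒ A.X)).inv ▷ (𝟙 A.X ⊠ A.mul ≫ A.mul) ⊗≫
        asc A.X A.X A.X ◁ (((wlComp A.X (𝟙 (A.X ⊠ₒ A.X)) A.mul).inv ≫ (wlComp A.X (𝟙 (A.X ⊠ₒ A.X)) A.mul).hom)) ▷ A.mul ⊗≫
        asc A.X A.X A.X ◁ (tId A.X (A.X ⊠ₒ A.X)).hom ▷ (𝟙 A.X ⊠ A.mul ≫ A.mul) ⊗≫
        𝟙 (asc A.X A.X A.X ≫ 𝟙 A.X ⊠ A.mul ≫ A.mul) := by bicategory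
    _ = (wrComp (𝟙 (A.X ⊠ₒ A.X)) A.mul A.X).hom ▷ ((𝟙 (A.X ⊠ₒ A.X)) ≫ A.mul) ⊗≫
        ((tId (A.X ⊠ₒ A.X) A.X).hom ▷ (A.mul ⊠ 𝟙 A.X ≫ A.mul) ≫ 𝟙 _ ◁ A.mulAssoc.hom) ⊗≫
        asc A.X A.X A.X ◁ ((tId A.X (A.X ⊠ₒ A.X)).inv ≫ (tId A.X (A.X ⊠ₒ A.X)).hom) ▷
          (𝟙 A.X ⊠ A.mul ≫ A.mul) ⊗≫
        𝟙 (asc A.X A.X A.X ≫ 𝟙 A.X ⊠ A.mul ≫ A.mul) := by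
      rw [x, Iso.inv_hom_id]
      bicategory
    _ = _ := by
      rw [Iso.inv_hom_id]
      bicategory

theorem idOneMul_leftUnitor :
    ((𝟙 (I : K)) ≫ A.one) ⊠ 𝟙 A.X ◁ (λ_ A.mul).hom ≫ ((λ_ A.one).hom ⊠₂ 𝟙 (𝟙 A.X)) ▷ A.mul ≫
      A.oneMul.hom = A.idOneMul.hom := by
  have x := whisker_exchange (tId I A.X).hom A.oneMul.hom
  rw [idOneMul_hom, wrComp_id_left]
  calc _ = (wrComp (𝟙 (I : K)) A.one A.X).hom ▷ ((𝟙 (A.X ⊠ₒ A.X)) ≫ A.mul) ⊗≫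
        ((tId I A.X).hom ▷ (A.one ⊠ 𝟙 A.X ≫ A.mul) ≫ 𝟙 _ ◁ A.oneMul.hom) ⊗≫ 𝟙 (lun A.X) := by bicategory
    _ = _ := by
      rw [← x]
      bicategory

theorem idMulOne_leftUnitor :
    𝟙 A.X ⊠ ((𝟙 (I : K)) ≫ A.one) ◁ (λ_ A.mul).hom ≫ (𝟙 (𝟙 A.X) ⊠₂ (λ_ A.one).hom) ▷ A.mul ≫
      A.mulOne.hom = A.idMulOne.hom := by
  have x := whisker_exchange (tId A.X I).hom A.mulOne.hom
  rw [idMulOne_hom, wlComp_id_left]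
  calc _ = (wlComp A.X (𝟙 (I : K)) A.one).hom ▷ ((𝟙 (A.X ⊠ₒ A.X)) ≫ A.mul) ⊗≫
        ((tId A.X I).hom ▷ (𝟙 A.X ⊠ A.one ≫ A.mul) ≫ 𝟙 _ ◁ A.mulOne.hom) ⊗≫ 𝟙 (run A.X) := by bicategory
    _ = _ := by
      rw [← x]
      bicategory

/-- The image of a pseudomonoid under the identity 2-functor. -/
theorem mapObj_id [Bicategory.Strict K] : (LaxMonoidalData.id K).mapObj A = A :=
  mk_eq (Strict.id_comp A.mul) (Strict.id_comp A.one)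
    (congrArg Iso.hom (Strict.leftUnitor_eqToIso A.mul))
    (congrArg Iso.hom (Strict.leftUnitor_eqToIso A.one))
    A.idAssoc_leftUnitor A.idOneMul_leftUnitor A.idMulOne_leftUnitor

end PsMonData

end IdentityImage

section Agreement

section Heq

variable {B : Type u₁} [Bicategory.{w₁, v₁} B]

theorem heq_of_isCyl {a b a' b' : B} {f : a ⟶ a'} {g : b ⟶ b'} {u u' : a ⟶ b} {v v' : a' ⟶ b'}
    {s : f ≫ v ≅ u ≫ g} {t : f ≫ v' ≅ u' ≫ g} {θ : u ⟶ u'} {θ' : v ⟶ v'} (hu : u = u')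
    (hv : v = v') (hθ : θ = eqToHom hu) (hθ' : θ' = eqToHom hv) (H : IsCyl s t θ θ') :
    HEq s t := by
  subst hu hv hθ hθ'
  exact heq_of_eq (Iso.ext (by simpa [IsCyl] using (Eq.symm H)))

theorem heq_of_whiskerRight {a b c : B} {f : b ⟶ c} {p p' : a ⟶ b} {q q' : a ⟶ c}
    {s : q ≅ p ≫ f} {t : q' ≅ p' ≫ f} {θ : p ⟶ p'} {θ' : q ⟶ q'} (hp : p = p') (hq : q = q')
    (hθ : θ = eqToHom hp) (hθ' : θ' = eqToHom hq) (H : s.hom ≫ θ ▷ f = θ' ≫ t.hom) :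
    HEq s t := by
  subst hp hq hθ hθ'
  exact heq_of_eq (Iso.ext (by simpa using H))

theorem IsCyl.toIsNat {a b c d a' b' c' d' : B} {f : a ⟶ b} {v : b ⟶ d} {u : a ⟶ c}
    {g : c ⟶ d} {f' : a' ⟶ b'} {v' : b' ⟶ d'} {u' : a' ⟶ c'} {g' : c' ⟶ d'} {x₀ : a ⟶ a'}
    {x₁ : b ⟶ b'} {y₁ : c ⟶ c'} {x₂ : d ⟶ d'} {P : f ≫ x₁ ≅ x₀ ≫ f'} {Q : v ≫ x₂ ≅ x₁ ≫ v'}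
    {P' : u ≫ y₁ ≅ x₀ ≫ u'} {Q' : g ≫ x₂ ≅ y₁ ≫ g'} {σ : f ≫ v ≅ u ≫ g} {σ' : f' ≫ v' ≅ u' ≫ g'}
    (H : IsCyl (MonTwoCat.sqV σ Q') (MonTwoCat.sqV P σ') P'.hom Q.hom) :
    IsNat (MonTwoCat.sqH P Q) (MonTwoCat.sqH P' Q') σ.hom σ'.hom := by
  have e := congrArg (fun y => (α_ f v x₂).hom ≫ y ≫ (α_ x₀ u' g').hom) H
  simp only [IsNat, MonTwoCat.sqV, MonTwoCat.sqH, Iso.trans_hom, Iso.symm_hom, whiskerRightIso_hom,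
    whiskerLeftIso_hom] at e ⊢
  refine Eq.trans ?_ ((Eq.symm e).trans ?_) <;> bicategory

theorem isCyl_leftUnitor {a b a' b' : B} {f : a ⟶ a'} {g : b ⟶ b'} {u : a ⟶ b} {v : a' ⟶ b'}
    (s : f ≫ v ≅ u ≫ g) : IsCyl (sqV (idSqV f) s) s (λ_ u).hom (λ_ v).hom := by
  simp only [IsCyl, sqV, idSqV, Iso.trans_hom, Iso.symm_hom, whiskerRightIso_hom,
    whiskerLeftIso_hom]
  bicategory

theorem reassocMap_eq_eqToHom [Bicategory.Strict B] {C : Type u₂} [Bicategory.{w₂, v₂} C]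
    (G : StrictPseudofunctor C B) {x : B} {a b c : C} (t : x ⟶ G.obj a) (q : a ⟶ b) (p : b ⟶ c)
    (h : (t ≫ G.map q) ≫ G.map p = t ≫ G.map (q ≫ p)) :
    (reassocMap G.toPseudofunctor t q p).hom = eqToHom h := by
  simp only [reassocMap, G.mapComp_eq_eqToIso, Strict.associator_eqToIso, eqToIso.hom,
    Iso.trans_hom, Iso.symm_hom, whiskerLeftIso_hom, eqToIso.inv, Bicategory.whiskerLeft_eqToHom,
    eqToHom_trans]

theorem comp_map_comp [Bicategory.Strict B] {C : Type u₂} [Bicategory.{w₂, v₂} C]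
    (G : StrictPseudofunctor C B) {x : B} {a b c : C} (t : x ⟶ G.obj a) (q : a ⟶ b) (p : b ⟶ c) :
    (t ≫ G.map q) ≫ G.map p = t ≫ G.map (q ≫ p) := by
  rw [G.map_comp, Strict.assoc]

end Heq

namespace StrongMorData

variable {K : Type u₁} [Bicategory.{w₁, v₁} K] [MonoidalBicategory K] {A B : PsMonData K}

theorem mapMor_id_agrees [Bicategory.Strict K] (f : StrongMorData A B) :
    ((LaxMonoidalData.id K).mapMor f).Agrees f where
  f_heq := HEq.rfl
  φ_heq := by
    have H : IsCyl (sqV (idSqV (f.f ⊠ f.f)) (im22 (StrictPseudofunctor.id K).toPseudofunctor f.φ))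
        f.φ (λ_ A.mul).hom (λ_ B.mul).hom := by
      have e : im22 (StrictPseudofunctor.id K).toPseudofunctor f.φ = f.φ :=
        Iso.ext ((Category.id_comp _).trans (Category.comp_id _))
      rw [e]
      exact isCyl_leftUnitor f.φ
    exact heq_of_isCyl (Strict.id_comp A.mul) (Strict.id_comp B.mul)
      (congrArg Iso.hom (Strict.leftUnitor_eqToIso A.mul))
      (congrArg Iso.hom (Strict.leftUnitor_eqToIso B.mul)) H
  φ₀_heq := by
    refine heq_of_whiskerRight (Strict.id_comp A.one) (Strict.id_comp B.one)
      (congrArg Iso.hom (Strict.leftUnitor_eqToIso A.one))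
      (congrArg Iso.hom (Strict.leftUnitor_eqToIso B.one)) ?_
    change (𝟙 I ◁ (f.φ₀.hom ≫ 𝟙 (A.one ≫ f.f)) ≫ (α_ (𝟙 I) A.one f.f).inv) ≫
      (λ_ A.one).hom ▷ f.f = (λ_ B.one).hom ≫ f.φ₀.hom
    simp

end StrongMorData

namespace LaxMonoidal

variable {K : Type u₁} [Bicategory.{w₁, v₁} K] {L : Type u₂} [Bicategory.{w₂, v₂} L]
  {M : Type u₃} [Bicategory.{w₃, v₃} M] [Bicategory.Strict M]
  [MonoidalBicategory K] [MonoidalBicategory L] [MonoidalBicategory M]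
  {F : StrictPseudofunctor K L} {G : StrictPseudofunctor L M}
  (m : LaxMonoidal F) (n : LaxMonoidal G)

/-- The image of a pseudomonoid under a composite is the iterated image. -/
theorem mapObj_comp (A : PsMonData K) :
    (m.toLaxMonoidalData.comp n.toLaxMonoidalData).mapObj A = n.mapObj (m.mapObj A) :=
  PsMonData.mk_eq (comp_map_comp G _ _ _) (comp_map_comp G _ _ _)
    (reassocMap_eq_eqToHom G (n.μ (F.obj A.X) (F.obj A.X)) (m.μ A.X A.X) (F.map A.mul) _)
    (reassocMap_eq_eqToHom G n.ι m.ι (F.map A.one) _)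
    (m.compMapAssoc_reassoc n A) (m.compMapOneMul_reassoc n A) (m.compMapMulOne_reassoc n A)

theorem mapMor_comp_agrees {A B : PsMonData K} (f : StrongMorData A B) :
    ((m.toLaxMonoidalData.comp n.toLaxMonoidalData).mapMor f).Agrees (n.mapMor (m.mapMor f)) where
  f_heq := HEq.rfl
  φ_heq := by
    have H : IsCyl (sqV (sqV (n.μNat (F.map f.f) (F.map f.f)) (mapSq G (m.μNat f.f f.f)))
          (mapSq G (mapSq F f.φ)))
        (sqV (n.μNat (F.map f.f) (F.map f.f)) (mapSq G (sqV (m.μNat f.f f.f) (mapSq F f.φ))))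
        (reassocMap G.toPseudofunctor (n.μ (F.obj A.X) (F.obj A.X)) (m.μ A.X A.X)
          (F.map A.mul)).hom
        (reassocMap G.toPseudofunctor (n.μ (F.obj B.X) (F.obj B.X)) (m.μ B.X B.X)
          (F.map B.mul)).hom :=
      (isCyl_associator _ _ _).comp
        (((MonTwoCat.isCyl_mapComp G.toPseudofunctor (m.μNat f.f f.f)
          (mapSq F f.φ)).symm).whiskerLeft _)
    have e := im22_comp F.toPseudofunctor G.toPseudofunctor f.φ
    refine heq_of_isCyl (comp_map_comp G _ _ _) (comp_map_comp G _ _ _)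
      (reassocMap_eq_eqToHom G (n.μ (F.obj A.X) (F.obj A.X)) (m.μ A.X A.X) (F.map A.mul) _)
      (reassocMap_eq_eqToHom G (n.μ (F.obj B.X) (F.obj B.X)) (m.μ B.X B.X) (F.map B.mul) _) ?_
    have e' : sqV (sqV (n.μNat (F.map f.f) (F.map f.f)) (mapSq G (m.μNat f.f f.f)))
        (im22 (F.toPseudofunctor.comp G.toPseudofunctor) f.φ) = sqV (sqV
          (n.μNat (F.map f.f) (F.map f.f)) (mapSq G (m.μNat f.f f.f))) (mapSq G (mapSq F f.φ)) :=
      congrArg _ e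
    rw [← e'] at H
    exact H
  φ₀_heq := by
    refine heq_of_whiskerRight (comp_map_comp G _ _ _) (comp_map_comp G _ _ _)
      (reassocMap_eq_eqToHom G n.ι m.ι (F.map A.one) _)
      (reassocMap_eq_eqToHom G n.ι m.ι (F.map B.one) _) ?_
    change ((n.ι ≫ G.map m.ι) ◁ (G.map₂ (F.map₂ f.φ₀.hom) ≫
          (G.map₂ (F.mapComp A.one f.f).hom ≫ (G.mapComp (F.map A.one) (F.map f.f)).hom)) ≫
            (α_ _ _ _).inv) ≫
        (reassocMap G.toPseudofunctor n.ι m.ι (F.map A.one)).hom ▷ G.map (F.map f.f) =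
      (reassocMap G.toPseudofunctor n.ι m.ι (F.map B.one)).hom ≫
        n.ι ◁ (G.map₂ (m.ι ◁ (F.map₂ f.φ₀.hom ≫ (F.mapComp A.one f.f).hom) ≫ (α_ _ _ _).inv) ≫
          (G.mapComp (m.ι ≫ F.map A.one) (F.map f.f)).hom) ≫ (α_ _ _ _).inv
    simp only [reassocMap, G.map₂_comp, G.map₂_whisker_left, Iso.trans_hom, Iso.symm_hom,
      whiskerLeftIso_hom, map₂_assocInv]
    simp

end LaxMonoidal

end Agreement

section Transport

variable {B : Type u₁} [Bicategory.{w₁, v₁} B]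

theorem naturality₂_of_heq {a b c d a' b' c' d' : B} (ha : a = a') (hb : b = b') (hc : c = c')
    (hd : d = d') {f g : a ⟶ b} {f' g' : a' ⟶ b'} (hf : HEq f f') (hg : HEq g g') {s : f ⟶ g}
    {s' : f' ⟶ g'} (hs : HEq s s') {x : a ⟶ c} {x' : a' ⟶ c'} (hx : HEq x x') {y : b ⟶ d}
    {y' : b' ⟶ d'} (hy : HEq y y') {h k : c ⟶ d} {h' k' : c' ⟶ d'} (hh : HEq h h')
    (hk : HEq k k') {r : h ⟶ k} {r' : h' ⟶ k'} (hr : HEq r r') (e : f ≫ y = x ≫ h)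
    (i : g ≫ y = x ≫ k) (e' : f' ≫ y' = x' ≫ h') (i' : g' ≫ y' = x' ≫ k')
    (H : s' ▷ y' ≫ eqToHom i' = eqToHom e' ≫ x' ◁ r') :
    s ▷ y ≫ eqToHom i = eqToHom e ≫ x ◁ r := by
  subst ha hb hc hd
  obtain rfl := eq_of_heq hf
  obtain rfl := eq_of_heq hg
  obtain rfl := eq_of_heq hh
  obtain rfl := eq_of_heq hk
  obtain rfl := eq_of_heq hx
  obtain rfl := eq_of_heq hy
  obtain rfl := eq_of_heq hs
  obtain rfl := eq_of_heq hr
  exact H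

theorem exists_inverse_of_heq {a b a' b' : B} (ha : a = a') (hb : b = b') {f : a ⟶ b}
    {f' : a' ⟶ b'} (hf : HEq f f') (H : ∃ g' : b' ⟶ a', f' ≫ g' = 𝟙 a' ∧ g' ≫ f' = 𝟙 b') :
    ∃ g : b ⟶ a, f ≫ g = 𝟙 a ∧ g ≫ f = 𝟙 b := by
  subst ha hb
  obtain rfl := eq_of_heq hf
  exact H

theorem whisker_unit_square {a b c d b' c' d' : B} {p : a ⟶ b} {q : a ⟶ b'} {x : b ⟶ b'}
    {y : c ⟶ c'} {z : d ⟶ d'} (e : q ≅ p ≫ x) {g : b ⟶ d} {g' : b' ⟶ d'}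
    (s : x ≫ g' ≅ g ≫ z) {h : b ⟶ c} {h' : b' ⟶ c'} (r : x ≫ h' ≅ h ≫ y) {k : c ⟶ d}
    {k' : c' ⟶ d'} (w : y ≫ k' ≅ k ≫ z) {θ : g ⟶ h ≫ k} {θ' : g' ⟶ h' ≫ k'}
    (H : IsCyl s (sqV r w) θ θ') :
    ((e.hom ▷ g' ≫ (α_ _ _ _).hom ≫ p ◁ s.hom ≫ (α_ _ _ _).inv) ≫
        (p ◁ θ ≫ (α_ _ _ _).inv) ▷ z ≫ (α_ _ _ _).hom) ≫ (p ≫ h) ◁ w.inv =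
      (q ◁ θ' ≫ (α_ _ _ _).inv) ≫
        (e.hom ▷ h' ≫ (α_ _ _ _).hom ≫ p ◁ r.hom ≫ (α_ _ _ _).inv) ▷ k' ≫ (α_ _ _ _).hom := by
  have h₁ : s.hom ≫ θ ▷ z ≫ (α_ _ _ _).hom ≫ h ◁ w.inv =
      x ◁ θ' ≫ (α_ _ _ _).inv ≫ r.hom ▷ k' ≫ (α_ _ _ _).hom := by
    have := H =≫ ((α_ _ _ _).hom ≫ h ◁ w.inv)
    simp only [sqV, Category.assoc, Iso.trans_hom, whiskerRightIso_hom, whiskerLeftIso_hom,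
      Iso.symm_hom, Iso.inv_hom_id_assoc, whiskerLeft_hom_inv, Category.comp_id] at this
    exact Eq.symm this
  have h₂ := congrArg (fun y => e.hom ▷ g' ≫ (α_ _ _ _).hom ≫ p ◁ y ≫ (α_ _ _ _).inv) h₁
  simp only [whiskerLeft_comp, Category.assoc] at h₂
  refine Eq.trans ?_ (h₂.trans ?_)
  · bicategory
  · rw [← associator_naturality_right_assoc, ← whisker_exchange_assoc]
    bicategory

end Transport

section Naturality

variable {K : Type u₁} [Bicategory.{w₁, v₁} K] {L : Type u₂} [Bicategory.{w₂, v₂} L]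
  [Bicategory.Strict L] [MonoidalBicategory K] [MonoidalBicategory L]
  {F G : StrictPseudofunctor K L} {τ : TwoNatTrans F G} {m : LaxMonoidalData F}
  {n : LaxMonoidalData G}

theorem TwoNatTrans.isNat_mapSq {a b a' b' : K} {f : a ⟶ a'} {g : b ⟶ b'} {u : a ⟶ b}
    {v : a' ⟶ b'} (s : f ≫ v ≅ u ≫ g) :
    IsNat (sqH (mapSq F s) (τ.sq v)) (sqH (τ.sq u) (mapSq G s)) (τ.sq f).inv (τ.sq g).inv := by
  have h := ((τ.isCyl_im22 s).transpose (θ := im22 F.toPseudofunctor s)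
    (θ' := im22 G.toPseudofunctor s))
  exact IsCyl.toIsNat (P := mapSq F s) (Q := τ.sq v) (P' := τ.sq u) (Q' := mapSq G s)
    (σ := (τ.sq f).symm) (σ' := (τ.sq g).symm) h

namespace MonoidalTrans

variable (t : MonoidalTrans τ m n) {A B : PsMonData K}

/-- The components at pseudomonoids are natural. -/
theorem component_naturality (f : StrongMorData A B) :
    (m.mapMor f).comp (t.component B) = (t.component A).comp (n.mapMor f) := by
  refine StrongMorData.eq_of_cell (τ.naturality f.f) (σ := (τ.sq f.f).inv) rfl ?_ ?_
  · have h := (IsCyl.toIsNat (t.u_modif f.f f.f)).sqV (TwoNatTrans.isNat_mapSq (τ := τ) f.φ)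
    rw [sqV_sqH, sqV_sqH] at h
    exact (h.conj (tComp _ _ _ _) (Iso.refl _) (tComp _ _ _ _) (Iso.refl _)).of_eq (by simp [tSq]; rfl)
      (by simp)
  · have h := (τ.isCyl_sq f.φ₀.hom).comp (τ.isCyl_mapComp A.one f.f)
    exact whisker_unit_square t.u₀ (τ.sq B.one) (τ.sq A.one) (τ.sq f.f) h

end MonoidalTrans

end Naturality

section Lift

variable {K : Type u₁} [Bicategory.{w₁, v₁} K] {L : Type u₂} [Bicategory.{w₂, v₂} L]
  [MonoidalBicategory L]

theorem StrongMor.comp_eq_comp_of_agrees {A B A' B' : PsMon L} {f : A ⟶ B} {g : A' ⟶ B'}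
    {x : A ⟶ A'} {y : B ⟶ B'} {C D C' D' : PsMonData L} {f' : StrongMorData C D}
    {g' : StrongMorData C' D'} {x' : StrongMorData C C'} {y' : StrongMorData D D'}
    (hA : A.toPsMonData = C) (hB : B.toPsMonData = D) (hA' : A'.toPsMonData = C')
    (hB' : B'.toPsMonData = D') (hf : (StrongMor.toStrongMorData f).Agrees f')
    (hg : (StrongMor.toStrongMorData g).Agrees g') (hx : (StrongMor.toStrongMorData x).Agrees x')
    (hy : (StrongMor.toStrongMorData y).Agrees y') (h : f'.comp y' = x'.comp g') :
    f ≫ y = x ≫ g := by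
  refine StrongMor.eq_of_data (StrongMorData.Agrees.eq ?_)
  exact (hf.comp hy hA hB hB').trans (h ▸ (hx.comp hg hA hA' hB').symm)

theorem StrongMor.exists_inverse_of_agrees [Bicategory.Strict L] {A A' : PsMon L} (x : A ⟶ A')
    {C C' : PsMonData L} {x' : StrongMorData C C'} (hA : A.toPsMonData = C)
    (hA' : A'.toPsMonData = C') (hx : (StrongMor.toStrongMorData x).Agrees x')
    (h : ∃ g : C'.X ⟶ C.X, x'.f ≫ g = 𝟙 C.X ∧ g ≫ x'.f = 𝟙 C'.X) :
    ∃ y : A' ⟶ A, x ≫ y = 𝟙 A ∧ y ≫ x = 𝟙 A' := by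
  obtain ⟨g, h, h'⟩ := exists_inverse_of_heq (congrArg PsMonData.X hA) (congrArg PsMonData.X hA')
    hx.f_heq h
  exact StrongMor.exists_inverse x h h'

theorem PsMonCell.naturality_of_heq {A B A' B' : PsMon L} {f k : A ⟶ B} {g l : A' ⟶ B'}
    {x : A ⟶ A'} {y : B ⟶ B'} (s : f ⟶ k) (r : g ⟶ l) {a b c d : L} {f' k' : a ⟶ b}
    {g' l' : c ⟶ d} {x' : a ⟶ c} {y' : b ⟶ d} {s' : f' ⟶ k'} {r' : g' ⟶ l'} (ha : A.X = a)
    (hb : B.X = b) (hc : A'.X = c) (hd : B'.X = d)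
    (hf : HEq (StrongMorData.f (StrongMor.toStrongMorData f)) f')
    (hk : HEq (StrongMorData.f (StrongMor.toStrongMorData k)) k')
    (hs : HEq (PsMonCell.hom s) s')
    (hx : HEq (StrongMorData.f (StrongMor.toStrongMorData x)) x')
    (hy : HEq (StrongMorData.f (StrongMor.toStrongMorData y)) y')
    (hg : HEq (StrongMorData.f (StrongMor.toStrongMorData g)) g')
    (hl : HEq (StrongMorData.f (StrongMor.toStrongMorData l)) l')
    (hr : HEq (PsMonCell.hom r) r') (e : f ≫ y = x ≫ g) (i : k ≫ y = x ≫ l)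
    (e' : f' ≫ y' = x' ≫ g') (i' : k' ≫ y' = x' ≫ l')
    (H : s' ▷ y' ≫ eqToHom i' = eqToHom e' ≫ x' ◁ r') :
    s ▷ y ≫ eqToHom i = eqToHom e ≫ x ◁ r := by
  have e₁ : StrongMorData.f (StrongMor.toStrongMorData f) ≫
      StrongMorData.f (StrongMor.toStrongMorData y) =
      StrongMorData.f (StrongMor.toStrongMorData x) ≫
        StrongMorData.f (StrongMor.toStrongMorData g) :=
    congrArg (fun w => StrongMorData.f (StrongMor.toStrongMorData w)) e
  have i₁ : StrongMorData.f (StrongMor.toStrongMorData k) ≫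
      StrongMorData.f (StrongMor.toStrongMorData y) =
      StrongMorData.f (StrongMor.toStrongMorData x) ≫
        StrongMorData.f (StrongMor.toStrongMorData l) :=
    congrArg (fun w => StrongMorData.f (StrongMor.toStrongMorData w)) i
  refine PsMonCell.hom_ext ?_
  refine (PsMonCell.comp_hom _ _).trans (Eq.trans ?_ (PsMonCell.comp_hom _ _).symm)
  refine (congrArg _ (PsMonCell.eqToHom_hom i i₁)).trans (Eq.trans ?_
    (congrArg (· ≫ _) (PsMonCell.eqToHom_hom e e₁).symm))
  exact naturality₂_of_heq ha hb hc hd hf hk hs hx hy hg hl hr e₁ i₁ e' i' H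

variable [MonoidalBicategory K] {F G : StrictPseudofunctor K L}
  {τ : TwoNatTrans F G} {m : LaxMonoidalData F} {n : LaxMonoidalData G}

namespace MonoidalTrans

theorem exists_twoNatTrans [Bicategory.Strict L] (t : MonoidalTrans τ m n)
    {P Q : StrictPseudofunctor (PsMon K) (PsMon L)} (hP : m.Lifts P) (hQ : n.Lifts Q)
    (hτ : τ.IsIso) :
    ∃ σ : TwoNatTrans P Q, σ.IsIso ∧ ∀ A : PsMon K,
      (StrongMor.toStrongMorData (σ.app A)).Agrees (t.component A.toPsMonData) := by
  choose app happ using fun A : PsMon K => exists_strongMor (t.component A.toPsMonData)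
    (t.isStrong_component A.toPsMonData) (hP.obj_eq A) (hQ.obj_eq A)
  have nat {A B : PsMon K} (f : A ⟶ B) : P.map f ≫ app B = app A ≫ Q.map f :=
    StrongMor.comp_eq_comp_of_agrees (hP.obj_eq A) (hP.obj_eq B) (hQ.obj_eq A) (hQ.obj_eq B)
      (hP.map_agrees f) (hQ.map_agrees f) (happ A) (happ B)
      (t.component_naturality (StrongMor.toStrongMorData f))
  have nat₂ {A B : PsMon K} {f g : A ⟶ B} (s : f ⟶ g) :
      P.map₂ s ▷ app B ≫ eqToHom (nat g) = eqToHom (nat f) ≫ app A ◁ Q.map₂ s :=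
    PsMonCell.naturality_of_heq _ _ (congrArg PsMonData.X (hP.obj_eq A))
      (congrArg PsMonData.X (hP.obj_eq B)) (congrArg PsMonData.X (hQ.obj_eq A))
      (congrArg PsMonData.X (hQ.obj_eq B)) (hP.map_agrees f).f_heq (hP.map_agrees g).f_heq
      (hP.map₂_heq s) (happ A).f_heq (happ B).f_heq (hQ.map_agrees f).f_heq
      (hQ.map_agrees g).f_heq (hQ.map₂_heq s) _ _ _ _ (τ.naturality₂ (PsMonCell.hom s))
  refine ⟨{ app := app, naturality := nat, naturality₂ := nat₂ }, fun A => ?_, happ⟩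
  exact StrongMor.exists_inverse_of_agrees (app A) (hP.obj_eq A) (hQ.obj_eq A) (happ A)
    (hτ A.X)

end MonoidalTrans

theorem LaxMonoidalData.lifts_id [Bicategory.Strict K] :
    (LaxMonoidalData.id K).Lifts (StrictPseudofunctor.id (PsMon K)) where
  obj_eq A := (PsMonData.mapObj_id A.toPsMonData).symm
  map_agrees f := (StrongMorData.mapMor_id_agrees (StrongMor.toStrongMorData f)).symm
  map₂_heq _ := HEq.rfl

theorem LaxMonoidal.lifts_comp {M : Type u₃} [Bicategory.{w₃, v₃} M] [MonoidalBicategory M]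
    [Bicategory.Strict K] [Bicategory.Strict L] [Bicategory.Strict M]
    {H : StrictPseudofunctor L M} (m : LaxMonoidal F) (n : LaxMonoidal H) :
    (m.toLaxMonoidalData.comp n.toLaxMonoidalData).Lifts (m.psMonFunctor.comp n.psMonFunctor) where
  obj_eq A := (m.mapObj_comp n A.toPsMonData).symm
  map_agrees f := (m.mapMor_comp_agrees n (StrongMor.toStrongMorData f)).symm
  map₂_heq _ := HEq.rfl

theorem MonoidalTwoEquivalence.exists_induces [Bicategory.Strict K] [Bicategory.Strict L]
    (E : MonoidalTwoEquivalence K L) :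
    ∃ P : TwoEquivalence (PsMon K) (PsMon L), E.Induces P := by
  obtain ⟨η, hη, hη'⟩ := E.unitMon.exists_twoNatTrans LaxMonoidalData.lifts_id
    (E.functorLax.lifts_comp E.inverseLax) E.unit_isIso
  obtain ⟨θ, hθ, hθ'⟩ := E.counitMon.exists_twoNatTrans
    (E.inverseLax.lifts_comp E.functorLax) LaxMonoidalData.lifts_id E.counit_isIso
  exact ⟨{ functor := E.functorLax.psMonFunctor
           inverse := E.inverseLax.psMonFunctor
           unit := η
           unit_isIso := hη
           counit := θ
           counit_isIso := hθ },
    { functor_lifts := E.functorLax.psMonFunctor_lifts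
      inverse_lifts := E.inverseLax.psMonFunctor_lifts
      unit_agrees := hη'
      counit_agrees := hθ' }⟩

end Lift

section Tails

variable {B : Type u₁} [Bicategory.{w₁, v₁} B]

/-- A 2-cell to a fivefold composite applied to a 1-cell. -/
def tl15 {a b c d e f z : B} {g : a ⟶ f} {p : a ⟶ b} {q : b ⟶ c} {r : c ⟶ d} {s : d ⟶ e}
    {t : e ⟶ f} (x : g ≅ p ≫ q ≫ r ≫ s ≫ t) (k : f ⟶ z) :
    g ≫ k ≅ p ≫ q ≫ r ≫ s ≫ t ≫ k :=
  whiskerRightIso x k ≪≫ α_ p (q ≫ r ≫ s ≫ t) k ≪≫ whiskerLeftIso p (α_ q (r ≫ s ≫ t) k ≪≫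
    whiskerLeftIso q (α_ r (s ≫ t) k ≪≫ whiskerLeftIso r (α_ s t k)))

/-- A 2-cell to an identity applied to a 1-cell. -/
def tl20 {a b z : B} {f : a ⟶ b} {g : b ⟶ a} (x : f ≫ g ≅ 𝟙 a) (k : a ⟶ z) : f ≫ g ≫ k ≅ k :=
  tl21 x k ≪≫ λ_ k

theorem tl15_nat {a b c d e f z : B} {g : a ⟶ f} {p : a ⟶ b} {q : b ⟶ c} {r : c ⟶ d} {s : d ⟶ e}
    {t : e ⟶ f} (x : g ≅ p ≫ q ≫ r ≫ s ≫ t) {k k' : f ⟶ z} (σ : k ⟶ k') :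
    g ◁ σ ≫ (tl15 x k').hom = (tl15 x k).hom ≫ p ◁ q ◁ r ◁ s ◁ t ◁ σ := by
  simp [tl15, whisker_exchange_assoc]

theorem tl20_nat {a b z : B} {f : a ⟶ b} {g : b ⟶ a} (x : f ≫ g ≅ 𝟙 a) {k k' : a ⟶ z}
    (σ : k ⟶ k') : f ◁ g ◁ σ ≫ (tl20 x k').hom = (tl20 x k).hom ≫ σ := by
  simp [tl20, reassoc_of% @tl21_nat]

variable {C : Type u₂} [Bicategory.{w₂, v₂} C] (P : Pseudofunctor B C)

/-- The image of a fivefold composite. -/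
def mc₅ {a b c d e f : B} (p : a ⟶ b) (q : b ⟶ c) (r : c ⟶ d) (s : d ⟶ e) (t : e ⟶ f) :
    P.map (p ≫ q ≫ r ≫ s ≫ t) ≅ P.map p ≫ P.map q ≫ P.map r ≫ P.map s ≫ P.map t :=
  P.mapComp p (q ≫ r ≫ s ≫ t) ≪≫ whiskerLeftIso (P.map p) (mc₄ P q r s t)

/-- The image of a sixfold composite. -/
def mc₆ {a b c d e f z : B} (p : a ⟶ b) (q : b ⟶ c) (r : c ⟶ d) (s : d ⟶ e) (t : e ⟶ f)
    (k : f ⟶ z) : P.map (p ≫ q ≫ r ≫ s ≫ t ≫ k) ≅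
      P.map p ≫ P.map q ≫ P.map r ≫ P.map s ≫ P.map t ≫ P.map k :=
  P.mapComp p (q ≫ r ≫ s ≫ t ≫ k) ≪≫ whiskerLeftIso (P.map p) (mc₅ P q r s t k)

/-- The image of a 2-cell to a fivefold composite. -/
def im15 {a b c d e f : B} {g : a ⟶ f} {p : a ⟶ b} {q : b ⟶ c} {r : c ⟶ d} {s : d ⟶ e}
    {t : e ⟶ f} (x : g ≅ p ≫ q ≫ r ≫ s ≫ t) :
    P.map g ≅ P.map p ≫ P.map q ≫ P.map r ≫ P.map s ≫ P.map t :=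
  P.map₂Iso x ≪≫ mc₅ P p q r s t

/-- The image of a 2-cell to an identity. -/
def im20 {a b : B} {f : a ⟶ b} {g : b ⟶ a} (x : f ≫ g ≅ 𝟙 a) :
    P.map f ≫ P.map g ≅ 𝟙 (P.obj a) :=
  (P.mapComp f g).symm ≪≫ P.map₂Iso x ≪≫ P.mapId a

theorem map₂_tl15 {a b c d e f z : B} {g : a ⟶ f} {p : a ⟶ b} {q : b ⟶ c} {r : c ⟶ d} {s : d ⟶ e}
    {t : e ⟶ f} (x : g ≅ p ≫ q ≫ r ≫ s ≫ t) (k : f ⟶ z) :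
    P.map₂ (tl15 x k).hom =
      (P.mapComp g k).hom ≫ (tl15 (im15 P x) (P.map k)).hom ≫ (mc₆ P p q r s t k).inv := by
  simp [tl15, im15, mc₃, mc₄, mc₅, mc₆, P.map₂_associator]

theorem map₂_tl20 {a b z : B} {f : a ⟶ b} {g : b ⟶ a} (x : f ≫ g ≅ 𝟙 a) (k : a ⟶ z) :
    P.map₂ (tl20 x k).hom = (mc₃ P f g k).hom ≫ (tl20 (im20 P x) (P.map k)).hom := by
  simp [tl20, tl21, im20, mc₃, map₂_assocInv P]

section Hexagons

variable {T R D X : B} {f : T ⟶ R} {e : R ⟶ T} {g : R ⟶ T} {g' : T ⟶ R} {p : R ⟶ D} {n : T ⟶ D}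
  {q : D ⟶ X} {b : D ⟶ D} {c : T ⟶ T} {d : R ⟶ R} {α : n ≫ q ≅ f ≫ p ≫ q} {s : p ≫ b ≅ g ≫ n}
  {s' : n ≫ b ≅ g' ≫ p} {γ : b ≫ q ≅ q} {l : d ≫ p ≅ p} {r : c ≫ n ≅ n} {u : e ≫ f ≅ 𝟙 R}

theorem im_hexagon_right {H : f ≫ g ≫ f ≅ c ≫ f ≫ d}
    (h : f ◁ g ◁ α.inv ≫ f ◁ (tl22 s q).inv ≫ f ◁ p ◁ γ.hom =
      (tl33 H (p ≫ q)).hom ≫ c ◁ f ◁ (tl21 l q).hom ≫ c ◁ α.inv ≫ (tl21 r q).hom ≫ α.hom) :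
    P.map f ◁ P.map g ◁ (im23 P α).inv ≫ P.map f ◁ (tl22 (im22 P s) (P.map q)).inv ≫
        P.map f ◁ P.map p ◁ (im21 P γ).hom =
      (tl33 (im33 P H) (P.map p ≫ P.map q)).hom ≫ P.map c ◁ P.map f ◁ (tl21 (im21 P l) _).hom ≫
        P.map c ◁ (im23 P α).inv ≫ (tl21 (im21 P r) (P.map q)).hom ≫ (im23 P α).hom := by
  have h' := congrArg (fun y => P.map f ◁ P.map g ◁ P.map f ◁ (P.mapComp p q).hom ≫
    (mc₅ P f g f p q).inv ≫ P.map₂ y ≫ (mc₃ P f p q).hom) h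
  have es : (tl22 s q).inv = (tl22 s.symm q).hom := by simp [tl22]
  have es' : (tl22 (im22 P s) (P.map q)).inv = (tl22 (im22 P s.symm) (P.map q)).hom := by
    simp only [tl22, im22, Iso.trans_hom, Iso.trans_inv, Iso.symm_hom, Iso.symm_inv,
      whiskerRightIso_hom, whiskerRightIso_inv, comp_whiskerRight, Category.assoc,
      PrelaxFunctor.map₂Iso_hom, PrelaxFunctor.map₂Iso_inv]
  have n1 := tl33_nat (im33 P H) (P.mapComp p q).hom
  rw [es] at h'
  rw [es']
  simp only [P.map₂_comp, P.map₂_whisker_left, map₂_tl22, map₂_tl33, map₂_tl21] at h'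
  rw [← cancel_epi (whiskerLeftIso (P.map f) (whiskerLeftIso (P.map g)
    (whiskerLeftIso (P.map f) (P.mapComp p q)))).hom]
  simp only [whiskerLeftIso_hom, reassoc_of% n1]
  simp only [im23, mc₃, mc₄, mc₅, im21, Iso.trans_hom, Iso.symm_hom, Iso.trans_inv, Iso.symm_inv, whiskerLeftIso_hom,
    whiskerLeftIso_inv, Category.assoc, Iso.inv_hom_id_assoc, whiskerLeft_comp, whiskerLeft_inv_hom_assoc, Category.comp_id, whiskerLeft_inv_hom, reassoc_of% @whiskerLeft₂_inv_hom, reassoc_of% @whiskerLeft₃_hom_inv,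
    PrelaxFunctor.map₂Iso_hom, PrelaxFunctor.map₂Iso_inv] at h' ⊢
  exact h'

theorem im_hexagon_left {H : g' ≅ f ≫ d ≫ e ≫ c ≫ f}
    (h : (tl22 s' q).inv ≫ n ◁ γ.hom ≫ α.hom =
      (tl15 H (p ≫ q)).hom ≫ f ◁ d ◁ e ◁ c ◁ α.inv ≫ f ◁ d ◁ e ◁ (tl21 r q).hom ≫
        f ◁ d ◁ e ◁ α.hom ≫ f ◁ d ◁ (tl20 u (p ≫ q)).hom ≫ f ◁ (tl21 l q).hom) :
    (tl22 (im22 P s') (P.map q)).inv ≫ P.map n ◁ (im21 P γ).hom ≫ (im23 P α).hom =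
      (tl15 (im15 P H) (P.map p ≫ P.map q)).hom ≫
        P.map f ◁ P.map d ◁ P.map e ◁ P.map c ◁ (im23 P α).inv ≫
        P.map f ◁ P.map d ◁ P.map e ◁ (tl21 (im21 P r) (P.map q)).hom ≫
        P.map f ◁ P.map d ◁ P.map e ◁ (im23 P α).hom ≫
        P.map f ◁ P.map d ◁ (tl20 (im20 P u) (P.map p ≫ P.map q)).hom ≫
        P.map f ◁ (tl21 (im21 P l) (P.map q)).hom := by
  have h' := congrArg (fun y => P.map g' ◁ (P.mapComp p q).hom ≫
    (mc₃ P g' p q).inv ≫ P.map₂ y ≫ (mc₃ P f p q).hom) h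
  have es : (tl22 s' q).inv = (tl22 s'.symm q).hom := by simp [tl22]
  have es' : (tl22 (im22 P s') (P.map q)).inv = (tl22 (im22 P s'.symm) (P.map q)).hom := by
    simp only [tl22, im22, Iso.trans_hom, Iso.trans_inv, Iso.symm_hom, Iso.symm_inv,
      whiskerRightIso_hom, whiskerRightIso_inv, comp_whiskerRight, Category.assoc,
      PrelaxFunctor.map₂Iso_hom, PrelaxFunctor.map₂Iso_inv]
  have n1 := tl15_nat (im15 P H) (P.mapComp p q).hom
  have n3 : P.map f ◁ P.map d ◁ P.map e ◁ P.map c ◁ P.map f ◁ (P.mapComp p q).hom ≫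
      P.map f ◁ P.map d ◁ P.map e ◁ P.map c ◁ P.map f ◁ (P.mapComp p q).inv = 𝟙 _ := by
    simp [← whiskerLeft_comp]
  have n2 := congrArg (fun y => P.map f ◁ P.map d ◁ y)
    (tl20_nat (im20 P u) (P.mapComp p q).hom)
  rw [es] at h'
  rw [es']
  simp only [P.map₂_comp, P.map₂_whisker_left, map₂_tl22, map₂_tl15, map₂_tl21, map₂_tl20] at h'
  rw [← cancel_epi (whiskerLeftIso (P.map g') (P.mapComp p q)).hom]
  simp only [whiskerLeft_comp] at n2
  simp only [whiskerLeftIso_hom, reassoc_of% n1]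
  simp only [im23, mc₃, mc₄, mc₅, mc₆, im21, Iso.trans_hom, Iso.symm_hom, Iso.trans_inv, Iso.symm_inv, whiskerLeftIso_hom,
    whiskerLeftIso_inv, Category.assoc, Iso.inv_hom_id_assoc, whiskerLeft_comp, whiskerLeft_inv_hom_assoc, whiskerLeft_hom_inv_assoc,
    Category.comp_id, whiskerLeft_inv_hom, reassoc_of% @whiskerLeft₂_inv_hom, reassoc_of% @whiskerLeft₃_inv_hom, PrelaxFunctor.map₂Iso_hom, PrelaxFunctor.map₂Iso_inv, reassoc_of% n2, reassoc_of% n3] at h' ⊢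
  exact h'

end Hexagons

end Tails

section HexagonTails

variable {K : Type u₁} [Bicategory.{w₁, v₁} K] [BraidedMonoidalBicategory K]

/-- The hexagon axiom for moving one object past two, for the data of a braided pseudomonoid. -/
def BrPsMonData.HexagonRight (A : BrPsMonData K) : Prop :=
  asc A.X A.X A.X ◁ brd A.X (A.X ⊠ₒ A.X) ◁ A.mulAssoc.inv ≫
      asc A.X A.X A.X ◁ (tl22 (braidNat (𝟙 A.X) A.mul) A.mul).inv ≫
      asc A.X A.X A.X ◁ 𝟙 A.X ⊠ A.mul ◁ A.γ.hom =
    (tl33 (hexR A.X A.X A.X) (𝟙 A.X ⊠ A.mul ≫ A.mul)).hom ≫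
      brd A.X A.X ⊠ 𝟙 A.X ◁ asc A.X A.X A.X ◁ (tl21 (l21 A.γ A.X) A.mul).hom ≫
      brd A.X A.X ⊠ 𝟙 A.X ◁ A.mulAssoc.inv ≫ (tl21 (r21 A.γ A.X) A.mul).hom ≫ A.mulAssoc.hom

/-- The hexagon axiom for moving two objects past one, for the data of a braided pseudomonoid. -/
def BrPsMonData.HexagonLeft (A : BrPsMonData K) : Prop :=
  (tl22 (braidNat A.mul (𝟙 A.X)) A.mul).inv ≫ A.mul ⊠ 𝟙 A.X ◁ A.γ.hom ≫ A.mulAssoc.hom =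
    (tl15 (hexS A.X A.X A.X) (𝟙 A.X ⊠ A.mul ≫ A.mul)).hom ≫
      asc A.X A.X A.X ◁ 𝟙 A.X ⊠ brd A.X A.X ◁ ascInv A.X A.X A.X ◁ brd A.X A.X ⊠ 𝟙 A.X ◁
        A.mulAssoc.inv ≫
      asc A.X A.X A.X ◁ 𝟙 A.X ⊠ brd A.X A.X ◁ ascInv A.X A.X A.X ◁
        (tl21 (r21 A.γ A.X) A.mul).hom ≫
      asc A.X A.X A.X ◁ 𝟙 A.X ⊠ brd A.X A.X ◁ ascInv A.X A.X A.X ◁ A.mulAssoc.hom ≫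
      asc A.X A.X A.X ◁ 𝟙 A.X ⊠ brd A.X A.X ◁
        (tl20 (assoc A.X A.X A.X).counit (𝟙 A.X ⊠ A.mul ≫ A.mul)).hom ≫
      asc A.X A.X A.X ◁ (tl21 (l21 A.γ A.X) A.mul).hom

theorem BrPsMonData.hexagonRight_iff (A : BrPsMonData K) :
    A.HexagonRight ↔
      (𝟙 (asc A.X A.X A.X ≫ brd A.X (A.X ⊠ₒ A.X) ≫ asc A.X A.X A.X ≫ 𝟙 A.X ⊠ A.mul ≫ A.mul) ⊗≫
        (asc A.X A.X A.X ≫ brd A.X (A.X ⊠ₒ A.X)) ◁ A.mulAssoc.inv ⊗≫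
        asc A.X A.X A.X ◁ (braidNat (𝟙 A.X) A.mul).inv ▷ A.mul ⊗≫
        (asc A.X A.X A.X ≫ 𝟙 A.X ⊠ A.mul) ◁ A.γ.hom ⊗≫
        𝟙 (asc A.X A.X A.X ≫ 𝟙 A.X ⊠ A.mul ≫ A.mul)) =
      (𝟙 (asc A.X A.X A.X ≫ brd A.X (A.X ⊠ₒ A.X) ≫ asc A.X A.X A.X ≫ 𝟙 A.X ⊠ A.mul ≫ A.mul) ⊗≫
        (hexR A.X A.X A.X).hom ▷ (𝟙 A.X ⊠ A.mul ≫ A.mul) ⊗≫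
        (brd A.X A.X ⊠ 𝟙 A.X ≫ asc A.X A.X A.X) ◁
          ((wlComp A.X (brd A.X A.X) A.mul).inv ≫ 𝟙 (𝟙 A.X) ⊠₂ A.γ.hom) ▷ A.mul ⊗≫
        brd A.X A.X ⊠ 𝟙 A.X ◁ A.mulAssoc.inv ⊗≫
        ((wrComp (brd A.X A.X) A.mul A.X).inv ≫ A.γ.hom ⊠₂ 𝟙 (𝟙 A.X)) ▷ A.mul ⊗≫
        A.mulAssoc.hom ⊗≫
        𝟙 (asc A.X A.X A.X ≫ 𝟙 A.X ⊠ A.mul ≫ A.mul)) := by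
  have e₁ {p q : (asc A.X A.X A.X ≫ brd A.X (A.X ⊠ₒ A.X) ≫ asc A.X A.X A.X ≫ 𝟙 A.X ⊠ A.mul ≫
      A.mul) ⟶ (asc A.X A.X A.X ≫ 𝟙 A.X ⊠ A.mul ≫ A.mul)} {p' q'} (h : p = p') (h' : q = q') :
      p = q ↔ p' = q' := by
    rw [h, h']
  simp only [BrPsMonData.HexagonRight, tl22, tl33, tl21, Iso.trans_hom, Iso.symm_hom,
    Iso.trans_inv, Iso.symm_inv, whiskerRightIso_inv,
    whiskerLeftIso_hom, whiskerRightIso_hom, r21_hom, l21_hom]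
  exact e₁ (by bicategory) (by bicategory)

theorem BrPsMonData.hexagonLeft_iff (A : BrPsMonData K) :
    A.HexagonLeft ↔
      (𝟙 (brd (A.X ⊠ₒ A.X) A.X ≫ 𝟙 A.X ⊠ A.mul ≫ A.mul) ⊗≫
        (braidNat A.mul (𝟙 A.X)).inv ▷ A.mul ⊗≫
        A.mul ⊠ 𝟙 A.X ◁ A.γ.hom ⊗≫
        A.mulAssoc.hom ⊗≫
        𝟙 (asc A.X A.X A.X ≫ 𝟙 A.X ⊠ A.mul ≫ A.mul)) =
      (𝟙 (brd (A.X ⊠ₒ A.X) A.X ≫ 𝟙 A.X ⊠ A.mul ≫ A.mul) ⊗≫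
        (hexS A.X A.X A.X).hom ▷ (𝟙 A.X ⊠ A.mul ≫ A.mul) ⊗≫
        (asc A.X A.X A.X ≫ 𝟙 A.X ⊠ brd A.X A.X ≫ ascInv A.X A.X A.X ≫ brd A.X A.X ⊠ 𝟙 A.X) ◁
          A.mulAssoc.inv ⊗≫
        (asc A.X A.X A.X ≫ 𝟙 A.X ⊠ brd A.X A.X ≫ ascInv A.X A.X A.X) ◁
          ((wrComp (brd A.X A.X) A.mul A.X).inv ≫ A.γ.hom ⊠₂ 𝟙 (𝟙 A.X)) ▷ A.mul ⊗≫
        (asc A.X A.X A.X ≫ 𝟙 A.X ⊠ brd A.X A.X ≫ ascInv A.X A.X A.X) ◁ A.mulAssoc.hom ⊗≫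
        (asc A.X A.X A.X ≫ 𝟙 A.X ⊠ brd A.X A.X) ◁ (assoc A.X A.X A.X).counit.hom ▷
          (𝟙 A.X ⊠ A.mul ≫ A.mul) ⊗≫
        asc A.X A.X A.X ◁ ((wlComp A.X (brd A.X A.X) A.mul).inv ≫ 𝟙 (𝟙 A.X) ⊠₂ A.γ.hom) ▷
          A.mul ⊗≫
        𝟙 (asc A.X A.X A.X ≫ 𝟙 A.X ⊠ A.mul ≫ A.mul)) := by
  have e₁ {p q : (brd (A.X ⊠ₒ A.X) A.X ≫ 𝟙 A.X ⊠ A.mul ≫ A.mul) ⟶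
      (asc A.X A.X A.X ≫ 𝟙 A.X ⊠ A.mul ≫ A.mul)} {p' q'} (h : p = p') (h' : q = q') :
      p = q ↔ p' = q' := by
    rw [h, h']
  simp only [BrPsMonData.HexagonLeft, tl22, tl15, tl20, tl21, Iso.trans_hom, Iso.symm_hom,
    Iso.trans_inv, Iso.symm_inv, whiskerRightIso_inv,
    whiskerLeftIso_hom, whiskerRightIso_hom, r21_hom, l21_hom]
  exact e₁ (by bicategory) (by bicategory)

theorem BrPsMon.hexagonRight (A : BrPsMon K) : A.toBrPsMonData.HexagonRight :=
  (BrPsMonData.hexagonRight_iff _).2 A.hexagon_right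

theorem BrPsMon.hexagonLeft (A : BrPsMon K) : A.toBrPsMonData.HexagonLeft :=
  (BrPsMonData.hexagonLeft_iff _).2 A.hexagon_left

end HexagonTails

section Image

variable {B : Type u₁} [Bicategory.{w₁, v₁} B] {C : Type u₂} [Bicategory.{w₂, v₂} C]

theorem im_braid (P : Pseudofunctor B C) {a b c d e : B} {f : a ⟶ b} {g : b ⟶ c} {h : a ⟶ e}
    {l : e ⟶ c} {q : c ⟶ d} {q' : e ⟶ d} {v : f ≫ g ≅ h ≫ l} {β : l ≫ q ≅ q'}
    {γ : f ≫ g ≫ q ≅ h ≫ q'} (H : γ.hom = (tl22 v q).hom ≫ h ◁ β.hom) {z : C}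
    (k : P.obj d ⟶ z) :
    (tl21 (im21 P γ) k).hom ≫ (tl12 (P.mapComp h q') k).hom =
      P.map f ◁ (tl12 (P.mapComp g q) k).hom ≫ (tl22 (im22 P v) (P.map q ≫ k)).hom ≫
        P.map h ◁ (tl21 (im21 P β) k).hom := by
  have h' := congrArg (fun y => (P.mapComp f (g ≫ q)).inv ≫ P.map₂ y ≫ (P.mapComp h q').hom) H
  simp only [P.map₂_comp, P.map₂_whisker_left, map₂_tl22, mc₃, Iso.trans_hom, Iso.trans_inv,
    Category.assoc, Iso.inv_hom_id_assoc, Iso.inv_hom_id, whiskerLeftIso_hom, whiskerLeftIso_inv,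
    Category.comp_id] at h'
  replace h' := congrArg (fun y => (α_ _ _ k).inv ≫ y ▷ k ≫ (α_ _ _ k).hom) h'
  simp only [tl12, tl21, tl22, im21, im22, Iso.trans_hom, Iso.symm_hom, whiskerRightIso_hom,
    PrelaxFunctor.map₂Iso_hom] at h' ⊢
  refine Eq.trans ?_ (h'.trans ?_) <;> bicategory

end Image

section Lax

variable {K : Type u₁} [Bicategory.{w₁, v₁} K] {L : Type u₂} [Bicategory.{w₂, v₂} L]
  [BraidedMonoidalBicategory K] [BraidedMonoidalBicategory L] {F : StrictPseudofunctor K L}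

namespace BraidedLaxMonoidal

variable (m : BraidedLaxMonoidal F)

theorem v_natL {a a' : K} (f : a ⟶ a') (b : K) :
    IsCyl (sqV (braidNat (F.map f) (𝟙 (F.obj b))) (m.μR b f))
      (sqV (m.μL f b) (im22 F.toPseudofunctor (braidNat f (𝟙 b)))) (m.v a b).hom
      (m.v a' b).hom := by
  refine (m.v_modif f (𝟙 b)).of_isNat (Iso.refl _ ⊠ᵢ F.mapId b) (Iso.refl _) ?_ ?_
  · exact IsNat.sqV (braidNat_nat (𝟙 (F.map f)) (F.mapId b).hom) (m.isNat_μR b f)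
  · exact IsNat.sqV (τ := 𝟙 _) (m.isNat_μL f b) (by simp [IsNat, mapSq, im22])

theorem v_natR (a : K) {b b' : K} (f : b ⟶ b') :
    IsCyl (sqV (braidNat (𝟙 (F.obj a)) (F.map f)) (m.μL f a))
      (sqV (m.μR a f) (im22 F.toPseudofunctor (braidNat (𝟙 a) f))) (m.v a b).hom
      (m.v a b').hom := by
  refine (m.v_modif (𝟙 a) f).of_isNat (F.mapId a ⊠ᵢ Iso.refl _) (Iso.refl _) ?_ ?_
  · exact IsNat.sqV (braidNat_nat (F.mapId a).hom (𝟙 (F.map f))) (m.isNat_μL f a)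
  · exact IsNat.sqV (τ := 𝟙 _) (m.isNat_μR a f) (by simp [IsNat, mapSq, im22])

section

variable {T : L} {b x : K} (t : T ⟶ F.obj b) (q : b ⟶ x) {z : L}

theorem v_cL (c : K) (k : F.obj (c ⊠ₒ x) ⟶ z) :
    (tl22 (braidNat (t ≫ F.map q) (𝟙 (F.obj c))) (m.μ c x ≫ k)).inv ≫ (t ≫ F.map q) ⊠ 𝟙 (F.obj c) ◁ (tl22 (m.v x c) k).hom ≫
        (m.cL t q c (F.map (brd x c) ≫ k)).hom =
      brd T (F.obj c) ◁ (m.cR t q c k).hom ≫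
        (tl22 (braidNat t (𝟙 (F.obj c))) (m.μ c b ≫ F.map (𝟙 c ⊠ q) ≫ k)).inv ≫
        t ⊠ 𝟙 (F.obj c) ◁ (tl22 (m.v b c) (F.map (𝟙 c ⊠ q) ≫ k)).hom ≫
        t ⊠ 𝟙 (F.obj c) ◁ m.μ b c ◁ (tl22 (im22 F.toPseudofunctor (braidNat q (𝟙 c))) k).inv := by
  have e := (m.v_natL q c).tl22 k
  have e1 := IsNat.tl_comp (σ := wrComp t (F.map q) (F.obj c)) (σ' := wlComp (F.obj c) t (F.map q)) (braidNat_comp_left t (F.map q) (F.obj c)) (m.μ c x ≫ k)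
  have n1 := tl22_nat (braidNat t (𝟙 (F.obj c))) (tl22 (m.μR c q) k).hom
  rw [← Category.assoc, ← whiskerLeftIso_hom (m.μ b c), ← Iso.eq_comp_inv] at e
  simp only [Category.assoc, whiskerLeftIso_inv] at e
  replace e := congrArg (fun w => t ⊠ 𝟙 (F.obj c) ◁ w) e
  simp only [whiskerLeft_comp] at e
  rw [Iso.inv_comp_eq]
  simp only [LaxMonoidal.cL, LaxMonoidal.cR, Iso.trans_hom, whiskerLeftIso_hom, whiskerLeft_comp, Category.assoc]
  rw [reassoc_of% e1, ← reassoc_of% n1, Iso.hom_inv_id_assoc, reassoc_of% @tl12_nat]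
  simp only [e]

theorem v_cR (c : K) (k : F.obj (x ⊠ₒ c) ⟶ z) :
    (tl22 (braidNat (𝟙 (F.obj c)) (t ≫ F.map q)) (m.μ x c ≫ k)).inv ≫ 𝟙 (F.obj c) ⊠ (t ≫ F.map q) ◁ (tl22 (m.v c x) k).hom ≫
        (m.cR t q c (F.map (brd c x) ≫ k)).hom =
      brd (F.obj c) T ◁ (m.cL t q c k).hom ≫
        (tl22 (braidNat (𝟙 (F.obj c)) t) (m.μ b c ≫ F.map (q ⊠ 𝟙 c) ≫ k)).inv ≫
        𝟙 (F.obj c) ⊠ t ◁ (tl22 (m.v c b) (F.map (q ⊠ 𝟙 c) ≫ k)).hom ≫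
        𝟙 (F.obj c) ⊠ t ◁ m.μ c b ◁ (tl22 (im22 F.toPseudofunctor (braidNat (𝟙 c) q)) k).inv := by
  have e := (m.v_natR c q).tl22 k
  have e1 := IsNat.tl_comp (σ := wlComp (F.obj c) t (F.map q)) (σ' := wrComp t (F.map q) (F.obj c)) (braidNat_comp_right (F.obj c) t (F.map q)) (m.μ x c ≫ k)
  have n1 := tl22_nat (braidNat (𝟙 (F.obj c)) t) (tl22 (m.μL q c) k).hom
  rw [← Category.assoc, ← whiskerLeftIso_hom (m.μ c b), ← Iso.eq_comp_inv] at e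
  simp only [Category.assoc, whiskerLeftIso_inv] at e
  replace e := congrArg (fun w => 𝟙 (F.obj c) ⊠ t ◁ w) e
  simp only [whiskerLeft_comp] at e
  rw [Iso.inv_comp_eq]
  simp only [LaxMonoidal.cL, LaxMonoidal.cR, Iso.trans_hom, whiskerLeftIso_hom, whiskerLeft_comp, Category.assoc]
  rw [reassoc_of% e1, ← reassoc_of% n1, Iso.hom_inv_id_assoc, reassoc_of% @tl12_nat]
  simp only [e]

end

section

variable (A : BrPsMonData K)

/-- The braiding 2-cell of the image of a braided pseudomonoid. -/
def mapBraid : brd (F.obj A.X) (F.obj A.X) ≫ m.μ A.X A.X ≫ F.map A.mul ≅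
    m.μ A.X A.X ≫ F.map A.mul :=
  (m.toBraidedLaxData.mapBrObj A).γ

theorem mapBraid_hom :
    (m.mapBraid A).hom = (tl22 (m.v A.X A.X) (F.map A.mul)).hom ≫
      m.μ A.X A.X ◁ (im21 F.toPseudofunctor A.γ).hom := by
  simp only [mapBraid, BraidedLaxData.mapBrObj, tl22, im21, Iso.trans_hom, Iso.symm_hom,
    whiskerRightIso_hom, Category.assoc]
  rfl

variable (b : K) {z : L}

theorem mapBraid_cL (k : F.obj (A.X ⊠ₒ b) ⟶ z) :
    (tl21 (r21 (m.mapBraid A) (F.obj b)) (m.μ A.X b ≫ k)).hom ≫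
        (m.cL (m.μ A.X A.X) A.mul b k).hom =
      brd (F.obj A.X) (F.obj A.X) ⊠ 𝟙 (F.obj b) ◁ (m.cL (m.μ A.X A.X) A.mul b k).hom ≫
        (tl22 (r22 (m.v A.X A.X) (F.obj b)) (m.μ (A.X ⊠ₒ A.X) b ≫ F.map (A.mul ⊠ 𝟙 b) ≫ k)).hom ≫
        m.μ A.X A.X ⊠ 𝟙 (F.obj b) ◁ (tl22 (m.μL (brd A.X A.X) b) (F.map (A.mul ⊠ 𝟙 b) ≫ k)).hom ≫
        m.μ A.X A.X ⊠ 𝟙 (F.obj b) ◁ m.μ (A.X ⊠ₒ A.X) b ◁ (tl21 (im21 F.toPseudofunctor (r21 A.γ b)) k).hom := by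
  have e : (tl21 (r21 (m.mapBraid A) (F.obj b)) (m.μ A.X b ≫ k)).hom ≫
      (tl12 (wrComp (m.μ A.X A.X) (F.map A.mul) (F.obj b)) (m.μ A.X b ≫ k)).hom =
        brd (F.obj A.X) (F.obj A.X) ⊠ 𝟙 (F.obj b) ◁ (tl12 (wrComp (m.μ A.X A.X) (F.map A.mul) (F.obj b)) (m.μ A.X b ≫ k)).hom ≫
          (tl22 (r22 (m.v A.X A.X) (F.obj b)) (F.map A.mul ⊠ 𝟙 (F.obj b) ≫ m.μ A.X b ≫ k)).hom ≫
          m.μ A.X A.X ⊠ 𝟙 (F.obj b) ◁ (tl21 (r21 (im21 F.toPseudofunctor A.γ) (F.obj b)) (m.μ A.X b ≫ k)).hom :=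
    im_braid (tensR (F.obj b)) (m.mapBraid_hom A) (m.μ A.X b ≫ k)
  have e' := congrArg (fun w => m.μ A.X A.X ⊠ 𝟙 (F.obj b) ◁ w) (m.μL_r21 A.γ b k)
  have n := tl22_nat (r22 (m.v A.X A.X) (F.obj b)) (tl22 (m.μL A.mul b) k).hom
  simp only [whiskerLeft_comp] at e'
  simp only [LaxMonoidal.cL, Iso.trans_hom, whiskerLeftIso_hom, whiskerLeft_comp,
    Category.assoc]
  rw [reassoc_of% e, reassoc_of% n, ← e']

theorem mapBraid_cR (k : F.obj (b ⊠ₒ A.X) ⟶ z) :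
    (tl21 (l21 (m.mapBraid A) (F.obj b)) (m.μ b A.X ≫ k)).hom ≫
        (m.cR (m.μ A.X A.X) A.mul b k).hom =
      𝟙 (F.obj b) ⊠ brd (F.obj A.X) (F.obj A.X) ◁ (m.cR (m.μ A.X A.X) A.mul b k).hom ≫
        (tl22 (l22 (m.v A.X A.X) (F.obj b)) (m.μ b (A.X ⊠ₒ A.X) ≫ F.map (𝟙 b ⊠ A.mul) ≫ k)).hom ≫
        𝟙 (F.obj b) ⊠ m.μ A.X A.X ◁ (tl22 (m.μR b (brd A.X A.X)) (F.map (𝟙 b ⊠ A.mul) ≫ k)).hom ≫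
        𝟙 (F.obj b) ⊠ m.μ A.X A.X ◁ m.μ b (A.X ⊠ₒ A.X) ◁ (tl21 (im21 F.toPseudofunctor (l21 A.γ b)) k).hom := by
  have e : (tl21 (l21 (m.mapBraid A) (F.obj b)) (m.μ b A.X ≫ k)).hom ≫
      (tl12 (wlComp (F.obj b) (m.μ A.X A.X) (F.map A.mul)) (m.μ b A.X ≫ k)).hom =
        𝟙 (F.obj b) ⊠ brd (F.obj A.X) (F.obj A.X) ◁ (tl12 (wlComp (F.obj b) (m.μ A.X A.X) (F.map A.mul)) (m.μ b A.X ≫ k)).hom ≫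
          (tl22 (l22 (m.v A.X A.X) (F.obj b)) (𝟙 (F.obj b) ⊠ F.map A.mul ≫ m.μ b A.X ≫ k)).hom ≫
          𝟙 (F.obj b) ⊠ m.μ A.X A.X ◁ (tl21 (l21 (im21 F.toPseudofunctor A.γ) (F.obj b)) (m.μ b A.X ≫ k)).hom :=
    im_braid (tensL (F.obj b)) (m.mapBraid_hom A) (m.μ b A.X ≫ k)
  have e' := congrArg (fun w => 𝟙 (F.obj b) ⊠ m.μ A.X A.X ◁ w) (m.μR_l21 A.γ b k)
  have n := tl22_nat (l22 (m.v A.X A.X) (F.obj b)) (tl22 (m.μR b A.mul) k).hom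
  simp only [whiskerLeft_comp] at e'
  simp only [LaxMonoidal.cR, Iso.trans_hom, whiskerLeftIso_hom, whiskerLeft_comp,
    Category.assoc]
  rw [reassoc_of% e, reassoc_of% n, ← e']

end

end BraidedLaxMonoidal

end Lax

section Lax

variable {K : Type u₁} [Bicategory.{w₁, v₁} K] {L : Type u₂} [Bicategory.{w₂, v₂} L]
  [BraidedMonoidalBicategory K] [BraidedMonoidalBicategory L] {F : StrictPseudofunctor K L}

theorem r22_inv {X : Type u₁} [Bicategory.{w₁, v₁} X] [TensorBicategory X] {a b a' b' : X}
    {f : a ⟶ a'} {g : b ⟶ b'} {u : a ⟶ b} {v : a' ⟶ b'} (s : f ≫ v ≅ u ≫ g) (z : X) :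
    (r22 s z).inv = ((wrComp u g z).inv ≫ s.inv ⊠₂ 𝟙 (𝟙 z)) ≫ (wrComp f v z).hom := by
  rfl

theorem l22_inv {X : Type u₁} [Bicategory.{w₁, v₁} X] [TensorBicategory X] {a b a' b' : X}
    {f : a ⟶ a'} {g : b ⟶ b'} {u : a ⟶ b} {v : a' ⟶ b'} (s : f ≫ v ≅ u ≫ g) (z : X) :
    (l22 s z).inv = ((wlComp z u g).inv ≫ 𝟙 (𝟙 z) ⊠₂ s.inv) ≫ (wlComp z f v).hom := by
  rfl

namespace BraidedLaxMonoidal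

variable (m : BraidedLaxMonoidal F)

theorem hexR_coherence_tail (a b c : K) {z : L} (k : F.obj (b ⊠ₒ c ⊠ₒ a) ⟶ z) :
    (tl33 (hexR (F.obj a) (F.obj b) (F.obj c)) (𝟙 (F.obj b) ⊠ m.μ c a ≫ m.μ b (c ⊠ₒ a) ≫ k)).hom ≫
        brd (F.obj a) (F.obj b) ⊠ 𝟙 (F.obj c) ◁ asc (F.obj b) (F.obj a) (F.obj c) ◁ (tl22 (l22 (m.v a c) (F.obj b)) (m.μ b (c ⊠ₒ a) ≫ k)).hom ≫
        brd (F.obj a) (F.obj b) ⊠ 𝟙 (F.obj c) ◁ asc (F.obj b) (F.obj a) (F.obj c) ◁ 𝟙 (F.obj b) ⊠ m.μ a c ◁ (tl22 (m.μR b (brd a c)) k).hom ≫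
        brd (F.obj a) (F.obj b) ⊠ 𝟙 (F.obj c) ◁ (tl33 (m.ω b a c) (F.map (𝟙 b ⊠ brd a c) ≫ k)).inv ≫
        (tl22 (r22 (m.v a b) (F.obj c)) (m.μ (b ⊠ₒ a) c ≫ F.map (asc b a c) ≫
          F.map (𝟙 b ⊠ brd a c) ≫ k)).hom ≫
        m.μ a b ⊠ 𝟙 (F.obj c) ◁ (tl22 (m.μL (brd a b) c) (F.map (asc b a c) ≫
          F.map (𝟙 b ⊠ brd a c) ≫ k)).hom =
      asc (F.obj a) (F.obj b) (F.obj c) ◁ brd (F.obj a) ((F.obj b) ⊠ₒ (F.obj c)) ◁ (tl33 (m.ω b c a) k).inv ≫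
        asc (F.obj a) (F.obj b) (F.obj c) ◁ (tl22 (braidNat (𝟙 (F.obj a)) (m.μ b c)) (m.μ (b ⊠ₒ c) a ≫
          F.map (asc b c a) ≫ k)).inv ≫
        asc (F.obj a) (F.obj b) (F.obj c) ◁ 𝟙 (F.obj a) ⊠ m.μ b c ◁ (tl22 (m.v a (b ⊠ₒ c)) (F.map (asc b c a) ≫ k)).hom ≫
        (tl33 (m.ω a b c) (F.map (brd a (b ⊠ₒ c)) ≫ F.map (asc b c a) ≫ k)).inv ≫
        m.μ a b ⊠ 𝟙 (F.obj c) ◁ m.μ (a ⊠ₒ b) c ◁ (tl33 (im33 F.toPseudofunctor (hexR a b c)) k).hom := by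
  have h := congrArg (fun y => 𝟙 (m.μ a b ⊠ 𝟙 (F.obj c) ≫ m.μ (a ⊠ₒ b) c ≫ F.map (asc a b c) ≫
    F.map (brd a (b ⊠ₒ c)) ≫ F.map (asc b c a) ≫ k) ⊗≫ y ▷ k ⊗≫
    𝟙 (brd (F.obj a) (F.obj b) ⊠ 𝟙 (F.obj c) ≫ asc (F.obj b) (F.obj a) (F.obj c) ≫ 𝟙 (F.obj b) ⊠ brd (F.obj a) (F.obj c) ≫ 𝟙 (F.obj b) ⊠ m.μ c a ≫ m.μ b (c ⊠ₒ a) ≫ k))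
    (m.hexR_coherence a b c)
  let I₁ := tl33 (m.ω a b c) (F.map (brd a (b ⊠ₒ c)) ≫ F.map (asc b c a) ≫ k) ≪≫
    whiskerLeftIso (asc (F.obj a) (F.obj b) (F.obj c)) (whiskerLeftIso (𝟙 (F.obj a) ⊠ m.μ b c)
      (tl22 (m.v a (b ⊠ₒ c)) (F.map (asc b c a) ≫ k)).symm) ≪≫
    whiskerLeftIso (asc (F.obj a) (F.obj b) (F.obj c)) (tl22 (braidNat (𝟙 (F.obj a)) (m.μ b c)) (m.μ (b ⊠ₒ c) a ≫
          F.map (asc b c a) ≫ k)) ≪≫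
    whiskerLeftIso (asc (F.obj a) (F.obj b) (F.obj c)) (whiskerLeftIso (brd (F.obj a) ((F.obj b) ⊠ₒ (F.obj c))) (tl33 (m.ω b c a) k))
  let I₂ := whiskerLeftIso (m.μ a b ⊠ 𝟙 (F.obj c)) (tl22 (m.μL (brd a b) c) (F.map (asc b a c) ≫
          F.map (𝟙 b ⊠ brd a c) ≫ k)).symm ≪≫
    (tl22 (r22 (m.v a b) (F.obj c)) (m.μ (b ⊠ₒ a) c ≫ F.map (asc b a c) ≫
          F.map (𝟙 b ⊠ brd a c) ≫ k)).symm ≪≫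
    whiskerLeftIso (brd (F.obj a) (F.obj b) ⊠ 𝟙 (F.obj c)) (tl33 (m.ω b a c) (F.map (𝟙 b ⊠ brd a c) ≫ k)) ≪≫
    whiskerLeftIso (brd (F.obj a) (F.obj b) ⊠ 𝟙 (F.obj c)) (whiskerLeftIso (asc (F.obj b) (F.obj a) (F.obj c)) (whiskerLeftIso (𝟙 (F.obj b) ⊠ m.μ a c)
      (tl22 (m.μR b (brd a c)) k).symm)) ≪≫
    whiskerLeftIso (brd (F.obj a) (F.obj b) ⊠ 𝟙 (F.obj c)) (whiskerLeftIso (asc (F.obj b) (F.obj a) (F.obj c))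
      (tl22 (l22 (m.v a c) (F.obj b)) (m.μ b (c ⊠ₒ a) ≫ k)).symm)
  have h' : I₁.hom ≫ (tl33 (hexR (F.obj a) (F.obj b) (F.obj c)) (𝟙 (F.obj b) ⊠ m.μ c a ≫ m.μ b (c ⊠ₒ a) ≫ k)).hom =
      m.μ a b ⊠ 𝟙 (F.obj c) ◁ m.μ (a ⊠ₒ b) c ◁ (tl33 (im33 F.toPseudofunctor (hexR a b c)) k).hom ≫
        I₂.hom := by
    simp only [I₁, I₂, tl22, tl33, Iso.trans_hom, Iso.trans_inv, Iso.symm_hom, Iso.symm_inv,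
      whiskerLeftIso_hom, whiskerRightIso_hom, whiskerLeftIso_inv, whiskerRightIso_inv, r22_inv,
      l22_inv, im33, mc₃, mapComp₃, PrelaxFunctor.map₂Iso_hom] at h ⊢
    refine Eq.trans ?_ (h.trans ?_) <;> bicategory
  rw [← Iso.eq_inv_comp, ← Category.assoc, ← Iso.comp_inv_eq] at h'
  simpa only [I₁, I₂, Iso.trans_inv, Iso.symm_inv, whiskerLeftIso_inv, Category.assoc] using h'

theorem hexS_coherence_tail (a b c : K) {z : L} (k : F.obj (c ⊠ₒ a ⊠ₒ b) ⟶ z) :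
    (tl15 (hexS (F.obj a) (F.obj b) (F.obj c)) (𝟙 (F.obj c) ⊠ m.μ a b ≫ m.μ c (a ⊠ₒ b) ≫ k)).hom ≫
        asc (F.obj a) (F.obj b) (F.obj c) ◁ 𝟙 (F.obj a) ⊠ brd (F.obj b) (F.obj c) ◁ ascInv (F.obj a) (F.obj c) (F.obj b) ◁ brd (F.obj a) (F.obj c) ⊠ 𝟙 (F.obj b) ◁ (tl33 (m.ω c a b) k).inv ≫
        asc (F.obj a) (F.obj b) (F.obj c) ◁ 𝟙 (F.obj a) ⊠ brd (F.obj b) (F.obj c) ◁ ascInv (F.obj a) (F.obj c) (F.obj b) ◁ (tl22 (r22 (m.v a c) (F.obj b)) (m.μ (c ⊠ₒ a) b ≫ F.map (asc c a b) ≫ k)).hom ≫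
        asc (F.obj a) (F.obj b) (F.obj c) ◁ 𝟙 (F.obj a) ⊠ brd (F.obj b) (F.obj c) ◁ ascInv (F.obj a) (F.obj c) (F.obj b) ◁ m.μ a c ⊠ 𝟙 (F.obj b) ◁ (tl22 (m.μL (brd a c) b) (F.map (asc c a b) ≫ k)).hom =
      (tl22 (braidNat (m.μ a b) (𝟙 (F.obj c))) (m.μ c (a ⊠ₒ b) ≫ k)).inv ≫
        m.μ a b ⊠ 𝟙 (F.obj c) ◁ (tl22 (m.v (a ⊠ₒ b) c) k).hom ≫
        m.μ a b ⊠ 𝟙 (F.obj c) ◁ m.μ (a ⊠ₒ b) c ◁ (tl15 (im15 F.toPseudofunctor (hexS a b c)) k).hom ≫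
        (tl33 (m.ω a b c) (F.map (𝟙 a ⊠ brd b c) ≫ F.map (ascInv a c b) ≫ F.map (brd a c ⊠ 𝟙 b) ≫ F.map (asc c a b) ≫ k)).hom ≫
        asc (F.obj a) (F.obj b) (F.obj c) ◁ 𝟙 (F.obj a) ⊠ m.μ b c ◁ (tl22 (m.μR a (brd b c)) (F.map (ascInv a c b) ≫ F.map (brd a c ⊠ 𝟙 b) ≫ F.map (asc c a b) ≫ k)).inv ≫
        asc (F.obj a) (F.obj b) (F.obj c) ◁ (tl22 (l22 (m.v b c) (F.obj a)) (m.μ a (c ⊠ₒ b) ≫ F.map (ascInv a c b) ≫ F.map (brd a c ⊠ 𝟙 b) ≫ F.map (asc c a b) ≫ k)).inv ≫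
        asc (F.obj a) (F.obj b) (F.obj c) ◁ 𝟙 (F.obj a) ⊠ brd (F.obj b) (F.obj c) ◁ (tl20 (assoc (F.obj a) (F.obj c) (F.obj b)).counit (𝟙 (F.obj a) ⊠ m.μ c b ≫
          m.μ a (c ⊠ₒ b) ≫ F.map (ascInv a c b) ≫ F.map (brd a c ⊠ 𝟙 b) ≫ F.map (asc c a b) ≫ k)).inv ≫
        asc (F.obj a) (F.obj b) (F.obj c) ◁ 𝟙 (F.obj a) ⊠ brd (F.obj b) (F.obj c) ◁ ascInv (F.obj a) (F.obj c) (F.obj b) ◁ (tl33 (m.ω a c b) (F.map (ascInv a c b) ≫ F.map (brd a c ⊠ 𝟙 b) ≫ F.map (asc c a b) ≫ k)).inv ≫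
        asc (F.obj a) (F.obj b) (F.obj c) ◁ 𝟙 (F.obj a) ⊠ brd (F.obj b) (F.obj c) ◁ ascInv (F.obj a) (F.obj c) (F.obj b) ◁ m.μ a c ⊠ 𝟙 (F.obj b) ◁ m.μ (a ⊠ₒ c) b ◁
          (tl20 (im20 F.toPseudofunctor (assoc a c b).unit.symm)
            (F.map (brd a c ⊠ 𝟙 b) ≫ F.map (asc c a b) ≫ k)).hom := by
  have h := congrArg (fun y => 𝟙 (m.μ a b ⊠ 𝟙 (F.obj c) ≫ m.μ (a ⊠ₒ b) c ≫ F.map (brd (a ⊠ₒ b) c) ≫ k)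
    ⊗≫ y ▷ k ⊗≫
    𝟙 (asc (F.obj a) (F.obj b) (F.obj c) ≫ 𝟙 (F.obj a) ⊠ brd (F.obj b) (F.obj c) ≫ ascInv (F.obj a) (F.obj c) (F.obj b) ≫ brd (F.obj a) (F.obj c) ⊠ 𝟙 (F.obj b) ≫ asc (F.obj c) (F.obj a) (F.obj b) ≫
      𝟙 (F.obj c) ⊠ m.μ a b ≫ m.μ c (a ⊠ₒ b) ≫ k))
    (m.hexS_coherence a b c)
  let I₁ := whiskerLeftIso (m.μ a b ⊠ 𝟙 (F.obj c)) (tl22 (m.v (a ⊠ₒ b) c) k).symm ≪≫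
    tl22 (braidNat (m.μ a b) (𝟙 (F.obj c))) (m.μ c (a ⊠ₒ b) ≫ k)
  let W := m.μ a b ⊠ 𝟙 (F.obj c) ◁ m.μ (a ⊠ₒ b) c ◁ (tl15 (im15 F.toPseudofunctor (hexS a b c)) k).hom ≫
        (tl33 (m.ω a b c) (F.map (𝟙 a ⊠ brd b c) ≫ F.map (ascInv a c b) ≫ F.map (brd a c ⊠ 𝟙 b) ≫ F.map (asc c a b) ≫ k)).hom ≫
        asc (F.obj a) (F.obj b) (F.obj c) ◁ 𝟙 (F.obj a) ⊠ m.μ b c ◁ (tl22 (m.μR a (brd b c)) (F.map (ascInv a c b) ≫ F.map (brd a c ⊠ 𝟙 b) ≫ F.map (asc c a b) ≫ k)).inv ≫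
        asc (F.obj a) (F.obj b) (F.obj c) ◁ (tl22 (l22 (m.v b c) (F.obj a)) (m.μ a (c ⊠ₒ b) ≫ F.map (ascInv a c b) ≫ F.map (brd a c ⊠ 𝟙 b) ≫ F.map (asc c a b) ≫ k)).inv ≫
        asc (F.obj a) (F.obj b) (F.obj c) ◁ 𝟙 (F.obj a) ⊠ brd (F.obj b) (F.obj c) ◁ (tl20 (assoc (F.obj a) (F.obj c) (F.obj b)).counit (𝟙 (F.obj a) ⊠ m.μ c b ≫
          m.μ a (c ⊠ₒ b) ≫ F.map (ascInv a c b) ≫ F.map (brd a c ⊠ 𝟙 b) ≫ F.map (asc c a b) ≫ k)).inv ≫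
        asc (F.obj a) (F.obj b) (F.obj c) ◁ 𝟙 (F.obj a) ⊠ brd (F.obj b) (F.obj c) ◁ ascInv (F.obj a) (F.obj c) (F.obj b) ◁ (tl33 (m.ω a c b) (F.map (ascInv a c b) ≫ F.map (brd a c ⊠ 𝟙 b) ≫ F.map (asc c a b) ≫ k)).inv ≫
        asc (F.obj a) (F.obj b) (F.obj c) ◁ 𝟙 (F.obj a) ⊠ brd (F.obj b) (F.obj c) ◁ ascInv (F.obj a) (F.obj c) (F.obj b) ◁ m.μ a c ⊠ 𝟙 (F.obj b) ◁ m.μ (a ⊠ₒ c) b ◁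
          (tl20 (im20 F.toPseudofunctor (assoc a c b).unit.symm)
            (F.map (brd a c ⊠ 𝟙 b) ≫ F.map (asc c a b) ≫ k)).hom
  let I₂ := whiskerLeftIso (asc (F.obj a) (F.obj b) (F.obj c)) (whiskerLeftIso (𝟙 (F.obj a) ⊠ brd (F.obj b) (F.obj c))
    (whiskerLeftIso (ascInv (F.obj a) (F.obj c) (F.obj b)) (whiskerLeftIso (m.μ a c ⊠ 𝟙 (F.obj b))
        (tl22 (m.μL (brd a c) b) (F.map (asc c a b) ≫ k)).symm ≪≫
      (tl22 (r22 (m.v a c) (F.obj b)) (m.μ (c ⊠ₒ a) b ≫ F.map (asc c a b) ≫ k)).symm ≪≫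
      whiskerLeftIso (brd (F.obj a) (F.obj c) ⊠ 𝟙 (F.obj b)) (tl33 (m.ω c a b) k))))
  have h' : I₁.hom ≫ (tl15 (hexS (F.obj a) (F.obj b) (F.obj c)) (𝟙 (F.obj c) ⊠ m.μ a b ≫ m.μ c (a ⊠ₒ b) ≫ k)).hom =
      W ≫ I₂.hom := by
    simp only [I₁, I₂, W, tl22, tl33, tl15, tl20, tl21, Iso.trans_hom, Iso.trans_inv, Iso.symm_hom,
      Iso.symm_inv, whiskerLeftIso_hom, whiskerRightIso_hom, whiskerLeftIso_inv,
      whiskerRightIso_inv, r22_inv, l22_inv, im15, im20, mc₃, mc₄, mc₅, mapComp₃, mapComp₅,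
      PrelaxFunctor.map₂Iso_hom] at h ⊢
    refine Eq.trans ?_ (h.trans ?_) <;> bicategory
  rw [← Iso.eq_inv_comp, ← Category.assoc, ← Iso.comp_inv_eq] at h'
  simpa only [I₁, I₂, W, Iso.trans_inv, Iso.symm_inv, whiskerLeftIso_inv, whiskerLeft_comp,
    Category.assoc] using h'

end BraidedLaxMonoidal

end Lax

section Tails

variable {B : Type u₁} [Bicategory.{w₁, v₁} B] {a b b' c c' d z : B} {f : a ⟶ b} {g : b ⟶ c}
  {h : c ⟶ d} {f' : a ⟶ b'} {g' : b' ⟶ c'} {h' : c' ⟶ d} {k k' : d ⟶ z}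

theorem tl33_inv_nat (s : f ≫ g ≫ h ≅ f' ≫ g' ≫ h') (σ : k ⟶ k') :
    f' ◁ g' ◁ h' ◁ σ ≫ (tl33 s k').inv = (tl33 s k).inv ≫ f ◁ g ◁ h ◁ σ := by
  rw [Iso.comp_inv_eq, Category.assoc, tl33_nat, Iso.inv_hom_id_assoc]

end Tails

section Lax

variable {K : Type u₁} [Bicategory.{w₁, v₁} K] {L : Type u₂} [Bicategory.{w₂, v₂} L]
  [BraidedMonoidalBicategory K] [BraidedMonoidalBicategory L] {F : StrictPseudofunctor K L}

namespace BraidedLaxMonoidal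

variable (m : BraidedLaxMonoidal F) (A : BrPsMonData K)

theorem mapAssoc_inv_cL :
    (m.mapAssoc A.toPsMonData).inv ≫ (m.cL (m.μ A.X A.X) A.mul A.X (F.map A.mul)).hom =
      asc (F.obj A.X) (F.obj A.X) (F.obj A.X) ◁ (m.cR (m.μ A.X A.X) A.mul A.X (F.map A.mul)).hom ≫ (tl33 (m.ω A.X A.X A.X) (F.map (𝟙 A.X ⊠ A.mul) ≫ F.map A.mul)).inv ≫
        (m.μ A.X A.X) ⊠ 𝟙 (F.obj A.X) ◁ m.μ (A.X ⊠ₒ A.X) A.X ◁ (im23 F.toPseudofunctor A.mulAssoc).inv := by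
  have e := m.mapAssoc_cR A.toPsMonData
  rw [Iso.inv_comp_eq, reassoc_of% e, Iso.hom_inv_id_assoc, whiskerLeft₂_hom_inv,
    Category.comp_id]

theorem mapBraid_hexagonRight_left :
    (asc (F.obj A.X) (F.obj A.X) (F.obj A.X) ◁ brd (F.obj A.X) ((F.obj A.X) ⊠ₒ (F.obj A.X)) ◁ (m.mapAssoc A.toPsMonData).inv ≫
      asc (F.obj A.X) (F.obj A.X) (F.obj A.X) ◁ (tl22 (braidNat (𝟙 (F.obj A.X)) (m.μ A.X A.X ≫ F.map A.mul)) (m.μ A.X A.X ≫ F.map A.mul)).inv ≫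
      asc (F.obj A.X) (F.obj A.X) (F.obj A.X) ◁ 𝟙 (F.obj A.X) ⊠ (m.μ A.X A.X ≫ F.map A.mul) ◁ (m.mapBraid A).hom) ≫
      asc (F.obj A.X) (F.obj A.X) (F.obj A.X) ◁ (m.cR (m.μ A.X A.X) A.mul A.X (F.map A.mul)).hom =
    asc (F.obj A.X) (F.obj A.X) (F.obj A.X) ◁ brd (F.obj A.X) ((F.obj A.X) ⊠ₒ (F.obj A.X)) ◁ asc (F.obj A.X) (F.obj A.X) (F.obj A.X) ◁ (m.cR (m.μ A.X A.X) A.mul A.X (F.map A.mul)).hom ≫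
      asc (F.obj A.X) (F.obj A.X) (F.obj A.X) ◁ brd (F.obj A.X) ((F.obj A.X) ⊠ₒ (F.obj A.X)) ◁ (tl33 (m.ω A.X A.X A.X) (F.map (𝟙 A.X ⊠ A.mul) ≫ F.map A.mul)).inv ≫
      asc (F.obj A.X) (F.obj A.X) (F.obj A.X) ◁ (tl22 (braidNat (𝟙 (F.obj A.X)) (m.μ A.X A.X)) (m.μ (A.X ⊠ₒ A.X) A.X ≫ F.map (asc A.X A.X A.X) ≫ (F.map (𝟙 A.X ⊠ A.mul) ≫ F.map A.mul))).inv ≫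
      asc (F.obj A.X) (F.obj A.X) (F.obj A.X) ◁ 𝟙 (F.obj A.X) ⊠ (m.μ A.X A.X) ◁ (tl22 (m.v A.X (A.X ⊠ₒ A.X)) (F.map (asc A.X A.X A.X) ≫ (F.map (𝟙 A.X ⊠ A.mul) ≫ F.map A.mul))).hom ≫
      (tl33 (m.ω A.X A.X A.X) (F.map (brd A.X (A.X ⊠ₒ A.X)) ≫ F.map (asc A.X A.X A.X) ≫ (F.map (𝟙 A.X ⊠ A.mul) ≫ F.map A.mul))).inv ≫
      (m.μ A.X A.X) ⊠ 𝟙 (F.obj A.X) ◁ m.μ (A.X ⊠ₒ A.X) A.X ◁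
        (F.map (asc A.X A.X A.X) ◁ F.map (brd A.X (A.X ⊠ₒ A.X)) ◁ (im23 F.toPseudofunctor A.mulAssoc).inv ≫
        F.map (asc A.X A.X A.X) ◁ (tl22 (im22 F.toPseudofunctor (braidNat (𝟙 A.X) A.mul)) (F.map A.mul)).inv ≫
        F.map (asc A.X A.X A.X) ◁ F.map (𝟙 A.X ⊠ A.mul) ◁ (im21 F.toPseudofunctor A.γ).hom) ≫
      (tl33 (m.ω A.X A.X A.X) (F.map (𝟙 A.X ⊠ A.mul) ≫ F.map A.mul)).hom := by
  have e1 := congrArg (fun w => asc (F.obj A.X) (F.obj A.X) (F.obj A.X) ◁ 𝟙 (F.obj A.X) ⊠ (m.μ A.X A.X ≫ F.map A.mul) ◁ w) (m.mapBraid_hom A)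
  have n1 := congrArg (fun w => asc (F.obj A.X) (F.obj A.X) (F.obj A.X) ◁ w) (m.cR_nat (m.μ A.X A.X) A.mul A.X (im21 F.toPseudofunctor A.γ).hom)
  have e2 := congrArg (fun w => asc (F.obj A.X) (F.obj A.X) (F.obj A.X) ◁ w) (m.v_cR (m.μ A.X A.X) A.mul A.X (F.map A.mul))
  have e3 := congrArg (fun w => asc (F.obj A.X) (F.obj A.X) (F.obj A.X) ◁ brd (F.obj A.X) ((F.obj A.X) ⊠ₒ (F.obj A.X)) ◁ w) (m.mapAssoc_inv_cL A)
  have n2 := congrArg (fun w => asc (F.obj A.X) (F.obj A.X) (F.obj A.X) ◁ w) (tl22_inv_nat (braidNat (𝟙 (F.obj A.X)) (m.μ A.X A.X))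
    (m.μ (A.X ⊠ₒ A.X) A.X ◁ (im23 F.toPseudofunctor A.mulAssoc).inv))
  have n3 := congrArg (fun w => asc (F.obj A.X) (F.obj A.X) (F.obj A.X) ◁ 𝟙 (F.obj A.X) ⊠ (m.μ A.X A.X) ◁ w) (tl22_nat (m.v A.X (A.X ⊠ₒ A.X))
    (im23 F.toPseudofunctor A.mulAssoc).inv)
  have n4 := tl33_nat (m.ω A.X A.X A.X)
    (F.map (brd A.X (A.X ⊠ₒ A.X)) ◁ (im23 F.toPseudofunctor A.mulAssoc).inv ≫
      (tl22 (im22 F.toPseudofunctor (braidNat (𝟙 A.X) A.mul)) (F.map A.mul)).inv ≫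
      F.map (𝟙 A.X ⊠ A.mul) ◁ (im21 F.toPseudofunctor A.γ).hom)
  rw [← Iso.inv_comp_eq] at n4
  simp only [whiskerLeft_comp, Category.assoc] at e1 n1 e2 e3 n2 n3 n4 ⊢
  rw [n4, reassoc_of% e1, n1, reassoc_of% e2, reassoc_of% e3, ← reassoc_of% n2, ← reassoc_of% n3]

theorem mapBraid_hexagonRight_right :
    ((tl33 (hexR (F.obj A.X) (F.obj A.X) (F.obj A.X)) (𝟙 (F.obj A.X) ⊠ (m.μ A.X A.X ≫ F.map A.mul) ≫ m.μ A.X A.X ≫ F.map A.mul)).hom ≫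
      brd (F.obj A.X) (F.obj A.X) ⊠ 𝟙 (F.obj A.X) ◁ asc (F.obj A.X) (F.obj A.X) (F.obj A.X) ◁ (tl21 (l21 (m.mapBraid A) (F.obj A.X)) (m.μ A.X A.X ≫ F.map A.mul)).hom ≫
      brd (F.obj A.X) (F.obj A.X) ⊠ 𝟙 (F.obj A.X) ◁ (m.mapAssoc A.toPsMonData).inv ≫ (tl21 (r21 (m.mapBraid A) (F.obj A.X)) (m.μ A.X A.X ≫ F.map A.mul)).hom ≫
      (m.mapAssoc A.toPsMonData).hom) ≫
      asc (F.obj A.X) (F.obj A.X) (F.obj A.X) ◁ (m.cR (m.μ A.X A.X) A.mul A.X (F.map A.mul)).hom =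
    asc (F.obj A.X) (F.obj A.X) (F.obj A.X) ◁ brd (F.obj A.X) ((F.obj A.X) ⊠ₒ (F.obj A.X)) ◁ asc (F.obj A.X) (F.obj A.X) (F.obj A.X) ◁ (m.cR (m.μ A.X A.X) A.mul A.X (F.map A.mul)).hom ≫
      asc (F.obj A.X) (F.obj A.X) (F.obj A.X) ◁ brd (F.obj A.X) ((F.obj A.X) ⊠ₒ (F.obj A.X)) ◁ (tl33 (m.ω A.X A.X A.X) (F.map (𝟙 A.X ⊠ A.mul) ≫ F.map A.mul)).inv ≫
      asc (F.obj A.X) (F.obj A.X) (F.obj A.X) ◁ (tl22 (braidNat (𝟙 (F.obj A.X)) (m.μ A.X A.X)) (m.μ (A.X ⊠ₒ A.X) A.X ≫ F.map (asc A.X A.X A.X) ≫ (F.map (𝟙 A.X ⊠ A.mul) ≫ F.map A.mul))).inv ≫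
      asc (F.obj A.X) (F.obj A.X) (F.obj A.X) ◁ 𝟙 (F.obj A.X) ⊠ (m.μ A.X A.X) ◁ (tl22 (m.v A.X (A.X ⊠ₒ A.X)) (F.map (asc A.X A.X A.X) ≫ (F.map (𝟙 A.X ⊠ A.mul) ≫ F.map A.mul))).hom ≫
      (tl33 (m.ω A.X A.X A.X) (F.map (brd A.X (A.X ⊠ₒ A.X)) ≫ F.map (asc A.X A.X A.X) ≫ (F.map (𝟙 A.X ⊠ A.mul) ≫ F.map A.mul))).inv ≫
      (m.μ A.X A.X) ⊠ 𝟙 (F.obj A.X) ◁ m.μ (A.X ⊠ₒ A.X) A.X ◁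
        ((tl33 (im33 F.toPseudofunctor (hexR A.X A.X A.X)) ((F.map (𝟙 A.X ⊠ A.mul) ≫ F.map A.mul))).hom ≫
        F.map (brd A.X A.X ⊠ 𝟙 A.X) ◁ F.map (asc A.X A.X A.X) ◁ (tl21 (im21 F.toPseudofunctor (l21 A.γ A.X)) (F.map A.mul)).hom ≫
        F.map (brd A.X A.X ⊠ 𝟙 A.X) ◁ (im23 F.toPseudofunctor A.mulAssoc).inv ≫
        (tl21 (im21 F.toPseudofunctor (r21 A.γ A.X)) (F.map A.mul)).hom ≫
        (im23 F.toPseudofunctor A.mulAssoc).hom) ≫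
      (tl33 (m.ω A.X A.X A.X) (F.map (𝟙 A.X ⊠ A.mul) ≫ F.map A.mul)).hom := by
  have e1 := m.mapAssoc_cR A.toPsMonData
  have e2 := m.mapBraid_cL A A.X (F.map A.mul)
  have e3 := congrArg (fun w => brd (F.obj A.X) (F.obj A.X) ⊠ 𝟙 (F.obj A.X) ◁ w) (m.mapAssoc_inv_cL A)
  have e4 := congrArg (fun w => brd (F.obj A.X) (F.obj A.X) ⊠ 𝟙 (F.obj A.X) ◁ asc (F.obj A.X) (F.obj A.X) (F.obj A.X) ◁ w) (m.mapBraid_cR A A.X (F.map A.mul))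
  have n1 := tl33_nat (hexR (F.obj A.X) (F.obj A.X) (F.obj A.X)) (m.cR (m.μ A.X A.X) A.mul A.X (F.map A.mul)).hom
  have n2 := congrArg (fun w => brd (F.obj A.X) (F.obj A.X) ⊠ 𝟙 (F.obj A.X) ◁ w) (tl33_inv_nat (m.ω A.X A.X A.X) (tl21 (im21 F.toPseudofunctor (l21 A.γ A.X)) (F.map A.mul)).hom)
  have n3 := tl22_nat (r22 (m.v A.X A.X) (F.obj A.X)) (m.μ (A.X ⊠ₒ A.X) A.X ◁
    (F.map (asc A.X A.X A.X) ◁ (tl21 (im21 F.toPseudofunctor (l21 A.γ A.X)) (F.map A.mul)).hom ≫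
      (im23 F.toPseudofunctor A.mulAssoc).inv))
  have n4 := congrArg (fun w => (m.μ A.X A.X) ⊠ 𝟙 (F.obj A.X) ◁ w) (tl22_nat (m.μL (brd A.X A.X) A.X)
    (F.map (asc A.X A.X A.X) ◁ (tl21 (im21 F.toPseudofunctor (l21 A.γ A.X)) (F.map A.mul)).hom ≫
      (im23 F.toPseudofunctor A.mulAssoc).inv))
  have h := m.hexR_coherence_tail A.X A.X A.X (F.map (𝟙 A.X ⊠ A.mul) ≫ F.map A.mul)
  simp only [whiskerLeft_comp, Category.assoc] at e1 e2 e3 e4 n1 n2 n3 n4 h ⊢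
  rw [e1, reassoc_of% e2, reassoc_of% e3, reassoc_of% e4, ← reassoc_of% n1, reassoc_of% n2, reassoc_of% n3, reassoc_of% n4, reassoc_of% h]

theorem mapBraid_hexagonRight (H : A.HexagonRight) :
    asc (F.obj A.X) (F.obj A.X) (F.obj A.X) ◁ brd (F.obj A.X) ((F.obj A.X) ⊠ₒ (F.obj A.X)) ◁ (m.mapAssoc A.toPsMonData).inv ≫
      asc (F.obj A.X) (F.obj A.X) (F.obj A.X) ◁ (tl22 (braidNat (𝟙 (F.obj A.X)) (m.μ A.X A.X ≫ F.map A.mul)) (m.μ A.X A.X ≫ F.map A.mul)).inv ≫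
      asc (F.obj A.X) (F.obj A.X) (F.obj A.X) ◁ 𝟙 (F.obj A.X) ⊠ (m.μ A.X A.X ≫ F.map A.mul) ◁ (m.mapBraid A).hom =
    (tl33 (hexR (F.obj A.X) (F.obj A.X) (F.obj A.X)) (𝟙 (F.obj A.X) ⊠ (m.μ A.X A.X ≫ F.map A.mul) ≫ m.μ A.X A.X ≫ F.map A.mul)).hom ≫
      brd (F.obj A.X) (F.obj A.X) ⊠ 𝟙 (F.obj A.X) ◁ asc (F.obj A.X) (F.obj A.X) (F.obj A.X) ◁ (tl21 (l21 (m.mapBraid A) (F.obj A.X)) (m.μ A.X A.X ≫ F.map A.mul)).hom ≫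
      brd (F.obj A.X) (F.obj A.X) ⊠ 𝟙 (F.obj A.X) ◁ (m.mapAssoc A.toPsMonData).inv ≫ (tl21 (r21 (m.mapBraid A) (F.obj A.X)) (m.μ A.X A.X ≫ F.map A.mul)).hom ≫
      (m.mapAssoc A.toPsMonData).hom := by
  rw [← cancel_mono (whiskerLeftIso (asc (F.obj A.X) (F.obj A.X) (F.obj A.X)) (m.cR (m.μ A.X A.X) A.mul A.X (F.map A.mul))).hom]
  simp only [whiskerLeftIso_hom]
  rw [mapBraid_hexagonRight_left, mapBraid_hexagonRight_right, im_hexagon_right F.toPseudofunctor H]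

theorem mapBrObj_hexagonRight (H : A.HexagonRight) :
    (m.toBraidedLaxData.mapBrObj A).HexagonRight :=
  m.mapBraid_hexagonRight A H

end BraidedLaxMonoidal

end Lax

section Tails

variable {B : Type u₁} [Bicategory.{w₁, v₁} B] {C : Type u₂} [Bicategory.{w₂, v₂} C]

theorem tl20_eq_of_leftZigzag {a b z : B} {f : a ⟶ b} {g : b ⟶ a} (x : f ≫ g ≅ 𝟙 a)
    (y : g ≫ f ≅ 𝟙 b) (h : leftZigzag x.inv y.hom = (λ_ f).hom ≫ (ρ_ f).inv) (k : b ⟶ z) :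
    (tl20 x (f ≫ k)).hom = f ◁ (tl20 y k).hom := by
  have h' := congrArg (fun w => (λ_ (f ≫ k)).inv ≫ (α_ _ f k).inv ≫ w ▷ k ≫ (α_ f _ k).hom ≫
    f ◁ (λ_ k).hom) h
  rw [← cancel_epi (tl20 x (f ≫ k)).inv, Iso.inv_hom_id]
  simp only [tl20, tl21, leftZigzag, Iso.trans_hom, Iso.trans_inv, Iso.symm_hom, Iso.symm_inv,
    whiskerRightIso_hom, whiskerRightIso_inv] at h' ⊢
  refine Eq.trans ?_ (h'.symm.trans ?_) <;> bicategory

theorem im20_unit_eq (P : Pseudofunctor B C) {a b : B} (e : a ≌ b) {z : C} (k : P.obj b ⟶ z) :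
    (tl20 (im20 P e.unit.symm) (P.map e.hom ≫ k)).hom =
      P.map e.hom ◁ (tl20 (im20 P e.counit) k).hom := by
  refine tl20_eq_of_leftZigzag _ _ (Eq.trans ?_ (P.mapAdjunction
    ⟨e.unit.hom, e.counit.hom, e.left_triangle_hom, e.right_triangle_hom⟩).left_triangle) k
  simp only [Pseudofunctor.mapAdjunction_unit, Pseudofunctor.mapAdjunction_counit, im20,
    Iso.trans_inv, Iso.trans_hom, Iso.symm_hom, Iso.symm_inv, PrelaxFunctor.map₂Iso_inv,
    PrelaxFunctor.map₂Iso_hom, Category.assoc]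

end Tails

section Lax

variable {K : Type u₁} [Bicategory.{w₁, v₁} K] {L : Type u₂} [Bicategory.{w₂, v₂} L]
  [BraidedMonoidalBicategory K] [BraidedMonoidalBicategory L] {F : StrictPseudofunctor K L}

namespace BraidedLaxMonoidal

variable (m : BraidedLaxMonoidal F) (A : BrPsMonData K)

theorem hexS_unit_slide (a b c : K) {z : L} {k : F.obj (a ⊠ₒ b ⊠ₒ c) ⟶ z}
   {k' : F.obj ((a ⊠ₒ b) ⊠ₒ c) ⟶ z} (ζ : k' ⟶ F.map (asc a b c) ≫ k) :
   (tl20 (assoc (F.obj a) (F.obj b) (F.obj c)).counit (𝟙 (F.obj a) ⊠ m.μ b c ≫ m.μ a (b ⊠ₒ c) ≫ F.map (ascInv a b c) ≫ k')).inv ≫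
     ascInv (F.obj a) (F.obj b) (F.obj c) ◁ (tl33 (m.ω a b c) (F.map (ascInv a b c) ≫ k')).inv ≫
     ascInv (F.obj a) (F.obj b) (F.obj c) ◁ m.μ a b ⊠ 𝟙 (F.obj c) ◁ m.μ (a ⊠ₒ b) c ◁
       (tl20 (im20 F.toPseudofunctor (assoc a b c).unit.symm) k').hom ≫
     ascInv (F.obj a) (F.obj b) (F.obj c) ◁ m.μ a b ⊠ 𝟙 (F.obj c) ◁ m.μ (a ⊠ₒ b) c ◁ ζ ≫
     ascInv (F.obj a) (F.obj b) (F.obj c) ◁ (tl33 (m.ω a b c) k).hom ≫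
     (tl20 (assoc (F.obj a) (F.obj b) (F.obj c)).counit (𝟙 (F.obj a) ⊠ m.μ b c ≫ m.μ a (b ⊠ₒ c) ≫ k)).hom =
   𝟙 (F.obj a) ⊠ m.μ b c ◁ m.μ a (b ⊠ₒ c) ◁ (F.map (ascInv a b c) ◁ ζ ≫ (tl20 (im20 F.toPseudofunctor (assoc a b c).counit) k).hom) := by
  have n1 := tl20_nat (im20 F.toPseudofunctor (assoc a b c).unit.symm) ζ
  rw [im20_unit_eq F.toPseudofunctor (assoc a b c)] at n1
  have n2 := tl33_nat (m.ω a b c) (F.map (ascInv a b c) ◁ ζ ≫ (tl20 (im20 F.toPseudofunctor (assoc a b c).counit) k).hom)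
  have n3 := tl20_nat (assoc (F.obj a) (F.obj b) (F.obj c)).counit (𝟙 (F.obj a) ⊠ m.μ b c ◁ m.μ a (b ⊠ₒ c) ◁ (F.map (ascInv a b c) ◁ ζ ≫ (tl20 (im20 F.toPseudofunctor (assoc a b c).counit) k).hom))
  have n4 := congrArg (fun w => ascInv (F.obj a) (F.obj b) (F.obj c) ◁ m.μ a b ⊠ 𝟙 (F.obj c) ◁
    m.μ (a ⊠ₒ b) c ◁ w) n1
  rw [← Iso.inv_comp_eq] at n2
  rw [Iso.inv_comp_eq, ← n3, ← n2]
  simp only [whiskerLeft_comp, Category.assoc] at n4 ⊢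
  rw [reassoc_of% n4]

theorem mapBraid_hexagonLeft_left :
    ((tl22 (braidNat (m.μ A.X A.X ≫ F.map A.mul) (𝟙 (F.obj A.X))) (m.μ A.X A.X ≫ F.map A.mul)).inv ≫ (m.μ A.X A.X ≫ F.map A.mul) ⊠ 𝟙 (F.obj A.X) ◁ (m.mapBraid A).hom ≫
      (m.mapAssoc A.toPsMonData).hom) ≫
      asc (F.obj A.X) (F.obj A.X) (F.obj A.X) ◁ (m.cR (m.μ A.X A.X) A.mul A.X (F.map A.mul)).hom =
    brd ((F.obj A.X) ⊠ₒ (F.obj A.X)) (F.obj A.X) ◁ (m.cR (m.μ A.X A.X) A.mul A.X (F.map A.mul)).hom ≫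
      (tl22 (braidNat (m.μ A.X A.X) (𝟙 (F.obj A.X))) (m.μ A.X (A.X ⊠ₒ A.X) ≫ (F.map (𝟙 A.X ⊠ A.mul) ≫ F.map A.mul))).inv ≫
      (m.μ A.X A.X) ⊠ 𝟙 (F.obj A.X) ◁ (tl22 (m.v (A.X ⊠ₒ A.X) A.X) ((F.map (𝟙 A.X ⊠ A.mul) ≫ F.map A.mul))).hom ≫
      (m.μ A.X A.X) ⊠ 𝟙 (F.obj A.X) ◁ m.μ (A.X ⊠ₒ A.X) A.X ◁
        ((tl22 (im22 F.toPseudofunctor (braidNat A.mul (𝟙 A.X))) (F.map A.mul)).inv ≫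
        F.map (A.mul ⊠ 𝟙 A.X) ◁ (im21 F.toPseudofunctor A.γ).hom ≫ (im23 F.toPseudofunctor A.mulAssoc).hom) ≫
      (tl33 (m.ω A.X A.X A.X) (F.map (𝟙 A.X ⊠ A.mul) ≫ F.map A.mul)).hom := by
  have e1 := congrArg (fun w => (m.μ A.X A.X ≫ F.map A.mul) ⊠ 𝟙 (F.obj A.X) ◁ w) (m.mapBraid_hom A)
  have n1 := m.cL_nat (m.μ A.X A.X) A.mul A.X (im21 F.toPseudofunctor A.γ).hom
  have e2 := m.v_cL (m.μ A.X A.X) A.mul A.X (F.map A.mul)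
  have e3 := m.mapAssoc_cR A.toPsMonData
  simp only [whiskerLeft_comp, Category.assoc] at e1 n1 e2 e3 ⊢
  rw [e3, reassoc_of% e1, reassoc_of% n1, reassoc_of% e2]

theorem mapBraid_hexagonLeft_right :
    ((tl15 (hexS (F.obj A.X) (F.obj A.X) (F.obj A.X)) (𝟙 (F.obj A.X) ⊠ (m.μ A.X A.X ≫ F.map A.mul) ≫ m.μ A.X A.X ≫ F.map A.mul)).hom ≫
      asc (F.obj A.X) (F.obj A.X) (F.obj A.X) ◁ 𝟙 (F.obj A.X) ⊠ brd (F.obj A.X) (F.obj A.X) ◁ ascInv (F.obj A.X) (F.obj A.X) (F.obj A.X) ◁ brd (F.obj A.X) (F.obj A.X) ⊠ 𝟙 (F.obj A.X) ◁ (m.mapAssoc A.toPsMonData).inv ≫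
      asc (F.obj A.X) (F.obj A.X) (F.obj A.X) ◁ 𝟙 (F.obj A.X) ⊠ brd (F.obj A.X) (F.obj A.X) ◁ ascInv (F.obj A.X) (F.obj A.X) (F.obj A.X) ◁ (tl21 (r21 (m.mapBraid A) (F.obj A.X)) (m.μ A.X A.X ≫ F.map A.mul)).hom ≫
      asc (F.obj A.X) (F.obj A.X) (F.obj A.X) ◁ 𝟙 (F.obj A.X) ⊠ brd (F.obj A.X) (F.obj A.X) ◁ ascInv (F.obj A.X) (F.obj A.X) (F.obj A.X) ◁ (m.mapAssoc A.toPsMonData).hom ≫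
      asc (F.obj A.X) (F.obj A.X) (F.obj A.X) ◁ 𝟙 (F.obj A.X) ⊠ brd (F.obj A.X) (F.obj A.X) ◁ (tl20 (assoc (F.obj A.X) (F.obj A.X) (F.obj A.X)).counit (𝟙 (F.obj A.X) ⊠ (m.μ A.X A.X ≫ F.map A.mul) ≫ m.μ A.X A.X ≫ F.map A.mul)).hom ≫
      asc (F.obj A.X) (F.obj A.X) (F.obj A.X) ◁ (tl21 (l21 (m.mapBraid A) (F.obj A.X)) (m.μ A.X A.X ≫ F.map A.mul)).hom) ≫
      asc (F.obj A.X) (F.obj A.X) (F.obj A.X) ◁ (m.cR (m.μ A.X A.X) A.mul A.X (F.map A.mul)).hom =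
    brd ((F.obj A.X) ⊠ₒ (F.obj A.X)) (F.obj A.X) ◁ (m.cR (m.μ A.X A.X) A.mul A.X (F.map A.mul)).hom ≫
      (tl22 (braidNat (m.μ A.X A.X) (𝟙 (F.obj A.X))) (m.μ A.X (A.X ⊠ₒ A.X) ≫ (F.map (𝟙 A.X ⊠ A.mul) ≫ F.map A.mul))).inv ≫
      (m.μ A.X A.X) ⊠ 𝟙 (F.obj A.X) ◁ (tl22 (m.v (A.X ⊠ₒ A.X) A.X) ((F.map (𝟙 A.X ⊠ A.mul) ≫ F.map A.mul))).hom ≫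
      (m.μ A.X A.X) ⊠ 𝟙 (F.obj A.X) ◁ m.μ (A.X ⊠ₒ A.X) A.X ◁
        ((tl15 (im15 F.toPseudofunctor (hexS A.X A.X A.X)) ((F.map (𝟙 A.X ⊠ A.mul) ≫ F.map A.mul))).hom ≫
        F.map (asc A.X A.X A.X) ◁ F.map (𝟙 A.X ⊠ brd A.X A.X) ◁ F.map (ascInv A.X A.X A.X) ◁ F.map (brd A.X A.X ⊠ 𝟙 A.X) ◁ (im23 F.toPseudofunctor A.mulAssoc).inv ≫
        F.map (asc A.X A.X A.X) ◁ F.map (𝟙 A.X ⊠ brd A.X A.X) ◁ F.map (ascInv A.X A.X A.X) ◁ (tl21 (im21 F.toPseudofunctor (r21 A.γ A.X)) (F.map A.mul)).hom ≫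
        F.map (asc A.X A.X A.X) ◁ F.map (𝟙 A.X ⊠ brd A.X A.X) ◁ F.map (ascInv A.X A.X A.X) ◁ (im23 F.toPseudofunctor A.mulAssoc).hom ≫
        F.map (asc A.X A.X A.X) ◁ F.map (𝟙 A.X ⊠ brd A.X A.X) ◁
          (tl20 (im20 F.toPseudofunctor (assoc A.X A.X A.X).counit) (F.map (𝟙 A.X ⊠ A.mul) ≫ F.map A.mul)).hom ≫
        F.map (asc A.X A.X A.X) ◁ (tl21 (im21 F.toPseudofunctor (l21 A.γ A.X)) (F.map A.mul)).hom) ≫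
      (tl33 (m.ω A.X A.X A.X) (F.map (𝟙 A.X ⊠ A.mul) ≫ F.map A.mul)).hom := by
  let ζ := F.map (brd A.X A.X ⊠ 𝟙 A.X) ◁ (im23 F.toPseudofunctor A.mulAssoc).inv ≫
        (tl21 (im21 F.toPseudofunctor (r21 A.γ A.X)) (F.map A.mul)).hom ≫
        (im23 F.toPseudofunctor A.mulAssoc).hom
  let σ := F.map (ascInv A.X A.X A.X) ◁ ζ ≫
    (tl20 (im20 F.toPseudofunctor (assoc A.X A.X A.X).counit) (F.map (𝟙 A.X ⊠ A.mul) ≫ F.map A.mul)).hom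
  have e1 := congrArg (fun w => asc (F.obj A.X) (F.obj A.X) (F.obj A.X) ◁ 𝟙 (F.obj A.X) ⊠ brd (F.obj A.X) (F.obj A.X) ◁ ascInv (F.obj A.X) (F.obj A.X) (F.obj A.X) ◁ w) (m.mapAssoc_cR A.toPsMonData)
  have e2 := congrArg (fun w => asc (F.obj A.X) (F.obj A.X) (F.obj A.X) ◁ 𝟙 (F.obj A.X) ⊠ brd (F.obj A.X) (F.obj A.X) ◁ ascInv (F.obj A.X) (F.obj A.X) (F.obj A.X) ◁ w) (m.mapBraid_cL A A.X (F.map A.mul))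
  have e3 := congrArg (fun w => asc (F.obj A.X) (F.obj A.X) (F.obj A.X) ◁ 𝟙 (F.obj A.X) ⊠ brd (F.obj A.X) (F.obj A.X) ◁ ascInv (F.obj A.X) (F.obj A.X) (F.obj A.X) ◁ brd (F.obj A.X) (F.obj A.X) ⊠ 𝟙 (F.obj A.X) ◁ w) (m.mapAssoc_inv_cL A)
  have e4 := congrArg (fun w => asc (F.obj A.X) (F.obj A.X) (F.obj A.X) ◁ w) (m.mapBraid_cR A A.X (F.map A.mul))
  have n0 := congrArg (fun w => asc (F.obj A.X) (F.obj A.X) (F.obj A.X) ◁ 𝟙 (F.obj A.X) ⊠ brd (F.obj A.X) (F.obj A.X) ◁ w) (tl20_nat (assoc (F.obj A.X) (F.obj A.X) (F.obj A.X)).counit (m.cR (m.μ A.X A.X) A.mul A.X (F.map A.mul)).hom)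
  have n1 := tl15_nat (hexS (F.obj A.X) (F.obj A.X) (F.obj A.X)) (m.cR (m.μ A.X A.X) A.mul A.X (F.map A.mul)).hom
  have n3 := congrArg (fun w => asc (F.obj A.X) (F.obj A.X) (F.obj A.X) ◁ 𝟙 (F.obj A.X) ⊠ brd (F.obj A.X) (F.obj A.X) ◁ ascInv (F.obj A.X) (F.obj A.X) (F.obj A.X) ◁ w) (tl22_nat (r22 (m.v A.X A.X) (F.obj A.X)) (m.μ (A.X ⊠ₒ A.X) A.X ◁
      (im23 F.toPseudofunctor A.mulAssoc).inv))
  have n4 := congrArg (fun w => asc (F.obj A.X) (F.obj A.X) (F.obj A.X) ◁ 𝟙 (F.obj A.X) ⊠ brd (F.obj A.X) (F.obj A.X) ◁ ascInv (F.obj A.X) (F.obj A.X) (F.obj A.X) ◁ (m.μ A.X A.X) ⊠ 𝟙 (F.obj A.X) ◁ w) (tl22_nat (m.μL (brd A.X A.X) A.X)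
      (im23 F.toPseudofunctor A.mulAssoc).inv)
  have h := m.hexS_coherence_tail A.X A.X A.X (F.map (𝟙 A.X ⊠ A.mul) ≫ F.map A.mul)
  have hs := congrArg (fun w => asc (F.obj A.X) (F.obj A.X) (F.obj A.X) ◁ 𝟙 (F.obj A.X) ⊠ brd (F.obj A.X) (F.obj A.X) ◁ w) (m.hexS_unit_slide A.X A.X A.X ζ)
  have n5 := congrArg (fun w => asc (F.obj A.X) (F.obj A.X) (F.obj A.X) ◁ w) (tl22_nat (l22 (m.v A.X A.X) (F.obj A.X)) (m.μ A.X (A.X ⊠ₒ A.X) ◁ σ))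
  have n6 := congrArg (fun w => asc (F.obj A.X) (F.obj A.X) (F.obj A.X) ◁ 𝟙 (F.obj A.X) ⊠ (m.μ A.X A.X) ◁ w) (tl22_nat (m.μR A.X (brd A.X A.X)) σ)
  have n7 := tl33_nat (m.ω A.X A.X A.X) (F.map (𝟙 A.X ⊠ brd A.X A.X) ◁ σ ≫
    (tl21 (im21 F.toPseudofunctor (l21 A.γ A.X)) (F.map A.mul)).hom)
  simp only [ζ, σ, whiskerLeft_comp, Category.assoc] at e1 e2 e3 e4 n0 n1 n3 n4 n5 n6 n7 h hs ⊢
  rw [e4, ← reassoc_of% n0, reassoc_of% e1, reassoc_of% e2, reassoc_of% e3, ← reassoc_of% n1,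
    reassoc_of% n3, reassoc_of% n4, reassoc_of% h, reassoc_of% hs,
    reassoc_of% n5, whiskerLeft_inv_hom_assoc, reassoc_of% n6, reassoc_of% @whiskerLeft₂_inv_hom, ← n7]

theorem mapBraid_hexagonLeft (H : A.HexagonLeft) :
    (tl22 (braidNat (m.μ A.X A.X ≫ F.map A.mul) (𝟙 (F.obj A.X))) (m.μ A.X A.X ≫ F.map A.mul)).inv ≫ (m.μ A.X A.X ≫ F.map A.mul) ⊠ 𝟙 (F.obj A.X) ◁ (m.mapBraid A).hom ≫
      (m.mapAssoc A.toPsMonData).hom =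
    (tl15 (hexS (F.obj A.X) (F.obj A.X) (F.obj A.X)) (𝟙 (F.obj A.X) ⊠ (m.μ A.X A.X ≫ F.map A.mul) ≫ m.μ A.X A.X ≫ F.map A.mul)).hom ≫
      asc (F.obj A.X) (F.obj A.X) (F.obj A.X) ◁ 𝟙 (F.obj A.X) ⊠ brd (F.obj A.X) (F.obj A.X) ◁ ascInv (F.obj A.X) (F.obj A.X) (F.obj A.X) ◁ brd (F.obj A.X) (F.obj A.X) ⊠ 𝟙 (F.obj A.X) ◁ (m.mapAssoc A.toPsMonData).inv ≫
      asc (F.obj A.X) (F.obj A.X) (F.obj A.X) ◁ 𝟙 (F.obj A.X) ⊠ brd (F.obj A.X) (F.obj A.X) ◁ ascInv (F.obj A.X) (F.obj A.X) (F.obj A.X) ◁ (tl21 (r21 (m.mapBraid A) (F.obj A.X)) (m.μ A.X A.X ≫ F.map A.mul)).hom ≫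
      asc (F.obj A.X) (F.obj A.X) (F.obj A.X) ◁ 𝟙 (F.obj A.X) ⊠ brd (F.obj A.X) (F.obj A.X) ◁ ascInv (F.obj A.X) (F.obj A.X) (F.obj A.X) ◁ (m.mapAssoc A.toPsMonData).hom ≫
      asc (F.obj A.X) (F.obj A.X) (F.obj A.X) ◁ 𝟙 (F.obj A.X) ⊠ brd (F.obj A.X) (F.obj A.X) ◁ (tl20 (assoc (F.obj A.X) (F.obj A.X) (F.obj A.X)).counit (𝟙 (F.obj A.X) ⊠ (m.μ A.X A.X ≫ F.map A.mul) ≫ m.μ A.X A.X ≫ F.map A.mul)).hom ≫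
      asc (F.obj A.X) (F.obj A.X) (F.obj A.X) ◁ (tl21 (l21 (m.mapBraid A) (F.obj A.X)) (m.μ A.X A.X ≫ F.map A.mul)).hom := by
  rw [← cancel_mono (whiskerLeftIso (asc (F.obj A.X) (F.obj A.X) (F.obj A.X)) (m.cR (m.μ A.X A.X) A.mul A.X (F.map A.mul))).hom]
  simp only [whiskerLeftIso_hom]
  rw [mapBraid_hexagonLeft_left, mapBraid_hexagonLeft_right, im_hexagon_left F.toPseudofunctor H]

theorem mapBrObj_hexagonLeft (H : A.HexagonLeft) :
    (m.toBraidedLaxData.mapBrObj A).HexagonLeft :=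
  m.mapBraid_hexagonLeft A H

end BraidedLaxMonoidal

end Lax

section Image

variable {K : Type u₁} [Bicategory.{w₁, v₁} K] [BraidedMonoidalBicategory K] {L : Type u₂}
  [Bicategory.{w₂, v₂} L] [BraidedMonoidalBicategory L] {F G : StrictPseudofunctor K L}

namespace BraidedLaxData

variable (m : BraidedLaxData F) (n : BraidedLaxData G) (A B : BrPsMonData K)

theorem mapBrObj_braiding_hom :
    (m.mapBrObj A).γ.hom = (tl22 (m.v A.X A.X) (F.map A.mul)).hom ≫
      m.μ A.X A.X ◁ (im21 F.toPseudofunctor A.γ).hom := by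
  simp only [mapBrObj, tl22, im21, Iso.trans_hom, Iso.symm_hom, whiskerRightIso_hom,
    Category.assoc]
  rfl

variable {A B m n}

theorem isCyl_mapBrObj_γ {g : F.obj A.X ⟶ G.obj B.X} {g₂ : F.obj (A.X ⊠ₒ A.X) ⟶ G.obj (B.X ⊠ₒ B.X)}
    {U : g ⊠ g ≫ n.μ B.X B.X ≅ m.μ A.X A.X ≫ g₂} {S : g₂ ≫ G.map B.mul ≅ F.map A.mul ≫ g}
    {Sb : g₂ ≫ G.map (brd B.X B.X) ≅ F.map (brd A.X A.X) ≫ g₂}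
    (hv : IsCyl (sqV (braidNat g g) U) (sqV U Sb) (m.v A.X A.X).hom (n.v B.X B.X).hom)
    (hγ : IsCyl (sqV Sb S) S (im21 F.toPseudofunctor A.γ).hom
      (im21 G.toPseudofunctor B.γ).hom) :
    IsCyl (sqV (braidNat g g) (sqV U S)) (sqV U S) (m.mapBrObj A).γ.hom (n.mapBrObj B).γ.hom := by
  rw [mapBrObj_braiding_hom, mapBrObj_braiding_hom]
  exact (hv.tl22_hom S).comp (hγ.whiskerLeft U)

end BraidedLaxData

end Image

section Braided

variable {K : Type u₁} [Bicategory.{w₁, v₁} K] [BraidedMonoidalBicategory K]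

/-- The data of a strong morphism is compatible with the braiding 2-cells. -/
def StrongMorData.IsBraided {A B : BrPsMonData K} (f : StrongMorData A.toPsMonData B.toPsMonData) :
    Prop :=
  IsCyl (sqV (braidNat f.f f.f) f.φ) f.φ A.γ.hom B.γ.hom

theorem StrongMorData.IsBraided.of_agrees {A B A' B' : BrPsMonData K}
    {f : StrongMorData A.toPsMonData B.toPsMonData}
    {f' : StrongMorData A'.toPsMonData B'.toPsMonData} (H : f'.IsBraided) (h : f.Agrees f')
    (hA : A = A') (hB : B = B') : f.IsBraided := by
  subst hA hB
  rwa [h.eq]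

theorem StrongMor.isBraided_of_comp {A B C : BrPsMon K} {F : A.toPsMon ⟶ B.toPsMon}
    {G : B.toPsMon ⟶ C.toPsMon}
    (H : HasQuasiInverse (StrongMorData.f (StrongMor.toStrongMorData F)))
    (hF : StrongMor.IsBraided F) (hFG : StrongMor.IsBraided (A := A) (B := C) (F ≫ G)) :
    StrongMor.IsBraided G := by
  change IsCyl (sqV (braidNat (F.f ≫ G.f) (F.f ≫ G.f))
    (sqConj (tComp F.f F.f G.f G.f) (Iso.refl _) (sqH F.φ G.φ)))
    (sqConj (tComp F.f F.f G.f G.f) (Iso.refl _) (sqH F.φ G.φ)) _ _ at hFG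
  rw [braidNat_comp_eq, sqV_conj, sqV_sqH] at hFG
  exact IsCyl.of_sqH (H.tensor H) hF hFG.of_conj

theorem BrPsMonData.ext_of_heq {A B : BrPsMonData K} (h : A.toPsMonData = B.toPsMonData)
    (hγ : HEq A.γ B.γ) : A = B := by
  obtain ⟨A, γ⟩ := A
  obtain ⟨B, γ'⟩ := B
  dsimp only at h
  subst h
  exact congrArg (BrPsMonData.mk A) (eq_of_heq hγ)

theorem heq_of_whiskerLeft {a b : K} {f : a ⟶ a} {p p' : a ⟶ b} {γ : f ≫ p ≅ p}
    {γ' : f ≫ p' ≅ p'} (h : p = p') {θ : p ⟶ p'} (hθ : θ = eqToHom h)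
    (e : γ.hom ≫ θ = f ◁ θ ≫ γ'.hom) : HEq γ γ' := by
  subst h hθ
  exact heq_of_eq (Iso.ext (by simpa using e))

theorem BrPsMonData.mapBrObj_id [Bicategory.Strict K] (A : BrPsMonData K) :
    (BraidedLaxData.id K).mapBrObj A = A := by
  refine ext_of_heq A.mapObj_id (heq_of_whiskerLeft (Strict.id_comp A.mul)
    (congrArg Iso.hom (Strict.leftUnitor_eqToIso A.mul)) ?_)
  refine (congrArg (· ≫ (λ_ A.mul).hom) (BraidedLaxData.mapBrObj_braiding_hom _ A)).trans ?_
  change ((tl22 (idSqV (brd A.X A.X)) A.mul).hom ≫ 𝟙 _ ◁ (𝟙 _ ≫ A.γ.hom)) ≫ (λ_ A.mul).hom =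
    brd A.X A.X ◁ (λ_ A.mul).hom ≫ A.γ.hom
  simp [tl22, idSqV]

end Braided

section Symmetric

variable {B : Type u₁} [Bicategory.{w₁, v₁} B] {C : Type u₂} [Bicategory.{w₂, v₂} C]

theorem im_symmetry (P : Pseudofunctor B C) {d x : B} {b : d ⟶ d} {q : d ⟶ x} {s : b ≫ b ≅ 𝟙 d}
    {γ : b ≫ q ≅ q} (h : b ◁ γ.hom ≫ γ.hom = (tl20 s q).hom) :
    P.map b ◁ (im21 P γ).hom ≫ (im21 P γ).hom = (tl20 (im20 P s) (P.map q)).hom := by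
  have h' := congrArg (fun y => (mc₃ P b b q).inv ≫ P.map₂ y) h
  simp only [P.map₂_comp, map₂_tl20, P.map₂_whisker_left, mc₃, Iso.trans_inv, whiskerLeftIso_inv,
    Category.assoc, Iso.inv_hom_id_assoc, Iso.trans_hom, whiskerLeftIso_hom,
    whiskerLeft_inv_hom_assoc] at h'
  simpa only [im21, Iso.trans_hom, Iso.symm_hom, PrelaxFunctor.map₂Iso_hom, whiskerLeft_comp,
    Category.assoc] using h'

variable {K : Type u₁} [Bicategory.{w₁, v₁} K] [SymmetricMonoidalBicategory K]

/-- The symmetry axiom, for the data of a braided pseudomonoid. -/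
def BrPsMonData.Symmetry (A : BrPsMonData K) : Prop :=
  brd A.X A.X ◁ A.γ.hom ≫ A.γ.hom =
    (tl20 (SymmetricMonoidalBicategory.syl A.X A.X).symm A.mul).hom

theorem BrPsMonData.symmetry_iff (A : BrPsMonData K) :
    A.Symmetry ↔ (𝟙 A.mul ⊗≫ (SymmetricMonoidalBicategory.syl A.X A.X).hom ▷ A.mul ⊗≫
      brd A.X A.X ◁ A.γ.hom ⊗≫ A.γ.hom) = 𝟙 A.mul := by
  have e : (𝟙 A.mul ⊗≫ (SymmetricMonoidalBicategory.syl A.X A.X).hom ▷ A.mul ⊗≫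
      brd A.X A.X ◁ A.γ.hom ⊗≫ A.γ.hom) =
      (tl20 (SymmetricMonoidalBicategory.syl A.X A.X).symm A.mul).inv ≫
        brd A.X A.X ◁ A.γ.hom ≫ A.γ.hom := by
    simp only [tl20, tl21, Iso.trans_inv, Iso.symm_inv, whiskerRightIso_inv]
    bicategory
  rw [e, Iso.inv_comp_eq, Category.comp_id, Symmetry]

variable {L : Type u₂} [Bicategory.{w₂, v₂} L] [SymmetricMonoidalBicategory L]
  {F : StrictPseudofunctor K L}

namespace SymmetricLaxMonoidal

variable (m : SymmetricLaxMonoidal F)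

theorem syl_coherence_tail (a b : K) {z : L} (k : F.obj (a ⊠ₒ b) ⟶ z) :
    brd (F.obj a) (F.obj b) ◁ (tl22 (m.v b a) k).hom ≫
        (tl22 (m.v a b) (F.map (brd b a) ≫ k)).hom ≫
        m.μ a b ◁ (tl20 (im20 F.toPseudofunctor (SymmetricMonoidalBicategory.syl a b).symm) k).hom =
      (tl20 (SymmetricMonoidalBicategory.syl (F.obj a) (F.obj b)).symm (m.μ a b ≫ k)).hom := by
  have h := congrArg (fun y => 𝟙 (m.μ a b ≫ k) ⊗≫ y ▷ k ⊗≫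
    𝟙 (m.μ a b ≫ F.map (brd a b) ≫ F.map (brd b a) ≫ k)) (m.syl_coherence a b)
  let T := whiskerLeftIso (m.μ a b)
    (tl20 (im20 F.toPseudofunctor (SymmetricMonoidalBicategory.syl a b).symm) k)
  have h' : (tl20 (SymmetricMonoidalBicategory.syl (F.obj a) (F.obj b)).symm (m.μ a b ≫ k)).inv ≫
      brd (F.obj a) (F.obj b) ◁ (tl22 (m.v b a) k).hom ≫
        (tl22 (m.v a b) (F.map (brd b a) ≫ k)).hom = T.inv := by
    simp only [T, tl22, tl20, tl21, im20, Iso.trans_hom, Iso.trans_inv, Iso.symm_hom, Iso.symm_inv,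
      whiskerLeftIso_inv, whiskerRightIso_hom, whiskerRightIso_inv, PrelaxFunctor.map₂Iso_inv] at h ⊢
    refine Eq.trans ?_ (h.trans ?_) <;> bicategory
  rw [Iso.inv_comp_eq, Iso.eq_comp_inv, Category.assoc] at h'
  exact h'

theorem mapBrObj_symmetry {A : BrPsMonData K} (H : A.Symmetry) :
    (m.toBraidedLaxData.mapBrObj A).Symmetry := by
  have e : brd (F.obj A.X) (F.obj A.X) ◁ (m.mapBraid A).hom ≫ (m.mapBraid A).hom =
      (tl20 (SymmetricMonoidalBicategory.syl (F.obj A.X) (F.obj A.X)).symm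
        (m.μ A.X A.X ≫ F.map A.mul)).hom := by
    have n := tl22_nat (m.v A.X A.X) (im21 F.toPseudofunctor A.γ).hom
    have i := congrArg (fun y => m.μ A.X A.X ◁ y) (im_symmetry F.toPseudofunctor H)
    rw [m.mapBraid_hom, whiskerLeft_comp, Category.assoc, reassoc_of% n, ← whiskerLeft_comp, i,
      m.syl_coherence_tail]
  exact e

end SymmetricLaxMonoidal

end Symmetric

section Lax

variable {K : Type u₁} [Bicategory.{w₁, v₁} K] {L : Type u₂} [Bicategory.{w₂, v₂} L]
  [BraidedMonoidalBicategory K] [BraidedMonoidalBicategory L] {F : StrictPseudofunctor K L}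

namespace BraidedLaxMonoidal

variable (m : BraidedLaxMonoidal F)

theorem isBraided_mapMor {A B : BrPsMonData K} {f : StrongMorData A.toPsMonData B.toPsMonData}
    (H : f.IsBraided) :
    StrongMorData.IsBraided (A := m.toBraidedLaxData.mapBrObj A)
      (B := m.toBraidedLaxData.mapBrObj B) (m.mapMor f) := by
  have hγ : IsCyl (sqV (im22 F.toPseudofunctor (braidNat f.f f.f)) (im22 F.toPseudofunctor f.φ))
      (im22 F.toPseudofunctor f.φ) (im21 F.toPseudofunctor A.γ).hom
      (im21 F.toPseudofunctor B.γ).hom := IsCyl.im21 F.toPseudofunctor H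
  change IsCyl (sqV (braidNat (F.map f.f) (F.map f.f)) (sqV (m.μNat f.f f.f)
    (im22 F.toPseudofunctor f.φ))) (sqV (m.μNat f.f f.f) (im22 F.toPseudofunctor f.φ))
    (m.toBraidedLaxData.mapBrObj A).γ.hom (m.toBraidedLaxData.mapBrObj B).γ.hom
  exact BraidedLaxData.isCyl_mapBrObj_γ (m := m.toBraidedLaxData) (n := m.toBraidedLaxData)
    (m.v_modif f.f f.f) hγ

theorem mapBrObj_comp {M : Type u₃} [Bicategory.{w₃, v₃} M] [Bicategory.Strict M]
    [BraidedMonoidalBicategory M] {G : StrictPseudofunctor L M} (n : BraidedLaxMonoidal G)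
    (A : BrPsMonData K) :
    (m.toBraidedLaxData.comp n.toBraidedLaxData).mapBrObj A =
      n.toBraidedLaxData.mapBrObj (m.toBraidedLaxData.mapBrObj A) := by
  refine BrPsMonData.ext_of_heq (m.mapObj_comp n.toLaxMonoidal A.toPsMonData)
    (heq_of_whiskerLeft (comp_map_comp G _ _ _)
    (reassocMap_eq_eqToHom G (n.μ (F.obj A.X) (F.obj A.X)) (m.μ A.X A.X) (F.map A.mul) _) ?_)
  have e : (im21 G.toPseudofunctor (m.mapBraid A)).hom =
      (G.mapComp (brd (F.obj A.X) (F.obj A.X)) (m.μ A.X A.X ≫ F.map A.mul)).inv ≫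
        G.map₂ ((tl22 (m.v A.X A.X) (F.map A.mul)).hom ≫
          m.μ A.X A.X ◁ (im21 F.toPseudofunctor A.γ).hom) :=
    congrArg (fun w => _ ≫ G.map₂ w) (m.mapBraid_hom A)
  have e' : ((tl22 (sqV (n.v (F.obj A.X) (F.obj A.X)) (im22 G.toPseudofunctor (m.v A.X A.X)))
      (G.map (F.map A.mul))).hom ≫ (n.μ (F.obj A.X) (F.obj A.X) ≫ G.map (m.μ A.X A.X)) ◁
        (im21 G.toPseudofunctor (im21 F.toPseudofunctor A.γ)).hom) ≫
        (reassocMap G.toPseudofunctor (n.μ (F.obj A.X) (F.obj A.X)) (m.μ A.X A.X)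
          (F.map A.mul)).hom =
      brd (G.obj (F.obj A.X)) (G.obj (F.obj A.X)) ◁
        (reassocMap G.toPseudofunctor (n.μ (F.obj A.X) (F.obj A.X)) (m.μ A.X A.X)
          (F.map A.mul)).hom ≫ (tl22 (n.v (F.obj A.X) (F.obj A.X)) (G.map (m.μ A.X A.X ≫ F.map A.mul))).hom ≫
          n.μ (F.obj A.X) (F.obj A.X) ◁ (im21 G.toPseudofunctor (m.mapBraid A)).hom := by
    have i := tl22_nat (n.v (F.obj A.X) (F.obj A.X)) (G.mapComp (m.μ A.X A.X) (F.map A.mul)).inv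
    rw [e, G.map₂_comp, map₂_tl22, G.map₂_whisker_left]
    simp only [reassocMap, Iso.trans_hom, whiskerLeftIso_hom, Iso.symm_hom, whiskerLeft_comp,
      Category.assoc]
    rw [reassoc_of% i]
    simp only [tl22, sqV, im21, mc₃, Iso.trans_hom, Iso.trans_inv, Iso.symm_hom,
      whiskerRightIso_hom, whiskerLeftIso_hom, whiskerLeftIso_inv, PrelaxFunctor.map₂Iso_hom]
    simp
  have e'' := im21_comp F.toPseudofunctor G.toPseudofunctor A.γ
  rw [← e''] at e'
  exact (congrArg (fun w => w ≫ (reassocMap G.toPseudofunctor (n.μ (F.obj A.X) (F.obj A.X))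
    (m.μ A.X A.X) (F.map A.mul)).hom) (BraidedLaxData.mapBrObj_braiding_hom _ A)).trans
    (e'.trans (congrArg (fun w => brd (G.obj (F.obj A.X)) (G.obj (F.obj A.X)) ◁
        (reassocMap G.toPseudofunctor (n.μ (F.obj A.X) (F.obj A.X)) (m.μ A.X A.X)
          (F.map A.mul)).hom ≫ w) (n.toBraidedLaxData.mapBrObj_braiding_hom
            (m.toBraidedLaxData.mapBrObj A)).symm))

end BraidedLaxMonoidal

theorem BraidedTrans.isBraided_component [Bicategory.Strict L] {G : StrictPseudofunctor K L}
    {τ : TwoNatTrans F G} {m : BraidedLaxData F} {n : BraidedLaxData G} (t : BraidedTrans τ m n)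
    (A : BrPsMonData K) :
    StrongMorData.IsBraided (A := m.mapBrObj A) (B := n.mapBrObj A)
      (t.component A.toPsMonData) :=
  BraidedLaxData.isCyl_mapBrObj_γ (t.braid_compat A.X A.X) (τ.isCyl_im21 A.γ)

end Lax

section OneCellClass

variable {C : Type u₁} [Bicategory.{w₁, v₁} C] {D : Type u₂} [Bicategory.{w₂, v₂} D]
  {X : Type u₃} {Y : Type v₃}

theorem OneCellClass.eqToHom_eq (S : OneCellClass X C) {a b : X}
    {f g : {f : S.obj a ⟶ S.obj b // S.mem f}} (h : f = g) :
    (letI := S.homCategory a b; (eqToHom h : f ⟶ g)) = eqToHom (congrArg Subtype.val h) := by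
  subst h
  rfl

/-- A 2-functor between locally full sub-2-categories, from its underlying assignments. -/
def OneCellClass.functor (S : OneCellClass X C) (T : OneCellClass Y D) (o : X → Y)
    (map : ∀ {a b : X}, (S.obj a ⟶ S.obj b) → (T.obj (o a) ⟶ T.obj (o b)))
    (map₂ : ∀ {a b : X} {f g : S.obj a ⟶ S.obj b}, (f ⟶ g) → (map f ⟶ map g))
    (mem : ∀ {a b : X} {f : S.obj a ⟶ S.obj b}, S.mem f → T.mem (map f))
    (map₂_id : ∀ {a b : X} (f : S.obj a ⟶ S.obj b), map₂ (𝟙 f) = 𝟙 (map f))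
    (map₂_comp : ∀ {a b : X} {f g h : S.obj a ⟶ S.obj b} (σ : f ⟶ g) (τ : g ⟶ h),
      map₂ (σ ≫ τ) = map₂ σ ≫ map₂ τ)
    (map_id : ∀ a : X, map (𝟙 (S.obj a)) = 𝟙 (T.obj (o a)))
    (map_comp : ∀ {a b c : X} (f : S.obj a ⟶ S.obj b) (g : S.obj b ⟶ S.obj c),
      map (f ≫ g) = map f ≫ map g)
    (map₂_whisker_left : ∀ {a b c : X} (f : S.obj a ⟶ S.obj b) {g g' : S.obj b ⟶ S.obj c}
      (σ : g ⟶ g'), map₂ (f ◁ σ) =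
        eqToHom (map_comp f g) ≫ map f ◁ map₂ σ ≫ eqToHom (map_comp f g').symm)
    (map₂_whisker_right : ∀ {a b c : X} {f f' : S.obj a ⟶ S.obj b} (σ : f ⟶ f')
      (g : S.obj b ⟶ S.obj c), map₂ (σ ▷ g) =
        eqToHom (map_comp f g) ≫ map₂ σ ▷ map g ≫ eqToHom (map_comp f' g).symm) :
    letI := S.bicategory
    letI := T.bicategory
    ∀ [Bicategory.Strict X] [Bicategory.Strict Y], StrictPseudofunctor X Y :=
  letI := S.bicategory
  letI := T.bicategory
  StrictPseudofunctor.mk'' {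
    obj := o
    map := fun f => ⟨map f.1, mem f.2⟩
    map₂ := fun σ => map₂ σ
    map₂_id := fun _ => map₂_id _
    map₂_comp := fun _ _ => map₂_comp _ _
    map_id := fun _ => Subtype.ext (map_id _)
    map_comp := fun _ _ => Subtype.ext (map_comp _ _)
    map₂_whisker_left := fun f _ _ σ => by
      rw [T.eqToHom_eq, T.eqToHom_eq]
      exact map₂_whisker_left f.1 σ
    map₂_whisker_right := fun σ g => by
      rw [T.eqToHom_eq, T.eqToHom_eq]
      exact map₂_whisker_right σ g.1 }

end OneCellClass

section Br

variable {K : Type u₁} [Bicategory.{w₁, v₁} K] {L : Type u₂} [Bicategory.{w₂, v₂} L]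
  [BraidedMonoidalBicategory K] [BraidedMonoidalBicategory L] {F : StrictPseudofunctor K L}

namespace BraidedLaxMonoidal

variable (m : BraidedLaxMonoidal F)

/-- The image of a braided pseudomonoid under a braided lax monoidal 2-functor. -/
def mapBrPsMon (A : BrPsMon K) : BrPsMon L where
  toPsMon := m.toLaxMonoidal.mapPsMon A.toPsMon
  γ := (m.toBraidedLaxData.mapBrObj A.toBrPsMonData).γ
  hexagon_right := (BrPsMonData.hexagonRight_iff _).1 (m.mapBrObj_hexagonRight _ A.hexagonRight)
  hexagon_left := (BrPsMonData.hexagonLeft_iff _).1 (m.mapBrObj_hexagonLeft _ A.hexagonLeft)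

/-- The 2-functor between 2-categories of braided pseudomonoids given by a braided lax monoidal
2-functor. -/
def brPsMonFunctor [Bicategory.Strict K] [Bicategory.Strict L] :
    StrictPseudofunctor (BrPsMon K) (BrPsMon L) :=
  OneCellClass.functor (brMor K) (brMor L) m.mapBrPsMon (fun f => m.psMonFunctor.map f)
    (fun σ => m.psMonFunctor.map₂ σ) (fun {A B f} h => m.isBraided_mapMor (A := A.toBrPsMonData)
      (B := B.toBrPsMonData) (f := StrongMor.toStrongMorData f) h)
    (fun _ => m.psMonFunctor.map₂_id _) (fun _ _ => m.psMonFunctor.map₂_comp _ _)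
    (fun _ => m.psMonFunctor.map_id _) (fun _ _ => m.psMonFunctor.map_comp _ _)
    (fun f _ _ σ => by
      refine (m.psMonFunctor.map₂_whisker_left f σ).trans ?_
      rw [m.psMonFunctor.mapComp_eq_eqToIso, m.psMonFunctor.mapComp_eq_eqToIso]
      rfl)
    (fun σ g => by
      refine (m.psMonFunctor.map₂_whisker_right σ g).trans ?_
      rw [m.psMonFunctor.mapComp_eq_eqToIso, m.psMonFunctor.mapComp_eq_eqToIso]
      rfl)

theorem brPsMonFunctor_lifts [Bicategory.Strict K] [Bicategory.Strict L] :
    m.toBraidedLaxData.Lifts m.brPsMonFunctor where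
  obj_eq _ := rfl
  map_agrees _ := .refl _
  map₂_heq _ := HEq.rfl

end BraidedLaxMonoidal

theorem BraidedLaxData.lifts_id [Bicategory.Strict K] :
    (BraidedLaxData.id K).Lifts (StrictPseudofunctor.id (BrPsMon K)) where
  obj_eq A := (BrPsMonData.mapBrObj_id A.toBrPsMonData).symm
  map_agrees f := (StrongMorData.mapMor_id_agrees (StrongMor.toStrongMorData f.1)).symm
  map₂_heq _ := HEq.rfl

theorem BraidedLaxMonoidal.lifts_comp {M : Type u₃} [Bicategory.{w₃, v₃} M]
    [BraidedMonoidalBicategory M] [Bicategory.Strict K] [Bicategory.Strict L]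
    [Bicategory.Strict M] {H : StrictPseudofunctor L M} (m : BraidedLaxMonoidal F)
    (n : BraidedLaxMonoidal H) :
    (m.toBraidedLaxData.comp n.toBraidedLaxData).Lifts
      (m.brPsMonFunctor.comp n.brPsMonFunctor) where
  obj_eq A := (m.mapBrObj_comp n A.toBrPsMonData).symm
  map_agrees f := (m.toLaxMonoidal.mapMor_comp_agrees n.toLaxMonoidal
    (StrongMor.toStrongMorData f.1)).symm
  map₂_heq _ := HEq.rfl

end Br

section Sym

variable {K : Type u₁} [Bicategory.{w₁, v₁} K] {L : Type u₂} [Bicategory.{w₂, v₂} L]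
  [SymmetricMonoidalBicategory K] [SymmetricMonoidalBicategory L] {F : StrictPseudofunctor K L}

namespace SymmetricLaxMonoidal

variable (m : SymmetricLaxMonoidal F)

/-- The image of a symmetric pseudomonoid under a symmetric lax monoidal 2-functor. -/
def mapSymPsMon (A : SymPsMon K) : SymPsMon L where
  toBrPsMon := m.toBraidedLaxMonoidal.mapBrPsMon A.toBrPsMon
  symmetry := (BrPsMonData.symmetry_iff _).1
    (m.mapBrObj_symmetry ((BrPsMonData.symmetry_iff A.toBrPsMonData).2 A.symmetry))

/-- The 2-functor between 2-categories of symmetric pseudomonoids given by a symmetric lax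
monoidal 2-functor. -/
def symPsMonFunctor [Bicategory.Strict K] [Bicategory.Strict L] :
    StrictPseudofunctor (SymPsMon K) (SymPsMon L) :=
  OneCellClass.functor (symMor K) (symMor L) m.mapSymPsMon (fun f => m.psMonFunctor.map f)
    (fun σ => m.psMonFunctor.map₂ σ) (fun {A B f} h => m.isBraided_mapMor (A := A.toBrPsMonData)
      (B := B.toBrPsMonData) (f := StrongMor.toStrongMorData f) h)
    (fun _ => m.psMonFunctor.map₂_id _) (fun _ _ => m.psMonFunctor.map₂_comp _ _)
    (fun _ => m.psMonFunctor.map_id _) (fun _ _ => m.psMonFunctor.map_comp _ _)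
    (fun f _ _ σ => by
      refine (m.psMonFunctor.map₂_whisker_left f σ).trans ?_
      rw [m.psMonFunctor.mapComp_eq_eqToIso, m.psMonFunctor.mapComp_eq_eqToIso]
      rfl)
    (fun σ g => by
      refine (m.psMonFunctor.map₂_whisker_right σ g).trans ?_
      rw [m.psMonFunctor.mapComp_eq_eqToIso, m.psMonFunctor.mapComp_eq_eqToIso]
      rfl)

theorem symPsMonFunctor_lifts [Bicategory.Strict K] [Bicategory.Strict L] :
    m.toBraidedLaxData.SymLifts m.symPsMonFunctor where
  obj_eq _ := rfl
  map_agrees _ := .refl _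
  map₂_heq _ := HEq.rfl

end SymmetricLaxMonoidal

theorem BraidedLaxData.symLifts_id [Bicategory.Strict K] :
    (BraidedLaxData.id K).SymLifts (StrictPseudofunctor.id (SymPsMon K)) where
  obj_eq A := (BrPsMonData.mapBrObj_id A.toBrPsMonData).symm
  map_agrees f := (StrongMorData.mapMor_id_agrees (StrongMor.toStrongMorData f.1)).symm
  map₂_heq _ := HEq.rfl

theorem SymmetricLaxMonoidal.symLifts_comp {M : Type u₃} [Bicategory.{w₃, v₃} M]
    [SymmetricMonoidalBicategory M] [Bicategory.Strict K] [Bicategory.Strict L]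
    [Bicategory.Strict M] {H : StrictPseudofunctor L M} (m : SymmetricLaxMonoidal F)
    (n : SymmetricLaxMonoidal H) :
    (m.toBraidedLaxData.comp n.toBraidedLaxData).SymLifts
      (m.symPsMonFunctor.comp n.symPsMonFunctor) where
  obj_eq A := (m.toBraidedLaxMonoidal.mapBrObj_comp n.toBraidedLaxMonoidal A.toBrPsMonData).symm
  map_agrees f := (m.toLaxMonoidal.mapMor_comp_agrees n.toLaxMonoidal
    (StrongMor.toStrongMorData f.1)).symm
  map₂_heq _ := HEq.rfl

end Sym

section Lift

variable {K : Type u₁} [Bicategory.{w₁, v₁} K] {L : Type u₂} [Bicategory.{w₂, v₂} L]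
  [MonoidalBicategory K] [MonoidalBicategory L] {F G : StrictPseudofunctor K L}
  {τ : TwoNatTrans F G} {m : LaxMonoidalData F} {n : LaxMonoidalData G} {X : Type u₃} {Y : Type v₃}

namespace OneCellClass

theorem exists_twoNatTrans [Bicategory.Strict L] (S : OneCellClass X (PsMon K))
    (T : OneCellClass Y (PsMon L)) (t : MonoidalTrans τ m n) (hτ : τ.IsIso) :
    letI := S.bicategory
    letI := T.bicategory
    ∀ (P Q : StrictPseudofunctor X Y)
      (_ : ∀ A, (T.obj (P.obj A)).toPsMonData = m.mapObj (S.obj A).toPsMonData)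
      (_ : ∀ A, (T.obj (Q.obj A)).toPsMonData = n.mapObj (S.obj A).toPsMonData)
      (_ : ∀ {A B : X} (f : A ⟶ B), (StrongMor.toStrongMorData (P.map f).1).Agrees
        (m.mapMor (StrongMor.toStrongMorData f.1)))
      (_ : ∀ {A B : X} (f : A ⟶ B), (StrongMor.toStrongMorData (Q.map f).1).Agrees
        (n.mapMor (StrongMor.toStrongMorData f.1)))
      (_ : ∀ {A B : X} {f g : A ⟶ B} (σ : f ⟶ g),
        HEq (PsMonCell.hom (P.map₂ σ)) (F.map₂ (PsMonCell.hom σ)))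
      (_ : ∀ {A B : X} {f g : A ⟶ B} (σ : f ⟶ g),
        HEq (PsMonCell.hom (Q.map₂ σ)) (G.map₂ (PsMonCell.hom σ)))
      (_ : ∀ (A : X) (x : T.obj (P.obj A) ⟶ T.obj (Q.obj A)),
        (StrongMor.toStrongMorData x).Agrees (t.component (S.obj A).toPsMonData) → T.mem x)
      (_ : ∀ {A B : Y} {x : T.obj A ⟶ T.obj B} {y : T.obj B ⟶ T.obj A}, T.mem x →
        x ≫ y = 𝟙 _ → y ≫ x = 𝟙 _ → T.mem y),
      ∃ σ : TwoNatTrans P Q, σ.IsIso ∧ ∀ A : X,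
        (StrongMor.toStrongMorData (σ.app A).1).Agrees
          (t.component (S.obj A).toPsMonData) := by
  let := S.bicategory
  let := T.bicategory
  intro P Q hP hQ hPm hQm hP₂ hQ₂ hmem hinv
  choose app happ using fun A : X => exists_strongMor (t.component (S.obj A).toPsMonData)
    (t.isStrong_component (S.obj A).toPsMonData) (hP A) (hQ A)
  have nat {A B : X} (f : A ⟶ B) : (P.map f).1 ≫ app B = app A ≫ (Q.map f).1 :=
    StrongMor.comp_eq_comp_of_agrees (hP A) (hP B) (hQ A) (hQ B) (hPm f) (hQm f) (happ A) (happ B)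
      (t.component_naturality (StrongMor.toStrongMorData f.1))
  let app' (A : X) : P.obj A ⟶ Q.obj A := ⟨app A, hmem A _ (happ A)⟩
  have nat' {A B : X} (f : A ⟶ B) : P.map f ≫ app' B = app' A ≫ Q.map f := Subtype.ext (nat f)
  have nat₂ {A B : X} {f g : A ⟶ B} (s : f ⟶ g) :
      P.map₂ s ▷ app' B ≫ eqToHom (nat' g) = eqToHom (nat' f) ≫ app' A ◁ Q.map₂ s := by
    rw [T.eqToHom_eq, T.eqToHom_eq]
    exact PsMonCell.naturality_of_heq _ _ (congrArg PsMonData.X (hP A))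
      (congrArg PsMonData.X (hP B)) (congrArg PsMonData.X (hQ A))
      (congrArg PsMonData.X (hQ B)) (hPm f).f_heq (hPm g).f_heq
      (hP₂ s) (happ A).f_heq (happ B).f_heq (hQm f).f_heq
      (hQm g).f_heq (hQ₂ s) _ _ _ _ (τ.naturality₂ (PsMonCell.hom s))
  refine ⟨{ app := app', naturality := nat', naturality₂ := nat₂ }, fun A => ?_, happ⟩
  obtain ⟨y, h, h'⟩ := StrongMor.exists_inverse_of_agrees (app A) (hP A) (hQ A) (happ A)
    (hτ (S.obj A).X)
  exact ⟨⟨y, hinv (app' A).2 h h'⟩, Subtype.ext h, Subtype.ext h'⟩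

end OneCellClass

end Lift

section Braided

variable {K : Type u₁} [Bicategory.{w₁, v₁} K] {L : Type u₂} [Bicategory.{w₂, v₂} L]
  [BraidedMonoidalBicategory K] [BraidedMonoidalBicategory L] {F G : StrictPseudofunctor K L}
  {τ : TwoNatTrans F G} {m : BraidedLaxData F} {n : BraidedLaxData G}

theorem StrongMor.isBraided_of_inverse {A B : BrPsMon L} {x : A.toPsMon ⟶ B.toPsMon}
    {y : B.toPsMon ⟶ A.toPsMon} (hx : StrongMor.IsBraided x) (h : x ≫ y = 𝟙 A.toPsMon)
    (h' : y ≫ x = 𝟙 B.toPsMon) : StrongMor.IsBraided (A := B) (B := A) y :=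
  StrongMor.isBraided_of_comp
    (HasQuasiInverse.of_inverse
      (congrArg (fun w => StrongMorData.f (StrongMor.toStrongMorData w)) h)
      (congrArg (fun w => StrongMorData.f (StrongMor.toStrongMorData w)) h'))
    hx (h ▸ StrongMor.isBraided_id A)

theorem BraidedTrans.isBraided_of_agrees [Bicategory.Strict L] (t : BraidedTrans τ m n)
    {A : BrPsMonData K} {B C : BrPsMonData L} (hB : B = m.mapBrObj A) (hC : C = n.mapBrObj A)
    {x : StrongMorData B.toPsMonData C.toPsMonData} (h : x.Agrees (t.component A.toPsMonData)) :
    x.IsBraided :=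
  StrongMorData.IsBraided.of_agrees (t.isBraided_component A) h hB hC

theorem BraidedTrans.exists_twoNatTrans [Bicategory.Strict L] (t : BraidedTrans τ m n)
    {P Q : StrictPseudofunctor (BrPsMon K) (BrPsMon L)} (hP : m.Lifts P) (hQ : n.Lifts Q)
    (hτ : τ.IsIso) :
    ∃ σ : TwoNatTrans P Q, σ.IsIso ∧ ∀ A : BrPsMon K,
      (StrongMor.toStrongMorData (σ.app A).1).Agrees (t.component A.toPsMonData) :=
  OneCellClass.exists_twoNatTrans (brMor K) (brMor L) t.toMonoidalTrans hτ P Q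
    (fun A => congrArg BrPsMonData.toPsMonData (hP.obj_eq A))
    (fun A => congrArg BrPsMonData.toPsMonData (hQ.obj_eq A))
    hP.map_agrees hQ.map_agrees hP.map₂_heq hQ.map₂_heq
    (fun A _ h => t.isBraided_of_agrees (A := A.toBrPsMonData) (hP.obj_eq A) (hQ.obj_eq A) h)
    (fun hx h h' => StrongMor.isBraided_of_inverse hx h h')

theorem BraidedTwoEquivalence.exists_induces [Bicategory.Strict K] [Bicategory.Strict L]
    (E : BraidedTwoEquivalence K L) :
    ∃ P : TwoEquivalence (BrPsMon K) (BrPsMon L), E.Induces P := by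
  obtain ⟨η, hη, hη'⟩ := E.unitMon.exists_twoNatTrans BraidedLaxData.lifts_id
    (E.functorLax.lifts_comp E.inverseLax) E.unit_isIso
  obtain ⟨θ, hθ, hθ'⟩ := E.counitMon.exists_twoNatTrans
    (E.inverseLax.lifts_comp E.functorLax) BraidedLaxData.lifts_id E.counit_isIso
  exact ⟨{ functor := E.functorLax.brPsMonFunctor
           inverse := E.inverseLax.brPsMonFunctor
           unit := η
           unit_isIso := hη
           counit := θ
           counit_isIso := hθ },
    { functor_lifts := E.functorLax.brPsMonFunctor_lifts
      inverse_lifts := E.inverseLax.brPsMonFunctor_lifts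
      unit_agrees := hη'
      counit_agrees := hθ' }⟩

end Braided

section Symmetric

variable {K : Type u₁} [Bicategory.{w₁, v₁} K] {L : Type u₂} [Bicategory.{w₂, v₂} L]
  [SymmetricMonoidalBicategory K] [SymmetricMonoidalBicategory L] {F G : StrictPseudofunctor K L}
  {τ : TwoNatTrans F G} {m : BraidedLaxData F} {n : BraidedLaxData G}

theorem BraidedTrans.exists_twoNatTrans_symPsMon [Bicategory.Strict L] (t : BraidedTrans τ m n)
    {P Q : StrictPseudofunctor (SymPsMon K) (SymPsMon L)} (hP : m.SymLifts P) (hQ : n.SymLifts Q)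
    (hτ : τ.IsIso) :
    ∃ σ : TwoNatTrans P Q, σ.IsIso ∧ ∀ A : SymPsMon K,
      (StrongMor.toStrongMorData (σ.app A).1).Agrees (t.component A.toPsMonData) :=
  OneCellClass.exists_twoNatTrans (symMor K) (symMor L) t.toMonoidalTrans hτ P Q
    (fun A => congrArg BrPsMonData.toPsMonData (hP.obj_eq A))
    (fun A => congrArg BrPsMonData.toPsMonData (hQ.obj_eq A))
    hP.map_agrees hQ.map_agrees hP.map₂_heq hQ.map₂_heq
    (fun A _ h => t.isBraided_of_agrees (A := A.toBrPsMonData) (hP.obj_eq A) (hQ.obj_eq A) h)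
    (fun {A B _ _} hx h h' =>
      StrongMor.isBraided_of_inverse (A := A.toBrPsMon) (B := B.toBrPsMon) hx h h')

theorem SymmetricTwoEquivalence.exists_induces [Bicategory.Strict K] [Bicategory.Strict L]
    (E : SymmetricTwoEquivalence K L) :
    ∃ P : TwoEquivalence (SymPsMon K) (SymPsMon L), E.Induces P := by
  obtain ⟨η, hη, hη'⟩ := E.unitMon.exists_twoNatTrans_symPsMon BraidedLaxData.symLifts_id
    (E.functorLax.symLifts_comp E.inverseLax) E.unit_isIso
  obtain ⟨θ, hθ, hθ'⟩ := E.counitMon.exists_twoNatTrans_symPsMon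
    (E.inverseLax.symLifts_comp E.functorLax) BraidedLaxData.symLifts_id E.counit_isIso
  exact ⟨{ functor := E.functorLax.symPsMonFunctor
           inverse := E.inverseLax.symPsMonFunctor
           unit := η
           unit_isIso := hη
           counit := θ
           counit_isIso := hθ },
    { functor_lifts := E.functorLax.symPsMonFunctor_lifts
      inverse_lifts := E.inverseLax.symPsMonFunctor_lifts
      unit_agrees := hη'
      counit_agrees := hθ' }⟩

end Symmetric

end MonTwoCat

theorem mainTheorem12 (K : Type u₁) [Bicategory.{w₁, v₁} K] [Bicategory.Strict K]
    (L : Type u₂) [Bicategory.{w₂, v₂} L] [Bicategory.Strict L] :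
    (∀ [MonoidalBicategory K] [MonoidalBicategory L] (E : MonoidalTwoEquivalence K L),
      ∃ P : TwoEquivalence (PsMon K) (PsMon L), E.Induces P) ∧
    (∀ [BraidedMonoidalBicategory K] [BraidedMonoidalBicategory L]
      (E : BraidedTwoEquivalence K L),
      ∃ P : TwoEquivalence (BrPsMon K) (BrPsMon L), E.Induces P) ∧
    (∀ [SymmetricMonoidalBicategory K] [SymmetricMonoidalBicategory L]
      (E : SymmetricTwoEquivalence K L),
      ∃ P : TwoEquivalence (SymPsMon K) (SymPsMon L), E.Induces P) := by
  exact ⟨fun E => E.exists_induces, fun E => E.exists_induces, fun E => E.exists_induces⟩
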